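/- Let $M$ be a simply connected $7$-manifold with a torsion-free $G_2$-structure $\varphi$ (so $\varphi$ is pointwise isomorphic to the standard $3$-form $\varphi_0$ on $\mathbb R^7$, it induces a metric $g$ and the $4$-form $\ast\varphi$, and $d\varphi=0$, $d{\ast}\varphi=0$). Let $\mathbb T^2\times SU(2)$ act smoothly on $M$, preserving $\varphi$, with cohomogeneity two (the maximal dimension of an orbit is $5$). Let $U_1,U_2$ and $V_1,V_2,V_3$ be the generating vector fields of $\mathbb T^2$ and of $SU(2)$, with $[V_i,V_j]=\epsilon_{ijk}V_k$. Let $\nu:M\to\mathbb R$ and $\mu=(\mu_1,\mu_2,\mu_3):M\to\mathbb R^3$ be multi-moment maps, i.e. smooth functions with $$d\nu=\varphi(U_1,U_2,\cdot),\qquad d\mu_i={\ast}\varphi(U_1,U_2,V_i,\cdot),$$ where the additive constants of $\mu$ are the ones for which $\mu$ is $SU(2)$-equivariant, i.e. $\mu_k=-{\ast}\varphi(U_1,U_2,V_i,V_j)$ for $(i,j,k)$ cyclic. Let $M_P$ be the principal set of the action (the points whose stabiliser is, up to conjugation, contained in every stabiliser), and $B=M_P/(\mathbb T^2\times SU(2))$.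 For a circle subgroup $S^1<SU(2)$ write $\mathbb T^3=\mathbb T^2\times S^1$. Submanifolds are embedded. The set $M_P$ is open, $B$ is a smooth surface for which $M_P\to B$ is a submersion, $|\mu|$ and $\nu$ descend to $B$, and $B$ carries the quotient metric of $g$. Moreover: 1. For every circle $S^1<SU(2)$, each connected $\mathbb T^3$-invariant coassociative submanifold of $M_P$ projects into a level set of $\nu$ on $B$. 2. Conversely, let $S^1<SU(2)$ be a circle, let $c\in\mathbb R$ and let $b\in B$ be a point of the level set $\{\nu=c\}$. The space of the $\mathbb T^3$-orbits in $M_P$ over $b$ is homeomorphic to $S^2$. For each $y\in S^2$ there is a connected $\mathbb T^3$-invariant coassociative submanifold $\Sigma_y$ of $M_P$ that contains the orbit corresponding to $y$ and that contains every connected $\mathbb T^3$-invariant coassociative submanifold of $M_P$ meeting this orbit. The projection of $\Sigma_y$ to $B$ lies in $\{\nu=c\}$ and is not a single point. 3. $(|\mu|,\nu)$ is a local orthogonal parametrization of $B$: the map $(|\mu|,\nu):B\to\mathbb R^2$ is a local diffeomorphism, and its coordinate vector fields are orthogonal for the quotient metric. 4. The coordinate lines $\{\nu=\mathrm{const}\}$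 correspond to $\mathbb T^3$-invariant coassociatives as in 1 and 2, and the coordinate lines $\{|\mu|=\mathrm{const}\}$ correspond to $\mathbb T^2$-invariant associatives: each connected $\mathbb T^2$-invariant associative submanifold of $M_P$ projects into a level set of $|\mu|$; conversely, through each $x\in M_P$ there is a connected $\mathbb T^2$-invariant associative submanifold of $M_P$ that contains every other such submanifold through $x$, and its projection to $B$ is the connected component, through the image of $x$, of the level set of $|\mu|$. -/

import Mathlib

open scoped Manifold ContDiff Topology Quaternion

noncomputable section

/-! ### The group `T² × SU(2)` -/

/-- `ℝ⁷` with its Euclidean structure. The coordinates `0, 1, 2` are `x₁, x₂, x₃` and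
`3, 4, 5, 6` are `a₀, a₁, a₂, a₃`. -/
abbrev E7 : Type := EuclideanSpace ℝ (Fin 7)

/-- The unit sphere in `ℝ³`. -/
abbrev S2 : Type := Metric.sphere (0 : EuclideanSpace ℝ (Fin 3)) 1

instance factFinrankQuaternion : Fact (Module.finrank ℝ ℍ[ℝ] = 3 + 1) :=
  ⟨Quaternion.finrank_eq_four⟩

/-- `SU(2)`, realised as the group of unit quaternions (with the smooth structure of `S³`). -/
abbrev SU2 : Type := Metric.sphere (0 : ℍ[ℝ]) 1

/-- The group `T² × SU(2)`. -/
abbrev T2SU2 : Type := Circle × Circle × SU2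

/-- The imaginary quaternion `v₀ i + v₁ j + v₂ k`. -/
def imQuaternion (v : Fin 3 → ℝ) : ℍ[ℝ] := ⟨0, v 0, v 1, v 2⟩

/-- The exponential map `su(2) = Im ℍ → SU(2)`. -/
def expSU2 (v : Fin 3 → ℝ) : SU2 :=
  ⟨NormedSpace.exp (imQuaternion v), by
    rw [mem_sphere_zero_iff_norm, Quaternion.norm_exp]
    simp [imQuaternion]⟩

/-- The circle subgroup of `SU(2)` with unit imaginary direction `n`. Every subgroup `S¹ < SU(2)`
is of this form; see `mem_circleSU2_iff`. -/
def circleSU2 (n : SU2) : Subgroup SU2 := Subgroup.centralizer {n}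

/-- `circleSU2 n` is `{cos t + (sin t) n}`. -/
theorem mem_circleSU2_iff (n : SU2) (hn : (n : ℍ[ℝ]).re = 0) (q : SU2) :
    q ∈ circleSU2 n ↔
      ∃ t : ℝ, (q : ℍ[ℝ]) = ((Real.cos t : ℝ) : ℍ[ℝ]) + Real.sin t • (n : ℍ[ℝ]) := by
  obtain ⟨n, hn1⟩ := n
  obtain ⟨q, hq1⟩ := q
  have hN : n.imI ^ 2 + n.imJ ^ 2 + n.imK ^ 2 = 1 := by
    have h1 : ‖n‖ = 1 := by simpa using hn1
    have h2 := Quaternion.normSq_def' (a := n)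
    rw [Quaternion.normSq_eq_norm_mul_self, h1] at h2
    simp only at hn
    rw [hn] at h2
    linarith
  have hQ : q.re ^ 2 + q.imI ^ 2 + q.imJ ^ 2 + q.imK ^ 2 = 1 := by
    have h1 : ‖q‖ = 1 := by simpa using hq1
    have h2 := Quaternion.normSq_def' (a := q)
    rw [Quaternion.normSq_eq_norm_mul_self, h1] at h2
    linarith
  simp only at hn
  rw [circleSU2, Subgroup.mem_centralizer_singleton_iff]
  simp only [Subtype.ext_iff, Metric.unitSphere.coe_mul]
  constructor
  · intro h
    have hI := congrArg QuaternionAlgebra.imI h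
    have hJ := congrArg QuaternionAlgebra.imJ h
    have hK := congrArg QuaternionAlgebra.imK h
    simp only [Quaternion.imI_mul, Quaternion.imJ_mul, Quaternion.imK_mul, hn] at hI hJ hK
    set s : ℝ := q.imI * n.imI + q.imJ * n.imJ + q.imK * n.imK with hs
    have h1 : q.imI = s * n.imI := by
      linear_combination (-q.imI) * hN + (n.imJ * hK - n.imK * hJ) / 2
    have h2 : q.imJ = s * n.imJ := by
      linear_combination (-q.imJ) * hN + (n.imK * hI - n.imI * hK) / 2
    have h3 : q.imK = s * n.imK := by
      linear_combination (-q.imK) * hN + (n.imI * hJ - n.imJ * hI) / 2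
    have hu : q.re ^ 2 + s ^ 2 = 1 := by
      rw [h1, h2, h3] at hQ
      linear_combination hQ - s ^ 2 * hN
    have hz : ‖(⟨q.re, s⟩ : ℂ)‖ = 1 := by
      rw [Complex.norm_def, Complex.normSq_mk, Real.sqrt_eq_one]
      linarith
    refine ⟨Complex.arg ⟨q.re, s⟩, ?_⟩
    have hc := Complex.norm_mul_cos_arg (⟨q.re, s⟩ : ℂ)
    have hsn := Complex.norm_mul_sin_arg (⟨q.re, s⟩ : ℂ)
    rw [hz, one_mul] at hc hsn
    simp only at hc hsn
    rw [hc, hsn]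
    ext <;> simp [hn, ← h1, ← h2, ← h3]
  · rintro ⟨t, rfl⟩
    rw [add_mul, mul_add, smul_mul_assoc, mul_smul_comm, Quaternion.coe_commutes]

/-- `T² = T² × {1}`. -/
def torus2 : Subgroup T2SU2 := Subgroup.prod ⊤ (Subgroup.prod ⊤ ⊥)

/-- `T³ = T² × S¹`, where `S¹ < SU(2)` is the circle with direction `n`. -/
def torus3 (n : SU2) : Subgroup T2SU2 := Subgroup.prod ⊤ (Subgroup.prod ⊤ (circleSU2 n))

/-! ### The linear model -/

/-- The `k`-form `dx_{I 0} ∧ ⋯ ∧ dx_{I (k-1)}` on `ℝ⁷`. -/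
def dxx {k : ℕ} (I : Fin k → Fin 7) (v : Fin k → E7) : ℝ :=
  Matrix.det (Matrix.of fun a b => v a (I b))

/-- `φ₀ = dx₁₂₃ + ∑ᵢ dxᵢ ∧ Ωᵢ` with `Ωᵢ = da₀ ∧ daᵢ - daⱼ ∧ daₖ`. -/
def phi0 (v : Fin 3 → E7) : ℝ :=
  dxx ![0, 1, 2] v + (dxx ![0, 3, 4] v - dxx ![0, 5, 6] v)
    + (dxx ![1, 3, 5] v - dxx ![1, 6, 4] v) + (dxx ![2, 3, 6] v - dxx ![2, 4, 5] v)

/-- `∗φ₀ = da₀₁₂₃ - ∑ᵢ dxⱼ ∧ dxₖ ∧ Ωᵢ`. -/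
def psi0 (v : Fin 4 → E7) : ℝ :=
  dxx ![3, 4, 5, 6] v - (dxx ![1, 2, 3, 4] v - dxx ![1, 2, 5, 6] v)
    - (dxx ![2, 0, 3, 5] v - dxx ![2, 0, 6, 4] v) - (dxx ![0, 1, 3, 6] v - dxx ![0, 1, 4, 5] v)

/-! ### Differential forms and `G₂` manifolds -/

section Forms

variable (M : Type*) [TopologicalSpace M] [ChartedSpace E7 M]

/-- A (not necessarily smooth) field of alternating `k`-forms on the tangent spaces of `M`. -/
abbrev FormField (k : ℕ) : Type _ := ∀ x : M, TangentSpace (𝓡 7) x [⋀^Fin k]→L[ℝ] ℝ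

variable {M}

/-- The expression of a form in the chart `c`, i.e. its pullback by `c⁻¹`. -/
def formInChart {k : ℕ} (α : FormField M k) (c : OpenPartialHomeomorph M E7) (y : E7) :
    E7 [⋀^Fin k]→L[ℝ] ℝ :=
  (α (c.symm y)).compContinuousLinearMap (mfderiv 𝓘(ℝ, E7) (𝓡 7) c.symm y)

def IsSmoothForm {k : ℕ} (α : FormField M k) : Prop :=
  ∀ c ∈ atlas E7 M, ContDiffOn ℝ ∞ (formInChart α c) c.target

def IsClosedForm {k : ℕ} (α : FormField M k) : Prop :=
  ∀ c ∈ atlas E7 M, ∀ y ∈ c.target, extDeriv (formInChart α c) y = 0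

end Forms

/-- A torsion-free `G₂`-structure `φ` on `M`, recorded together with the metric `g = g_φ` and the
`4`-form `ψ = ∗_φ φ`. Both are determined by `φ`: at each point, some linear isomorphism from `ℝ⁷`
to the tangent space identifies `φ` with `φ₀`, and every such isomorphism identifies `g` with the
Euclidean metric and `ψ` with `∗φ₀`, since the stabiliser of `φ₀` lies in `SO(7)`. -/
structure G2Manifold (M : Type*) [TopologicalSpace M] [ChartedSpace E7 M]
    [IsManifold (𝓡 7) ∞ M] where
  φ : FormField M 3
  g : Bundle.ContMDiffRiemannianMetric (𝓡 7) ∞ E7 (fun x : M => TangentSpace (𝓡 7) x)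
  ψ : FormField M 4
  smooth_φ : IsSmoothForm φ
  smooth_ψ : IsSmoothForm ψ
  adapted : ∀ x : M, ∃ p : E7 ≃L[ℝ] TangentSpace (𝓡 7) x,
    (∀ v : Fin 3 → E7, φ x (fun i => p (v i)) = phi0 v) ∧
    (∀ u v : E7, g.inner x (p u) (p v) = inner ℝ u v) ∧
    (∀ v : Fin 4 → E7, ψ x (fun i => p (v i)) = psi0 v)
  closed_φ : IsClosedForm φ
  closed_ψ : IsClosedForm ψ

/-! ### Submanifolds and calibrated submanifolds -/

section Submanifolds

variable {M : Type*} [TopologicalSpace M] [ChartedSpace E7 M] [IsManifold (𝓡 7) ∞ M]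

/-- `S` is a smooth embedded `k`-dimensional submanifold of `M` (without boundary, not necessarily
closed as a subset). -/
def IsSubmanifold (k : ℕ) (S : Set M) : Prop :=
  ∀ x ∈ S, ∃ c ∈ IsManifold.maximalAtlas (𝓡 7) ∞ M, x ∈ c.source ∧
    ∃ F : Submodule ℝ E7, Module.finrank ℝ F = k ∧ ∀ y ∈ c.source, y ∈ S ↔ c y ∈ F

/-- The velocities at `x` of the curves in `S` through `x`; for a submanifold this is `T_x S`. -/
def tangentTo (S : Set M) (x : M) : Set (TangentSpace (𝓡 7) x) :=
  {v | ∃ γ : ℝ → M, γ 0 = x ∧ (∀ᶠ t in 𝓝 (0 : ℝ), γ t ∈ S) ∧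
    MDifferentiableAt 𝓘(ℝ, ℝ) (𝓡 7) γ 0 ∧ (mfderiv 𝓘(ℝ, ℝ) (𝓡 7) γ 0 (1 : ℝ) : E7) = v}

namespace G2Manifold

variable (G : G2Manifold M)

/-- The tuple `e` of tangent vectors is orthonormal. -/
def IsOrthonormal {k : ℕ} {x : M} (e : Fin k → TangentSpace (𝓡 7) x) : Prop :=
  ∀ i j, G.g.inner x (e i) (e j) = if i = j then 1 else 0

/-- `F` is a `3`-plane on which `φ` is the volume form of an orientation of `F`. -/
def IsAssociativePlane {x : M} (F : Submodule ℝ (TangentSpace (𝓡 7) x)) : Prop :=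
  Module.finrank ℝ F = 3 ∧
    ∀ e : Fin 3 → TangentSpace (𝓡 7) x, (∀ i, e i ∈ F) → G.IsOrthonormal e → |G.φ x e| = 1

/-- `F` is a `4`-plane on which `∗φ` is the volume form of an orientation of `F`. -/
def IsCoassociativePlane {x : M} (F : Submodule ℝ (TangentSpace (𝓡 7) x)) : Prop :=
  Module.finrank ℝ F = 4 ∧
    ∀ e : Fin 4 → TangentSpace (𝓡 7) x, (∀ i, e i ∈ F) → G.IsOrthonormal e → |G.ψ x e| = 1

def IsAssociative (L : Set M) : Prop :=
  IsSubmanifold 3 L ∧ ∀ x ∈ L, ∃ F : Submodule ℝ (TangentSpace (𝓡 7) x),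
    (F : Set (TangentSpace (𝓡 7) x)) = tangentTo L x ∧ G.IsAssociativePlane F

def IsCoassociative (S : Set M) : Prop :=
  IsSubmanifold 4 S ∧ ∀ x ∈ S, ∃ F : Submodule ℝ (TangentSpace (𝓡 7) x),
    (F : Set (TangentSpace (𝓡 7) x)) = tangentTo S x ∧ G.IsCoassociativePlane F

end G2Manifold

end Submanifolds

/-! ### The action -/

section Action

variable {M : Type*} [TopologicalSpace M] [ChartedSpace E7 M] [MulAction T2SU2 M]

variable (M) in
/-- The action map `(T² × SU(2)) × M → M` is smooth. -/
def IsSmoothAction : Prop :=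
  ContMDiff (((𝓡 1).prod ((𝓡 1).prod (𝓡 3))).prod (𝓡 7)) (𝓡 7) ∞
    (fun p : T2SU2 × M => p.1 • p.2)

/-- Every group element pulls `α` back to itself. -/
def IsInvariantForm {k : ℕ} (α : FormField M k) : Prop :=
  ∀ (a : T2SU2) (x : M) (v : Fin k → TangentSpace (𝓡 7) x),
    α (a • x) (fun i => mfderiv (𝓡 7) (𝓡 7) (fun y : M => a • y) x (v i)) = α x v

/-- The one-parameter group generating the `l`-th circle of `T²`. -/
def torusFlow (l : Fin 2) (t : ℝ) : T2SU2 :=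
  (if l = 0 then Circle.exp t else 1, if l = 1 then Circle.exp t else 1, 1)

/-- The one-parameter group generated by `eᵢ / 2`, where `e₀, e₁, e₂` are the imaginary units. -/
def su2Flow (i : Fin 3) (t : ℝ) : T2SU2 := (1, 1, expSU2 (Pi.single i (t / 2)))

/-- The generating vector fields `U₁, U₂` of `T²`: `U(x) = d/dt|₀ exp(-t u) • x`. -/
def genU (l : Fin 2) (x : M) : TangentSpace (𝓡 7) x :=
  (mfderiv 𝓘(ℝ, ℝ) (𝓡 7) (fun t : ℝ => torusFlow l (-t) • x) 0 (1 : ℝ) : E7)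

/-- The generating vector fields `V₁, V₂, V₃` of `SU(2)`, with `[Vᵢ, Vⱼ] = ε_{ijk} Vₖ`. -/
def genV (i : Fin 3) (x : M) : TangentSpace (𝓡 7) x :=
  (mfderiv 𝓘(ℝ, ℝ) (𝓡 7) (fun t : ℝ => su2Flow i (-t) • x) 0 (1 : ℝ) : E7)

/-- The tangent space at `x` of the orbit of `x`. -/
def orbitTangent (x : M) : Submodule ℝ (TangentSpace (𝓡 7) x) :=
  Submodule.span ℝ (Set.range (fun l => genU l x) ∪ Set.range (fun i => genV i x))

variable (M) in
/-- The orbits have dimension at most `5`, the dimension of the group; the action has cohomogeneity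
two if this dimension is attained. -/
def HasCohomogeneityTwo : Prop := ∃ x : M, Module.finrank ℝ (orbitTangent x) = 5

variable (M) in
/-- The principal set `M_P`: the points whose stabiliser is conjugate to a subgroup of every
stabiliser. -/
def principalSet : Set M :=
  {x | ∀ y : M, ∃ a : T2SU2, ∀ h ∈ MulAction.stabilizer T2SU2 x,
    a * h * a⁻¹ ∈ MulAction.stabilizer T2SU2 y}

variable (M) in
/-- The orbit relation on `M_P`. -/
abbrev principalSetoid : Setoid (principalSet M) :=
  (MulAction.orbitRel T2SU2 M).comap Subtype.val

variable (M) in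
/-- The quotient `B` of `M_P` by the group, with the quotient topology. -/
abbrev OrbitSurface : Type _ := Quotient (principalSetoid M)

/-- The projection `M_P → B`. -/
def projB (x : principalSet M) : OrbitSurface M := Quotient.mk (principalSetoid M) x

/-- The image in `B` of (the part in `M_P` of) a subset of `M`. -/
def imageB (S : Set M) : Set (OrbitSurface M) := projB '' (Subtype.val ⁻¹' S)

/-- The space of the `T³`-orbits in `M_P` that lie over the point `b` of `B`, as a subspace of the
orbit space `M / T³`. -/
def fibreModT3 (n : SU2) (b : OrbitSurface M) :
    Set (Quotient (MulAction.orbitRel (torus3 n) M)) :=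
  (fun x : principalSet M => Quotient.mk (MulAction.orbitRel (torus3 n) M) x.1) '' (projB ⁻¹' {b})

/-- `S` is invariant under the subgroup `H`. -/
def IsInvariantSet (H : Subgroup T2SU2) (S : Set M) : Prop := ∀ a ∈ H, ∀ x ∈ S, a • x ∈ S

/-- The projection `M_P → B` on the open submanifold `M_P`. -/
def projOpen (hP : IsOpen (principalSet M)) (x : (⟨principalSet M, hP⟩ : TopologicalSpace.Opens M)) :
    OrbitSurface M := projB ⟨x.1, x.2⟩

/-- With the given charts, `B` is a smooth Hausdorff surface for which the projection `M_P → B` is a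
smooth submersion. There is at most one such smooth structure. -/
structure IsQuotientSurface (hP : IsOpen (principalSet M))
    [ChartedSpace (EuclideanSpace ℝ (Fin 2)) (OrbitSurface M)] : Prop where
  t2 : T2Space (OrbitSurface M)
  isManifold : IsManifold (𝓡 2) ∞ (OrbitSurface M)
  contMDiff : ContMDiff (𝓡 7) (𝓡 2) ∞ (projOpen hP)
  submersion : ∀ x, Function.Surjective (mfderiv (𝓡 7) (𝓡 2) (projOpen hP) x)

variable [IsManifold (𝓡 7) ∞ M] (G : G2Manifold M)

/-- `ν` and `μ` are multi-moment maps: `dν = φ(U₁, U₂, ·)` and `dμᵢ = ∗φ(U₁, U₂, Vᵢ, ·)`. This fixes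
`ν` and `μ` up to constants; the constants of `μ` are chosen such that
`μₖ = -∗φ(U₁, U₂, Vᵢ, Vⱼ)` for `(i, j, k)` cyclic, which is the unique choice for which `μ` is
`SU(2)`-equivariant. -/
structure IsMultiMomentPair (ν : M → ℝ) (μ : M → EuclideanSpace ℝ (Fin 3)) : Prop where
  smooth_ν : ContMDiff (𝓡 7) 𝓘(ℝ, ℝ) ∞ ν
  smooth_μ : ContMDiff (𝓡 7) 𝓘(ℝ, EuclideanSpace ℝ (Fin 3)) ∞ μ
  dν : ∀ (x : M) (v : TangentSpace (𝓡 7) x),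
    (mfderiv (𝓡 7) 𝓘(ℝ, ℝ) ν x v : ℝ) = G.φ x ![genU 0 x, genU 1 x, v]
  dμ : ∀ (i : Fin 3) (x : M) (v : TangentSpace (𝓡 7) x),
    (mfderiv (𝓡 7) 𝓘(ℝ, ℝ) (fun y => μ y i) x v : ℝ) =
      G.ψ x ![genU 0 x, genU 1 x, genV i x, v]
  normalised : ∀ (i : Fin 3) (x : M),
    μ x (i + 2) = -G.ψ x ![genU 0 x, genU 1 x, genV i x, genV (i + 1) x]

/-- A connected `T²`-invariant associative submanifold of `M_P`. -/
structure IsT2Associative (L : Set M) : Prop where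
  subset : L ⊆ principalSet M
  connected : IsConnected L
  invariant : IsInvariantSet torus2 L
  associative : G.IsAssociative L

/-- A connected `T³`-invariant coassociative submanifold of `M_P`, where `T³ = T² × S¹` and `n` is
the direction of `S¹`. -/
structure IsT3Coassociative (n : SU2) (S : Set M) : Prop where
  subset : S ⊆ principalSet M
  connected : IsConnected S
  invariant : IsInvariantSet (torus3 n) S
  coassociative : G.IsCoassociative S

/-- `X` is orthogonal to the orbit of `x`. -/
def IsHorizontal {x : M} (X : TangentSpace (𝓡 7) x) : Prop :=
  ∀ Y ∈ orbitTangent x, G.g.inner x Y X = 0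

/-- `gB` is the quotient metric on `B`: the differential of `M_P → B` is isometric on the vectors
orthogonal to the orbits. -/
def IsQuotientMetric (hP : IsOpen (principalSet M))
    [ChartedSpace (EuclideanSpace ℝ (Fin 2)) (OrbitSurface M)]
    (gB : ∀ b : OrbitSurface M,
      TangentSpace (𝓡 2) b →ₗ[ℝ] TangentSpace (𝓡 2) b →ₗ[ℝ] ℝ) : Prop :=
  ∀ (x : (⟨principalSet M, hP⟩ : TopologicalSpace.Opens M)) (Z W : TangentSpace (𝓡 7) x),
    let ι := mfderiv (𝓡 7) (𝓡 7)
      (Subtype.val : (⟨principalSet M, hP⟩ : TopologicalSpace.Opens M) → M) x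
    let P := mfderiv (𝓡 7) (𝓡 2) (projOpen hP) x
    IsHorizontal G (ι Z) → IsHorizontal G (ι W) →
      gB (projOpen hP x) (P Z) (P W) = G.g.inner x.1 (ι Z) (ι W)

/-- The functions `f₁, f₂` form local orthogonal coordinates on `B`: `(f₁, f₂)` is a local
diffeomorphism to `ℝ²`, and at every point the coordinate vectors `∂/∂f₁ ∈ ker df₂` and
`∂/∂f₂ ∈ ker df₁` are orthogonal. -/
structure IsLocalOrthogonalParametrization
    [ChartedSpace (EuclideanSpace ℝ (Fin 2)) (OrbitSurface M)]
    (gB : ∀ b : OrbitSurface M,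
      TangentSpace (𝓡 2) b →ₗ[ℝ] TangentSpace (𝓡 2) b →ₗ[ℝ] ℝ)
    (f₁ f₂ : OrbitSurface M → ℝ) : Prop where
  localDiffeo : IsLocalDiffeomorph (𝓡 2) 𝓘(ℝ, ℝ × ℝ) ∞ (fun b => (f₁ b, f₂ b))
  orthogonal : ∀ (b : OrbitSurface M) (X Y : TangentSpace (𝓡 2) b),
    (mfderiv (𝓡 2) 𝓘(ℝ, ℝ) f₂ b X : ℝ) = 0 → (mfderiv (𝓡 2) 𝓘(ℝ, ℝ) f₁ b Y : ℝ) = 0 →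
      gB b X Y = 0

end Action

end

/-! Write `V_w` for the fundamental field of `w ∈ ℝ³ = su(2)`. On the principal set the action is
locally free (`injective_fundField_of_mem_principalSet`), so `U₁, U₂, V_w` are independent for `w ≠
0`.

Calibrated planes. The differential of `ν` is invariant and the group is compact, so `ν` is
invariant (`ν_smul`) and `φ(U₁, U₂, ·)` vanishes along the orbits. Thus `U₁, U₂, V_w` is an
isotropic triple. It lies in exactly one coassociative plane, whose fourth direction is dual to
`∗φ(U₁, U₂, V_w, ·)`, that is, `∇⟨μ, w⟩` (`coassociative_plane`). Likewise the only associative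
plane containing `U₁, U₂` is completed by `U₁ × U₂ = ∇ν` (`associative_plane`). These facts rest on
the algebra of the cross product of `ℝ⁷`, as does the fact that linear maps preserving `φ₀` are
isometries.

Coordinates. The gradients `∇ν` and `∇|μ|²` are orthogonal because `∗φ(u, v, w, u × v) = 0`. The
first is nonzero since `U₁, U₂` are independent. The second is `2∇⟨μ, w⟩` with `w = μ(x)`, so it is
nonzero unless `μ(x) = 0`. In that case the three functionals `∗φ(U₁, U₂, V_i, ·)` would kill the
six-dimensional span of the orbit and `∇ν`, hence be dependent, contradicting `∇⟨μ, w⟩ ≠ 0`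
(`μ_ne_zero`). So the orbit directions are the common kernel of `dν` and `d|μ|²`, and a slice shows
that `(|μ|, ν)` is a local homeomorphism on `B`. It serves as the atlas of `B`, and the quotient
metric is diagonal in it. An element fixing `x` fixes `U₁, U₂, V_{μ(x)}`, hence the whole tangent
space, so its `SU(2)` part is `±1`; this gives the openness of the principal set.

Foliations. A connected `T³`-invariant coassociative is tangent to the `T³`-orbits and to `∇⟨μ, n⟩`,
so it lies in a leaf swept out by the torus and the flow of the normalised gradient. The function
`⟨μ, n⟩` is `T³`-invariant and grows at unit speed along that flow, so each of its levels meets a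
leaf in at most one compact torus orbit, and leaves are embedded (`Box.eventually_mem_leaf_iff`).
Since `φ` vanishes on coassociative planes, `ν` is constant on them. The associative leaves arise in
the same way from `T²` and `∇ν`; there `|μ|` is constant by orthogonality of the gradients.

Nonconstancy. If a coassociative leaf projected to a point, then `∇⟨μ, n⟩` would be the fundamental
vector of some `ξ`. The functional `A w = d⟨μ, w⟩(∇|μ|²)` would vanish on `n`, on `ξ` and, after one
more differentiation, on `ξ × n`, hence everywhere; but `A (μ x) > 0`.

The sphere. The stabilisers lie in `T² × {±1}` and `±1 ∈ S¹`, so the `T³`-orbits over a point of `B`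
form `SU(2)` modulo `S¹`. -/

/-! ### The inverse function theorem on a neighbourhood -/

section InverseFunction

variable {E F : Type*} [NormedAddCommGroup E] [NormedSpace ℝ E] [CompleteSpace E]
  [NormedAddCommGroup F] [NormedSpace ℝ F]

/-- A smooth map with invertible derivative at `x₀` restricts to a diffeomorphism. -/
theorem exists_openPartialHomeomorph_of_contDiffOn {f : E → F} {U : Set E} (hU : IsOpen U)
    (hf : ContDiffOn ℝ ∞ f U) {x₀ : E} (hx₀ : x₀ ∈ U) (e : E ≃L[ℝ] F)
    (he : HasFDerivAt f (e : E →L[ℝ] F) x₀) :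
    ∃ h : OpenPartialHomeomorph E F, x₀ ∈ h.source ∧ h.source ⊆ U ∧ (∀ x, h x = f x) ∧
      ContDiffOn ℝ ∞ h h.source ∧ ContDiffOn ℝ ∞ h.symm h.target := by
  have hfx : ContDiffAt ℝ ∞ f x₀ := hf.contDiffAt (hU.mem_nhds hx₀)
  have hn : (∞ : WithTop ℕ∞) ≠ 0 := by simp
  set h0 := hfx.toOpenPartialHomeomorph f he hn with hh0
  have hc : ContinuousOn (fderiv ℝ f) U := hf.continuousOn_fderiv_of_isOpen hU (by simp)
  -- Restricting to the points with invertible derivative makes the inverse smooth on its whole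
  -- domain, not only at the image of `x₀`.
  set V : Set E := U ∩ fderiv ℝ f ⁻¹' Set.range ((↑) : (E ≃L[ℝ] F) → E →L[ℝ] F) with hV
  have hVo : IsOpen V := hc.isOpen_inter_preimage hU ContinuousLinearEquiv.isOpen
  have hs : (h0.restrOpen V hVo).source = h0.source ∩ V := by simp
  refine ⟨h0.restrOpen V hVo, ?_, ?_, fun x => rfl, ?_, ?_⟩
  · rw [hs]
    exact ⟨hfx.mem_toOpenPartialHomeomorph_source he hn, hx₀, e, he.fderiv.symm⟩
  · rw [hs]; exact fun x hx => hx.2.1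
  · rw [hs]; exact (hf.mono (fun x hx => hx.2.1) : ContDiffOn ℝ ∞ f (h0.source ∩ V))
  · intro y hy
    have hy' := (h0.restrOpen V hVo).map_target hy
    rw [hs] at hy'
    obtain ⟨-, hyU, e', he'⟩ := hy'
    have hd : ContDiffAt ℝ ∞ f ((h0.restrOpen V hVo).symm y) := hf.contDiffAt (hU.mem_nhds hyU)
    have := (hd.differentiableAt (by simp)).hasFDerivAt
    rw [← he'] at this
    exact ((h0.restrOpen V hVo).contDiffAt_symm hy this hd).contDiffWithinAt

end InverseFunction

/-! ### Smooth dependence of solutions of ordinary differential equations -/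

section Nemytskii

variable {I : Type} [TopologicalSpace I] [CompactSpace I]

/-- Pointwise evaluation `C(I, E →L F) × C(I, E) → C(I, F)` as a bilinear map. -/
noncomputable def pointwiseApply (I : Type) [TopologicalSpace I] [CompactSpace I] (E F : Type)
    [NormedAddCommGroup E] [NormedSpace ℝ E] [NormedAddCommGroup F] [NormedSpace ℝ F] :
    C(I, E →L[ℝ] F) →L[ℝ] C(I, E) →L[ℝ] C(I, F) :=
  LinearMap.mkContinuous₂
    (LinearMap.mk₂ ℝ (fun (A : C(I, E →L[ℝ] F)) (v : C(I, E)) =>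
        (⟨fun t => A t (v t), by fun_prop⟩ : C(I, F)))
      (fun _ _ _ => by ext; simp) (fun _ _ _ => by ext; simp)
      (fun _ _ _ => by ext; simp) (fun _ _ _ => by ext; simp)) 1 (fun A v => by
    rw [ContinuousMap.norm_le _ (by positivity)]
    intro t
    calc ‖A t (v t)‖ ≤ ‖A t‖ * ‖v t‖ := (A t).le_opNorm _
      _ ≤ 1 * ‖A‖ * ‖v‖ := by
        rw [one_mul]; gcongr <;> exact ContinuousMap.norm_coe_le_norm _ _)

theorem pointwiseApply_apply {E F : Type}
    [NormedAddCommGroup E] [NormedSpace ℝ E] [NormedAddCommGroup F] [NormedSpace ℝ F]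
    (A : C(I, E →L[ℝ] F)) (v : C(I, E)) (t : I) : pointwiseApply I E F A v t = A t (v t) := rfl

/-- Postcomposition with `f'` is continuous for the uniform norm, so along paths near `u` the
derivative stays within `ε` of `f' (u t)`, uniformly in `t`. The mean value inequality for `x ↦ f x
- f' (u t) x` then bounds the remainder uniformly. -/
theorem hasFDerivAt_postcomp {E F : Type} [NormedAddCommGroup E] [NormedSpace ℝ E]
    [NormedAddCommGroup F] [NormedSpace ℝ F] {f : C(E, F)} {f' : C(E, E →L[ℝ] F)}
    (hf : ∀ x, HasFDerivAt f (f' x) x) (u : C(I, E)) :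
    HasFDerivAt (fun u : C(I, E) => f.comp u) (pointwiseApply I E F (f'.comp u)) u := by
  rw [hasFDerivAt_iff_isLittleO_nhds_zero, Asymptotics.isLittleO_iff]
  intro ε hε
  have hcont : Continuous (fun u : C(I, E) => f'.comp u) := ContinuousMap.continuous_postcomp f'
  obtain ⟨δ, hδ, hδ'⟩ := (Metric.continuous_iff (α := C(I, E)) (β := C(I, E →L[ℝ] F))).1 hcont u ε hε
  filter_upwards [Metric.ball_mem_nhds (0 : C(I, E)) hδ] with v hv
  rw [mem_ball_zero_iff] at hv
  rw [ContinuousMap.norm_le _ (by positivity)]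
  intro t
  have hvt : ‖v t‖ < δ := (ContinuousMap.norm_coe_le_norm v t).trans_lt hv
  have key := Convex.norm_image_sub_le_of_norm_hasFDerivWithin_le (𝕜 := ℝ)
    (f := fun x => f x - f' (u t) x) (f' := fun x => f' x - f' (u t)) (C := ε)
    (s := Metric.ball (u t) δ) (x := u t) (y := u t + v t)
    (fun x _ => ((hf x).sub (f' (u t)).hasFDerivAt).hasFDerivWithinAt)
    (fun x hx => by
      -- Translating the whole path by a constant gives a path that passes through `x` at time `t`
      -- and is as close to `u` as `x` is to `u t`.
      have h1 : dist (u + ContinuousMap.const I (x - u t)) u < δ := by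
        rw [dist_eq_norm, add_sub_cancel_left]
        refine (ContinuousMap.norm_lt_iff _ hδ).2 fun s => ?_
        simpa [dist_eq_norm] using hx
      have h2 := (ContinuousMap.dist_apply_le_dist t).trans_lt (hδ' _ h1)
      rw [dist_eq_norm] at h2
      simpa using h2.le)
    (convex_ball _ _) (Metric.mem_ball_self hδ) (by simpa [dist_eq_norm] using hvt)
  calc _ = ‖f (u t + v t) - f' (u t) (u t + v t) - (f (u t) - f' (u t) (u t))‖ := by
        simp only [ContinuousMap.sub_apply, ContinuousMap.comp_apply, ContinuousMap.add_apply,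
          pointwiseApply_apply, map_add]
        congr 1; abel
    _ ≤ ε * ‖u t + v t - u t‖ := key
    _ ≤ ε * ‖v‖ := by
        rw [add_sub_cancel_left]; gcongr; exact ContinuousMap.norm_coe_le_norm _ _

/-- The derivative of `u ↦ f ∘ u` is postcomposition with `f'` followed by a bounded linear map, so
the induction passes from `f` to `f'`. The spaces vary because `f'` takes values in `E →L[ℝ] F`. -/
theorem contDiff_postcomp_nat (n : ℕ) : ∀ {E F : Type} [NormedAddCommGroup E] [NormedSpace ℝ E]
    [NormedAddCommGroup F] [NormedSpace ℝ F] (f : C(E, F)), ContDiff ℝ n f →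
    ContDiff ℝ n (fun u : C(I, E) => f.comp u) := by
  induction n with
  | zero =>
    intro E F _ _ _ _ f _
    rw [Nat.cast_zero, contDiff_zero]
    exact ContinuousMap.continuous_postcomp f
  | succ n ih =>
    intro E F _ _ _ _ f hf
    rw [Nat.cast_succ] at hf ⊢
    obtain ⟨f', hf', hd⟩ := contDiff_succ_iff_hasFDerivAt.1 hf
    refine contDiff_succ_iff_hasFDerivAt.2 ⟨fun u => pointwiseApply I E F
      ((⟨f', hf'.continuous⟩ : C(E, E →L[ℝ] F)).comp u), ?_, fun u => hasFDerivAt_postcomp hd u⟩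
    exact (pointwiseApply I E F).contDiff.comp (ih ⟨f', hf'.continuous⟩ hf')

theorem contDiff_postcomp {E F : Type} [NormedAddCommGroup E] [NormedSpace ℝ E]
    [NormedAddCommGroup F] [NormedSpace ℝ F] (f : C(E, F)) (hf : ContDiff ℝ ∞ f) :
    ContDiff ℝ ∞ (fun u : C(I, E) => f.comp u) :=
  contDiff_infty.2 fun n => contDiff_postcomp_nat n f (contDiff_infty.1 hf n)

end Nemytskii

section SmoothFlow

open Set

variable {E : Type} [NormedAddCommGroup E] [NormedSpace ℝ E]

/-- The continuous linear map `v ↦ (s ↦ ∫₀ˢ v)` on `C([0,1], E)`. -/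
noncomputable def primitiveCLM (E : Type) [NormedAddCommGroup E] [NormedSpace ℝ E] :
    C(Icc (0 : ℝ) 1, E) →L[ℝ] C(Icc (0 : ℝ) 1, E) :=
  LinearMap.mkContinuous
    { toFun := fun v => ⟨fun s => ∫ r in (0 : ℝ)..s, v (projIcc 0 1 zero_le_one r), by
        have hv : Continuous fun r : ℝ => v (projIcc 0 1 zero_le_one r) :=
          v.continuous.comp continuous_projIcc
        exact (intervalIntegral.continuous_primitive
          (fun a b => hv.intervalIntegrable a b) 0).comp continuous_subtype_val⟩
      map_add' := fun v w => by
        ext s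
        exact intervalIntegral.integral_add
          ((v.continuous.comp continuous_projIcc).intervalIntegrable _ _)
          ((w.continuous.comp continuous_projIcc).intervalIntegrable _ _)
      map_smul' := fun c v => by
        ext s
        exact intervalIntegral.integral_smul c _ } 1 (fun v => by
    rw [ContinuousMap.norm_le _ (by positivity)]
    intro s
    have := intervalIntegral.norm_integral_le_of_norm_le_const (a := 0) (b := s) (C := ‖v‖)
      (f := fun r => v (projIcc 0 1 zero_le_one r))
      (fun r _ => ContinuousMap.norm_coe_le_norm v _)
    refine this.trans ?_
    rw [sub_zero, abs_of_nonneg s.2.1, one_mul]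
    exact mul_le_of_le_one_right (norm_nonneg v) s.2.2)

/-- Rescaling a path. -/
def rescalePath (s : Icc (0 : ℝ) 1) (v : C(Icc (0 : ℝ) 1, E)) : C(Icc (0 : ℝ) 1, E) :=
  v.comp ⟨fun r => s * r, by fun_prop⟩

theorem norm_rescalePath_le (s : Icc (0 : ℝ) 1) (v : C(Icc (0 : ℝ) 1, E)) :
    ‖rescalePath s v‖ ≤ ‖v‖ :=
  (ContinuousMap.norm_le _ (norm_nonneg v)).2 fun r => ContinuousMap.norm_coe_le_norm v (s * r)

/-- Substitution `q ↦ s q` in the integral: slowing a path down by `s` amounts to replacing `τ` by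
`s τ` in the equation `u = τ ∫ f(x + u)`. -/
theorem smul_primitiveCLM_rescalePath (s : Icc (0 : ℝ) 1) (v : C(Icc (0 : ℝ) 1, E)) :
    (s : ℝ) • primitiveCLM E (rescalePath s v) = rescalePath s (primitiveCLM E v) := by
  ext r
  change (s : ℝ) • (∫ q in (0 : ℝ)..r, v (s * projIcc 0 1 zero_le_one q)) =
    ∫ q in (0 : ℝ)..((s * r : Icc (0 : ℝ) 1) : ℝ), v (projIcc 0 1 zero_le_one q)
  have h1 : ∀ q ∈ uIcc (0 : ℝ) r, v (s * projIcc 0 1 zero_le_one q) =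
      v (projIcc 0 1 zero_le_one (s * q)) := by
    intro q hq
    rw [uIcc_of_le r.2.1] at hq
    have hq' : q ∈ Icc (0 : ℝ) 1 := ⟨hq.1, hq.2.trans r.2.2⟩
    rw [projIcc_of_mem zero_le_one hq', projIcc_of_mem zero_le_one
      ⟨mul_nonneg s.2.1 hq'.1, mul_le_one₀ s.2.2 hq'.1 hq'.2⟩]
    rfl
  rw [intervalIntegral.integral_congr h1,
    intervalIntegral.smul_integral_comp_mul_left (fun q => v (projIcc 0 1 zero_le_one q))]
  simp

/-- The solutions of `x' = f x` near `x₀`, as a smooth family in the space of paths on `[0, 1]`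
(after rescaling the time). -/
theorem exists_smooth_path_family [CompleteSpace E] {f : E → E} (hf : ContDiff ℝ ∞ f)
    (x₀ : E) : ∃ (u : ℝ × E → C(Icc (0 : ℝ) 1, E)) (ε : ℝ), 0 < ε ∧
      ContDiffOn ℝ ∞ u (Metric.ball 0 ε ×ˢ Metric.ball x₀ ε) ∧
      (∀ p ∈ Metric.ball (0 : ℝ) ε ×ˢ Metric.ball x₀ ε, u p = p.1 • primitiveCLM E
        ((⟨f, hf.continuous⟩ : C(E, E)).comp
          (ContinuousLinearMap.const ℝ (Icc (0 : ℝ) 1) p.2 + u p))) ∧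
      ∀ (τ : ℝ) (x : E), (τ, x) ∈ Metric.ball (0 : ℝ) ε ×ˢ Metric.ball x₀ ε →
        ∀ s : Icc (0 : ℝ) 1, u (s * τ, x) = rescalePath s (u (τ, x)) := by
  let fC : C(E, E) := ⟨f, hf.continuous⟩
  let cst : E →L[ℝ] C(Icc (0 : ℝ) 1, E) := ContinuousLinearMap.const ℝ (Icc (0 : ℝ) 1)
  let S : E × C(Icc (0 : ℝ) 1, E) → C(Icc (0 : ℝ) 1, E) :=
    fun q => primitiveCLM E (fC.comp (cst q.1 + q.2))
  have hS : ContDiff ℝ ∞ S := by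
    have h1 : ContDiff ℝ ∞ (fun u : C(Icc (0 : ℝ) 1, E) => fC.comp u) := contDiff_postcomp fC hf
    have h2 : ContDiff ℝ ∞ (fun q : E × C(Icc (0 : ℝ) 1, E) => cst q.1 + q.2) := by fun_prop
    exact (primitiveCLM E).contDiff.comp (h1.comp h2)
  -- The integral equation `u = τ S(x, u)` becomes an inversion problem: its solutions are the
  -- preimages of `(x, τ, 0)` under `G`.
  let G : E × ℝ × C(Icc (0 : ℝ) 1, E) → E × ℝ × C(Icc (0 : ℝ) 1, E) :=
    fun p => (p.1, p.2.1, p.2.2 - p.2.1 • S (p.1, p.2.2))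
  have hG : ContDiff ℝ ∞ G := by
    have : ContDiff ℝ ∞ (fun p : E × ℝ × C(Icc (0 : ℝ) 1, E) => S (p.1, p.2.2)) :=
      hS.comp (by fun_prop)
    fun_prop
  let w := S (x₀, 0)
  let P1 := ContinuousLinearMap.fst ℝ E (ℝ × C(Icc (0 : ℝ) 1, E))
  let P2 := (ContinuousLinearMap.fst ℝ ℝ C(Icc (0 : ℝ) 1, E)).comp
    (ContinuousLinearMap.snd ℝ E (ℝ × C(Icc (0 : ℝ) 1, E)))
  let P3 := (ContinuousLinearMap.snd ℝ ℝ C(Icc (0 : ℝ) 1, E)).comp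
    (ContinuousLinearMap.snd ℝ E (ℝ × C(Icc (0 : ℝ) 1, E)))
  -- At `τ = 0` the term `τ dS` drops out, so the derivative of `G` is the shear that subtracts `τ
  -- S(x₀, 0)`.
  let e : (E × ℝ × C(Icc (0 : ℝ) 1, E)) ≃L[ℝ] (E × ℝ × C(Icc (0 : ℝ) 1, E)) :=
    ContinuousLinearEquiv.equivOfInverse (P1.prod (P2.prod (P3 - P2.smulRight w)))
      (P1.prod (P2.prod (P3 + P2.smulRight w)))
      (fun p => by ext <;> simp [P1, P2, P3]) (fun p => by ext <;> simp [P1, P2, P3])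
  have he : HasFDerivAt G (e : E × ℝ × C(Icc (0 : ℝ) 1, E) →L[ℝ] _) (x₀, 0, 0) := by
    have hSd : HasFDerivAt (fun p : E × ℝ × C(Icc (0 : ℝ) 1, E) => S (p.1, p.2.2))
        (fderiv ℝ (fun p : E × ℝ × C(Icc (0 : ℝ) 1, E) => S (p.1, p.2.2)) (x₀, 0, 0))
        (x₀, 0, 0) := by
      apply DifferentiableAt.hasFDerivAt
      exact ((hS.comp (f := fun p : E × ℝ × C(Icc (0 : ℝ) 1, E) => (p.1, p.2.2))
        (by fun_prop)).differentiable (by simp)) _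
    have h2 : HasFDerivAt (fun p : E × ℝ × C(Icc (0 : ℝ) 1, E) => p.2.1) P2 (x₀, 0, 0) :=
      P2.hasFDerivAt
    have h3 : HasFDerivAt (fun p : E × ℝ × C(Icc (0 : ℝ) 1, E) => p.2.2) P3 (x₀, 0, 0) :=
      P3.hasFDerivAt
    have := P1.hasFDerivAt.prodMk (h2.prodMk (h3.sub (h2.smul hSd)))
    have h4 : (e : E × ℝ × C(Icc (0 : ℝ) 1, E) →L[ℝ] E × ℝ × C(Icc (0 : ℝ) 1, E)) =
        P1.prod (P2.prod (P3 - (((0 : ℝ) • fderiv ℝ (fun p : E × ℝ × C(Icc (0 : ℝ) 1, E) =>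
          S (p.1, p.2.2)) (x₀, 0, 0)) + P2.smulRight (S (x₀, 0))))) := by
      rw [zero_smul, zero_add]; rfl
    rw [h4]
    exact this
  obtain ⟨h, hx, -, hhG, -, hsymm⟩ :=
    exists_openPartialHomeomorph_of_contDiffOn isOpen_univ hG.contDiffOn (mem_univ _) e he
  obtain ⟨δ, hδ, hδs⟩ := Metric.mem_nhds_iff.1 (h.open_source.mem_nhds hx)
  have hG0 : h (x₀, 0, 0) = (x₀, 0, 0) := by rw [hhG]; simp [G]
  have hcont : ContinuousAt (fun p : ℝ × E => h.symm (p.2, p.1, 0)) (0, x₀) := by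
    have h1 : ContinuousAt h.symm (x₀, 0, 0) := by
      rw [← hG0]; exact h.continuousAt_symm (h.map_source hx)
    exact ContinuousAt.comp (f := fun p : ℝ × E => (p.2, p.1, (0 : C(Icc (0 : ℝ) 1, E)))) h1
      (by fun_prop)
  have htgt : ∀ᶠ p : ℝ × E in 𝓝 (0, x₀), (p.2, p.1, (0 : C(Icc (0 : ℝ) 1, E))) ∈ h.target := by
    have : ContinuousAt (fun p : ℝ × E => (p.2, p.1, (0 : C(Icc (0 : ℝ) 1, E)))) (0, x₀) := by
      fun_prop
    apply this.eventually_mem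
    apply h.open_target.mem_nhds
    have := h.map_source hx
    rwa [hG0] at this
  have hball : ∀ᶠ p : ℝ × E in 𝓝 (0, x₀), h.symm (p.2, p.1, 0) ∈ Metric.ball (x₀, 0, 0) δ := by
    apply hcont.eventually_mem
    have : h.symm (x₀, 0, 0) = (x₀, 0, 0) := by
      conv_lhs => rw [← hG0]
      exact h.left_inv hx
    rw [this]
    exact Metric.ball_mem_nhds _ hδ
  obtain ⟨ε, hε, hεs⟩ := Metric.mem_nhds_iff.1 (htgt.and hball)
  rw [← ball_prod_same] at hεs
  let u : ℝ × E → C(Icc (0 : ℝ) 1, E) := fun p => (h.symm (p.2, p.1, 0)).2.2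
  have hu : ∀ p ∈ Metric.ball (0 : ℝ) ε ×ˢ Metric.ball x₀ ε,
      h.symm (p.2, p.1, 0) = (p.2, p.1, u p) ∧ u p = p.1 • S (p.2, u p) := by
    intro p hp
    have h1 := h.right_inv (hεs hp).1
    rw [hhG] at h1
    simp only [G, Prod.mk.injEq] at h1
    obtain ⟨h1, h2, h3⟩ := h1
    refine ⟨by ext1; exacts [h1, by ext1; exacts [h2, rfl]], ?_⟩
    rw [h1, h2, sub_eq_zero] at h3
    exact h3
  -- The slowed-down path solves the equation for `s τ`. Neither it nor `s τ` has grown in norm, so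
  -- it stays in the ball where `G` is injective and must be the chosen solution.
  have hscale : ∀ (τ : ℝ) (x : E), (τ, x) ∈ Metric.ball (0 : ℝ) ε ×ˢ Metric.ball x₀ ε →
      ∀ s : Icc (0 : ℝ) 1, u (s * τ, x) = rescalePath s (u (τ, x)) := by
    intro τ x hp s
    have hb := (hεs hp).2
    obtain ⟨h1, h2⟩ := hu _ hp
    simp only at h1 h2 hb
    rw [h1, ← ball_prod_same, ← ball_prod_same] at hb
    obtain ⟨hb1, hb2, hb3⟩ := hb
    rw [mem_ball_zero_iff] at hb2 hb3
    have hmem : (x, (s : ℝ) * τ, rescalePath s (u (τ, x))) ∈ h.source := by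
      apply hδs
      rw [← ball_prod_same, ← ball_prod_same]
      refine ⟨hb1, ?_, ?_⟩
      · rw [mem_ball_zero_iff, norm_mul, Real.norm_of_nonneg s.2.1]
        exact (mul_le_of_le_one_left (norm_nonneg τ) s.2.2).trans_lt hb2
      · rw [mem_ball_zero_iff]
        exact (norm_rescalePath_le s _).trans_lt hb3
    have hval : h (x, (s : ℝ) * τ, rescalePath s (u (τ, x))) = (x, (s : ℝ) * τ, 0) := by
      rw [hhG]
      simp only [G, Prod.mk.injEq, true_and]
      have h4 : S (x, rescalePath s (u (τ, x))) =
          primitiveCLM E (rescalePath s (fC.comp (cst x + u (τ, x)))) := rfl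
      rw [h4, mul_comm, mul_smul, smul_primitiveCLM_rescalePath, sub_eq_zero]
      conv_lhs => rw [h2]
      rfl
    have := h.left_inv hmem
    rw [hval] at this
    exact congrArg (fun q => q.2.2) this
  have h1 : ContDiffOn ℝ ∞ (fun p : ℝ × E => h.symm (p.2, p.1, 0))
      (Metric.ball 0 ε ×ˢ Metric.ball x₀ ε) :=
    hsymm.comp (by fun_prop) (fun p hp => (hεs hp).1)
  exact ⟨u, ε, hε, h1.snd.snd, fun p hp => (hu p hp).2, hscale⟩

/-- A globally defined smooth vector field has a smooth local flow near every point. -/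
theorem exists_smooth_flow_of_contDiff [CompleteSpace E] {f : E → E} (hf : ContDiff ℝ ∞ f)
    (x₀ : E) : ∃ (Φ : ℝ × E → E) (ε : ℝ), 0 < ε ∧
      ContDiffOn ℝ ∞ Φ (Metric.ball 0 ε ×ˢ Metric.ball x₀ ε) ∧
      (∀ x ∈ Metric.ball x₀ ε, Φ (0, x) = x) ∧
      ∀ t ∈ Metric.ball (0 : ℝ) ε, ∀ x ∈ Metric.ball x₀ ε,
        HasDerivAt (fun t => Φ (t, x)) (f (Φ (t, x))) t := by
  obtain ⟨u, ε, hε, hsm, hu, hscale⟩ := exists_smooth_path_family hf x₀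
  have hΦ : ContDiffOn ℝ ∞ (fun p : ℝ × E => p.2 + u p ⟨1, by simp⟩)
      (Metric.ball 0 ε ×ˢ Metric.ball x₀ ε) := by
    have h3 : ContDiff ℝ ∞ (fun v : C(Icc (0 : ℝ) 1, E) => v ⟨1, by simp⟩) :=
      (ContinuousMap.evalCLM ℝ (⟨1, by simp⟩ : Icc (0 : ℝ) 1) :
        C(Icc (0 : ℝ) 1, E) →L[ℝ] E).contDiff
    exact contDiff_snd.contDiffOn.add (h3.comp_contDiffOn hsm)
  have hhalf : Metric.ball (0 : ℝ) (ε / 2) ×ˢ Metric.ball x₀ (ε / 2) ⊆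
      Metric.ball (0 : ℝ) ε ×ˢ Metric.ball x₀ ε :=
    prod_mono (Metric.ball_subset_ball (by linarith)) (Metric.ball_subset_ball (by linarith))
  refine ⟨fun p => p.2 + u p ⟨1, by simp⟩, ε / 2, by positivity, hΦ.mono hhalf, ?_, ?_⟩
  · intro x hx
    have := hu (0, x) (hhalf ⟨Metric.mem_ball_self (by positivity), hx⟩)
    rw [zero_smul] at this
    simp [this]
  · intro t ht x hx
    have hx' := Metric.ball_subset_ball (show ε / 2 ≤ ε by linarith) hx
    rw [mem_ball_zero_iff, Real.norm_eq_abs] at ht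
    -- Differentiability in `t` follows from smoothness of the family, so a one-sided derivative
    -- suffices to find the value. Writing `t = s τ` with `τ = ±ε/2` and `s < 1` places `t` inside
    -- the single path `u (τ, x)`, with room to the right of `s` even when `t = 0`.
    obtain ⟨τ, s, hτ0, hτε, hs1, hst⟩ : ∃ (τ : ℝ) (s : Icc (0 : ℝ) 1), τ ≠ 0 ∧ |τ| < ε ∧
        (s : ℝ) < 1 ∧ s * τ = t := by
      rcases le_total 0 t with h0 | h0
      · rw [abs_of_nonneg h0] at ht
        refine ⟨ε / 2, ⟨t / (ε / 2), by positivity, (div_le_one (by positivity)).2 ht.le⟩,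
          by positivity, ?_, (div_lt_one (by positivity)).2 ht, by field_simp⟩
        rw [abs_of_pos (by positivity)]; linarith
      · rw [abs_of_nonpos h0] at ht
        refine ⟨-(ε / 2), ⟨-t / (ε / 2), div_nonneg (by linarith) (by positivity),
          (div_le_one (by positivity)).2 ht.le⟩, by simpa using hε.ne', ?_,
          (div_lt_one (by positivity)).2 ht, by field_simp⟩
        rw [abs_neg, abs_of_pos (by positivity)]; linarith
    have hp : (τ, x) ∈ Metric.ball (0 : ℝ) ε ×ˢ Metric.ball x₀ ε :=
      ⟨by rwa [mem_ball_zero_iff], hx'⟩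
    set Φ : ℝ → E := fun t => x + u (t, x) ⟨1, by simp⟩ with hΦdef
    have hd : DifferentiableAt ℝ Φ t := by
      have h1 : ContDiffAt ℝ ∞ (fun p : ℝ × E => p.2 + u p ⟨1, by simp⟩) (t, x) :=
        hΦ.contDiffAt ((Metric.isOpen_ball.prod Metric.isOpen_ball).mem_nhds
          ⟨by rw [mem_ball_zero_iff, Real.norm_eq_abs]; linarith, hx'⟩)
      exact (h1.differentiableAt (by simp)).comp (f := fun t : ℝ => (t, x)) t (by fun_prop)
    have hΦs : ∀ r : Icc (0 : ℝ) 1, Φ (r * τ) = x + u (τ, x) r := by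
      intro r
      simp only [hΦdef, hscale τ x hp r]
      congr 1
      change u (τ, x) (r * 1) = u (τ, x) r
      rw [mul_one]
    let v : C(Icc (0 : ℝ) 1, E) := (⟨f, hf.continuous⟩ : C(E, E)).comp
      (ContinuousLinearMap.const ℝ (Icc (0 : ℝ) 1) x + u (τ, x))
    have hv : Continuous fun r : ℝ => v (projIcc 0 1 zero_le_one r) :=
      v.continuous.comp continuous_projIcc
    have hk : HasDerivAt (fun r : ℝ => x + τ • ∫ q in (0 : ℝ)..r, v (projIcc 0 1 zero_le_one q))
        (τ • v (projIcc 0 1 zero_le_one s)) s :=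
      ((hv.integral_hasStrictDerivAt 0 s).hasDerivAt.const_smul τ).const_add x
    have hg : HasDerivAt (fun r : ℝ => Φ (r * τ)) (τ • deriv Φ t) s := by
      have h1 : HasDerivAt Φ (deriv Φ t) ((s : ℝ) * τ) := by rw [hst]; exact hd.hasDerivAt
      exact h1.scomp (s : ℝ) (by simpa using (hasDerivAt_id (s : ℝ)).mul_const τ)
    have hset : ∀ r ∈ Icc (s : ℝ) 1, Φ (r * τ) =
        x + τ • ∫ q in (0 : ℝ)..r, v (projIcc 0 1 zero_le_one q) := by
      intro r hr
      have hr' : r ∈ Icc (0 : ℝ) 1 := ⟨s.2.1.trans hr.1, hr.2⟩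
      have h1 := hΦs ⟨r, hr'⟩
      have h2 := congrArg (fun z => z ⟨r, hr'⟩) (hu _ hp)
      simp only at h1 h2
      rw [h1, h2]
      rfl
    have hun : UniqueDiffWithinAt ℝ (Icc (s : ℝ) 1) s :=
      (uniqueDiffOn_Icc hs1) _ ⟨le_rfl, hs1.le⟩
    have heq := hun.eq_deriv _ hg.hasDerivWithinAt
      ((hk.hasDerivWithinAt (s := Icc (s : ℝ) 1)).congr hset (hset _ ⟨le_rfl, hs1.le⟩))
    have hfin : deriv Φ t = f (Φ t) := by
      have h1 := smul_right_injective E hτ0 heq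
      rw [h1, ← hst, hΦs s, projIcc_of_mem zero_le_one s.2]
      rfl
    have := hd.hasDerivAt
    rwa [hfin] at this

/-- A vector field which is smooth near a point has a smooth local flow there. -/
theorem exists_smooth_flow [FiniteDimensional ℝ E] {f : E → E} {U : Set E} (hU : IsOpen U)
    (hf : ContDiffOn ℝ ∞ f U) {x₀ : E} (hx₀ : x₀ ∈ U) : ∃ (Φ : ℝ × E → E) (ε : ℝ), 0 < ε ∧
      ContDiffOn ℝ ∞ Φ (Metric.ball 0 ε ×ˢ Metric.ball x₀ ε) ∧
      (∀ x ∈ Metric.ball x₀ ε, Φ (0, x) = x) ∧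
      ∀ t ∈ Metric.ball (0 : ℝ) ε, ∀ x ∈ Metric.ball x₀ ε, Φ (t, x) ∈ U ∧
        HasDerivAt (fun t => Φ (t, x)) (f (Φ (t, x))) t := by
  have : CompleteSpace E := FiniteDimensional.complete ℝ E
  obtain ⟨r, hr, hrU⟩ := Metric.mem_nhds_iff.1 (hU.mem_nhds hx₀)
  -- The bump function makes the field global. It equals `1` on the ball of radius `r / 3`, where
  -- the flow is kept by shrinking times and initial points.
  let b : ContDiffBump x₀ := ⟨r / 3, r / 2, by positivity, by linarith⟩
  have hg : ContDiff ℝ ∞ (fun x => b x • f x) := by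
    rw [contDiff_iff_contDiffAt]
    intro x
    by_cases hx : x ∈ U
    · exact b.contDiff.contDiffAt.smul (hf.contDiffAt (hU.mem_nhds hx))
    · have hx2 : x ∉ Metric.closedBall x₀ (r / 2) := fun h =>
        hx (hrU (Metric.closedBall_subset_ball (by linarith) h))
      have : (fun x => b x • f x) =ᶠ[𝓝 x] fun _ => 0 := by
        filter_upwards [Metric.isClosed_closedBall.isOpen_compl.mem_nhds hx2] with y hy
        rw [b.zero_of_le_dist, zero_smul]
        simp only [mem_compl_iff, Metric.mem_closedBall, not_le] at hy
        exact hy.le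
      exact contDiffAt_const.congr_of_eventuallyEq this
  obtain ⟨Φ, ε, hε, hΦ, h0, hd⟩ := exists_smooth_flow_of_contDiff hg x₀
  have hc : ContinuousAt Φ (0, x₀) := (hΦ.continuousOn).continuousAt
    ((Metric.isOpen_ball.prod Metric.isOpen_ball).mem_nhds
      ⟨Metric.mem_ball_self hε, Metric.mem_ball_self hε⟩)
  have hm : Φ ⁻¹' (Metric.ball x₀ (r / 3)) ∈ 𝓝 ((0 : ℝ), x₀) := by
    apply hc
    rw [h0 _ (Metric.mem_ball_self hε)]
    exact Metric.ball_mem_nhds _ (by positivity)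
  obtain ⟨δ, hδ, hδs⟩ := Metric.mem_nhds_iff.1 hm
  rw [← ball_prod_same] at hδs
  refine ⟨Φ, min ε δ, lt_min hε hδ, hΦ.mono ?_, fun x hx => h0 x ?_, fun t ht x hx => ?_⟩
  · exact prod_mono (Metric.ball_subset_ball (min_le_left _ _))
      (Metric.ball_subset_ball (min_le_left _ _))
  · exact Metric.ball_subset_ball (min_le_left _ _) hx
  · have h1 : Φ (t, x) ∈ Metric.ball x₀ (r / 3) :=
      hδs ⟨Metric.ball_subset_ball (min_le_right _ _) ht,
        Metric.ball_subset_ball (min_le_right _ _) hx⟩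
    refine ⟨hrU (Metric.ball_subset_ball (by linarith) h1), ?_⟩
    have h2 := hd t (Metric.ball_subset_ball (min_le_left _ _) ht) x
      (Metric.ball_subset_ball (min_le_left _ _) hx)
    rwa [b.one_of_mem_closedBall (Metric.ball_subset_closedBall h1), one_smul] at h2

end SmoothFlow

noncomputable section

/-! ### Linear algebra of the standard `G₂`-structure on `ℝ⁷` -/

/-- The cross product of `ℝ⁷` determined by `⟪u × v, w⟫ = φ₀(u, v, w)`. -/
def cross7 (u v : E7) : E7 := !₂[
  (u 1 * v 2 - u 2 * v 1) + (u 3 * v 4 - u 4 * v 3) - (u 5 * v 6 - u 6 * v 5),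
  (u 2 * v 0 - u 0 * v 2) + (u 3 * v 5 - u 5 * v 3) - (u 6 * v 4 - u 4 * v 6),
  (u 0 * v 1 - u 1 * v 0) + (u 3 * v 6 - u 6 * v 3) - (u 4 * v 5 - u 5 * v 4),
  (u 4 * v 0 - u 0 * v 4) + (u 5 * v 1 - u 1 * v 5) + (u 6 * v 2 - u 2 * v 6),
  (u 0 * v 3 - u 3 * v 0) - (u 1 * v 6 - u 6 * v 1) - (u 5 * v 2 - u 2 * v 5),
  -(u 6 * v 0 - u 0 * v 6) + (u 1 * v 3 - u 3 * v 1) - (u 2 * v 4 - u 4 * v 2),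
  -(u 0 * v 5 - u 5 * v 0) - (u 4 * v 1 - u 1 * v 4) + (u 2 * v 3 - u 3 * v 2)]

theorem inner_e7 (u v : E7) : inner ℝ u v = u 0 * v 0 + u 1 * v 1 + u 2 * v 2 + u 3 * v 3 +
    u 4 * v 4 + u 5 * v 5 + u 6 * v 6 := by
  rw [PiLp.inner_apply, Fin.sum_univ_seven]
  simp [mul_comm]

theorem inner_cross7 (u v w : E7) : inner ℝ (cross7 u v) w = phi0 ![u, v, w] := by
  rw [inner_e7]
  simp [cross7, phi0, dxx, Matrix.det_fin_three]
  ring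

/-- A polynomial identity in the coordinates; afterwards `ψ₀` is handled only through the cross
product. -/
theorem psi0_eq (u v w z : E7) : psi0 ![u, v, w, z] =
    inner ℝ u w * inner ℝ v z - inner ℝ u z * inner ℝ v w
      - inner ℝ (cross7 u v) (cross7 w z) := by
  simp only [inner_e7]
  simp [cross7, psi0, dxx, Matrix.det_succ_row_zero, Fin.sum_univ_succ, Fin.succAbove]
  ring

/-- The alternative law `u (u v) = (u u) v` of the octonions, read on imaginary parts. Most
identities below follow from it and from the cyclicity of the triple product. -/
theorem cross7_cross7_self (u v : E7) :
    cross7 u (cross7 u v) = (inner ℝ u v : ℝ) • u - (inner ℝ u u : ℝ) • v := by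
  simp only [inner_e7]
  ext i
  fin_cases i <;> simp [cross7] <;> ring

theorem cross7_swap (u v : E7) : cross7 v u = - cross7 u v := by
  ext i
  fin_cases i <;> simp [cross7] <;> ring

theorem cross7_add_right (u v w : E7) : cross7 u (v + w) = cross7 u v + cross7 u w := by
  ext i
  fin_cases i <;> simp [cross7] <;> ring

theorem cross7_smul_right (u v : E7) (c : ℝ) : cross7 u (c • v) = c • cross7 u v := by
  ext i
  fin_cases i <;> simp [cross7] <;> ring

theorem inner_cross7_left (u v : E7) : inner ℝ (cross7 u v) u = (0 : ℝ) := by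
  rw [inner_e7]; simp [cross7]; ring

theorem inner_cross7_right (u v : E7) : inner ℝ (cross7 u v) v = (0 : ℝ) := by
  rw [inner_e7]; simp [cross7]; ring

/-- The triple product `⟪u × v, w⟫` is cyclic. -/
theorem inner_cross7_cyclic (u v w : E7) : inner ℝ (cross7 u v) w = (inner ℝ (cross7 v w) u : ℝ) := by
  simp only [inner_e7]; simp [cross7]; ring

/-- The cross product as a bilinear map. -/
def cross7L : E7 →ₗ[ℝ] E7 →ₗ[ℝ] E7 :=
  LinearMap.mk₂ ℝ cross7
    (fun u v w => by rw [cross7_swap, cross7_add_right, cross7_swap w u, cross7_swap w v]; abel)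
    (fun c u v => by rw [cross7_swap, cross7_smul_right, cross7_swap v u, smul_neg])
    cross7_add_right (fun c u v => cross7_smul_right u v c)

theorem cross7L_apply (u v : E7) : cross7L u v = cross7 u v := rfl

theorem cross7_add_left (u v w : E7) : cross7 (u + v) w = cross7 u w + cross7 v w := by
  simp [← cross7L_apply]

theorem cross7_smul_left (u v : E7) (c : ℝ) : cross7 (c • u) v = c • cross7 u v := by
  simp [← cross7L_apply]

theorem cross7_self (u : E7) : cross7 u u = 0 := by
  ext i
  fin_cases i <;> simp [cross7] <;> ring

theorem cross7_neg_right (u v : E7) : cross7 u (-v) = -cross7 u v := by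
  simp [← cross7L_apply]

theorem cross7_neg_left (u v : E7) : cross7 (-u) v = -cross7 u v := by
  simp [← cross7L_apply]

/-- Polarisation of `|u × v|² = |u|²|v|² - ⟪u, v⟫²`. -/
theorem inner_cross7_cross7 (u v w : E7) : (inner ℝ (cross7 u v) (cross7 u w) : ℝ) =
    inner ℝ u u * inner ℝ v w - inner ℝ u v * inner ℝ u w := by
  have h1 := inner_cross7_cyclic u v (cross7 u w)
  have h2 := inner_cross7_cyclic (cross7 u w) u v
  have h3 : cross7 (cross7 u w) u = - cross7 u (cross7 u w) := by rw [cross7_swap]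
  rw [h1, inner_cross7_cyclic, h3, cross7_cross7_self, neg_sub, inner_sub_left, inner_smul_left,
    inner_smul_left, real_inner_comm w v]
  simp only [conj_trivial]
  ring

/-- The vector dual to `ψ₀(u, v, w, ·)`. -/
def chi7 (u v w : E7) : E7 :=
  (inner ℝ u w : ℝ) • v - (inner ℝ v w : ℝ) • u - cross7 (cross7 u v) w

theorem inner_chi7 (u v w z : E7) : inner ℝ (chi7 u v w) z = psi0 ![u, v, w, z] := by
  have h : (inner ℝ (cross7 u v) (cross7 w z) : ℝ) = inner ℝ (cross7 (cross7 u v) w) z := by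
    rw [real_inner_comm, inner_cross7_cyclic, inner_cross7_cyclic]
  rw [psi0_eq, h, chi7, inner_sub_left, inner_sub_left, inner_smul_left, inner_smul_left]
  simp only [conj_trivial]
  ring

theorem inner_cross7_cross7_mid (u v w : E7) : (inner ℝ (cross7 (cross7 u v) w) v : ℝ) =
    inner ℝ v v * inner ℝ u w - inner ℝ u v * inner ℝ v w := by
  have h := cross7_cross7_self v u
  rw [← inner_cross7_cyclic, cross7_swap v u, cross7_neg_right, h, inner_neg_left,
    inner_sub_left, inner_smul_left, inner_smul_left, real_inner_comm v u]
  simp only [conj_trivial]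
  ring

theorem inner_cross7_cross7_mid' (u v w : E7) : (inner ℝ (cross7 (cross7 u v) w) u : ℝ) =
    inner ℝ u v * inner ℝ u w - inner ℝ u u * inner ℝ v w := by
  have h := cross7_cross7_self u v
  rw [← inner_cross7_cyclic, h,
    inner_sub_left, inner_smul_left, inner_smul_left]
  simp only [conj_trivial]

/-- The norm of `χ` in terms of the Gram determinant and `φ₀`. -/
theorem inner_chi7_chi7 (u v w w' : E7) : (inner ℝ (chi7 u v w) (chi7 u v w') : ℝ) =
    (inner ℝ w w' * (inner ℝ u u * inner ℝ v v - inner ℝ u v ^ 2)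
      - inner ℝ v w * (inner ℝ u u * inner ℝ v w' - inner ℝ u w' * inner ℝ u v)
      + inner ℝ u w * (inner ℝ u v * inner ℝ v w' - inner ℝ u w' * inner ℝ v v))
    - inner ℝ (cross7 u v) w * inner ℝ (cross7 u v) w' := by
  have h1 := inner_cross7_cross7 (cross7 u v) w w'
  have h2 := inner_cross7_cross7 u v v
  have h3 := inner_cross7_cross7_mid u v w
  have h4 := inner_cross7_cross7_mid' u v w
  have h5 := inner_cross7_cross7_mid u v w'
  have h6 := inner_cross7_cross7_mid' u v w'
  rw [h2] at h1
  have e1 : (inner ℝ v u : ℝ) = inner ℝ u v := real_inner_comm _ _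
  have e2 : (inner ℝ u (cross7 (cross7 u v) w') : ℝ) = _ := (real_inner_comm _ _).trans h6
  have e3 : (inner ℝ v (cross7 (cross7 u v) w') : ℝ) = _ := (real_inner_comm _ _).trans h5
  rw [chi7, chi7, inner_sub_left, inner_sub_left, inner_sub_right, inner_sub_right,
    inner_sub_right, inner_sub_right, inner_sub_right, inner_sub_right]
  simp only [real_inner_smul_left, real_inner_smul_right, h1, h3, h4, e1, e2, e3]
  ring

theorem det_adjoint_e7 (T : E7 →ₗ[ℝ] E7) : LinearMap.det (LinearMap.adjoint T) = LinearMap.det T := by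
  let b := EuclideanSpace.basisFun (Fin 7) ℝ
  rw [← LinearMap.det_toMatrix b.toBasis, LinearMap.toMatrix_adjoint, Matrix.det_conjTranspose,
    LinearMap.det_toMatrix]
  rfl

/-- The operator `v ↦ u × v + ⟪a, v⟫ a`. -/
def crossRankOne (u a : E7) : E7 →ₗ[ℝ] E7 := cross7L u + (innerₛₗ ℝ a).smulRight a

theorem crossRankOne_apply (u a v : E7) :
    crossRankOne u a v = cross7 u v + (inner ℝ a v : ℝ) • a := rfl

theorem adjoint_crossRankOne (u a : E7) :
    LinearMap.adjoint (crossRankOne u a) = crossRankOne (-u) a := by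
  symm
  rw [LinearMap.eq_adjoint_iff]
  intro v w
  have h : (inner ℝ v (cross7 u w) : ℝ) = - inner ℝ (cross7 u v) w := by
    rw [real_inner_comm, inner_cross7_cyclic, inner_cross7_cyclic, cross7_swap u v, inner_neg_left]
  rw [crossRankOne_apply, crossRankOne_apply, inner_add_left, inner_add_right, cross7_neg_left,
    inner_neg_left, real_inner_smul_left, real_inner_smul_right, h, real_inner_comm a v]
  ring

/-- The map `u × ·` kills `u`; a rank one term along `u` makes it invertible, with a determinant
that knows `|u|`. Its product with the adjoint is `|u|²` on the complement of `u` and `α⁴|u|⁴` on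
`u`, that is, `|u|²` times a transvection with determinant `α⁴|u|²`. -/
theorem det_crossRankOne_sq (u : E7) (hu : u ≠ 0) (α : ℝ) :
    LinearMap.det (crossRankOne u (α • u)) ^ 2 = (inner ℝ u u : ℝ) ^ 8 * α ^ 4 := by
  have hs : (inner ℝ u u : ℝ) ≠ 0 := by simpa using hu
  set s : ℝ := inner ℝ u u with hsdef
  have h1 : crossRankOne (-u) (α • u) ∘ₗ crossRankOne u (α • u) =
      s • LinearMap.transvection (((α ^ 4 * s - 1) / s) • innerₛₗ ℝ u) u := by
    ext1 v
    have e1 : (inner ℝ u (cross7 u v) : ℝ) = 0 := by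
      rw [real_inner_comm]; exact inner_cross7_left u v
    have e2 : s * ((α ^ 4 * s - 1) / s) = α ^ 4 * s - 1 := by field_simp
    rw [LinearMap.comp_apply, crossRankOne_apply, crossRankOne_apply, LinearMap.smul_apply,
      LinearMap.transvection.apply, LinearMap.smul_apply, innerₛₗ_apply_apply, cross7_neg_left,
      cross7_add_right, cross7_cross7_self, cross7_smul_right, cross7_smul_right, cross7_self]
    simp only [inner_add_right, real_inner_smul_left, real_inner_smul_right, e1, ← hsdef,
      smul_add, smul_smul, smul_eq_mul, smul_zero, add_zero]
    rw [← mul_assoc s, e2]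
    module
  have h2 := congrArg LinearMap.det h1
  rw [LinearMap.det_comp, ← adjoint_crossRankOne, det_adjoint_e7, LinearMap.det_smul,
    LinearMap.transvection.det, LinearMap.smul_apply, innerₛₗ_apply_apply, ← hsdef,
    finrank_euclideanSpace_fin] at h2
  rw [sq, h2, smul_eq_mul]
  field_simp
  ring

/-- A linear map preserving `φ₀` is an isometry. -/
theorem inner_map_of_preserves_phi0 (A : E7 →ₗ[ℝ] E7)
    (hA : ∀ u v w, (inner ℝ (cross7 (A u) (A v)) (A w) : ℝ) = inner ℝ (cross7 u v) w) (u v : E7) :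
    (inner ℝ (A u) (A v) : ℝ) = inner ℝ u v := by
  -- If `A u = 0` then `u × · = 0`, and the `i`-th coordinate of `u × (u × eᵢ) = 0` gives `uᵢ² =
  -- |u|²`. Summing over seven coordinates, `|u|² = 7|u|²`.
  have hinj : ∀ u, A u = 0 → u = 0 := by
    intro u hu
    have h1 : ∀ v, cross7 u v = 0 := fun v => by
      refine ext_inner_right ℝ fun w => ?_
      rw [← hA, hu, ← cross7L_apply]; simp
    have h2 : ∀ i : Fin 7, u i * u i = inner ℝ u u := fun i => by
      have := cross7_cross7_self u (EuclideanSpace.single i 1)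
      rw [h1] at this
      have := congrArg (fun z : E7 => z i) this
      simp [EuclideanSpace.inner_single_right] at this
      rw [EuclideanSpace.real_norm_sq_eq] at this
      rw [inner_e7]
      simp [Fin.sum_univ_seven] at this
      linarith
    have h3 : (inner ℝ u u : ℝ) = 7 * inner ℝ u u := by
      conv_lhs => rw [inner_e7]
      simp only [h2]; ring
    exact inner_self_eq_zero.1 (by linarith : (inner ℝ u u : ℝ) = 0)
  -- Compare the determinants of the operators attached to `u` and to `A u`. Preservation of `φ₀`
  -- transports the cross product part, but the rank one part needs `⟨A u, A ·⟩` proportional to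
  -- `⟨u, ·⟩`. The transvection `P` along `u` arranges this without changing `φ₀(u, ·, ·)`. The
  -- outcome is `(det A)⁴ S⁸ = s⁸ (S / s)⁴`.
  have key : ∀ u, |LinearMap.det A| * inner ℝ (A u) (A u) = (inner ℝ u u : ℝ) := by
    intro u
    by_cases hu : u = 0
    · simp [hu]
    have hAu : A u ≠ 0 := fun h => hu (hinj u h)
    have hs : (0 : ℝ) < inner ℝ u u := real_inner_self_pos.2 hu
    have hS : (0 : ℝ) < inner ℝ (A u) (A u) := real_inner_self_pos.2 hAu
    set s : ℝ := inner ℝ u u with hsdef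
    set S : ℝ := inner ℝ (A u) (A u) with hSdef
    let l : E7 →ₗ[ℝ] ℝ := (-S⁻¹) • ((innerₛₗ ℝ (A u)).comp A - (S / s) • innerₛₗ ℝ u)
    have hl : ∀ v, l v = -S⁻¹ * (inner ℝ (A u) (A v) - S / s * inner ℝ u v) := fun v => rfl
    let P := LinearMap.transvection l u
    have hP : ∀ v, P v = v + l v • u := fun v => rfl
    have hlu : l u = 0 := by
      rw [hl, ← hsdef, ← hSdef]; field_simp; simp
    have hconj : LinearMap.adjoint (A ∘ₗ P) ∘ₗ crossRankOne (A u) ((1 : ℝ) • A u) ∘ₗ (A ∘ₗ P) =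
        crossRankOne u ((S / s) • u) := by
      ext1 v
      refine ext_inner_right ℝ fun w => ?_
      have e1 : ∀ v, (inner ℝ (A u) (A (P v)) : ℝ) = S / s * inner ℝ u v := by
        intro v
        rw [hP, map_add, map_smul, inner_add_right, real_inner_smul_right, ← hSdef, hl]
        field_simp; ring
      have e2 : (inner ℝ (cross7 u (P v)) (P w) : ℝ) = inner ℝ (cross7 u v) w := by
        rw [hP, hP, cross7_add_right, cross7_smul_right, cross7_self, smul_zero, add_zero,
          inner_add_right, real_inner_smul_right, inner_cross7_left]; ring
      rw [LinearMap.comp_apply, LinearMap.adjoint_inner_left, LinearMap.comp_apply,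
        LinearMap.comp_apply, LinearMap.comp_apply, crossRankOne_apply, crossRankOne_apply,
        inner_add_left, inner_add_left, hA, e2, one_smul, real_inner_smul_left,
        real_inner_smul_left, real_inner_smul_left, real_inner_smul_left, e1, e1]
    have hdet := congrArg LinearMap.det hconj
    rw [LinearMap.det_comp, LinearMap.det_comp, det_adjoint_e7, LinearMap.det_comp,
      LinearMap.transvection.det, hlu] at hdet
    have h4 : LinearMap.det A ^ 4 * S ^ 8 = s ^ 8 * (S / s) ^ 4 := by
      have h5 := det_crossRankOne_sq (A u) hAu 1
      rw [← hSdef] at h5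
      rw [hsdef, ← det_crossRankOne_sq u hu, ← hdet]
      linear_combination (-LinearMap.det A ^ 4) * h5
    have h6 : (|LinearMap.det A| * S) ^ 4 = s ^ 4 := by
      have h7 : |LinearMap.det A| ^ 4 = LinearMap.det A ^ 4 := by
        rw [Even.pow_abs (by decide)]
      rw [mul_pow, h7]
      have h8 : s ^ 8 * (S / s) ^ 4 = s ^ 4 * S ^ 4 := by field_simp
      rw [h8] at h4
      have h9 : S ^ 4 ≠ 0 := by positivity
      apply mul_right_cancel₀ h9
      linear_combination h4
    exact (pow_left_inj₀ (by positivity) hs.le (by norm_num)).1 h6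
  set d := |LinearMap.det A| with hd
  have hd0 : d ≠ 0 := by
    intro h
    have := key (EuclideanSpace.single 0 1)
    rw [h, zero_mul] at this
    simp at this
  -- Polarising `key` shows that `A` times its adjoint is the scalar `d⁻¹`; taking determinants, `d²
  -- = d⁻⁷`, so `d = 1`.
  have hT : LinearMap.adjoint A ∘ₗ A = d⁻¹ • (1 : E7 →ₗ[ℝ] E7) := by
    have hsym : (LinearMap.adjoint A ∘ₗ A - d⁻¹ • (1 : E7 →ₗ[ℝ] E7)).IsSymmetric := by
      intro x y
      simp only [LinearMap.sub_apply, LinearMap.comp_apply, inner_sub_left, inner_sub_right,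
        LinearMap.adjoint_inner_left, LinearMap.adjoint_inner_right, LinearMap.smul_apply,
        Module.End.one_apply, real_inner_smul_left, real_inner_smul_right]
    rw [← sub_eq_zero]
    refine hsym.inner_map_self_eq_zero.1 fun x => ?_
    simp only [LinearMap.sub_apply, LinearMap.comp_apply, inner_sub_left,
        LinearMap.adjoint_inner_left, LinearMap.smul_apply,
        Module.End.one_apply, real_inner_smul_left]
    rw [← key x]; field_simp; ring
  have hdd := congrArg LinearMap.det hT
  rw [LinearMap.det_comp, det_adjoint_e7, LinearMap.det_smul, map_one, mul_one,
    finrank_euclideanSpace_fin, ← abs_mul_abs_self, ← hd, inv_pow] at hdd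
  have hd9 : d ^ 9 = 1 := by field_simp at hdd; linear_combination hdd
  have hd1 : d = 1 := (pow_eq_one_iff_of_nonneg (abs_nonneg _) (by norm_num)).1 hd9
  rw [hd1, inv_one, one_smul] at hT
  rw [← LinearMap.adjoint_inner_left, ← LinearMap.comp_apply, hT]
  rfl

/-- It is enough to test against vectors `A w`, since an isometry of `ℝ⁷` is onto. -/
theorem cross7_map_of_preserves_phi0 (A : E7 →ₗ[ℝ] E7)
    (hA : ∀ u v w, (inner ℝ (cross7 (A u) (A v)) (A w) : ℝ) = inner ℝ (cross7 u v) w) (u v : E7) :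
    cross7 (A u) (A v) = A (cross7 u v) := by
  have hiso := inner_map_of_preserves_phi0 A hA
  have hinj : Function.Injective A := by
    rw [← LinearMap.ker_eq_bot, LinearMap.ker_eq_bot']
    intro x hx
    have := hiso x x
    rw [hx, inner_zero_left] at this
    exact inner_self_eq_zero.1 this.symm
  have hsurj : Function.Surjective A := LinearMap.injective_iff_surjective.1 hinj
  refine ext_inner_right ℝ fun z => ?_
  obtain ⟨w, rfl⟩ := hsurj z
  rw [hA, hiso]

theorem psi0_map_of_preserves_phi0 (A : E7 →ₗ[ℝ] E7)
    (hA : ∀ u v w, (inner ℝ (cross7 (A u) (A v)) (A w) : ℝ) = inner ℝ (cross7 u v) w)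
    (u v w z : E7) : psi0 ![A u, A v, A w, A z] = psi0 ![u, v, w, z] := by
  have hiso := inner_map_of_preserves_phi0 A hA
  rw [psi0_eq, psi0_eq, cross7_map_of_preserves_phi0 A hA, cross7_map_of_preserves_phi0 A hA]
  simp only [hiso]

/-- A proper subspace which is closed under the cross product has dimension at most `3`. -/
theorem eq_top_of_cross7_mem (W : Submodule ℝ E7) (hW : ∀ u ∈ W, ∀ v ∈ W, cross7 u v ∈ W)
    (hdim : 3 < Module.finrank ℝ W) : W = ⊤ := by
  by_contra hne
  have hperp : Wᗮ ≠ ⊥ := fun h => hne (Submodule.orthogonal_eq_bot_iff.1 h)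
  obtain ⟨e, heW, he0⟩ := Submodule.exists_mem_ne_zero_of_ne_bot hperp
  -- A vector `e ≠ 0` orthogonal to `W` embeds `W` into `Wᗮ` by `w ↦ e × w`, because `⟨e × w, z⟩ =
  -- ⟨w × z, e⟩ = 0` for `z ∈ W`. So `2 dim W ≤ 7`.
  have hmem : ∀ w : W, cross7 e w ∈ Wᗮ := by
    intro w
    rw [Submodule.mem_orthogonal]
    intro z hz
    rw [real_inner_comm, inner_cross7_cyclic]
    exact (Submodule.mem_orthogonal W e).1 heW _ (hW _ w.2 _ hz)
  let L : W →ₗ[ℝ] Wᗮ := LinearMap.codRestrict Wᗮ ((cross7L e).comp W.subtype) hmem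
  have hL : Function.Injective L := by
    rw [← LinearMap.ker_eq_bot, LinearMap.ker_eq_bot']
    intro w hw
    have h1 : cross7 e w = 0 := congrArg Subtype.val hw
    have h2 := cross7_cross7_self e w
    have h3 : (inner ℝ e (w : E7) : ℝ) = 0 := by
      rw [real_inner_comm]; exact (Submodule.mem_orthogonal W e).1 heW _ w.2
    rw [h1, h3, zero_smul, zero_sub, ← cross7L_apply, map_zero, zero_eq_neg, smul_eq_zero] at h2
    rcases h2 with h2 | h2
    · exact absurd (inner_self_eq_zero.1 h2) he0
    · exact Subtype.ext h2
  have h1 := LinearMap.finrank_le_finrank_of_injective hL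
  have h2 := Submodule.finrank_add_finrank_orthogonal W
  rw [finrank_euclideanSpace_fin] at h2
  omega

/-! ### Coassociative planes -/

theorem inner_cross7_mem_span_eq_zero (g : Fin 3 → E7) (z : E7)
    (h01 : (inner ℝ (cross7 (g 0) (g 1)) z : ℝ) = 0) (h02 : (inner ℝ (cross7 (g 0) (g 2)) z : ℝ) = 0)
    (h12 : (inner ℝ (cross7 (g 1) (g 2)) z : ℝ) = 0) :
    ∀ a ∈ Submodule.span ℝ (Set.range g), ∀ b ∈ Submodule.span ℝ (Set.range g),
      (inner ℝ (cross7 a b) z : ℝ) = 0 := by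
  intro a ha b hb
  obtain ⟨a, rfl⟩ := (Submodule.mem_span_range_iff_exists_fun ℝ).1 ha
  obtain ⟨b, rfl⟩ := (Submodule.mem_span_range_iff_exists_fun ℝ).1 hb
  simp only [Fin.sum_univ_three, cross7_add_left, cross7_add_right, cross7_smul_left,
    cross7_smul_right, cross7_self, inner_add_left, real_inner_smul_left,
    cross7_swap (g 0) (g 1), cross7_swap (g 0) (g 2), cross7_swap (g 1) (g 2), inner_neg_left,
    h01, h02, h12, inner_zero_left]
  ring

theorem inner_cross7_perm {a b c : E7} (h : (inner ℝ (cross7 a b) c : ℝ) = 0) :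
    (inner ℝ (cross7 b c) a : ℝ) = 0 ∧ (inner ℝ (cross7 c a) b : ℝ) = 0 ∧
    (inner ℝ (cross7 b a) c : ℝ) = 0 ∧ (inner ℝ (cross7 c b) a : ℝ) = 0 ∧
    (inner ℝ (cross7 a c) b : ℝ) = 0 := by
  have h1 : (inner ℝ (cross7 b c) a : ℝ) = 0 := by rw [← inner_cross7_cyclic]; exact h
  have h2 : (inner ℝ (cross7 c a) b : ℝ) = 0 := by rw [← inner_cross7_cyclic]; exact h1
  refine ⟨h1, h2, ?_, ?_, ?_⟩
  · rw [cross7_swap a b, inner_neg_left, h, neg_zero]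
  · rw [cross7_swap b c, inner_neg_left, h1, neg_zero]
  · rw [cross7_swap c a, inner_neg_left, h2, neg_zero]

theorem isotropic_span_of_triples (g : Fin 4 → E7)
    (h012 : (inner ℝ (cross7 (g 0) (g 1)) (g 2) : ℝ) = 0)
    (h013 : (inner ℝ (cross7 (g 0) (g 1)) (g 3) : ℝ) = 0)
    (h023 : (inner ℝ (cross7 (g 0) (g 2)) (g 3) : ℝ) = 0)
    (h123 : (inner ℝ (cross7 (g 1) (g 2)) (g 3) : ℝ) = 0) :
    ∀ a ∈ Submodule.span ℝ (Set.range g), ∀ b ∈ Submodule.span ℝ (Set.range g),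
      ∀ c ∈ Submodule.span ℝ (Set.range g), (inner ℝ (cross7 a b) c : ℝ) = 0 := by
  intro a ha b hb c hc
  obtain ⟨p1, p2, p3, p4, p5⟩ := inner_cross7_perm h012
  obtain ⟨q1, q2, q3, q4, q5⟩ := inner_cross7_perm h013
  obtain ⟨r1, r2, r3, r4, r5⟩ := inner_cross7_perm h023
  obtain ⟨s1, s2, s3, s4, s5⟩ := inner_cross7_perm h123
  have H : ∀ i j k, (inner ℝ (cross7 (g i) (g j)) (g k) : ℝ) = 0 := by
    intro i j k
    fin_cases i <;> fin_cases j <;> fin_cases k <;>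
      simp only [Fin.zero_eta, Fin.mk_one, Fin.reduceFinMk, cross7_self, inner_zero_left,
        inner_cross7_left, inner_cross7_right] <;> assumption
  obtain ⟨a, rfl⟩ := (Submodule.mem_span_range_iff_exists_fun ℝ).1 ha
  obtain ⟨b, rfl⟩ := (Submodule.mem_span_range_iff_exists_fun ℝ).1 hb
  obtain ⟨c, rfl⟩ := (Submodule.mem_span_range_iff_exists_fun ℝ).1 hc
  rw [← cross7L_apply]
  simp only [map_sum, LinearMap.sum_apply, map_smul, LinearMap.smul_apply, sum_inner, inner_sum,
    real_inner_smul_left, real_inner_smul_right, cross7L_apply, H, mul_zero,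
    Finset.sum_const_zero]

/-- The orthonormal frame generated by an orthonormal triple `e` with `φ₀(e) = 0`. -/
theorem orthonormal_coassociative_frame (e : Fin 3 → E7) (he : Orthonormal ℝ e)
    (hφ : (inner ℝ (cross7 (e 0) (e 1)) (e 2) : ℝ) = 0) :
    Orthonormal ℝ ![e 0, e 1, e 2, cross7 (cross7 (e 0) (e 1)) (e 2), cross7 (e 0) (e 1),
      cross7 (e 0) (e 2), cross7 (e 1) (e 2)] := by
  have hi := orthonormal_iff_ite.1 he
  have n00 : (inner ℝ (e 0) (e 0) : ℝ) = 1 := by simpa using hi 0 0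
  have n11 : (inner ℝ (e 1) (e 1) : ℝ) = 1 := by simpa using hi 1 1
  have n22 : (inner ℝ (e 2) (e 2) : ℝ) = 1 := by simpa using hi 2 2
  have n01 : (inner ℝ (e 0) (e 1) : ℝ) = 0 := by simpa using hi 0 1
  have n02 : (inner ℝ (e 0) (e 2) : ℝ) = 0 := by simpa using hi 0 2
  have n12 : (inner ℝ (e 1) (e 2) : ℝ) = 0 := by simpa using hi 1 2
  have n10 : (inner ℝ (e 1) (e 0) : ℝ) = 0 := by simpa using hi 1 0
  have n20 : (inner ℝ (e 2) (e 0) : ℝ) = 0 := by simpa using hi 2 0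
  have n21 : (inner ℝ (e 2) (e 1) : ℝ) = 0 := by simpa using hi 2 1
  obtain ⟨p1, p2, p3, p4, p5⟩ := inner_cross7_perm hφ
  have sw : ∀ a b c d : E7, (inner ℝ (cross7 a b) (cross7 c d) : ℝ) =
      inner ℝ (cross7 b a) (cross7 d c) := fun a b c d => by
    rw [cross7_swap b a, cross7_swap d c, inner_neg_neg]
  have sw1 : ∀ a b c : E7, (inner ℝ (cross7 a b) c : ℝ) =
      -inner ℝ (cross7 b a) c := fun a b c => by
    rw [cross7_swap b a, inner_neg_left]
  set n := cross7 (e 0) (e 1) with hn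
  have m0 : (inner ℝ (cross7 n (e 2)) (e 0) : ℝ) = 0 := by
    rw [inner_cross7_cross7_mid', n01, n12, n02]; ring
  have m1 : (inner ℝ (cross7 n (e 2)) (e 1) : ℝ) = 0 := by
    rw [inner_cross7_cross7_mid, n01, n12, n02]; ring
  have nn : (inner ℝ n n : ℝ) = 1 := by rw [inner_cross7_cross7, n00, n11, n01]; ring
  have m3 : (inner ℝ (cross7 n (e 2)) (cross7 n (e 2)) : ℝ) = 1 := by
    rw [inner_cross7_cross7, nn, n22, hφ]; ring
  have n0 : (inner ℝ n (e 0) : ℝ) = 0 := inner_cross7_left _ _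
  have n1 : (inner ℝ n (e 1) : ℝ) = 0 := inner_cross7_right _ _
  have hc2 : (inner ℝ (e 2) n : ℝ) = 0 := by rw [real_inner_comm]; exact hφ
  have m5 : (inner ℝ (cross7 n (e 2)) (cross7 (e 0) (e 2)) : ℝ) = 0 := by
    rw [sw, inner_cross7_cross7, n0, n20]; ring
  have m6 : (inner ℝ (cross7 n (e 2)) (cross7 (e 1) (e 2)) : ℝ) = 0 := by
    rw [sw, inner_cross7_cross7, n1, n21]; ring
  have k5 : (inner ℝ n (cross7 (e 0) (e 2)) : ℝ) = 0 := by
    rw [hn, inner_cross7_cross7, n12, n01]; ring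
  have k6 : (inner ℝ n (cross7 (e 1) (e 2)) : ℝ) = 0 := by
    rw [hn, sw1, inner_cross7_cross7, n02, n10]; ring
  have k55 : (inner ℝ (cross7 (e 0) (e 2)) (cross7 (e 0) (e 2)) : ℝ) = 1 := by
    rw [inner_cross7_cross7, n00, n22, n02]; ring
  have k66 : (inner ℝ (cross7 (e 1) (e 2)) (cross7 (e 1) (e 2)) : ℝ) = 1 := by
    rw [inner_cross7_cross7, n11, n22, n12]; ring
  have k56 : (inner ℝ (cross7 (e 0) (e 2)) (cross7 (e 1) (e 2)) : ℝ) = 0 := by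
    rw [sw, inner_cross7_cross7, n22, n01, n20]; ring
  have l50 : (inner ℝ (cross7 (e 0) (e 2)) (e 0) : ℝ) = 0 := inner_cross7_left _ _
  have l52 : (inner ℝ (cross7 (e 0) (e 2)) (e 2) : ℝ) = 0 := inner_cross7_right _ _
  have l61 : (inner ℝ (cross7 (e 1) (e 2)) (e 1) : ℝ) = 0 := inner_cross7_left _ _
  have l62 : (inner ℝ (cross7 (e 1) (e 2)) (e 2) : ℝ) = 0 := inner_cross7_right _ _
  have m2 : (inner ℝ (cross7 n (e 2)) (e 2) : ℝ) = 0 := inner_cross7_right _ _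
  have m4 : (inner ℝ (cross7 n (e 2)) n : ℝ) = 0 := inner_cross7_left _ _
  rw [orthonormal_iff_ite]
  have hsymm : ∀ i j : Fin 7, i ≤ j → inner ℝ
      (![e 0, e 1, e 2, cross7 n (e 2), n, cross7 (e 0) (e 2), cross7 (e 1) (e 2)] j)
      (![e 0, e 1, e 2, cross7 n (e 2), n, cross7 (e 0) (e 2), cross7 (e 1) (e 2)] i) =
      if i = j then (1 : ℝ) else 0 := by
    intro i j hij
    fin_cases i <;> fin_cases j <;> first | (exact absurd hij (by decide)) | skip
    all_goals simp only [Fin.zero_eta, Fin.mk_one, Fin.reduceFinMk, Matrix.cons_val,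
      Fin.reduceEq, if_true, if_false, zero_ne_one]
    all_goals first | assumption | (rw [real_inner_comm]; assumption)
  intro i j
  rcases le_total i j with h | h
  · rw [real_inner_comm]; exact hsymm i j h
  · rw [hsymm j i h]; simp [eq_comm]

theorem exists_orthonormalBasis_e7 (f : Fin 7 → E7) (hf : Orthonormal ℝ f) :
    ∃ b : OrthonormalBasis (Fin 7) ℝ E7, ∀ i, b i = f i := by
  obtain ⟨b, hb⟩ := Orthonormal.exists_orthonormalBasis_extension_of_card_eq (𝕜 := ℝ) (E := E7)
    (ι := Fin 7) (by simp) (v := f) (s := Set.univ) (hf.comp _ Subtype.val_injective)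
  exact ⟨b, fun i => hb i (Set.mem_univ i)⟩

theorem exists_orthonormal_span_eq {k : ℕ} (F : Submodule ℝ E7) (hF : Module.finrank ℝ F = k) :
    ∃ e : Fin k → E7, Orthonormal ℝ e ∧ Submodule.span ℝ (Set.range e) = F := by
  let b := (stdOrthonormalBasis ℝ F).reindex (finCongr hF)
  refine ⟨fun i => b i, b.orthonormal.comp_linearIsometry F.subtypeₗᵢ, ?_⟩
  have h := b.toBasis.span_eq
  have h2 := congrArg (Submodule.map F.subtype) h
  rw [Submodule.map_span, Submodule.map_subtype_top, ← Set.range_comp] at h2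
  convert h2 using 3
  ext i
  simp

theorem span_eq_of_orthonormal {k : ℕ} (F : Submodule ℝ E7) (hF : Module.finrank ℝ F = k)
    (e : Fin k → E7) (he : Orthonormal ℝ e) (heF : ∀ i, e i ∈ F) :
    Submodule.span ℝ (Set.range e) = F := by
  apply Submodule.eq_of_le_of_finrank_eq
  · rw [Submodule.span_le]; rintro _ ⟨i, rfl⟩; exact heF i
  · rw [finrank_span_eq_card he.linearIndependent, hF, Fintype.card_fin]

/-- A `4`-plane on which `φ₀` vanishes is coassociative. -/
theorem abs_psi0_eq_one_of_isotropic (e : Fin 4 → E7) (he : Orthonormal ℝ e)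
    (hφ : ∀ i j k, (inner ℝ (cross7 (e i) (e j)) (e k) : ℝ) = 0) : |psi0 e| = 1 := by
  have he3 := orthonormal_coassociative_frame ![e 0, e 1, e 2]
    (by
      have := he.comp ![0, 1, 2] (by decide)
      convert this using 1
      ext i; fin_cases i <;> rfl) (hφ 0 1 2)
  obtain ⟨b, hb⟩ := exists_orthonormalBasis_e7 _ he3
  have hi := orthonormal_iff_ite.1 he
  -- Parseval for `e 3`: by orthonormality and isotropy only the component along the fourth frame
  -- vector survives, and that component is `-psi0 e`.
  have h1 := b.sum_inner_mul_inner (e 3) (e 3)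
  have hψ : psi0 e = inner ℝ (e 0) (e 2) * inner ℝ (e 1) (e 3) -
      inner ℝ (e 0) (e 3) * inner ℝ (e 1) (e 2) -
        inner ℝ (cross7 (e 0) (e 1)) (cross7 (e 2) (e 3)) := by
    rw [← psi0_eq]; congr 1; ext i; fin_cases i <;> rfl
  have h3 : (inner ℝ (cross7 (cross7 (e 0) (e 1)) (e 2)) (e 3) : ℝ) =
      inner ℝ (cross7 (e 0) (e 1)) (cross7 (e 2) (e 3)) := by
    rw [real_inner_comm (cross7 (e 2) (e 3)), inner_cross7_cyclic, inner_cross7_cyclic,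
      ← inner_cross7_cyclic]
  simp only [Fin.sum_univ_seven, hb, Matrix.cons_val, Matrix.cons_val_zero,
    Matrix.cons_val_one] at h1
  rw [real_inner_comm (cross7 (e 0) (e 1)) (e 3), real_inner_comm (cross7 (e 0) (e 2)) (e 3),
    real_inner_comm (cross7 (e 1) (e 2)) (e 3),
    real_inner_comm (cross7 (cross7 (e 0) (e 1)) (e 2)) (e 3), hφ, hφ, hφ, h3, hi, hi, hi, hi, hi,
    hi, hi] at h1
  rw [hi, hi, hi, hi] at hψ
  simp at hψ h1
  rw [hψ, abs_neg]
  rcases mul_self_eq_one_iff.1 h1 with h | h <;> simp [h]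

/-- `φ₀` vanishes on coassociative planes. -/
theorem isotropic_of_abs_psi0_eq_one (F : Submodule ℝ E7) (hF : Module.finrank ℝ F = 4)
    (hψ : ∀ e : Fin 4 → E7, (∀ i, e i ∈ F) → Orthonormal ℝ e → |psi0 e| = 1) :
    ∀ a ∈ F, ∀ b ∈ F, ∀ c ∈ F, (inner ℝ (cross7 a b) c : ℝ) = 0 := by
  obtain ⟨e, he, hspan⟩ := exists_orthonormal_span_eq F hF
  have heF : ∀ i, e i ∈ F := fun i => by
    rw [← hspan]; exact Submodule.subset_span ⟨i, rfl⟩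
  have key : ∀ e : Fin 4 → E7, (∀ i, e i ∈ F) → Orthonormal ℝ e →
      (inner ℝ (cross7 (e 0) (e 1)) (e 2) : ℝ) = 0 := by
    intro e heF he
    have hi := orthonormal_iff_ite.1 he
    -- Here `|χ|² = 1 - φ₀²`, while `ψ₀ = ⟨χ, e 3⟩` is at most `|χ|` in absolute value; so `|ψ₀| =
    -- 1` forces `φ₀ = 0`.
    have h1 := inner_chi7_chi7 (e 0) (e 1) (e 2) (e 2)
    have h2 : (inner ℝ (chi7 (e 0) (e 1) (e 2)) (e 3) : ℝ) = psi0 e := by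
      rw [inner_chi7]; congr 1; ext i; fin_cases i <;> rfl
    rw [hi, hi, hi, hi, hi, hi] at h1
    simp at h1
    have h3 := abs_real_inner_le_norm (chi7 (e 0) (e 1) (e 2)) (e 3)
    rw [h2, hψ e heF he, he.1 3, mul_one] at h3
    nlinarith [norm_nonneg (chi7 (e 0) (e 1) (e 2)),
      mul_self_nonneg (inner ℝ (cross7 (e 0) (e 1)) (e 2) : ℝ)]
  have kp : ∀ σ : Fin 4 → Fin 4, Function.Injective σ →
      (inner ℝ (cross7 (e (σ 0)) (e (σ 1))) (e (σ 2)) : ℝ) = 0 := fun σ hσ =>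
    key (e ∘ σ) (fun i => heF _) (he.comp σ hσ)
  rw [← hspan]
  exact isotropic_span_of_triples e (kp id Function.injective_id)
    (kp ![0, 1, 3, 2] (by decide)) (kp ![0, 2, 3, 1] (by decide)) (kp ![1, 2, 3, 0] (by decide))

/-- An isotropic `3`-plane lies in a unique coassociative plane. -/
theorem coassociative_completion (u v w : E7) (hli : LinearIndependent ℝ ![u, v, w])
    (hφ : (inner ℝ (cross7 u v) w : ℝ) = 0) (F : Submodule ℝ E7)
    (hF : ∀ z, z ∈ F ↔ (inner ℝ (cross7 u v) z : ℝ) = 0 ∧ (inner ℝ (cross7 u w) z : ℝ) = 0 ∧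
      (inner ℝ (cross7 v w) z : ℝ) = 0) :
    Module.finrank ℝ F = 4 ∧ ∀ a ∈ F, ∀ b ∈ F, ∀ c ∈ F, (inner ℝ (cross7 a b) c : ℝ) = 0 := by
  -- In the frame generated by an orthonormal basis of `T`, the last three vectors are the pairwise
  -- cross products, to which `F` is orthogonal, and the first four span `F`.
  set T := Submodule.span ℝ (Set.range ![u, v, w]) with hT
  have hTd : Module.finrank ℝ T = 3 := by rw [finrank_span_eq_card hli, Fintype.card_fin]
  obtain ⟨e, he, hspan⟩ := exists_orthonormal_span_eq T hTd
  have heT : ∀ i, e i ∈ T := fun i => by rw [← hspan]; exact Submodule.subset_span ⟨i, rfl⟩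
  have hFT : ∀ z ∈ F, ∀ a ∈ T, ∀ b ∈ T, (inner ℝ (cross7 a b) z : ℝ) = 0 := fun z hz =>
    inner_cross7_mem_span_eq_zero ![u, v, w] z ((hF z).1 hz).1 ((hF z).1 hz).2.1 ((hF z).1 hz).2.2
  obtain ⟨p1, p2, p3, p4, p5⟩ := inner_cross7_perm hφ
  have hTF : T ≤ F := by
    rw [hT, Submodule.span_le]
    rintro _ ⟨i, rfl⟩
    fin_cases i
    · exact (hF u).2 ⟨inner_cross7_left _ _, inner_cross7_left _ _, p1⟩
    · exact (hF v).2 ⟨inner_cross7_right _ _, p5, inner_cross7_left _ _⟩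
    · exact (hF w).2 ⟨hφ, inner_cross7_right _ _, inner_cross7_right _ _⟩
  have hTi : ∀ a ∈ T, ∀ b ∈ T, ∀ c ∈ T, (inner ℝ (cross7 a b) c : ℝ) = 0 :=
    fun a ha b hb c hc => hFT c (hTF hc) a ha b hb
  have hon := orthonormal_coassociative_frame e he (hTi _ (heT 0) _ (heT 1) _ (heT 2))
  set B := ![e 0, e 1, e 2, cross7 (cross7 (e 0) (e 1)) (e 2), cross7 (e 0) (e 1),
      cross7 (e 0) (e 2), cross7 (e 1) (e 2)] with hB
  obtain ⟨b, hb⟩ := exists_orthonormalBasis_e7 B hon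
  have hBi := orthonormal_iff_ite.1 hon
  set g : Fin 4 → E7 := ![e 0, e 1, e 2, cross7 (cross7 (e 0) (e 1)) (e 2)] with hg
  have hgB : g = B ∘ Fin.castLE (by norm_num) := by
    ext i; fin_cases i <;> rfl
  have hgon : Orthonormal ℝ g := by
    rw [hgB]; exact hon.comp _ (Fin.castLE_injective _)
  have h34 : (inner ℝ (B 4) (B 3) : ℝ) = 0 := by rw [hBi]; rfl
  have h35 : (inner ℝ (B 5) (B 3) : ℝ) = 0 := by rw [hBi]; rfl
  have h36 : (inner ℝ (B 6) (B 3) : ℝ) = 0 := by rw [hBi]; rfl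
  have hgspan : Submodule.span ℝ (Set.range g) = F := by
    apply le_antisymm
    · rw [Submodule.span_le]
      rintro _ ⟨i, rfl⟩
      fin_cases i
      · exact hTF (heT 0)
      · exact hTF (heT 1)
      · exact hTF (heT 2)
      · have h := inner_cross7_mem_span_eq_zero e (B 3) h34 h35 h36
        rw [hspan] at h
        have hm : ∀ i, ![u, v, w] i ∈ T := fun i => Submodule.subset_span ⟨i, rfl⟩
        exact (hF _).2 ⟨h _ (hm 0) _ (hm 1), h _ (hm 0) _ (hm 2), h _ (hm 1) _ (hm 2)⟩
    · intro z hz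
      have h1 := b.sum_repr' z
      have z4 : (inner ℝ (B 4) z : ℝ) = 0 := hFT z hz _ (heT 0) _ (heT 1)
      have z5 : (inner ℝ (B 5) z : ℝ) = 0 := hFT z hz _ (heT 0) _ (heT 2)
      have z6 : (inner ℝ (B 6) z : ℝ) = 0 := hFT z hz _ (heT 1) _ (heT 2)
      simp only [Fin.sum_univ_seven, hb, z4, z5, z6, zero_smul, add_zero] at h1
      rw [← h1]
      have hm : ∀ i, g i ∈ Submodule.span ℝ (Set.range g) := fun i =>
        Submodule.subset_span ⟨i, rfl⟩
      exact add_mem (add_mem (add_mem (Submodule.smul_mem _ _ (hm 0))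
        (Submodule.smul_mem _ _ (hm 1))) (Submodule.smul_mem _ _ (hm 2)))
        (Submodule.smul_mem _ _ (hm 3))
  refine ⟨?_, ?_⟩
  · rw [← hgspan, finrank_span_eq_card hgon.linearIndependent, Fintype.card_fin]
  · rw [← hgspan]
    exact isotropic_span_of_triples g (hTi _ (heT 0) _ (heT 1) _ (heT 2)) h34 h35 h36

/-! ### Associative planes -/

theorem cross7_mem_span {ι : Type*} (g : ι → E7) (F : Submodule ℝ E7)
    (h : ∀ i j, cross7 (g i) (g j) ∈ F) :
    ∀ a ∈ Submodule.span ℝ (Set.range g), ∀ b ∈ Submodule.span ℝ (Set.range g),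
      cross7 a b ∈ F := by
  have h1 : ∀ i, ∀ b ∈ Submodule.span ℝ (Set.range g), cross7 (g i) b ∈ F := by
    intro i b hb
    have : Submodule.span ℝ (Set.range g) ≤ F.comap (cross7L (g i)) := by
      rw [Submodule.span_le]; rintro _ ⟨j, rfl⟩; exact h i j
    exact this hb
  intro a ha b hb
  have : Submodule.span ℝ (Set.range g) ≤ F.comap (cross7L.flip b) := by
    rw [Submodule.span_le]; rintro _ ⟨j, rfl⟩; exact h1 j b hb
  exact this ha

/-- Equality in Cauchy–Schwarz: `e₀ × e₁` and `e₂` are unit vectors with inner product `±1`, hence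
`e₀ × e₁ = ±e₂`. -/
theorem cross7_mem_of_abs_phi0_eq_one (F : Submodule ℝ E7) (hF : Module.finrank ℝ F = 3)
    (hφ : ∀ e : Fin 3 → E7, (∀ i, e i ∈ F) → Orthonormal ℝ e → |phi0 e| = 1) :
    ∀ a ∈ F, ∀ b ∈ F, cross7 a b ∈ F := by
  obtain ⟨e, he, hspan⟩ := exists_orthonormal_span_eq F hF
  have heF : ∀ i, e i ∈ F := fun i => by
    rw [← hspan]; exact Submodule.subset_span ⟨i, rfl⟩
  have key : ∀ e : Fin 3 → E7, (∀ i, e i ∈ F) → Orthonormal ℝ e → cross7 (e 0) (e 1) ∈ F := by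
    intro e heF he
    have hi := orthonormal_iff_ite.1 he
    have h2 : (inner ℝ (cross7 (e 0) (e 1)) (e 2) : ℝ) = phi0 e := by
      rw [inner_cross7]; congr 1; ext i; fin_cases i <;> rfl
    have h1 := inner_cross7_cross7 (e 0) (e 1) (e 1)
    rw [hi, hi, hi] at h1
    simp only [if_true, zero_ne_one, if_false] at h1
    have h22 : (inner ℝ (e 2) (e 2) : ℝ) = 1 := by simpa using hi 2 2
    set c := phi0 e with hc
    have hc2 : c * c = 1 := by
      rw [← abs_mul_abs_self, hφ e heF he]; norm_num
    have h3 : cross7 (e 0) (e 1) - c • e 2 = 0 := by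
      rw [← inner_self_eq_zero (𝕜 := ℝ), inner_sub_left, inner_sub_right, inner_sub_right,
        real_inner_smul_left, real_inner_smul_left, real_inner_smul_right, real_inner_smul_right,
        real_inner_comm (cross7 (e 0) (e 1)) (e 2), h2, h1, h22]
      linear_combination -hc2
    rw [sub_eq_zero] at h3
    rw [h3]
    exact F.smul_mem _ (heF 2)
  have k01 := key e heF he
  have k02 := key (e ∘ ![0, 2, 1]) (fun i => heF _) (he.comp _ (by decide))
  have k12 := key (e ∘ ![1, 2, 0]) (fun i => heF _) (he.comp _ (by decide))
  have := cross7_mem_span e F (by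
    intro i j
    fin_cases i <;> fin_cases j <;>
      simp only [Fin.zero_eta, Fin.mk_one, Fin.reduceFinMk, cross7_self, zero_mem]
    · exact k01
    · exact k02
    · rw [cross7_swap (e 0)]; exact neg_mem k01
    · exact k12
    · rw [cross7_swap (e 0)]; exact neg_mem k02
    · rw [cross7_swap (e 1)]; exact neg_mem k12)
  rwa [hspan] at this

/-- Being of length one and orthogonal to `e₀` and `e₁`, the vector `e₀ × e₁` of `F` can only be
`±e₂`. -/
theorem abs_phi0_eq_one_of_cross7_mem (F : Submodule ℝ E7) (hF : Module.finrank ℝ F = 3)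
    (hcl : ∀ a ∈ F, ∀ b ∈ F, cross7 a b ∈ F) (e : Fin 3 → E7) (heF : ∀ i, e i ∈ F)
    (he : Orthonormal ℝ e) : |phi0 e| = 1 := by
  have hspan := span_eq_of_orthonormal F hF e he heF
  have hi := orthonormal_iff_ite.1 he
  have h2 : (inner ℝ (cross7 (e 0) (e 1)) (e 2) : ℝ) = phi0 e := by
    rw [inner_cross7]; congr 1; ext i; fin_cases i <;> rfl
  have hm := hcl _ (heF 0) _ (heF 1)
  rw [← hspan] at hm
  obtain ⟨x, hx⟩ := (Submodule.mem_span_range_iff_exists_fun ℝ).1 hm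
  have h1 := inner_cross7_cross7 (e 0) (e 1) (e 1)
  have e0 := inner_cross7_left (e 0) (e 1)
  have e1 := inner_cross7_right (e 0) (e 1)
  rw [← hx] at h1 h2 e0 e1
  simp only [Fin.sum_univ_three, inner_add_left, inner_add_right, real_inner_smul_left,
    real_inner_smul_right, hi] at h1 h2 e0 e1
  simp at h1 h2 e0 e1
  rw [e0, e1] at h1
  rw [← h2]
  simp only [mul_zero, zero_add] at h1
  rcases mul_self_eq_one_iff.1 h1 with h | h <;> simp [h]

/-- If `u × v = 0`, then expanding `u × (u × v) = 0` gives a linear relation between `u` and `v`. -/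
theorem inner_cross7_self_pos {u v : E7} (h : LinearIndependent ℝ ![u, v]) :
    (0 : ℝ) < inner ℝ (cross7 u v) (cross7 u v) := by
  rw [real_inner_self_pos]
  intro h0
  have h1 := cross7_cross7_self u v
  rw [h0, ← cross7L_apply, map_zero] at h1
  have h2 := LinearIndependent.pair_iff.1 h (inner ℝ u v) (-inner ℝ u u) (by
    rw [h1]; module)
  have h3 : u = 0 := inner_self_eq_zero.1 (neg_eq_zero.1 h2.2)
  have := h.ne_zero 0
  exact this h3

theorem associative_span (u v : E7) (h : LinearIndependent ℝ ![u, v]) :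
    Module.finrank ℝ (Submodule.span ℝ (Set.range ![u, v, cross7 u v])) = 3 ∧
    ∀ a ∈ Submodule.span ℝ (Set.range ![u, v, cross7 u v]),
      ∀ b ∈ Submodule.span ℝ (Set.range ![u, v, cross7 u v]),
        cross7 a b ∈ Submodule.span ℝ (Set.range ![u, v, cross7 u v]) := by
  have hpos := inner_cross7_self_pos h
  constructor
  · have : LinearIndependent ℝ ![u, v, cross7 u v] := by
      rw [Fintype.linearIndependent_iff]
      intro g hg
      rw [Fin.sum_univ_three] at hg
      simp only [Matrix.cons_val] at hg
      have h1 := congrArg (fun z => (inner ℝ (cross7 u v) z : ℝ)) hg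
      simp only [inner_add_right, real_inner_smul_right, inner_cross7_left, inner_cross7_right,
        inner_zero_right, mul_zero, zero_add] at h1
      have h2 : g 2 = 0 := (mul_eq_zero.1 h1).resolve_right hpos.ne'
      rw [h2, zero_smul, add_zero] at hg
      have h3 := LinearIndependent.pair_iff.1 h _ _ hg
      intro i; fin_cases i
      exacts [h3.1, h3.2, h2]
    rw [finrank_span_eq_card this, Fintype.card_fin]
  · have hm : ∀ i, ![u, v, cross7 u v] i ∈ Submodule.span ℝ (Set.range ![u, v, cross7 u v]) :=
      fun i => Submodule.subset_span ⟨i, rfl⟩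
    have m0 : u ∈ Submodule.span ℝ (Set.range ![u, v, cross7 u v]) := hm 0
    have m1 : v ∈ Submodule.span ℝ (Set.range ![u, v, cross7 u v]) := hm 1
    have m2 : cross7 u v ∈ Submodule.span ℝ (Set.range ![u, v, cross7 u v]) := hm 2
    have k02 : cross7 u (cross7 u v) ∈ Submodule.span ℝ (Set.range ![u, v, cross7 u v]) := by
      rw [cross7_cross7_self]
      exact sub_mem (Submodule.smul_mem _ _ m0) (Submodule.smul_mem _ _ m1)
    have k12 : cross7 v (cross7 u v) ∈ Submodule.span ℝ (Set.range ![u, v, cross7 u v]) := by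
      have : cross7 v (cross7 u v) = -((inner ℝ v u : ℝ) • v - (inner ℝ v v : ℝ) • u) := by
        rw [cross7_swap v u, cross7_neg_right, cross7_cross7_self]
      rw [this]
      exact neg_mem (sub_mem (Submodule.smul_mem _ _ m1) (Submodule.smul_mem _ _ m0))
    apply cross7_mem_span
    intro i j
    fin_cases i <;> fin_cases j <;>
      simp only [Fin.zero_eta, Fin.mk_one, Fin.reduceFinMk, Matrix.cons_val, cross7_self, zero_mem]
    · exact m2
    · exact k02
    · rw [cross7_swap u v]; exact neg_mem m2
    · exact k12
    · rw [cross7_swap u (cross7 u v)]; exact neg_mem k02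
    · rw [cross7_swap v (cross7 u v)]; exact neg_mem k12

namespace G2Manifold

variable {M : Type*} [TopologicalSpace M] [ChartedSpace E7 M] [IsManifold (𝓡 7) ∞ M]
  (G : G2Manifold M)

/-! ### The linear algebra of the tangent spaces of a `G₂`-manifold -/

/-- Through such a frame the pointwise statements about `φ`, the metric and `∗φ` become statements
about `cross7` and `chi7`. -/
theorem exists_frame (x : M) : ∃ p : E7 ≃L[ℝ] TangentSpace (𝓡 7) x,
    (∀ u v w : E7, G.φ x ![p u, p v, p w] = inner ℝ (cross7 u v) w) ∧
    (∀ e : Fin 3 → E7, G.φ x (fun i => p (e i)) = phi0 e) ∧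
    (∀ u v : E7, G.g.inner x (p u) (p v) = inner ℝ u v) ∧
    (∀ u v w z : E7, G.ψ x ![p u, p v, p w, p z] = inner ℝ (chi7 u v w) z) ∧
    (∀ e : Fin 4 → E7, G.ψ x (fun i => p (e i)) = psi0 e) := by
  obtain ⟨p, h1, h2, h3⟩ := G.adapted x
  refine ⟨p, fun u v w => ?_, h1, h2, fun u v w z => ?_, h3⟩
  · rw [inner_cross7, ← h1]; congr 1; ext1 i; fin_cases i <;> rfl
  · rw [inner_chi7, ← h3]; congr 1; ext1 i; fin_cases i <;> rfl

theorem g_self_pos {x : M} {v : TangentSpace (𝓡 7) x} (hv : v ≠ 0) : 0 < G.g.inner x v v :=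
  G.g.pos x v hv

theorem eq_zero_of_g_self {x : M} {v : TangentSpace (𝓡 7) x} (hv : G.g.inner x v v = 0) :
    v = 0 := by
  by_contra h
  exact (G.g_self_pos h).ne' hv

theorem ext_g {x : M} {u v : TangentSpace (𝓡 7) x}
    (h : ∀ z, G.g.inner x u z = G.g.inner x v z) : u = v := by
  rw [← sub_eq_zero]
  apply G.eq_zero_of_g_self
  have h1 : G.g.inner x (u - v) = G.g.inner x u - G.g.inner x v := map_sub _ _ _
  rw [h1]
  show G.g.inner x u (u - v) - G.g.inner x v (u - v) = 0
  rw [h, sub_self]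

theorem isInvertible_g (x : M) : (G.g.inner x).IsInvertible := by
  obtain ⟨p, -, -, h, -⟩ := G.exists_frame x
  let e : E7 ≃L[ℝ] (E7 →L[ℝ] ℝ) := (InnerProductSpace.toDual ℝ E7).toContinuousLinearEquiv
  let q : (E7 →L[ℝ] ℝ) ≃L[ℝ] (TangentSpace (𝓡 7) x →L[ℝ] ℝ) :=
    p.arrowCongr (ContinuousLinearEquiv.refl ℝ ℝ)
  refine ⟨(p.symm.trans e).trans q, ?_⟩
  ext u v
  have := h (p.symm u) (p.symm v)
  rw [p.apply_symm_apply, p.apply_symm_apply] at this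
  rw [this]
  rfl

/-- The vector dual to a covector. -/
def sharp (x : M) (α : TangentSpace (𝓡 7) x →L[ℝ] ℝ) : TangentSpace (𝓡 7) x :=
  (G.g.inner x).inverse α

theorem g_sharp (x : M) (α : TangentSpace (𝓡 7) x →L[ℝ] ℝ) (v : TangentSpace (𝓡 7) x) :
    G.g.inner x (G.sharp x α) v = α v := by
  obtain ⟨e, he⟩ := G.isInvertible_g x
  have h : G.g.inner x (G.sharp x α) = α := by
    rw [sharp, ← he, ContinuousLinearMap.inverse_equiv]
    exact e.apply_symm_apply α
  rw [h]

variable {G}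

theorem linearIndependent_frame {ι : Type*} {x : M} (p : E7 ≃L[ℝ] TangentSpace (𝓡 7) x)
    {e : ι → E7} : LinearIndependent ℝ (fun i => p (e i)) ↔ LinearIndependent ℝ e :=
  LinearMap.linearIndependent_iff (p : E7 →ₗ[ℝ] TangentSpace (𝓡 7) x)
    (LinearMap.ker_eq_bot.2 p.injective)

theorem linearIndependent_frame_two {x : M} (p : E7 ≃L[ℝ] TangentSpace (𝓡 7) x)
    {u v : E7} : LinearIndependent ℝ ![p u, p v] ↔ LinearIndependent ℝ ![u, v] := by
  rw [← linearIndependent_frame p]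
  have : ![p u, p v] = fun i => p (![u, v] i) := by ext1 i; fin_cases i <;> rfl
  rw [this]

theorem linearIndependent_frame_three {x : M} (p : E7 ≃L[ℝ] TangentSpace (𝓡 7) x)
    {u v w : E7} : LinearIndependent ℝ ![p u, p v, p w] ↔ LinearIndependent ℝ ![u, v, w] := by
  rw [← linearIndependent_frame p]
  have : ![p u, p v, p w] = fun i => p (![u, v, w] i) := by ext1 i; fin_cases i <;> rfl
  rw [this]

/-- Isomorphisms preserving `φ` preserve the metric and `∗φ`. -/
theorem preserves_of_preserves_φ {x y : M}
    (A : TangentSpace (𝓡 7) x →L[ℝ] TangentSpace (𝓡 7) y)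
    (hA : ∀ u v w, G.φ y ![A u, A v, A w] = G.φ x ![u, v, w]) :
    (∀ u v, G.g.inner y (A u) (A v) = G.g.inner x u v) ∧
    (∀ u v w z, G.ψ y ![A u, A v, A w, A z] = G.ψ x ![u, v, w, z]) := by
  obtain ⟨p, p1, -, p2, p3, -⟩ := G.exists_frame x
  obtain ⟨q, q1, -, q2, q3, -⟩ := G.exists_frame y
  let B : E7 →ₗ[ℝ] E7 := (q.symm : TangentSpace (𝓡 7) y →ₗ[ℝ] E7) ∘ₗ
    (A : TangentSpace (𝓡 7) x →ₗ[ℝ] TangentSpace (𝓡 7) y) ∘ₗ (p : E7 →ₗ[ℝ] TangentSpace (𝓡 7) x)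
  have hqB : ∀ u, A (p u) = q (B u) := fun u => (q.apply_symm_apply _).symm
  have hB : ∀ u v w, (inner ℝ (cross7 (B u) (B v)) (B w) : ℝ) = inner ℝ (cross7 u v) w := by
    intro u v w
    rw [← q1, ← p1, ← hqB, ← hqB, ← hqB, hA]
  constructor
  · intro u v
    obtain ⟨u, rfl⟩ := p.surjective u
    obtain ⟨v, rfl⟩ := p.surjective v
    rw [hqB, hqB, q2, p2, inner_map_of_preserves_phi0 B hB]
  · intro u v w z
    obtain ⟨u, rfl⟩ := p.surjective u
    obtain ⟨v, rfl⟩ := p.surjective v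
    obtain ⟨w, rfl⟩ := p.surjective w
    obtain ⟨z, rfl⟩ := p.surjective z
    rw [hqB, hqB, hqB, hqB, q3, p3, inner_chi7, inner_chi7, psi0_map_of_preserves_phi0 B hB]

/-- An automorphism of `φ` which fixes three vectors `u, v, w` that are independent and satisfy
`φ(u, v, w) = 0` is the identity. -/
theorem eq_self_of_fixes {x y : M} (h : y = x)
    (A : TangentSpace (𝓡 7) x →L[ℝ] TangentSpace (𝓡 7) y)
    (hA : ∀ u v w, G.φ y ![A u, A v, A w] = G.φ x ![u, v, w])
    {u v w : TangentSpace (𝓡 7) x} (hli : LinearIndependent ℝ ![u, v, w])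
    (hφ : G.φ x ![u, v, w] = 0)
    (hu : (A u : E7) = u) (hv : (A v : E7) = v) (hw : (A w : E7) = w)
    (z : TangentSpace (𝓡 7) x) : (A z : E7) = z := by
  subst h
  obtain ⟨p, p1, -, p2, p3, -⟩ := G.exists_frame y
  let B : E7 →ₗ[ℝ] E7 := (p.symm : TangentSpace (𝓡 7) y →ₗ[ℝ] E7) ∘ₗ
    (A : TangentSpace (𝓡 7) y →ₗ[ℝ] TangentSpace (𝓡 7) y) ∘ₗ (p : E7 →ₗ[ℝ] TangentSpace (𝓡 7) y)
  have hqB : ∀ u, A (p u) = p (B u) := fun u => (p.apply_symm_apply _).symm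
  have hB : ∀ u v w, (inner ℝ (cross7 (B u) (B v)) (B w) : ℝ) = inner ℝ (cross7 u v) w := by
    intro u v w
    rw [← p1, ← p1, ← hqB, ← hqB, ← hqB, hA]
  -- The fixed vectors are closed under the cross product. They contain `u, v, w` and also `u × v`,
  -- which is orthogonal to `u`, `v` and, by `φ(u, v, w) = 0`, to `w`. A closed subspace of
  -- dimension four is everything.
  let W : Submodule ℝ E7 := LinearMap.ker (B - LinearMap.id)
  have hW : ∀ a, a ∈ W ↔ B a = a := fun a => by
    rw [LinearMap.mem_ker, LinearMap.sub_apply, sub_eq_zero]; rfl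
  have hWc : ∀ a ∈ W, ∀ b ∈ W, cross7 a b ∈ W := by
    intro a ha b hb
    rw [hW] at ha hb ⊢
    rw [← cross7_map_of_preserves_phi0 B hB, ha, hb]
  obtain ⟨u, rfl⟩ := p.surjective u
  obtain ⟨v, rfl⟩ := p.surjective v
  obtain ⟨w, rfl⟩ := p.surjective w
  have hli' : LinearIndependent ℝ ![u, v, w] := by
    rwa [linearIndependent_frame_three p] at hli
  have hmem : ∀ a, A (p a) = p a → a ∈ W := fun a ha => by
    rw [hW]; apply p.injective; rw [← hqB, ha]
  have hu' := hmem u hu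
  have hv' := hmem v hv
  have hw' := hmem w hw
  rw [p1] at hφ
  have huv : LinearIndependent ℝ ![u, v] := by
    have := hli'.comp ![0, 1] (by decide)
    convert this using 1
    ext1 i; fin_cases i <;> rfl
  have hpos := inner_cross7_self_pos huv
  have hli4 : LinearIndependent ℝ ![u, v, w, cross7 u v] := by
    rw [Fintype.linearIndependent_iff] at hli' ⊢
    intro c hc
    rw [Fin.sum_univ_four] at hc
    simp only [Matrix.cons_val] at hc
    have h1 := congrArg (fun z => (inner ℝ (cross7 u v) z : ℝ)) hc
    simp only [inner_add_right, real_inner_smul_right, inner_cross7_left, inner_cross7_right,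
      inner_zero_right, mul_zero, zero_add, hφ] at h1
    have h2 : c 3 = 0 := (mul_eq_zero.1 h1).resolve_right hpos.ne'
    rw [h2, zero_smul, add_zero] at hc
    have h3 := hli' ![c 0, c 1, c 2] (by simpa [Fin.sum_univ_three] using hc)
    intro i; fin_cases i
    exacts [h3 0, h3 1, h3 2, h2]
  have htop : W = ⊤ := by
    apply eq_top_of_cross7_mem W hWc
    have hle : Submodule.span ℝ (Set.range ![u, v, w, cross7 u v]) ≤ W := by
      rw [Submodule.span_le]
      rintro _ ⟨i, rfl⟩
      fin_cases i
      exacts [hu', hv', hw', hWc u hu' v hv']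
    have := Submodule.finrank_mono hle
    rw [finrank_span_eq_card hli4, Fintype.card_fin] at this
    omega
  obtain ⟨z, rfl⟩ := p.surjective z
  have : z ∈ W := by rw [htop]; trivial
  rw [hW] at this
  rw [hqB, this]

theorem g_χ_χ {x : M} {u v w w' X X' : TangentSpace (𝓡 7) x}
    (hX : ∀ z, G.g.inner x X z = G.ψ x ![u, v, w, z])
    (hX' : ∀ z, G.g.inner x X' z = G.ψ x ![u, v, w', z]) :
    G.g.inner x X X' =
    (G.g.inner x w w' * (G.g.inner x u u * G.g.inner x v v - G.g.inner x u v ^ 2)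
      - G.g.inner x v w * (G.g.inner x u u * G.g.inner x v w' - G.g.inner x u w' * G.g.inner x u v)
      + G.g.inner x u w * (G.g.inner x u v * G.g.inner x v w' - G.g.inner x u w' * G.g.inner x v v))
    - G.φ x ![u, v, w] * G.φ x ![u, v, w'] := by
  obtain ⟨p, p1, -, p2, p3, -⟩ := G.exists_frame x
  obtain ⟨u, rfl⟩ := p.surjective u
  obtain ⟨v, rfl⟩ := p.surjective v
  obtain ⟨w, rfl⟩ := p.surjective w
  obtain ⟨w', rfl⟩ := p.surjective w'
  have h1 : X = p (chi7 u v w) := by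
    apply G.ext_g
    intro z
    obtain ⟨z, rfl⟩ := p.surjective z
    rw [hX, p3, p2]
  have h2 : X' = p (chi7 u v w') := by
    apply G.ext_g
    intro z
    obtain ⟨z, rfl⟩ := p.surjective z
    rw [hX', p3, p2]
  rw [h1, h2]
  simp only [p1, p2, inner_chi7_chi7]

theorem g_cross_self {x : M} {u v N : TangentSpace (𝓡 7) x}
    (hN : ∀ z, G.g.inner x N z = G.φ x ![u, v, z]) :
    G.g.inner x N N = G.g.inner x u u * G.g.inner x v v - G.g.inner x u v ^ 2 := by
  obtain ⟨p, p1, -, p2, p3, -⟩ := G.exists_frame x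
  obtain ⟨u, rfl⟩ := p.surjective u
  obtain ⟨v, rfl⟩ := p.surjective v
  have h1 : N = p (cross7 u v) := by
    apply G.ext_g
    intro z
    obtain ⟨z, rfl⟩ := p.surjective z
    rw [hN, p1, p2]
  rw [h1]
  simp only [p2, inner_cross7_cross7]
  ring

/-- The source of the orthogonality of `∇ν` and `∇|μ|²`: each of the three terms of `chi7 u v w` is
orthogonal to `u × v`. -/
theorem ψ_cross {x : M} {u v N : TangentSpace (𝓡 7) x}
    (hN : ∀ z, G.g.inner x N z = G.φ x ![u, v, z]) (w : TangentSpace (𝓡 7) x) :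
    G.ψ x ![u, v, w, N] = 0 := by
  obtain ⟨p, p1, -, p2, p3, -⟩ := G.exists_frame x
  obtain ⟨u, rfl⟩ := p.surjective u
  obtain ⟨v, rfl⟩ := p.surjective v
  obtain ⟨w, rfl⟩ := p.surjective w
  have h1 : N = p (cross7 u v) := by
    apply G.ext_g
    intro z
    obtain ⟨z, rfl⟩ := p.surjective z
    rw [hN, p1, p2]
  rw [h1, p3, chi7, inner_sub_left, inner_sub_left, real_inner_smul_left, real_inner_smul_left,
    inner_cross7_left, real_inner_comm (cross7 u v) v, inner_cross7_right,
    real_inner_comm (cross7 u v) u, inner_cross7_left]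
  ring

/-- The Cauchy–Schwarz inequality for independent vectors. -/
theorem gram_two_pos {x : M} {u v : TangentSpace (𝓡 7) x} (h : LinearIndependent ℝ ![u, v]) :
    0 < G.g.inner x u u * G.g.inner x v v - G.g.inner x u v ^ 2 := by
  obtain ⟨p, -, -, p2, -, -⟩ := G.exists_frame x
  obtain ⟨u, rfl⟩ := p.surjective u
  obtain ⟨v, rfl⟩ := p.surjective v
  have := inner_cross7_self_pos ((linearIndependent_frame_two p).1 h)
  rw [inner_cross7_cross7] at this
  simp only [p2]
  linarith

theorem orthonormal_comp {x : M} {k : ℕ} {p : E7 ≃L[ℝ] TangentSpace (𝓡 7) x}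
    (p2 : ∀ u v : E7, G.g.inner x (p u) (p v) = inner ℝ u v) (e : Fin k → E7) :
    G.IsOrthonormal (fun i => p (e i)) ↔ Orthonormal ℝ e := by
  rw [orthonormal_iff_ite]
  simp only [IsOrthonormal, p2]

theorem IsCoassociativePlane.isotropic {x : M} {F : Submodule ℝ (TangentSpace (𝓡 7) x)}
    (hF : G.IsCoassociativePlane F) {a b c : TangentSpace (𝓡 7) x} (ha : a ∈ F) (hb : b ∈ F)
    (hc : c ∈ F) : G.φ x ![a, b, c] = 0 := by
  obtain ⟨p, p1, -, p2, p3, p4⟩ := G.exists_frame x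
  have h := isotropic_of_abs_psi0_eq_one (F.comap (p : E7 →ₗ[ℝ] TangentSpace (𝓡 7) x)) (by
    rw [← hF.1]
    exact (p.toLinearEquiv.ofSubmodule' F).finrank_eq) (fun e heF he => by
      rw [← p4]
      exact hF.2 _ heF ((orthonormal_comp p2 e).2 he))
  obtain ⟨a, rfl⟩ := p.surjective a
  obtain ⟨b, rfl⟩ := p.surjective b
  obtain ⟨c, rfl⟩ := p.surjective c
  rw [p1]
  exact h a ha b hb c hc

/-- The coassociative plane spanned by an isotropic triple `u, v, w` and `χ(u, v, w)`. -/
theorem isCoassociativePlane_span {x : M} {u v w X : TangentSpace (𝓡 7) x}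
    (hli : LinearIndependent ℝ ![u, v, w]) (hφ : G.φ x ![u, v, w] = 0)
    (hX : ∀ z, G.g.inner x X z = G.ψ x ![u, v, w, z]) (hX0 : X ≠ 0) :
    G.IsCoassociativePlane (Submodule.span ℝ (Set.range ![u, v, w, X])) ∧
    ∀ F : Submodule ℝ (TangentSpace (𝓡 7) x), G.IsCoassociativePlane F → u ∈ F → v ∈ F → w ∈ F →
      F = Submodule.span ℝ (Set.range ![u, v, w, X]) := by
  have hXu : G.g.inner x X u = 0 := by
    rw [hX]; exact (G.ψ x).map_eq_zero_of_eq _ (i := 0) (j := 3) rfl (by decide)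
  have hXv : G.g.inner x X v = 0 := by
    rw [hX]; exact (G.ψ x).map_eq_zero_of_eq _ (i := 1) (j := 3) rfl (by decide)
  have hXw : G.g.inner x X w = 0 := by
    rw [hX]; exact (G.ψ x).map_eq_zero_of_eq _ (i := 2) (j := 3) rfl (by decide)
  have hli4 : LinearIndependent ℝ ![u, v, w, X] := by
    rw [Fintype.linearIndependent_iff] at hli ⊢
    intro c hc
    rw [Fin.sum_univ_four] at hc
    simp only [Matrix.cons_val] at hc
    have h1 := congrArg (fun z => G.g.inner x X z) hc
    simp only [map_add, map_smul, hXu, hXv, hXw, zero_add, map_zero,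
      smul_eq_mul, mul_zero] at h1
    have h2 : c 3 = 0 := (mul_eq_zero.1 h1).resolve_right (G.g_self_pos hX0).ne'
    rw [h2, zero_smul, add_zero] at hc
    have h3 := hli ![c 0, c 1, c 2] (by simpa [Fin.sum_univ_three] using hc)
    intro i; fin_cases i
    exacts [h3 0, h3 1, h3 2, h2]
  have hfin : Module.finrank ℝ (Submodule.span ℝ (Set.range ![u, v, w, X])) = 4 := by
    rw [finrank_span_eq_card hli4, Fintype.card_fin]
  obtain ⟨p, p1, -, p2, p3, p4⟩ := G.exists_frame x
  obtain ⟨u, rfl⟩ := p.surjective u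
  obtain ⟨v, rfl⟩ := p.surjective v
  obtain ⟨w, rfl⟩ := p.surjective w
  obtain ⟨X, rfl⟩ := p.surjective X
  -- The only candidate: the vectors annihilated by `φ(a, b, ·)` for all `a, b` among `u, v, w`. It
  -- has dimension four, contains the four spanning vectors, and contains every coassociative plane
  -- through `u, v, w`.
  let F0 : Submodule ℝ E7 := LinearMap.ker (innerₛₗ ℝ (cross7 u v)) ⊓
    (LinearMap.ker (innerₛₗ ℝ (cross7 u w)) ⊓ LinearMap.ker (innerₛₗ ℝ (cross7 v w)))
  have hF0 : ∀ z, z ∈ F0 ↔ (inner ℝ (cross7 u v) z : ℝ) = 0 ∧ (inner ℝ (cross7 u w) z : ℝ) = 0 ∧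
      (inner ℝ (cross7 v w) z : ℝ) = 0 := fun z => Iff.rfl
  rw [p1] at hφ
  obtain ⟨p1', p2', p3', p4', p5'⟩ := inner_cross7_perm hφ
  obtain ⟨hd, hiso⟩ := coassociative_completion u v w ((linearIndependent_frame_three p).1 hli) hφ
    F0 hF0
  have hXF : X ∈ F0 := by
    have hz : ∀ z, (inner ℝ z X : ℝ) = inner ℝ (chi7 u v w) z := fun z => by
      rw [real_inner_comm, ← p2, ← p3, hX]
    rw [hF0]
    have c1 := cross7_cross7_self w u
    have c2 := cross7_cross7_self w v
    refine ⟨?_, ?_, ?_⟩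
    · rw [hz, chi7, inner_sub_left, inner_sub_left, real_inner_smul_left, real_inner_smul_left,
        inner_cross7_left, real_inner_comm (cross7 u v) v, inner_cross7_right,
        real_inner_comm (cross7 u v) u, inner_cross7_left]
      ring
    · rw [hz, inner_chi7, psi0_eq, cross7_swap w u, cross7_neg_right, c1,
        inner_neg_right, inner_neg_right, inner_neg_right, inner_sub_right, real_inner_smul_right,
        real_inner_smul_right, hφ, inner_cross7_left, real_inner_comm (cross7 w u) v,
        real_inner_comm (cross7 w u) u, inner_cross7_right, p2']
      ring
    · rw [hz, inner_chi7, psi0_eq, cross7_swap w v, cross7_neg_right, c2,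
        inner_neg_right, inner_neg_right, inner_neg_right, inner_sub_right, real_inner_smul_right,
        real_inner_smul_right, hφ, inner_cross7_right, real_inner_comm (cross7 w v) v,
        real_inner_comm (cross7 w v) u, inner_cross7_right, p4']
      ring
  have hgen : ∀ z ∈ Set.range ![p u, p v, p w, p X], z ∈ F0.map (p : E7 →ₗ[ℝ] TangentSpace (𝓡 7) x) := by
    rintro _ ⟨i, rfl⟩
    fin_cases i
    · exact ⟨u, (hF0 u).2 ⟨inner_cross7_left _ _, inner_cross7_left _ _, p1'⟩, rfl⟩
    · exact ⟨v, (hF0 v).2 ⟨inner_cross7_right _ _, p5', inner_cross7_left _ _⟩, rfl⟩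
    · exact ⟨w, (hF0 w).2 ⟨hφ, inner_cross7_right _ _, inner_cross7_right _ _⟩, rfl⟩
    · exact ⟨X, hXF, rfl⟩
  have hmapd : ∀ W : Submodule ℝ E7,
      Module.finrank ℝ (W.map (p : E7 →ₗ[ℝ] TangentSpace (𝓡 7) x)) = Module.finrank ℝ W := fun W =>
    (p.toLinearEquiv.submoduleMap W).finrank_eq.symm
  have hspan : Submodule.span ℝ (Set.range ![p u, p v, p w, p X]) =
      F0.map (p : E7 →ₗ[ℝ] TangentSpace (𝓡 7) x) := by
    have : FiniteDimensional ℝ (F0.map (p : E7 →ₗ[ℝ] TangentSpace (𝓡 7) x)) := inferInstance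
    apply Submodule.eq_of_le_of_finrank_eq (Submodule.span_le.2 hgen)
    rw [hfin, hmapd, hd]
  refine ⟨⟨hfin, fun e he heo => ?_⟩, fun F hF hu hv hw => ?_⟩
  · choose e' he' hee using fun i => (hspan ▸ he i : e i ∈ F0.map (p : E7 →ₗ[ℝ] TangentSpace (𝓡 7) x))
    have hee' : e = fun i => p (e' i) := funext fun i => (hee i).symm
    rw [hee', p4]
    refine abs_psi0_eq_one_of_isotropic e' ?_ (fun i j k => hiso _ (he' i) _ (he' j) _ (he' k))
    rw [← orthonormal_comp p2, ← hee']
    exact heo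
  · rw [hspan]
    have : FiniteDimensional ℝ (F0.map (p : E7 →ₗ[ℝ] TangentSpace (𝓡 7) x)) := inferInstance
    apply Submodule.eq_of_le_of_finrank_eq
    · intro z hz
      obtain ⟨z, rfl⟩ := p.surjective z
      refine ⟨z, (hF0 z).2 ⟨?_, ?_, ?_⟩, rfl⟩
      · rw [← p1]; exact hF.isotropic hu hv hz
      · rw [← p1]; exact hF.isotropic hu hw hz
      · rw [← p1]; exact hF.isotropic hv hw hz
    · rw [hF.1, hmapd, hd]

/-- The associative plane spanned by `u, v` and `u × v`. -/
theorem isAssociativePlane_span {x : M} {u v N : TangentSpace (𝓡 7) x}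
    (hli : LinearIndependent ℝ ![u, v]) (hN : ∀ z, G.g.inner x N z = G.φ x ![u, v, z]) :
    G.IsAssociativePlane (Submodule.span ℝ (Set.range ![u, v, N])) ∧
    ∀ F : Submodule ℝ (TangentSpace (𝓡 7) x), G.IsAssociativePlane F → u ∈ F → v ∈ F →
      F = Submodule.span ℝ (Set.range ![u, v, N]) := by
  obtain ⟨p, p1, p4, p2, -, -⟩ := G.exists_frame x
  obtain ⟨u, rfl⟩ := p.surjective u
  obtain ⟨v, rfl⟩ := p.surjective v
  have h1 : N = p (cross7 u v) := by
    apply G.ext_g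
    intro z
    obtain ⟨z, rfl⟩ := p.surjective z
    rw [hN, p1, p2]
  subst h1
  obtain ⟨hd, hcl⟩ := associative_span u v ((linearIndependent_frame_two p).1 hli)
  have hspan : Submodule.span ℝ (Set.range ![p u, p v, p (cross7 u v)]) =
      (Submodule.span ℝ (Set.range ![u, v, cross7 u v])).map
        (p : E7 →ₗ[ℝ] TangentSpace (𝓡 7) x) := by
    rw [Submodule.map_span, ← Set.range_comp]
    congr 2
    ext1 i
    fin_cases i <;> rfl
  have hmapd : ∀ W : Submodule ℝ E7,
      Module.finrank ℝ (W.map (p : E7 →ₗ[ℝ] TangentSpace (𝓡 7) x)) = Module.finrank ℝ W := fun W =>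
    (p.toLinearEquiv.submoduleMap W).finrank_eq.symm
  have hfin : Module.finrank ℝ (Submodule.span ℝ (Set.range ![p u, p v, p (cross7 u v)])) = 3 := by
    rw [hspan, hmapd, hd]
  refine ⟨⟨hfin, fun e he heo => ?_⟩, fun F hF hu hv => ?_⟩
  · choose e' he' hee using fun i => (hspan ▸ he i :
      e i ∈ (Submodule.span ℝ (Set.range ![u, v, cross7 u v])).map
        (p : E7 →ₗ[ℝ] TangentSpace (𝓡 7) x))
    have hee' : e = fun i => p (e' i) := funext fun i => (hee i).symm
    rw [hee', p4]
    refine abs_phi0_eq_one_of_cross7_mem _ hd hcl e' he' ?_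
    rw [← orthonormal_comp p2, ← hee']
    exact heo
  · have h := cross7_mem_of_abs_phi0_eq_one (F.comap (p : E7 →ₗ[ℝ] TangentSpace (𝓡 7) x)) (by
      rw [← hF.1]
      exact (p.toLinearEquiv.ofSubmodule' F).finrank_eq) (fun e heF he => by
        rw [← p4]
        exact hF.2 _ heF ((orthonormal_comp p2 e).2 he))
    have : FiniteDimensional ℝ F := Module.finite_of_finrank_pos (by rw [hF.1]; norm_num)
    symm
    apply Submodule.eq_of_le_of_finrank_eq
    · rw [Submodule.span_le]
      rintro _ ⟨i, rfl⟩
      fin_cases i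
      exacts [hu, hv, h u hu v hv]
    · rw [hF.1, hfin]

end G2Manifold

/-! ### The exponential map of `T² × SU(2)` -/

/-- The Lie algebra of `T² × SU(2)`, in the basis of the generating vector fields. -/
abbrev LieT2SU2 : Type := (Fin 2 → ℝ) × (Fin 3 → ℝ)

@[simp] theorem imQuaternion_re (v : Fin 3 → ℝ) : (imQuaternion v).re = 0 := rfl
@[simp] theorem imQuaternion_imI (v : Fin 3 → ℝ) : (imQuaternion v).imI = v 0 := rfl
@[simp] theorem imQuaternion_imJ (v : Fin 3 → ℝ) : (imQuaternion v).imJ = v 1 := rfl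
@[simp] theorem imQuaternion_imK (v : Fin 3 → ℝ) : (imQuaternion v).imK = v 2 := rfl

/-- `imQuaternion` as a linear map. -/
def imQuaternionL : (Fin 3 → ℝ) →ₗ[ℝ] ℍ[ℝ] where
  toFun := imQuaternion
  map_add' u v := by ext <;> simp
  map_smul' c u := by ext <;> simp

theorem imQuaternionL_apply (v : Fin 3 → ℝ) : imQuaternionL v = imQuaternion v := rfl

/-- The imaginary part of a quaternion. -/
def imPart (q : ℍ[ℝ]) : Fin 3 → ℝ := ![q.imI, q.imJ, q.imK]

theorem imPart_imQuaternion (v : Fin 3 → ℝ) : imPart (imQuaternion v) = v := by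
  ext i; fin_cases i <;> rfl

theorem imQuaternion_imPart (q : ℍ[ℝ]) (hq : q.re = 0) : imQuaternion (imPart q) = q := by
  ext <;> simp [imPart, hq]

theorem expSU2_add {u v : Fin 3 → ℝ} (h : Commute (imQuaternion u) (imQuaternion v)) :
    expSU2 (u + v) = expSU2 u * expSU2 v := by
  apply Subtype.ext
  rw [Metric.unitSphere.coe_mul]
  show NormedSpace.exp (imQuaternionL (u + v)) = NormedSpace.exp _ * NormedSpace.exp _
  rw [map_add]
  let _ : NormedAlgebra ℚ ℍ[ℝ] := NormedAlgebra.restrictScalars ℚ ℝ ℍ[ℝ]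
  exact NormedSpace.exp_add_of_commute h

theorem expSU2_zero : expSU2 0 = 1 := by
  apply Subtype.ext
  show NormedSpace.exp (imQuaternionL 0) = 1
  rw [map_zero, NormedSpace.exp_zero]

theorem star_mul_self_SU2 (q : SU2) : star (q : ℍ[ℝ]) * q = 1 := by
  have h1 : ‖(q : ℍ[ℝ])‖ = 1 := by simp
  rw [Quaternion.star_mul_self, Quaternion.normSq_eq_norm_mul_self, h1]
  simp

theorem self_mul_star_SU2 (q : SU2) : (q : ℍ[ℝ]) * star (q : ℍ[ℝ]) = 1 := by
  have h1 : ‖(q : ℍ[ℝ])‖ = 1 := by simp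
  rw [Quaternion.self_mul_star, Quaternion.normSq_eq_norm_mul_self, h1]
  simp

theorem coe_inv_SU2 (q : SU2) : ((q⁻¹ : SU2) : ℍ[ℝ]) = star (q : ℍ[ℝ]) := by
  have h : ((q⁻¹ : SU2) : ℍ[ℝ]) * q = 1 := by
    rw [← Metric.unitSphere.coe_mul, inv_mul_cancel]; rfl
  calc ((q⁻¹ : SU2) : ℍ[ℝ]) = (q⁻¹ : SU2) * (q * star (q : ℍ[ℝ])) := by
        rw [self_mul_star_SU2, mul_one]
    _ = star (q : ℍ[ℝ]) := by rw [← mul_assoc, h, one_mul]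

theorem expSU2_conj (q : SU2) (u v : Fin 3 → ℝ)
    (h : imQuaternion v = q * imQuaternion u * star (q : ℍ[ℝ])) :
    q * expSU2 u * q⁻¹ = expSU2 v := by
  apply Subtype.ext
  rw [Metric.unitSphere.coe_mul, Metric.unitSphere.coe_mul]
  have hq : (q : ℍ[ℝ]) ≠ 0 := by
    intro h0
    have := self_mul_star_SU2 q
    rw [h0, zero_mul] at this
    exact zero_ne_one this
  have hs : star (q : ℍ[ℝ]) = (q : ℍ[ℝ])⁻¹ := eq_inv_of_mul_eq_one_left (star_mul_self_SU2 q)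
  show (q : ℍ[ℝ]) * NormedSpace.exp (imQuaternion u) * _ = NormedSpace.exp (imQuaternion v)
  let _ : NormedAlgebra ℚ ℍ[ℝ] := NormedAlgebra.restrictScalars ℚ ℝ ℍ[ℝ]
  rw [h, coe_inv_SU2, hs, NormedSpace.exp_conj _ _ hq]

/-- The rotation `w ↦ q w q⁻¹` of `ℝ³ = Im ℍ`. -/
def rotSU2 (q : SU2) : (Fin 3 → ℝ) →ₗ[ℝ] (Fin 3 → ℝ) where
  toFun w := imPart (q * imQuaternion w * star (q : ℍ[ℝ]))
  map_add' u v := by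
    rw [← imQuaternionL_apply, map_add, mul_add, add_mul]
    ext i; fin_cases i <;> simp [imPart, imQuaternionL_apply]
  map_smul' c u := by
    rw [← imQuaternionL_apply, map_smul, mul_smul_comm, smul_mul_assoc]
    ext i; fin_cases i <;> simp [imPart, imQuaternionL_apply]

theorem imQuaternion_rotSU2 (q : SU2) (w : Fin 3 → ℝ) :
    imQuaternion (rotSU2 q w) = q * imQuaternion w * star (q : ℍ[ℝ]) := by
  apply imQuaternion_imPart
  simp only [Quaternion.re_mul, Quaternion.imI_mul, Quaternion.imJ_mul, Quaternion.imK_mul,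
    Quaternion.re_star, Quaternion.imI_star, Quaternion.imJ_star, Quaternion.imK_star, imQuaternion_re,
    imQuaternion_imI, imQuaternion_imJ, imQuaternion_imK]
  ring

theorem imQuaternion_injective : Function.Injective imQuaternion := fun u v h => by
  rw [← imPart_imQuaternion u, h, imPart_imQuaternion]

theorem rotSU2_mul (q r : SU2) (w : Fin 3 → ℝ) : rotSU2 (q * r) w = rotSU2 q (rotSU2 r w) := by
  apply imQuaternion_injective
  rw [imQuaternion_rotSU2, imQuaternion_rotSU2, imQuaternion_rotSU2, Metric.unitSphere.coe_mul,
    star_mul]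
  simp only [mul_assoc]

theorem rotSU2_one (w : Fin 3 → ℝ) : rotSU2 1 w = w := by
  apply imQuaternion_injective
  rw [imQuaternion_rotSU2, Metric.unitSphere.coe_one]
  simp

theorem rotSU2_inv_rotSU2 (q : SU2) (w : Fin 3 → ℝ) : rotSU2 q⁻¹ (rotSU2 q w) = w := by
  rw [← rotSU2_mul, inv_mul_cancel, rotSU2_one]

theorem rotSU2_rotSU2_inv (q : SU2) (w : Fin 3 → ℝ) : rotSU2 q (rotSU2 q⁻¹ w) = w := by
  rw [← rotSU2_mul, mul_inv_cancel, rotSU2_one]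

open Matrix in
theorem imQuaternion_mul (u v : Fin 3 → ℝ) :
    imQuaternion u * imQuaternion v = -((u ⬝ᵥ v : ℝ) : ℍ[ℝ]) + imQuaternion (crossProduct u v) := by
  ext <;> simp [dotProduct, Fin.sum_univ_three, cross_apply] <;> ring

theorem imQuaternion_rotSU2_mul (q : SU2) (u v : Fin 3 → ℝ) :
    imQuaternion (rotSU2 q u) * imQuaternion (rotSU2 q v) =
      q * (imQuaternion u * imQuaternion v) * star (q : ℍ[ℝ]) := by
  rw [imQuaternion_rotSU2, imQuaternion_rotSU2]
  calc _ = q * imQuaternion u * (star (q : ℍ[ℝ]) * q) * imQuaternion v * star (q : ℍ[ℝ]) := by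
        simp only [mul_assoc]
    _ = _ := by rw [star_mul_self_SU2, mul_one]; simp only [mul_assoc]

open Matrix in
-- Conjugation is an algebra automorphism, and the product of imaginary quaternions has minus the
-- dot product as real part and the cross product as imaginary part; so both are preserved at once.
theorem rotSU2_dotProduct_cross (q : SU2) (u v : Fin 3 → ℝ) :
    rotSU2 q u ⬝ᵥ rotSU2 q v = u ⬝ᵥ v ∧
      crossProduct (rotSU2 q u) (rotSU2 q v) = rotSU2 q (crossProduct u v) := by
  have h := imQuaternion_rotSU2_mul q u v
  rw [imQuaternion_mul, imQuaternion_mul, mul_add, add_mul, ← imQuaternion_rotSU2, mul_neg, neg_mul,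
    ← Quaternion.coe_commutes, mul_assoc, self_mul_star_SU2, mul_one] at h
  have hre : rotSU2 q u ⬝ᵥ rotSU2 q v = u ⬝ᵥ v := by
    have := congrArg QuaternionAlgebra.re h
    simpa using this
  refine ⟨hre, imQuaternion_injective ?_⟩
  rw [hre] at h
  exact add_left_cancel h

/-- A unit quaternion which acts trivially on `Im ℍ` is central. -/
theorem mem_center_of_rotSU2_eq (q : SU2) (h : ∀ w, rotSU2 q w = w) :
    ∃ ε : ℝ, (ε = 1 ∨ ε = -1) ∧ (q : ℍ[ℝ]) = (ε : ℍ[ℝ]) := by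
  have hc : ∀ w, (q : ℍ[ℝ]) * imQuaternion w = imQuaternion w * q := fun w => by
    have := imQuaternion_rotSU2 q w
    rw [h] at this
    rw [this, mul_assoc _ (star (q : ℍ[ℝ])), star_mul_self_SU2, mul_one, ← this]
  have hI := hc ![1, 0, 0]
  have hJ := hc ![0, 1, 0]
  have h1 := congrArg QuaternionAlgebra.imK hI
  have h2 := congrArg QuaternionAlgebra.imJ hI
  have h3 := congrArg QuaternionAlgebra.imK hJ
  simp at h1 h2 h3
  have e1 : (q : ℍ[ℝ]).imI = 0 := by linarith
  have e2 : (q : ℍ[ℝ]).imJ = 0 := by linarith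
  have e3 : (q : ℍ[ℝ]).imK = 0 := by linarith
  have hq : (q : ℍ[ℝ]) = ((q : ℍ[ℝ]).re : ℍ[ℝ]) := by ext <;> simp [e1, e2, e3]
  refine ⟨(q : ℍ[ℝ]).re, ?_, hq⟩
  have hn : ‖(q : ℍ[ℝ])‖ = 1 := by simp
  rw [hq, Quaternion.norm_coe, Real.norm_eq_abs] at hn
  exact eq_or_eq_neg_of_abs_eq hn

/-- The exponential map of `T² × SU(2)`. -/
def lieExp (ξ : LieT2SU2) : T2SU2 :=
  (Circle.exp (-ξ.1 0), Circle.exp (-ξ.1 1), expSU2 (-(2⁻¹ : ℝ) • ξ.2))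

theorem lieExp_zero : lieExp 0 = 1 := by
  simp [lieExp, expSU2_zero]

theorem lieExp_add {ξ η : LieT2SU2} (h : Commute (imQuaternion ξ.2) (imQuaternion η.2)) :
    lieExp (ξ + η) = lieExp ξ * lieExp η := by
  have h' : Commute (imQuaternion (-(2⁻¹ : ℝ) • ξ.2)) (imQuaternion (-(2⁻¹ : ℝ) • η.2)) := by
    simp only [← imQuaternionL_apply, map_smul] at h ⊢
    exact (h.smul_left _).smul_right _
  simp only [lieExp, Prod.snd_add, Prod.fst_add, smul_add, expSU2_add h', Pi.add_apply, neg_add,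
    Circle.exp_add, Prod.mk_mul_mk]

theorem lieExp_add_smul (s t : ℝ) (ξ : LieT2SU2) :
    lieExp ((s + t) • ξ) = lieExp (s • ξ) * lieExp (t • ξ) := by
  rw [add_smul]
  apply lieExp_add
  simp only [Prod.smul_snd, ← imQuaternionL_apply, map_smul]
  exact ((Commute.refl _).smul_left _).smul_right _

theorem contMDiff_expSU2 : ContMDiff 𝓘(ℝ, Fin 3 → ℝ) (𝓡 3) ∞ expSU2 := by
  apply ContMDiff.codRestrict_sphere (n := 3) (f := fun v => NormedSpace.exp (imQuaternion v))
  apply ContDiff.contMDiff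
  have h1 : ContDiff ℝ ∞ (fun q : ℍ[ℝ] => NormedSpace.exp q) := by
    rw [contDiff_iff_contDiffAt]
    intro q
    exact (NormedSpace.exp_analytic (𝕂 := ℝ) q).contDiffAt
  exact h1.comp imQuaternionL.toContinuousLinearMap.contDiff

theorem contMDiff_lieExp :
    ContMDiff 𝓘(ℝ, LieT2SU2) ((𝓡 1).prod ((𝓡 1).prod (𝓡 3))) ∞ lieExp := by
  have h0 : ∀ i : Fin 2, ContMDiff 𝓘(ℝ, LieT2SU2) 𝓘(ℝ, ℝ) ∞ (fun ξ : LieT2SU2 => -ξ.1 i) := by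
    intro i
    apply ContDiff.contMDiff
    fun_prop
  have h2 : ContMDiff 𝓘(ℝ, LieT2SU2) 𝓘(ℝ, Fin 3 → ℝ) ∞
      (fun ξ : LieT2SU2 => -(2⁻¹ : ℝ) • ξ.2) := by
    apply ContDiff.contMDiff
    fun_prop
  exact ((contMDiff_circleExp).comp (h0 0)).prodMk
    (((contMDiff_circleExp).comp (h0 1)).prodMk (contMDiff_expSU2.comp h2))

/-- The adjoint action. -/
def adT2SU2 (g : T2SU2) : LieT2SU2 →ₗ[ℝ] LieT2SU2 := LinearMap.prodMap LinearMap.id (rotSU2 g.2.2)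

theorem adT2SU2_apply (g : T2SU2) (ξ : LieT2SU2) : adT2SU2 g ξ = (ξ.1, rotSU2 g.2.2 ξ.2) := rfl

theorem mul_lieExp (g : T2SU2) (ξ : LieT2SU2) : g * lieExp ξ = lieExp (adT2SU2 g ξ) * g := by
  rw [← mul_inv_eq_iff_eq_mul]
  have h : g.2.2 * expSU2 (-(2⁻¹ : ℝ) • ξ.2) * g.2.2⁻¹ =
      expSU2 (-(2⁻¹ : ℝ) • rotSU2 g.2.2 ξ.2) := by
    apply expSU2_conj
    rw [← map_smul, imQuaternion_rotSU2]
  ext1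
  · simp [lieExp, adT2SU2_apply]
  · ext1
    · simp [lieExp, adT2SU2_apply]
    · exact h

theorem adT2SU2_injective (g : T2SU2) : Function.Injective (adT2SU2 g) := by
  intro ξ η h
  rw [adT2SU2_apply, adT2SU2_apply, Prod.mk.injEq] at h
  ext1
  · exact h.1
  · rw [← rotSU2_inv_rotSU2 g.2.2 ξ.2, h.2, rotSU2_inv_rotSU2]

/-- The signs and the factor `1/2` in `lieExp` are such that the one-parameter groups behind `genU`
and `genV` are the images of the coordinate lines of the Lie algebra. -/
theorem torusFlow_neg_eq (l : Fin 2) (t : ℝ) :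
    torusFlow l (-t) = lieExp (t • (Pi.single l 1, 0)) := by
  fin_cases l <;> simp [torusFlow, lieExp, expSU2_zero]

theorem su2Flow_neg_eq (i : Fin 3) (t : ℝ) :
    su2Flow i (-t) = lieExp (t • (0, Pi.single i 1)) := by
  have : (Pi.single i (-t / 2) : Fin 3 → ℝ) = -(2⁻¹ : ℝ) • t • Pi.single i (1 : ℝ) := by
    ext j
    by_cases h : j = i
    · subst h; simp; ring
    · simp [h]
  simp [su2Flow, lieExp, this]

theorem commute_smul_imQuaternion {u : Fin 3 → ℝ} (s t : ℝ) :
    Commute (imQuaternion (s • u)) (imQuaternion (t • u)) := by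
  simp only [← imQuaternionL_apply, map_smul]
  exact ((Commute.refl _).smul_left _).smul_right _

/-- The Lie algebra of `T²`. -/
def lieTorus2 : Submodule ℝ LieT2SU2 := Submodule.prod ⊤ ⊥

/-- The Lie algebra of `T³`. -/
def lieTorus3 (n : Fin 3 → ℝ) : Submodule ℝ LieT2SU2 := Submodule.prod ⊤ (ℝ ∙ n)

theorem lieTorus2_commute : ∀ ξ ∈ lieTorus2, ∀ η ∈ lieTorus2,
    Commute (imQuaternion ξ.2) (imQuaternion η.2) := by
  rintro ξ hξ η hη
  rw [(Submodule.mem_bot ℝ).1 hξ.2, (Submodule.mem_bot ℝ).1 hη.2]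

theorem lieTorus3_commute (n : Fin 3 → ℝ) : ∀ ξ ∈ lieTorus3 n, ∀ η ∈ lieTorus3 n,
    Commute (imQuaternion ξ.2) (imQuaternion η.2) := by
  rintro ξ hξ η hη
  obtain ⟨s, hs⟩ := Submodule.mem_span_singleton.1 hξ.2
  obtain ⟨t, ht⟩ := Submodule.mem_span_singleton.1 hη.2
  rw [← hs, ← ht]
  exact commute_smul_imQuaternion s t

theorem lieExp_mem_torus2 {ξ : LieT2SU2} (hξ : ξ ∈ lieTorus2) : lieExp ξ ∈ torus2 := by
  refine ⟨trivial, trivial, ?_⟩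
  simp [lieExp, (Submodule.mem_bot ℝ).1 hξ.2, expSU2_zero]

theorem exists_circle_exp (z : Circle) : ∃ a ∈ Set.Icc (-Real.pi) Real.pi, Circle.exp (-a) = z := by
  refine ⟨-Complex.arg z, ⟨?_, ?_⟩, ?_⟩
  · linarith [Complex.arg_le_pi (z : ℂ)]
  · linarith [Complex.neg_pi_lt_arg (z : ℂ)]
  · rw [neg_neg, Circle.exp_arg]

/-- The cube in the Lie algebra of `T²` which is mapped onto `T²`. -/
def torusCube : Set (Fin 2 → ℝ) := Set.pi Set.univ fun _ => Set.Icc (-Real.pi) Real.pi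

theorem isCompact_torusCube : IsCompact torusCube := isCompact_univ_pi fun _ => isCompact_Icc

theorem exists_lieExp_torus (s t : Circle) : ∃ a ∈ torusCube, lieExp (a, 0) = (s, t, 1) := by
  obtain ⟨a, ha, hs⟩ := exists_circle_exp s
  obtain ⟨b, hb, ht⟩ := exists_circle_exp t
  refine ⟨![a, b], fun i _ => ?_, ?_⟩
  · fin_cases i
    exacts [ha, hb]
  · simp [lieExp, hs, ht, expSU2_zero]

/-- A compact piece of the Lie algebra that maps onto the torus: compactness arguments over the
torus can then be run with Lie algebra elements, which may be subtracted from one another. -/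
theorem exists_lieExp_eq_torus2 : ∃ C : Set LieT2SU2, IsCompact C ∧ C ⊆ lieTorus2 ∧
    ∀ g ∈ torus2, ∃ ξ ∈ C, lieExp ξ = g := by
  refine ⟨torusCube ×ˢ {0}, isCompact_torusCube.prod isCompact_singleton, ?_, ?_⟩
  · rintro ξ ⟨-, h⟩
    exact ⟨trivial, h⟩
  · rintro ⟨s, t, q⟩ ⟨-, -, hq⟩
    obtain rfl : q = 1 := hq
    obtain ⟨a, ha, h⟩ := exists_lieExp_torus s t
    exact ⟨(a, 0), ⟨ha, rfl⟩, h⟩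

/-- The direction in `ℝ³` of an imaginary unit quaternion. -/
def dirSU2 (n : SU2) : Fin 3 → ℝ := imPart n

theorem imQuaternion_dirSU2 {n : SU2} (hn : (n : ℍ[ℝ]).re = 0) :
    imQuaternion (dirSU2 n) = (n : ℍ[ℝ]) := imQuaternion_imPart _ hn

theorem coe_expSU2_smul {n : SU2} (hn : (n : ℍ[ℝ]).re = 0) (t : ℝ) :
    (expSU2 (t • dirSU2 n) : ℍ[ℝ]) =
      ((Real.cos t : ℝ) : ℍ[ℝ]) + Real.sin t • (n : ℍ[ℝ]) := by
  have hN : ‖(n : ℍ[ℝ])‖ = 1 := by simp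
  have h1 : imQuaternion (t • dirSU2 n) = t • (n : ℍ[ℝ]) := by
    rw [← imQuaternionL_apply, map_smul, imQuaternionL_apply, imQuaternion_dirSU2 hn]
  show NormedSpace.exp (imQuaternion (t • dirSU2 n)) = _
  rw [h1, Quaternion.exp_of_re_eq_zero _ (by simp [hn]), norm_smul, hN, mul_one, Real.norm_eq_abs,
    Real.cos_abs, smul_smul]
  congr 2
  rcases eq_or_ne t 0 with rfl | ht
  · simp
  · rcases abs_choice t with h | h
    · rw [h]; field_simp
    · rw [h, Real.sin_neg]; field_simp

theorem lieExp_mem_torus3 {n : SU2} (hn : (n : ℍ[ℝ]).re = 0) {ξ : LieT2SU2}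
    (hξ : ξ ∈ lieTorus3 (dirSU2 n)) : lieExp ξ ∈ torus3 n := by
  refine ⟨trivial, trivial, ?_⟩
  obtain ⟨s, hs⟩ := Submodule.mem_span_singleton.1 hξ.2
  refine (mem_circleSU2_iff n hn _).2 ?_
  refine ⟨-(2⁻¹ : ℝ) * s, ?_⟩
  show (expSU2 (-(2⁻¹ : ℝ) • ξ.2) : ℍ[ℝ]) = _
  rw [← hs, smul_smul, coe_expSU2_smul hn]

theorem exists_lieExp_eq_torus3 {n : SU2} (hn : (n : ℍ[ℝ]).re = 0) :
    ∃ C : Set LieT2SU2, IsCompact C ∧ C ⊆ lieTorus3 (dirSU2 n) ∧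
      ∀ g ∈ torus3 n, ∃ ξ ∈ C, lieExp ξ = g := by
  refine ⟨torusCube ×ˢ ((fun s : ℝ => s • dirSU2 n) '' Set.Icc (-(4 * Real.pi)) (4 * Real.pi)),
    isCompact_torusCube.prod (isCompact_Icc.image (by fun_prop)), ?_, ?_⟩
  · rintro ξ ⟨-, s, -, h⟩
    exact ⟨trivial, Submodule.mem_span_singleton.2 ⟨s, h⟩⟩
  · rintro ⟨s, t, q⟩ ⟨-, -, hq⟩
    obtain ⟨a, ha, h⟩ := exists_lieExp_torus s t
    obtain ⟨θ, hθ⟩ := (mem_circleSU2_iff n hn _).1 hq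
    obtain ⟨b, hb, hbθ⟩ := exists_circle_exp (Circle.exp θ)
    have h1 := congrArg (fun z : Circle => (z : ℂ).re) hbθ
    have h2 := congrArg (fun z : Circle => (z : ℂ).im) hbθ
    simp only [Circle.coe_exp, Complex.exp_ofReal_mul_I_re, Complex.exp_ofReal_mul_I_im] at h1 h2
    -- `lieExp` halves and negates the coefficient, so the angle `-b` is produced by `2 b`. As `|b|
    -- ≤ π`, the interval `[-4π, 4π]` is ample.
    refine ⟨(a, (2 * b) • dirSU2 n), ⟨ha, 2 * b, ⟨?_, ?_⟩, rfl⟩, ?_⟩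
    · linarith [hb.1, Real.pi_pos]
    · linarith [hb.2, Real.pi_pos]
    · simp only [lieExp, Prod.mk.injEq] at h ⊢
      refine ⟨h.1, h.2.1, Subtype.ext ?_⟩
      rw [smul_smul, show -(2⁻¹ : ℝ) * (2 * b) = -b by ring, coe_expSU2_smul hn, h1, h2]
      exact hθ.symm

theorem continuous_lieExp : Continuous lieExp := contMDiff_lieExp.continuous

/-! ### Maps with vanishing differential -/

section ZeroDerivative

variable {E F N N' : Type*} [NormedAddCommGroup E] [NormedSpace ℝ E] [NormedAddCommGroup F]
  [NormedSpace ℝ F] [TopologicalSpace N] [ChartedSpace E N] [IsManifold 𝓘(ℝ, E) 1 N]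
  [TopologicalSpace N'] [ChartedSpace F N'] [IsManifold 𝓘(ℝ, F) 1 N']

/-- A map with vanishing derivative is locally constant. -/
theorem isLocallyConstant_of_mfderiv_eq_zero {f : N → N'}
    (hf : MDifferentiable 𝓘(ℝ, E) 𝓘(ℝ, F) f)
    (h : ∀ x, mfderiv 𝓘(ℝ, E) 𝓘(ℝ, F) f x = 0) : IsLocallyConstant f := by
  rw [IsLocallyConstant.iff_eventually_eq]
  intro x
  set e := chartAt E x with he
  set e' := chartAt F (f x) with he'
  have hO : IsOpen (e.target ∩ e.symm ⁻¹' (f ⁻¹' e'.source)) :=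
    e.isOpen_inter_preimage_symm (e'.open_source.preimage hf.continuous)
  have hx : e x ∈ e.target ∩ e.symm ⁻¹' (f ⁻¹' e'.source) := by
    refine ⟨mem_chart_target E x, ?_⟩
    rw [Set.mem_preimage, Set.mem_preimage, e.left_inv (mem_chart_source E x)]
    exact mem_chart_source F (f x)
  obtain ⟨r, hr, hball⟩ := Metric.isOpen_iff.1 hO _ hx
  have hd : ∀ z ∈ Metric.ball (e x) r, HasFDerivAt (fun z => e' (f (e.symm z))) (0 : E →L[ℝ] F) z := by
    intro z hz
    obtain ⟨h1, h2⟩ := hball hz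
    have m1 := (mdifferentiableAt_atlas_symm (I := 𝓘(ℝ, E)) (chart_mem_atlas E x) h1).hasMFDerivAt
    have m2 := (hf (e.symm z)).hasMFDerivAt
    rw [h] at m2
    have m3 := (mdifferentiableAt_atlas (I := 𝓘(ℝ, F)) (chart_mem_atlas F (f x)) h2).hasMFDerivAt
    have m4 := m3.comp z (m2.comp z m1)
    have m5 := hasMFDerivAt_iff_hasFDerivAt.1 m4
    rw [ContinuousLinearMap.zero_comp, ContinuousLinearMap.comp_zero] at m5
    exact m5
  have hconst : ∀ z ∈ Metric.ball (e x) r, e' (f (e.symm z)) = e' (f x) := by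
    intro z hz
    have := (convex_ball (e x) r).is_const_of_fderivWithin_eq_zero (𝕜 := ℝ)
      (f := fun z => e' (f (e.symm z)))
      (fun z hz => (hd z hz).differentiableAt.differentiableWithinAt)
      (fun z hz => by
        rw [fderivWithin_of_isOpen Metric.isOpen_ball hz, (hd z hz).fderiv]) hz
      (Metric.mem_ball_self hr)
    rw [this, e.left_inv (mem_chart_source E x)]
  have hev : ∀ᶠ y in 𝓝 x, y ∈ e.source ∧ e y ∈ Metric.ball (e x) r :=
    Filter.Eventually.and (e.open_source.mem_nhds (mem_chart_source E x))
      ((e.continuousAt (mem_chart_source E x)).eventually (Metric.ball_mem_nhds _ hr))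
  filter_upwards [hev] with y hy
  have h1 := hconst _ hy.2
  have h2 := (hball hy.2).2
  rw [Set.mem_preimage, Set.mem_preimage, e.left_inv hy.1] at h2
  rw [e.left_inv hy.1] at h1
  exact e'.injOn h2 (mem_chart_source F (f x)) h1

theorem eq_of_mfderiv_eq_zero [PreconnectedSpace N] {f : N → N'}
    (hf : MDifferentiable 𝓘(ℝ, E) 𝓘(ℝ, F) f)
    (h : ∀ x, mfderiv 𝓘(ℝ, E) 𝓘(ℝ, F) f x = 0) (x y : N) : f x = f y :=
  (isLocallyConstant_of_mfderiv_eq_zero hf h).apply_eq_of_preconnectedSpace x y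

end ZeroDerivative

/-! ### Velocities of curves and tangent vectors -/

section Velocity

variable {M : Type*} [TopologicalSpace M] [ChartedSpace E7 M]

/-- The curve `γ` has velocity `v` at time `t`. -/
def HasVelocity (γ : ℝ → M) (t : ℝ) (v : TangentSpace (𝓡 7) (γ t)) : Prop :=
  HasMFDerivAt 𝓘(ℝ, ℝ) (𝓡 7) γ t (ContinuousLinearMap.toSpanSingleton ℝ (v : E7))

theorem hasVelocity_of_hasMFDerivAt {γ : ℝ → M} {t : ℝ} {L : ℝ →L[ℝ] E7} {v : E7}
    (h : HasMFDerivAt 𝓘(ℝ, ℝ) (𝓡 7) γ t L) (hL : L 1 = v) : HasVelocity γ t v := by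
  have : L = ContinuousLinearMap.toSpanSingleton ℝ v := by ext; simp [hL]
  rw [this] at h
  exact h

theorem HasVelocity.unique {γ : ℝ → M} {t : ℝ} {v w : TangentSpace (𝓡 7) (γ t)}
    (hv : HasVelocity γ t v) (hw : HasVelocity γ t w) : v = w := by
  have h := congrArg (fun L : ℝ →L[ℝ] E7 => L 1) (hasMFDerivAt_unique hv hw)
  have h1 : (1 : ℝ) • (v : E7) = (1 : ℝ) • (w : E7) := h
  rwa [one_smul, one_smul] at h1

theorem HasVelocity.mfderiv_one {γ : ℝ → M} {t : ℝ} {v : TangentSpace (𝓡 7) (γ t)}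
    (hv : HasVelocity γ t v) : (mfderiv 𝓘(ℝ, ℝ) (𝓡 7) γ t (1 : ℝ) : E7) = v := by
  rw [hv.mfderiv]
  exact one_smul ℝ _

theorem hasVelocity_mfderiv {γ : ℝ → M} {t : ℝ} (h : MDifferentiableAt 𝓘(ℝ, ℝ) (𝓡 7) γ t) :
    HasVelocity γ t (mfderiv 𝓘(ℝ, ℝ) (𝓡 7) γ t (1 : ℝ) : E7) :=
  hasVelocity_of_hasMFDerivAt h.hasMFDerivAt rfl

theorem HasVelocity.congr_of_eventuallyEq {γ γ' : ℝ → M} {t : ℝ} {v : E7}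
    (hv : HasVelocity γ t v) (h : γ' =ᶠ[𝓝 t] γ) : HasVelocity γ' t v :=
  (show HasMFDerivAt 𝓘(ℝ, ℝ) (𝓡 7) γ t (ContinuousLinearMap.toSpanSingleton ℝ v) from
    hv).congr_of_eventuallyEq h

theorem HasVelocity.continuousAt {γ : ℝ → M} {t : ℝ} {v : E7} (hv : HasVelocity γ t v) :
    ContinuousAt γ t := HasMFDerivAt.continuousAt hv

theorem HasVelocity.comp {γ : ℝ → M} {t : ℝ} {v : E7} (hv : HasVelocity γ t v)
    {σ : ℝ → ℝ} {s : ℝ} (hst : σ s = t) (hσ : HasDerivAt σ 1 s) :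
    HasVelocity (fun s => γ (σ s)) s v := by
  subst hst
  have h1 : HasMFDerivAt 𝓘(ℝ, ℝ) 𝓘(ℝ, ℝ) σ s (ContinuousLinearMap.toSpanSingleton ℝ (1 : ℝ)) :=
    hasMFDerivAt_iff_hasFDerivAt.2 hσ.hasFDerivAt
  have h2 := HasMFDerivAt.comp s hv h1
  exact hasVelocity_of_hasMFDerivAt h2 (by
    show ((1 : ℝ) • (1 : ℝ)) • v = v
    rw [one_smul, one_smul])

theorem HasVelocity.map {M' : Type*} [TopologicalSpace M'] [ChartedSpace E7 M'] {γ : ℝ → M} {t : ℝ}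
    {v : TangentSpace (𝓡 7) (γ t)} (hv : HasVelocity γ t v)
    {f : M → M'} {L : TangentSpace (𝓡 7) (γ t) →L[ℝ] TangentSpace (𝓡 7) (f (γ t))}
    (hf : HasMFDerivAt (𝓡 7) (𝓡 7) f (γ t) L) : HasVelocity (fun s => f (γ s)) t (L v) := by
  have h2 := HasMFDerivAt.comp t hf hv
  exact hasVelocity_of_hasMFDerivAt h2 (congrArg L (one_smul ℝ v))

theorem HasVelocity.hasDerivAt {F : Type*} [NormedAddCommGroup F] [NormedSpace ℝ F] {γ : ℝ → M}
    {t : ℝ} {v : TangentSpace (𝓡 7) (γ t)} (hv : HasVelocity γ t v)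
    {f : M → F} {L : TangentSpace (𝓡 7) (γ t) →L[ℝ] F}
    (hf : HasMFDerivAt (𝓡 7) 𝓘(ℝ, F) f (γ t) L) : HasDerivAt (fun s => f (γ s)) (L v) t := by
  have h2 := hasMFDerivAt_iff_hasFDerivAt.1 (HasMFDerivAt.comp t hf hv)
  have h3 : (L : E7 →L[ℝ] F).comp (ContinuousLinearMap.toSpanSingleton ℝ (v : E7)) =
      ContinuousLinearMap.toSpanSingleton ℝ ((L : E7 →L[ℝ] F) v) := by
    ext; simp
  exact (h3 ▸ h2 : HasFDerivAt _ (ContinuousLinearMap.toSpanSingleton ℝ ((L : E7 →L[ℝ] F) v)) t)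

theorem HasVelocity.of_model {F : Type*} [NormedAddCommGroup F] [NormedSpace ℝ F] {γ : ℝ → F}
    {t : ℝ} {v : F} (hv : HasDerivAt γ v t) {f : F → M} {L : F →L[ℝ] TangentSpace (𝓡 7) (f (γ t))}
    (hf : HasMFDerivAt 𝓘(ℝ, F) (𝓡 7) f (γ t) L) : HasVelocity (fun s => f (γ s)) t (L v) := by
  have h1 : HasMFDerivAt 𝓘(ℝ, ℝ) 𝓘(ℝ, F) γ t (ContinuousLinearMap.toSpanSingleton ℝ v) :=
    hasMFDerivAt_iff_hasFDerivAt.2 hv.hasFDerivAt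
  have h2 := HasMFDerivAt.comp t hf h1
  exact hasVelocity_of_hasMFDerivAt h2 (congrArg L (one_smul ℝ v))

theorem mem_tangentTo {S : Set M} {x : M} {v : TangentSpace (𝓡 7) x} : v ∈ tangentTo S x ↔
    ∃ γ : ℝ → M, ∃ w : E7, γ 0 = x ∧ w = v ∧ (∀ᶠ t in 𝓝 (0 : ℝ), γ t ∈ S) ∧ HasVelocity γ 0 w := by
  constructor
  · rintro ⟨γ, h0, hS, hd, hv⟩
    exact ⟨γ, _, h0, hv, hS, hasVelocity_mfderiv hd⟩
  · rintro ⟨γ, w, h0, rfl, hS, hv⟩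
    exact ⟨γ, h0, hS, hv.mdifferentiableAt, hv.mfderiv_one⟩

end Velocity

local instance instMonoidT2SU2 : Monoid T2SU2 := inferInstance

section Fields

variable {M : Type*} [TopologicalSpace M] [ChartedSpace E7 M] [MulAction T2SU2 M]

/-! ### The fundamental vector fields -/

/-- The fundamental vector field of an element of the Lie algebra. -/
def fundField (x : M) : LieT2SU2 →L[ℝ] TangentSpace (𝓡 7) x :=
  (mfderiv 𝓘(ℝ, LieT2SU2) (𝓡 7) (fun ξ : LieT2SU2 => lieExp ξ • x) 0 : LieT2SU2 →L[ℝ] E7)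

/-- The differential of the action of a group element. -/
def smulDeriv (g : T2SU2) (x : M) : TangentSpace (𝓡 7) x →L[ℝ] TangentSpace (𝓡 7) (g • x) :=
  mfderiv (𝓡 7) (𝓡 7) (fun y : M => g • y) x

variable (hs : IsSmoothAction M)
include hs

theorem IsSmoothAction.contMDiff_smul (g : T2SU2) : ContMDiff (𝓡 7) (𝓡 7) ∞ (fun x : M => g • x) :=
  ContMDiff.comp (f := fun x : M => ((g, x) : T2SU2 × M)) hs (contMDiff_const.prodMk contMDiff_id)

theorem IsSmoothAction.contMDiff_lieExp_smul :
    ContMDiff (𝓘(ℝ, LieT2SU2).prod (𝓡 7)) (𝓡 7) ∞ (fun p : LieT2SU2 × M => lieExp p.1 • p.2) :=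
  ContMDiff.comp (f := fun p : LieT2SU2 × M => ((lieExp p.1, p.2) : T2SU2 × M)) hs
    ((contMDiff_lieExp.comp contMDiff_fst).prodMk contMDiff_snd)

theorem IsSmoothAction.continuousSMul : ContinuousSMul T2SU2 M := ⟨ContMDiff.continuous hs⟩

theorem IsSmoothAction.contMDiff_lieExp_smul_left (x : M) :
    ContMDiff 𝓘(ℝ, LieT2SU2) (𝓡 7) ∞ (fun ξ : LieT2SU2 => lieExp ξ • x) :=
  ContMDiff.comp (f := fun ξ : LieT2SU2 => ((ξ, x) : LieT2SU2 × M)) hs.contMDiff_lieExp_smul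
    (contMDiff_id.prodMk contMDiff_const)

theorem hasMFDerivAt_lieExp_smul (x : M) : HasMFDerivAt 𝓘(ℝ, LieT2SU2) (𝓡 7)
    (fun ξ : LieT2SU2 => lieExp ξ • x) 0 (fundField x : LieT2SU2 →L[ℝ] E7) :=
  ((hs.contMDiff_lieExp_smul_left x).mdifferentiable (by simp) 0).hasMFDerivAt

/-- `t ↦ exp(tξ) • x` has velocity `fundField x ξ` at `0`. -/
theorem hasVelocity_lieExp_smul_zero (x : M) (ξ : LieT2SU2) :
    HasVelocity (fun t : ℝ => lieExp (t • ξ) • x) 0 (fundField x ξ : E7) := by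
  have h1 : HasDerivAt (fun t : ℝ => t • ξ) ξ 0 := by
    simpa using (hasDerivAt_id (0 : ℝ)).smul_const ξ
  have h2 : HasMFDerivAt 𝓘(ℝ, LieT2SU2) (𝓡 7) (fun ξ : LieT2SU2 => lieExp ξ • x) ((0 : ℝ) • ξ)
      (fundField x : LieT2SU2 →L[ℝ] E7) := by
    rw [zero_smul]; exact hasMFDerivAt_lieExp_smul hs x
  exact HasVelocity.of_model h1 h2

theorem genU_eq (l : Fin 2) (x : M) : genU l x = fundField x (Pi.single l 1, 0) := by
  have h := hasVelocity_lieExp_smul_zero hs x (Pi.single l 1, 0)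
  have h1 : (fun t : ℝ => lieExp (t • ((Pi.single l 1, 0) : LieT2SU2)) • x) =
      fun t : ℝ => torusFlow l (-t) • x := funext fun t => by rw [torusFlow_neg_eq]
  rw [h1] at h
  exact h.mfderiv_one

theorem genV_eq (i : Fin 3) (x : M) : genV i x = fundField x (0, Pi.single i 1) := by
  have h := hasVelocity_lieExp_smul_zero hs x (0, Pi.single i 1)
  have h1 : (fun t : ℝ => lieExp (t • ((0, Pi.single i 1) : LieT2SU2)) • x) =
      fun t : ℝ => su2Flow i (-t) • x := funext fun t => by rw [su2Flow_neg_eq]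
  rw [h1] at h
  exact h.mfderiv_one

theorem hasMFDerivAt_smul (g : T2SU2) (x : M) :
    HasMFDerivAt (𝓡 7) (𝓡 7) (fun y : M => g • y) x (smulDeriv g x) :=
  ((hs.contMDiff_smul g).mdifferentiable (by simp) x).hasMFDerivAt

/-- Differentiate `g exp(tξ) = exp(t Ad_g ξ) g` at `t = 0`. -/
theorem smulDeriv_fundField (g : T2SU2) (x : M) (ξ : LieT2SU2) :
    smulDeriv g x (fundField x ξ) = fundField (g • x) (adT2SU2 g ξ) := by
  have h1 : HasMFDerivAt (𝓡 7) (𝓡 7) (fun y : M => g • y) (lieExp ((0 : ℝ) • ξ) • x)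
      (smulDeriv g x : E7 →L[ℝ] E7) := by
    rw [zero_smul, lieExp_zero, one_smul]; exact hasMFDerivAt_smul hs g x
  have h2 := (hasVelocity_lieExp_smul_zero hs x ξ).map h1
  have h3 := hasVelocity_lieExp_smul_zero hs (g • x) (adT2SU2 g ξ)
  have h4 : (fun t : ℝ => lieExp (t • adT2SU2 g ξ) • g • x) =
      fun t : ℝ => g • lieExp (t • ξ) • x := by
    ext t
    rw [smul_smul, smul_smul, mul_lieExp, map_smul]
  rw [h4] at h3
  exact h2.unique h3

end Fields

theorem HasMFDerivAt.congr_apply {F N : Type*} [NormedAddCommGroup F] [NormedSpace ℝ F]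
    [TopologicalSpace N] [ChartedSpace E7 N] {f : N → F} {x : N}
    {L L' : TangentSpace (𝓡 7) x →L[ℝ] F} (h : HasMFDerivAt (𝓡 7) 𝓘(ℝ, F) f x L)
    (hL : ∀ v, L v = L' v) : HasMFDerivAt (𝓡 7) 𝓘(ℝ, F) f x L' := by
  rwa [← ContinuousLinearMap.ext hL]

/-! ### Gradients and the invariance of the `G₂`-structure -/

section Differential

variable {M : Type*} [TopologicalSpace M] [ChartedSpace E7 M]

/-- The differential of a real function. -/
def differential (f : M → ℝ) (x : M) : TangentSpace (𝓡 7) x →L[ℝ] ℝ :=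
  mfderiv (𝓡 7) 𝓘(ℝ, ℝ) f x

theorem hasMFDerivAt_differential {f : M → ℝ} (hf : ContMDiff (𝓡 7) 𝓘(ℝ, ℝ) ∞ f) (x : M) :
    HasMFDerivAt (𝓡 7) 𝓘(ℝ, ℝ) f x (differential f x) :=
  (hf.mdifferentiable (by simp) x).hasMFDerivAt

theorem HasMFDerivAt.differential_eq {f : M → ℝ} {x : M} {L : TangentSpace (𝓡 7) x →L[ℝ] ℝ}
    (h : HasMFDerivAt (𝓡 7) 𝓘(ℝ, ℝ) f x L) : differential f x = L := h.mfderiv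

end Differential

namespace G2Manifold

variable {M : Type*} [TopologicalSpace M] [ChartedSpace E7 M] [IsManifold (𝓡 7) ∞ M]
  (G : G2Manifold M)

theorem cons_four_eq_update_two {α : Type*} (a b c d c' : α) :
    ![a, b, c, d] = Function.update ![a, b, c', d] 2 c := by
  ext1 i; fin_cases i <;> rfl

theorem cons_four_eq_update_three {α : Type*} (a b c d d' : α) :
    ![a, b, c, d] = Function.update ![a, b, c, d'] 3 d := by
  ext1 i; fin_cases i <;> rfl

/-- The bilinear form `ψ(a, b, ·, ·)`. -/
def ψ₂ (x : M) (a b : TangentSpace (𝓡 7) x) :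
    TangentSpace (𝓡 7) x →ₗ[ℝ] TangentSpace (𝓡 7) x →ₗ[ℝ] ℝ :=
  LinearMap.mk₂ ℝ (fun c d => G.ψ x ![a, b, c, d])
    (fun c c' d => by
      rw [cons_four_eq_update_two a b (c + c') d 0, (G.ψ x).map_update_add,
        ← cons_four_eq_update_two, ← cons_four_eq_update_two])
    (fun r c d => by
      rw [cons_four_eq_update_two a b (r • c) d 0, (G.ψ x).map_update_smul,
        ← cons_four_eq_update_two])
    (fun c d d' => by
      rw [cons_four_eq_update_three a b c (d + d') 0, (G.ψ x).map_update_add,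
        ← cons_four_eq_update_three, ← cons_four_eq_update_three])
    (fun r c d => by
      rw [cons_four_eq_update_three a b c (r • d) 0, (G.ψ x).map_update_smul,
        ← cons_four_eq_update_three])

theorem ψ₂_apply (x : M) (a b c d : TangentSpace (𝓡 7) x) :
    G.ψ₂ x a b c d = G.ψ x ![a, b, c, d] := rfl

theorem ψ₂_self (x : M) (a b c : TangentSpace (𝓡 7) x) : G.ψ₂ x a b c c = 0 :=
  (G.ψ x).map_eq_zero_of_eq _ (i := 2) (j := 3) rfl (by decide)

theorem ψ₂_left (x : M) (a b c : TangentSpace (𝓡 7) x) : G.ψ₂ x a b c a = 0 :=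
  (G.ψ x).map_eq_zero_of_eq _ (i := 0) (j := 3) rfl (by decide)

theorem ψ₂_right (x : M) (a b c : TangentSpace (𝓡 7) x) : G.ψ₂ x a b c b = 0 :=
  (G.ψ x).map_eq_zero_of_eq _ (i := 1) (j := 3) rfl (by decide)

theorem ψ₂_swap (x : M) (a b c d : TangentSpace (𝓡 7) x) :
    G.ψ₂ x a b d c = -G.ψ₂ x a b c d := by
  have h := G.ψ₂_self x a b (c + d)
  simp only [map_add, LinearMap.add_apply, ψ₂_self] at h
  linarith

/-- The gradient of a function. -/
def grad (f : M → ℝ) (x : M) : TangentSpace (𝓡 7) x := G.sharp x (differential f x)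

theorem g_grad (f : M → ℝ) (x : M) (v : TangentSpace (𝓡 7) x) :
    G.g.inner x (G.grad f x) v = differential f x v := G.g_sharp x _ v

variable [MulAction T2SU2 M] (hs : IsSmoothAction M) (hinv : IsInvariantForm G.φ)

section Invariance

variable {G}

include hinv in
theorem φ_smulDeriv (g : T2SU2) (x : M) (u v w : TangentSpace (𝓡 7) x) :
    G.φ (g • x) ![smulDeriv g x u, smulDeriv g x v, smulDeriv g x w] = G.φ x ![u, v, w] := by
  rw [← hinv g x ![u, v, w]]
  congr 1
  ext1 i; fin_cases i <;> rfl

include hinv in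
theorem g_smulDeriv (g : T2SU2) (x : M) (u v : TangentSpace (𝓡 7) x) :
    G.g.inner (g • x) (smulDeriv g x u) (smulDeriv g x v) = G.g.inner x u v :=
  (preserves_of_preserves_φ (smulDeriv g x) (φ_smulDeriv hinv g x)).1 u v

include hinv in
theorem ψ_smulDeriv (g : T2SU2) (x : M) (u v w z : TangentSpace (𝓡 7) x) :
    G.ψ (g • x) ![smulDeriv g x u, smulDeriv g x v, smulDeriv g x w, smulDeriv g x z] =
      G.ψ x ![u, v, w, z] :=
  (preserves_of_preserves_φ (smulDeriv g x) (φ_smulDeriv hinv g x)).2 u v w z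

include hs

/-- `T²` is central, so the adjoint action fixes its Lie algebra. -/
theorem smulDeriv_genU (g : T2SU2) (l : Fin 2) (x : M) :
    smulDeriv g x (genU l x) = genU l (g • x) := by
  rw [genU_eq hs, genU_eq hs, smulDeriv_fundField hs]
  simp [adT2SU2_apply]

theorem smulDeriv_surjective (g : T2SU2) (x : M) : Function.Surjective (smulDeriv g x) := by
  intro v
  have h1 := hasMFDerivAt_smul hs g⁻¹ (g • x)
  have h2 : HasMFDerivAt (𝓡 7) (𝓡 7) (fun y : M => g • y) (g⁻¹ • g • x)
      (smulDeriv g x : E7 →L[ℝ] E7) := by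
    rw [inv_smul_smul]; exact hasMFDerivAt_smul hs g x
  have h3 := HasMFDerivAt.comp (g • x) h2 h1
  have h4 : ((fun y : M => g • y) ∘ fun y : M => g⁻¹ • y) = id := by
    ext y; simp
  rw [h4] at h3
  have h5 := congrArg (fun L : E7 →L[ℝ] E7 => L v) (hasMFDerivAt_unique h3 (hasMFDerivAt_id (g • x)))
  exact ⟨(smulDeriv g⁻¹ (g • x) v : E7), h5⟩

include hinv in
/-- The gradient of a function that is invariant under `g` is mapped to itself by `g`. -/
theorem smulDeriv_grad {f : M → ℝ} (hf : ContMDiff (𝓡 7) 𝓘(ℝ, ℝ) ∞ f) {g : T2SU2}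
    (hg : ∀ x, f (g • x) = f x) (x : M) : smulDeriv g x (G.grad f x) = G.grad f (g • x) := by
  apply G.ext_g
  intro z
  obtain ⟨v, rfl⟩ := smulDeriv_surjective hs g x z
  rw [g_smulDeriv hinv, g_grad, g_grad]
  have h1 := (hasMFDerivAt_differential hf (g • x)).comp x (hasMFDerivAt_smul hs g x)
  have h2 : f ∘ (fun y : M => g • y) = f := funext hg
  rw [h2] at h1
  rw [HasMFDerivAt.differential_eq h1]
  rfl

/-- A function invariant under a one-parameter group has vanishing derivative along it. -/
theorem differential_fundField {f : M → ℝ} (hf : ContMDiff (𝓡 7) 𝓘(ℝ, ℝ) ∞ f) {x : M} {ξ : LieT2SU2}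
    (hg : ∀ t : ℝ, f (lieExp (t • ξ) • x) = f x) :
    differential f x (fundField x ξ) = 0 := by
  have h1 : HasMFDerivAt (𝓡 7) 𝓘(ℝ, ℝ) f (lieExp ((0 : ℝ) • ξ) • x)
      (differential f x : E7 →L[ℝ] ℝ) := by
    rw [zero_smul, lieExp_zero, one_smul]
    exact hasMFDerivAt_differential hf x
  have h2 := (hasVelocity_lieExp_smul_zero hs x ξ).hasDerivAt h1
  simp only [hg] at h2
  exact h2.unique (hasDerivAt_const _ _)

end Invariance

end G2Manifold

/-! ### Invariance and equivariance of the multi-moment maps -/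

namespace IsMultiMomentPair

variable {M : Type*} [TopologicalSpace M] [ChartedSpace E7 M] [IsManifold (𝓡 7) ∞ M]
  [MulAction T2SU2 M] {G : G2Manifold M} {ν : M → ℝ} {μ : M → EuclideanSpace ℝ (Fin 3)}

open G2Manifold Matrix

variable (hmm : IsMultiMomentPair G ν μ) (hs : IsSmoothAction M) (hinv : IsInvariantForm G.φ)
include hmm hs

include hinv in
/-- `ν` is invariant. -/
theorem ν_smul [PreconnectedSpace M] (g : T2SU2) (x : M) : ν (g • x) = ν x := by
  have := hs.continuousSMul
  -- `φ`, `U₁` and `U₂` are preserved, so `ν ∘ g` and `ν` have the same differential and differ by a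
  -- constant on the connected manifold `M`.
  have hd : ∀ g : T2SU2, ∀ x y : M, ν (g • x) - ν x = ν (g • y) - ν y := by
    intro g
    have h0 : ∀ x, HasMFDerivAt (𝓡 7) 𝓘(ℝ, ℝ) (fun x => ν (g • x) - ν x) x 0 := by
      intro x
      have h1 := (hmm.smooth_ν.mdifferentiable (by simp) (g • x)).hasMFDerivAt.comp x
        (hasMFDerivAt_smul hs g x)
      have h2 := h1.sub (hmm.smooth_ν.mdifferentiable (by simp) x).hasMFDerivAt
      refine h2.congr_apply fun v => ?_
      have h3 := hmm.dν (g • x) (smulDeriv g x v)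
      rw [← smulDeriv_genU hs, ← smulDeriv_genU hs, φ_smulDeriv hinv, ← hmm.dν] at h3
      exact sub_eq_zero.2 h3
    exact eq_of_mfderiv_eq_zero (fun x => (h0 x).mdifferentiableAt) (fun x => (h0 x).mfderiv)
  -- Evaluated at a maximum of `ν` on the compact orbit, this constant is at most zero; the same for
  -- `g⁻¹` gives equality.
  obtain ⟨g₀, -, hg₀⟩ := isCompact_univ.exists_isMaxOn (Set.univ_nonempty (α := T2SU2))
    (f := fun h : T2SU2 => ν (h • x))
    (hmm.smooth_ν.continuous.comp (continuous_id.smul continuous_const)).continuousOn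
  have key : ∀ g : T2SU2, ν (g • x) ≤ ν x := by
    intro g
    have h1 := hd g x (g₀ • x)
    have h2 : ν ((g * g₀) • x) ≤ ν (g₀ • x) := hg₀ (Set.mem_univ (g * g₀))
    rw [← smul_smul] at h2
    linarith
  have h1 := key g⁻¹
  have h2 := hd g x (g⁻¹ • x)
  rw [smul_inv_smul] at h2
  linarith [key g]

omit hs in
-- The normalisation of `μ` covers the cyclic pairs, and antisymmetry in the last two slots of `∗φ`
-- gives the others.
theorem ψ₂_genV_self (i j : Fin 3) (x : M) :
    G.ψ₂ x (genU 0 x) (genU 1 x) (genV i x) (genV j x) =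
      -((fun k => μ x k) ⬝ᵥ crossProduct (Pi.single i (1 : ℝ)) (Pi.single j 1)) := by
  have h : ∀ i : Fin 3, G.ψ₂ x (genU 0 x) (genU 1 x) (genV i x) (genV (i + 1) x) = -μ x (i + 2) :=
    fun i => by rw [hmm.normalised, ψ₂_apply, neg_neg]
  have h0 := h 0
  have h1 := h 1
  have h2 := h 2
  have h0' := (G.ψ₂_swap x (genU 0 x) (genU 1 x) (genV 0 x) (genV 1 x)).trans (neg_eq_iff_eq_neg.2 h0)
  have h1' := (G.ψ₂_swap x (genU 0 x) (genU 1 x) (genV 1 x) (genV 2 x)).trans (neg_eq_iff_eq_neg.2 h1)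
  have h2' := (G.ψ₂_swap x (genU 0 x) (genU 1 x) (genV 2 x) (genV 0 x)).trans (neg_eq_iff_eq_neg.2 h2)
  fin_cases i <;> fin_cases j <;>
    simp [ψ₂_self, cross_apply, dotProduct, Fin.sum_univ_three] <;> assumption

/-- `∗φ(U₁, U₂, V_u, V_v) = -⟨μ, u × v⟩`. -/
theorem ψ₂_fundField (u v : Fin 3 → ℝ) (x : M) :
    G.ψ₂ x (genU 0 x) (genU 1 x) (fundField x (0, u)) (fundField x (0, v)) =
      -((fun k => μ x k) ⬝ᵥ crossProduct u v) := by
  let V : (Fin 3 → ℝ) →ₗ[ℝ] TangentSpace (𝓡 7) x :=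
    (fundField x : LieT2SU2 →ₗ[ℝ] TangentSpace (𝓡 7) x) ∘ₗ LinearMap.inr ℝ _ _
  have hB : (G.ψ₂ x (genU 0 x) (genU 1 x)).compl₁₂ V V = LinearMap.mk₂ ℝ
      (fun u v : Fin 3 → ℝ => -((fun k => μ x k) ⬝ᵥ crossProduct u v))
      (fun a b c => by simp [dotProduct_add]; ring) (fun r a b => by simp)
      (fun a b c => by simp [dotProduct_add]; ring) (fun r a b => by simp) := by
    apply LinearMap.pi_ext'
    intro i
    ext j
    simpa [V, genV_eq hs] using hmm.ψ₂_genV_self i j x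
  exact LinearMap.congr_fun₂ hB u v

theorem dμ_fundField (i : Fin 3) (x : M) (v : TangentSpace (𝓡 7) x) :
    differential (fun y => μ y i) x v =
      G.ψ₂ x (genU 0 x) (genU 1 x) (fundField x (0, Pi.single i 1)) v := by
  rw [← genV_eq hs]
  exact hmm.dμ i x v

include hinv in
/-- `μ` is equivariant. -/
theorem μ_smul (g : T2SU2) (x : M) : (fun k => μ (g • x) k) = rotSU2 g.2.2 (fun k => μ x k) := by
  -- The invariance of `∗φ(U₁, U₂, V_u, V_v) = -⟨μ, u × v⟩`. Cross products span `ℝ³`, so this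
  -- determines `μ (g • x)`.
  have h1 : ∀ u v : Fin 3 → ℝ, (fun k => μ (g • x) k) ⬝ᵥ rotSU2 g.2.2 (crossProduct u v) =
      (fun k => μ x k) ⬝ᵥ crossProduct u v := by
    intro u v
    have h := ψ_smulDeriv hinv g x (genU 0 x) (genU 1 x) (fundField x (0, u)) (fundField x (0, v))
    rw [smulDeriv_genU hs, smulDeriv_genU hs, smulDeriv_fundField hs, smulDeriv_fundField hs,
      ← ψ₂_apply, ← ψ₂_apply] at h
    simp only [adT2SU2_apply] at h
    rw [hmm.ψ₂_fundField hs, hmm.ψ₂_fundField hs, (rotSU2_dotProduct_cross _ _ _).2] at h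
    exact neg_injective h
  have h2 : ∀ u, (fun k => μ (g • x) k) ⬝ᵥ rotSU2 g.2.2 u = (fun k => μ x k) ⬝ᵥ u := by
    intro u
    have hu : u = u 0 • crossProduct (Pi.single 1 1) (Pi.single 2 1) +
        (u 1 • crossProduct (Pi.single 2 1) (Pi.single 0 1) +
          u 2 • crossProduct (Pi.single 0 1) (Pi.single 1 1)) := by
      ext i
      fin_cases i <;> simp [cross_apply]
    rw [hu]
    simp only [map_add, map_smul, dotProduct_add, dotProduct_smul, h1]
  refine dotProduct_eq _ _ fun u => ?_
  rw [← rotSU2_rotSU2_inv g.2.2 u, h2, (rotSU2_dotProduct_cross _ _ _).1]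

include hinv in
theorem norm_μ_smul (g : T2SU2) (x : M) : ‖μ (g • x)‖ = ‖μ x‖ := by
  have h : ∀ y : M, ‖μ y‖ ^ 2 = (fun k => μ y k) ⬝ᵥ (fun k => μ y k) := by
    intro y
    rw [EuclideanSpace.real_norm_sq_eq]
    simp [dotProduct, sq]
  have h2 : ‖μ (g • x)‖ ^ 2 = ‖μ x‖ ^ 2 := by
    rw [h, h, hmm.μ_smul hs hinv, (rotSU2_dotProduct_cross _ _ _).1]
  exact (sq_eq_sq₀ (norm_nonneg _) (norm_nonneg _)).1 h2

end IsMultiMomentPair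

/-- Three functionals which vanish on a hyperplane are linearly dependent. -/
theorem exists_ne_zero_map_eq_zero_of_hyperplane {T : Type*} [AddCommGroup T] [Module ℝ T]
    [FiniteDimensional ℝ T] (W : Submodule ℝ T)
    (hW : Module.finrank ℝ T = Module.finrank ℝ W + 1) (V : (Fin 3 → ℝ) →ₗ[ℝ] Module.Dual ℝ T)
    (hV : ∀ w, ∀ z ∈ W, V w z = 0) : ∃ w, w ≠ 0 ∧ V w = 0 := by
  have hV' : ∀ w, V w ∈ W.dualAnnihilator := fun w => (Submodule.mem_dualAnnihilator _).2 (hV w)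
  have hann : Module.finrank ℝ W.dualAnnihilator = 1 := by
    have := Subspace.finrank_add_finrank_dualAnnihilator_eq W
    omega
  by_contra! h
  have hinj : Function.Injective V := (injective_iff_map_eq_zero V).2 fun w hw => by
    by_contra hw0
    exact h w hw0 hw
  have hle : LinearMap.range V ≤ W.dualAnnihilator := by
    rintro _ ⟨w, rfl⟩
    exact hV' w
  have h3 := Submodule.finrank_mono hle
  rw [hann, LinearMap.finrank_range_of_inj hinj] at h3
  simp at h3

namespace G2Manifold

variable {M : Type*} [TopologicalSpace M] [ChartedSpace E7 M] [IsManifold (𝓡 7) ∞ M]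
  {G : G2Manifold M}

theorem g_symm (x : M) (u v : TangentSpace (𝓡 7) x) : G.g.inner x u v = G.g.inner x v u :=
  G.g.symm x u v

/-- With `D` the Gram determinant of `u, v`, the vector `D w - α u - β v` is `D` times the component
of `w` orthogonal to them. When `φ(u, v, w) = 0` its squared length is `D |X|²`, so `X` cannot
vanish. -/
theorem g_χ_pos {x : M} {u v w X : TangentSpace (𝓡 7) x}
    (hli : LinearIndependent ℝ ![u, v, w]) (hφ : G.φ x ![u, v, w] = 0)
    (hX : ∀ z, G.g.inner x X z = G.ψ x ![u, v, w, z]) : 0 < G.g.inner x X X := by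
  have huv : LinearIndependent ℝ ![u, v] := by
    have := hli.comp ![0, 1] (by decide)
    convert this using 1
    ext1 i; fin_cases i <;> rfl
  have hD := G.gram_two_pos huv
  have h := g_χ_χ hX hX
  rw [hφ, mul_zero, sub_zero] at h
  set D := G.g.inner x u u * G.g.inner x v v - G.g.inner x u v ^ 2 with hDdef
  set α := G.g.inner x u w * G.g.inner x v v - G.g.inner x v w * G.g.inner x u v with hα
  set β := G.g.inner x v w * G.g.inner x u u - G.g.inner x u w * G.g.inner x u v with hβ
  have hs : D • w - α • u - β • v ≠ 0 := by
    intro h0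
    have h1 := Fintype.linearIndependent_iff.1 hli ![-α, -β, D] (by
      rw [Fin.sum_univ_three, ← h0]
      simp only [Matrix.cons_val]
      module) 2
    exact hD.ne' h1
  have h2 : G.g.inner x (D • w - α • u - β • v) (D • w - α • u - β • v) =
      D * G.g.inner x X X := by
    have e1 := g_symm (G := G) x v u
    have e2 := g_symm (G := G) x w u
    have e3 := g_symm (G := G) x w v
    rw [h]
    have hsub : ∀ a b c : TangentSpace (𝓡 7) x,
        G.g.inner x (a - b) c = G.g.inner x a c - G.g.inner x b c := fun a b c => by
      rw [map_sub]; rfl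
    have hsmul : ∀ (r : ℝ) (a c : TangentSpace (𝓡 7) x),
        G.g.inner x (r • a) c = r * G.g.inner x a c := fun r a c => by
      rw [map_smul]; rfl
    have hsub' : ∀ a b c : TangentSpace (𝓡 7) x,
        G.g.inner x c (a - b) = G.g.inner x c a - G.g.inner x c b := fun a b c => map_sub _ _ _
    have hsmul' : ∀ (r : ℝ) (a c : TangentSpace (𝓡 7) x),
        G.g.inner x c (r • a) = r * G.g.inner x c a := fun r a c => map_smul _ _ _
    simp only [hsub, hsmul, hsub', hsmul', e1, e2, e3]
    rw [hDdef, hα, hβ]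
    ring
  have h3 := G.g_self_pos hs
  rw [h2] at h3
  exact pos_of_mul_pos_right h3 hD.le

end G2Manifold

namespace IsMultiMomentPair

variable {M : Type*} [TopologicalSpace M] [ChartedSpace E7 M] [IsManifold (𝓡 7) ∞ M]
  [MulAction T2SU2 M] {G : G2Manifold M} {ν : M → ℝ} {μ : M → EuclideanSpace ℝ (Fin 3)}

open G2Manifold Matrix

variable (hmm : IsMultiMomentPair G ν μ) (hs : IsSmoothAction M) (hinv : IsInvariantForm G.φ)

/-- The component of `μ` in the direction `w`. -/
def muDir (μ : M → EuclideanSpace ℝ (Fin 3)) (w : Fin 3 → ℝ) (x : M) : ℝ := (fun k => μ x k) ⬝ᵥ w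

theorem _root_.dotProduct_eq_three (u w : Fin 3 → ℝ) : u ⬝ᵥ w = w 0 * u 0 + w 1 * u 1 + w 2 * u 2 := by
  simp [dotProduct, Fin.sum_univ_three, mul_comm]

include hmm in
theorem smooth_muDir (w : Fin 3 → ℝ) : ContMDiff (𝓡 7) 𝓘(ℝ, ℝ) ∞ (muDir μ w) := by
  have h : ContDiff ℝ ∞ (fun m : EuclideanSpace ℝ (Fin 3) => (fun k => m k) ⬝ᵥ w) := by
    simp only [dotProduct_eq_three]
    fun_prop
  exact h.contMDiff.comp hmm.smooth_μ

include hmm in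
theorem smooth_normSq : ContMDiff (𝓡 7) 𝓘(ℝ, ℝ) ∞ (fun x => ‖μ x‖ ^ 2) :=
  (contDiff_norm_sq ℝ).contMDiff.comp hmm.smooth_μ

include hmm in
theorem hasMFDerivAt_μ (i : Fin 3) (x : M) : HasMFDerivAt (𝓡 7) 𝓘(ℝ, ℝ) (fun y => μ y i) x
    (differential (fun y => μ y i) x) := by
  have h : ContDiff ℝ ∞ (fun m : EuclideanSpace ℝ (Fin 3) => m i) := by fun_prop
  exact hasMFDerivAt_differential (h.contMDiff.comp hmm.smooth_μ) x

include hmm hs in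
theorem differential_muDir (w : Fin 3 → ℝ) (x : M) (v : TangentSpace (𝓡 7) x) :
    differential (muDir μ w) x v =
      G.ψ₂ x (genU 0 x) (genU 1 x) (fundField x (0, w)) v := by
  have h := (((hmm.hasMFDerivAt_μ 0 x).const_smul (w 0)).add
    ((hmm.hasMFDerivAt_μ 1 x).const_smul (w 1))).add ((hmm.hasMFDerivAt_μ 2 x).const_smul (w 2))
  have h1 : muDir μ w = (w 0 • (fun y => μ y 0) + w 1 • fun y => μ y 1) + w 2 • fun y => μ y 2 := by
    ext y
    simp [muDir, dotProduct_eq_three]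
  rw [h1, HasMFDerivAt.differential_eq h]
  have hw : ((0, w) : LieT2SU2) = w 0 • (0, Pi.single 0 1) + w 1 • (0, Pi.single 1 1) +
      w 2 • (0, Pi.single 2 1) := by
    ext i
    · simp
    · fin_cases i <;> simp
  rw [hw]
  simp only [map_add, map_smul, LinearMap.add_apply, LinearMap.smul_apply, ← hmm.dμ_fundField hs]
  rfl

include hmm hs in
-- At `x`, the differential of `|μ|²` is twice that of the component of `μ` in the frozen direction
-- `μ(x)`.
theorem differential_normSq (x : M) (v : TangentSpace (𝓡 7) x) :
    differential (fun y => ‖μ y‖ ^ 2) x v =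
      2 * G.ψ₂ x (genU 0 x) (genU 1 x) (fundField x (0, fun k => μ x k)) v := by
  have h0 := hmm.hasMFDerivAt_μ 0 x
  have h1 := hmm.hasMFDerivAt_μ 1 x
  have h2 := hmm.hasMFDerivAt_μ 2 x
  have h := ((h0.mul h0).add (h1.mul h1)).add (h2.mul h2)
  have e : (fun y => ‖μ y‖ ^ 2) = ((fun y => μ y 0) * (fun y => μ y 0) +
      (fun y => μ y 1) * fun y => μ y 1) + (fun y => μ y 2) * fun y => μ y 2 := by
    ext y
    rw [EuclideanSpace.real_norm_sq_eq, Fin.sum_univ_three, sq, sq, sq]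
    rfl
  rw [e, HasMFDerivAt.differential_eq h]
  have hw : ((0, fun k => μ x k) : LieT2SU2) = μ x 0 • (0, Pi.single 0 1) +
      μ x 1 • (0, Pi.single 1 1) + μ x 2 • (0, Pi.single 2 1) := by
    ext i
    · simp
    · fin_cases i <;> simp
  rw [hw]
  simp only [map_add, map_smul, LinearMap.add_apply, LinearMap.smul_apply, ← hmm.dμ_fundField hs]
  show (μ x 0 * differential (fun y => μ y 0) x v +
      μ x 0 * differential (fun y => μ y 0) x v) +
    (μ x 1 * differential (fun y => μ y 1) x v +
      μ x 1 * differential (fun y => μ y 1) x v) +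
    (μ x 2 * differential (fun y => μ y 2) x v +
      μ x 2 * differential (fun y => μ y 2) x v) = 2 *
    (μ x 0 * differential (fun y => μ y 0) x v +
      μ x 1 * differential (fun y => μ y 1) x v +
      μ x 2 * differential (fun y => μ y 2) x v)
  ring

include hmm in
theorem differential_ν (x : M) (z : TangentSpace (𝓡 7) x) :
    differential ν x z = G.φ x ![genU 0 x, genU 1 x, z] := hmm.dν x z

include hmm in
theorem g_grad_ν (x : M) (z : TangentSpace (𝓡 7) x) :
    G.g.inner x (G.grad ν x) z = G.φ x ![genU 0 x, genU 1 x, z] := by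
  rw [g_grad, hmm.differential_ν]

include hmm hs in
theorem g_grad_muDir (w : Fin 3 → ℝ) (x : M) (z : TangentSpace (𝓡 7) x) :
    G.g.inner x (G.grad (muDir μ w) x) z =
      G.ψ x ![genU 0 x, genU 1 x, fundField x (0, w), z] := by
  rw [g_grad, hmm.differential_muDir hs]; rfl

include hmm hs hinv

/-! ### Gradients at the points with five-dimensional orbits -/

section Regular

variable [PreconnectedSpace M] {x : M} (hx : Function.Injective (fundField x))

/-- `ν` is constant on the orbits. This isotropy is what makes coassociatives through the
`T³`-orbits possible. -/
theorem φ_fundField (x : M) (ξ : LieT2SU2) :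
    G.φ x ![genU 0 x, genU 1 x, fundField x ξ] = 0 := by
  rw [← hmm.differential_ν]
  exact differential_fundField hs hmm.smooth_ν fun t => hmm.ν_smul hs hinv _ _

omit hmm hinv [PreconnectedSpace M] in
theorem _root_.linearIndependent_genU_fundField (hx : Function.Injective (fundField x))
    {w : Fin 3 → ℝ} (hw : w ≠ 0) :
    LinearIndependent ℝ ![genU 0 x, genU 1 x, fundField x (0, w)] := by
  rw [Fintype.linearIndependent_iff]
  intro c hc
  rw [Fin.sum_univ_three] at hc
  simp only [Matrix.cons_val, genU_eq hs, ← map_smul, ← map_add] at hc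
  have h := (map_eq_zero_iff (fundField x) hx).1 hc
  have h0 := congrFun (congrArg Prod.fst h) 0
  have h1 := congrFun (congrArg Prod.fst h) 1
  have h2 := congrArg Prod.snd h
  simp at h0 h1 h2
  intro i
  fin_cases i
  exacts [h0, h1, h2.resolve_right hw]

omit hmm hinv [PreconnectedSpace M] in
theorem _root_.linearIndependent_genU (hx : Function.Injective (fundField x)) :
    LinearIndependent ℝ ![genU 0 x, genU 1 x] := by
  have h : (Pi.single 0 1 : Fin 3 → ℝ) ≠ 0 := by
    intro h
    simpa using congrFun h 0
  have := (linearIndependent_genU_fundField hs hx h).comp ![0, 1] (by decide)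
  convert this using 1
  ext1 i; fin_cases i <;> rfl

include hx

omit hinv [PreconnectedSpace M] in
theorem g_grad_ν_pos : 0 < G.g.inner x (G.grad ν x) (G.grad ν x) := by
  rw [g_cross_self (hmm.g_grad_ν x)]
  exact G.gram_two_pos (linearIndependent_genU hs hx)

theorem g_grad_muDir_pos {w : Fin 3 → ℝ} (hw : w ≠ 0) :
    0 < G.g.inner x (G.grad (muDir μ w) x) (G.grad (muDir μ w) x) :=
  g_χ_pos (linearIndependent_genU_fundField hs hx hw) (hmm.φ_fundField hs hinv x _)
    (hmm.g_grad_muDir hs w x)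

omit hs hinv hx [PreconnectedSpace M] in
theorem ψ₂_grad_ν (x : M) (w : TangentSpace (𝓡 7) x) :
    G.ψ₂ x (genU 0 x) (genU 1 x) w (G.grad ν x) = 0 := ψ_cross (hmm.g_grad_ν x) w

/-- `μ` does not vanish at the points with a five-dimensional orbit. -/
theorem μ_ne_zero : μ x ≠ 0 := by
  intro h0
  have hN := hmm.g_grad_ν_pos hs hx
  -- `W` is spanned by the orbit and `∇ν`. These are independent, because `dν` vanishes on the orbit
  -- but not on `∇ν`; so `W` is a hyperplane.
  let W : Submodule ℝ (TangentSpace (𝓡 7) x) :=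
    LinearMap.range (LinearMap.coprod (fundField x : LieT2SU2 →ₗ[ℝ] TangentSpace (𝓡 7) x)
      (LinearMap.toSpanSingleton ℝ (TangentSpace (𝓡 7) x) (G.grad ν x)))
  have hinj : Function.Injective (LinearMap.coprod
      (fundField x : LieT2SU2 →ₗ[ℝ] TangentSpace (𝓡 7) x)
      (LinearMap.toSpanSingleton ℝ (TangentSpace (𝓡 7) x) (G.grad ν x))) := by
    rw [← LinearMap.ker_eq_bot, LinearMap.ker_eq_bot']
    rintro ⟨ξ, t⟩ h
    have h : fundField x ξ + t • G.grad ν x = 0 := h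
    have h1 := congrArg (G.g.inner x (G.grad ν x)) h
    rw [map_add, map_smul, map_zero, hmm.g_grad_ν, hmm.φ_fundField hs hinv, zero_add,
      smul_eq_mul] at h1
    have ht : t = 0 := (mul_eq_zero.1 h1).resolve_right hN.ne'
    rw [ht, zero_smul, add_zero] at h
    rw [ht, (map_eq_zero_iff (fundField x) hx).1 h]
    rfl
  have hW : Module.finrank ℝ W = 6 := by
    rw [LinearMap.finrank_range_of_inj hinj]
    simp
  have : FiniteDimensional ℝ (TangentSpace (𝓡 7) x) := inferInstanceAs (FiniteDimensional ℝ E7)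
  have hT : Module.finrank ℝ (TangentSpace (𝓡 7) x) = 7 :=
    (finrank_euclideanSpace_fin : Module.finrank ℝ E7 = 7)
  let V : (Fin 3 → ℝ) →ₗ[ℝ] Module.Dual ℝ (TangentSpace (𝓡 7) x) :=
    G.ψ₂ x (genU 0 x) (genU 1 x) ∘ₗ (fundField x : LieT2SU2 →ₗ[ℝ] TangentSpace (𝓡 7) x) ∘ₗ
      LinearMap.inr ℝ _ _
  -- The functional `∗φ(U₁, U₂, V_w, ·)` vanishes on `U₁, U₂` by antisymmetry, on the `SU(2)`
  -- directions because its values there are components of `μ(x) = 0`, and on `∇ν = U₁ × U₂` by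
  -- `ψ_cross`. Some such functional with `w ≠ 0` is then zero, although it is dual to `∇⟨μ, w⟩ ≠
  -- 0`.
  have hV : ∀ w, ∀ z ∈ W, V w z = 0 := by
    intro w
    rintro _ ⟨⟨⟨a, u⟩, t⟩, rfl⟩
    show G.ψ₂ x (genU 0 x) (genU 1 x) (fundField x (0, w)) (fundField x (a, u) + t • G.grad ν x) = 0
    have ha : ((a, u) : LieT2SU2) = a 0 • (Pi.single 0 1, 0) + a 1 • (Pi.single 1 1, 0) + (0, u) := by
      ext i
      · fin_cases i <;> simp
      · simp
    rw [ha, map_add, map_smul, hmm.ψ₂_grad_ν]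
    simp only [map_add, map_smul, ← genU_eq hs, ψ₂_left, ψ₂_right,
      hmm.ψ₂_fundField hs, h0]
    simp [dotProduct]
  obtain ⟨w, hw0, hVw⟩ := exists_ne_zero_map_eq_zero_of_hyperplane W (by rw [hT, hW]) V hV
  have h1 := hmm.g_grad_muDir_pos hs hinv hx hw0
  rw [hmm.g_grad_muDir hs] at h1
  have h2 := LinearMap.congr_fun hVw (G.grad (muDir μ w) x)
  exact h1.ne' h2

/-- At `x` the gradient is `2 ∇⟨μ, w⟩` for the constant `w = μ(x)`, which is nonzero by `μ_ne_zero`.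
-/
theorem g_grad_normSq_pos : 0 < G.g.inner x (G.grad (fun y => ‖μ y‖ ^ 2) x)
    (G.grad (fun y => ‖μ y‖ ^ 2) x) := by
  have hw : (fun k => μ x k) ≠ 0 := by
    intro h
    apply hmm.μ_ne_zero hs hinv hx
    ext k
    exact congrFun h k
  have h := hmm.g_grad_muDir_pos hs hinv hx hw
  have h1 : G.grad (fun y => ‖μ y‖ ^ 2) x = (2 : ℝ) • G.grad (muDir μ fun k => μ x k) x := by
    apply G.ext_g
    intro z
    rw [g_grad, hmm.differential_normSq hs, map_smul]
    show _ = 2 * G.g.inner x (G.grad (muDir μ fun k => μ x k) x) z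
    rw [hmm.g_grad_muDir hs]
    rfl
  apply G.g_self_pos
  rw [h1]
  intro h2
  rw [(smul_eq_zero.1 h2).resolve_left two_ne_zero] at h
  simp at h

omit hinv hx [PreconnectedSpace M] in
theorem g_grad_ν_grad_normSq (x : M) :
    G.g.inner x (G.grad ν x) (G.grad (fun y => ‖μ y‖ ^ 2) x) = 0 := by
  rw [g_symm, g_grad, hmm.differential_normSq hs, hmm.ψ₂_grad_ν, mul_zero]

omit hx [PreconnectedSpace M] in
theorem differential_normSq_fundField (x : M) (ξ : LieT2SU2) :
    differential (fun y => ‖μ y‖ ^ 2) x (fundField x ξ) = 0 :=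
  differential_fundField hs hmm.smooth_normSq fun t => by rw [hmm.norm_μ_smul hs hinv]

/-- The tangent space of a five-dimensional orbit is the common kernel of `dν` and `d|μ|²`. -/
theorem mem_range_fundField {v : TangentSpace (𝓡 7) x}
    (h1 : differential ν x v = 0)
    (h2 : differential (fun y => ‖μ y‖ ^ 2) x v = 0) :
    ∃ ξ, fundField x ξ = v := by
  have hN := hmm.g_grad_ν_pos hs hx
  have hX := hmm.g_grad_normSq_pos hs hinv hx
  have hNX := hmm.g_grad_ν_grad_normSq hs x
  have hXN := hNX
  rw [g_symm] at hXN
  rw [g_grad] at hN hX hNX hXN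
  let L : TangentSpace (𝓡 7) x →ₗ[ℝ] ℝ × ℝ :=
    LinearMap.prod (differential ν x : TangentSpace (𝓡 7) x →ₗ[ℝ] ℝ)
      (differential (fun y => ‖μ y‖ ^ 2) x : TangentSpace (𝓡 7) x →ₗ[ℝ] ℝ)
  have hL : ∀ z, L z = (differential ν x z,
    differential (fun y => ‖μ y‖ ^ 2) x z) := fun z => rfl
  have hsurj : LinearMap.range L = ⊤ := by
    rw [LinearMap.range_eq_top]
    rintro ⟨s, t⟩
    refine ⟨(s / differential ν x (G.grad ν x)) • G.grad ν x +
      (t / differential (fun y => ‖μ y‖ ^ 2) x (G.grad (fun y => ‖μ y‖ ^ 2) x)) •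
        G.grad (fun y => ‖μ y‖ ^ 2) x, ?_⟩
    rw [map_add, map_smul, map_smul, hL, hL, hNX, hXN]
    ext
    · simp [div_mul_cancel₀ _ hN.ne']
    · simp [div_mul_cancel₀ _ hX.ne']
  have : FiniteDimensional ℝ (TangentSpace (𝓡 7) x) := inferInstanceAs (FiniteDimensional ℝ E7)
  have hT : Module.finrank ℝ (TangentSpace (𝓡 7) x) = 7 :=
    (finrank_euclideanSpace_fin : Module.finrank ℝ E7 = 7)
  have hker : Module.finrank ℝ (LinearMap.ker L) = 5 := by
    have := LinearMap.finrank_range_add_finrank_ker L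
    rw [hsurj, hT, finrank_top] at this
    simp at this
    omega
  -- The orbit directions lie in the kernel, and both spaces have dimension five.
  have heq : LinearMap.range (fundField x : LieT2SU2 →ₗ[ℝ] TangentSpace (𝓡 7) x) =
      LinearMap.ker L := by
    apply Submodule.eq_of_le_of_finrank_eq
    · rintro _ ⟨ξ, rfl⟩
      rw [LinearMap.mem_ker, hL]
      have e1 := hmm.differential_ν x (fundField x ξ)
      rw [hmm.φ_fundField hs hinv] at e1
      have e2 := hmm.differential_normSq_fundField hs hinv x ξ
      exact Prod.ext e1 e2
    · rw [hker, LinearMap.finrank_range_of_inj hx]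
      simp
  have hv : v ∈ LinearMap.ker L := by
    rw [LinearMap.mem_ker, hL]
    exact Prod.ext h1 h2
  rw [← heq] at hv
  exact hv

end Regular

end IsMultiMomentPair

/-! ### Parametrisations -/

section Parametrization

variable {M : Type*} [TopologicalSpace M] [ChartedSpace E7 M] [IsManifold (𝓡 7) ∞ M]
  {F : Type} [NormedAddCommGroup F] [NormedSpace ℝ F] [FiniteDimensional ℝ F]

/-- A smooth map from a `7`-dimensional vector space to `M` with injective differential is a local
diffeomorphism. -/
theorem exists_openPartialHomeomorph_of_parametrization (hF : Module.finrank ℝ F = 7) {Θ : F → M}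
    {O : Set F} (hO : IsOpen O) (hΘ : ContMDiffOn 𝓘(ℝ, F) (𝓡 7) ∞ Θ O) {p : F} (hp : p ∈ O)
    (hinj : Function.Injective (mfderiv 𝓘(ℝ, F) (𝓡 7) Θ p)) :
    ∃ h : OpenPartialHomeomorph F M, p ∈ h.source ∧ h.source ⊆ O ∧ (∀ q ∈ h.source, h q = Θ q) ∧
      ContMDiffOn 𝓘(ℝ, F) (𝓡 7) ∞ h h.source ∧ ContMDiffOn (𝓡 7) 𝓘(ℝ, F) ∞ h.symm h.target := by
  have : CompleteSpace F := FiniteDimensional.complete ℝ F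
  set c := chartAt E7 (Θ p) with hc
  have hcs := mem_chart_source E7 (Θ p)
  set U := O ∩ Θ ⁻¹' c.source with hU
  have hUo : IsOpen U := hΘ.continuousOn.isOpen_inter_preimage hO c.open_source
  have hpU : p ∈ U := ⟨hp, hcs⟩
  have hcs1 : ContMDiffOn (𝓡 7) 𝓘(ℝ, E7) ∞ c c.source := contMDiffOn_chart (x := Θ p)
  have hcs2 : ContMDiffOn 𝓘(ℝ, E7) (𝓡 7) ∞ c.symm c.target := contMDiffOn_chart_symm (x := Θ p)
  have hsm : ContDiffOn ℝ ∞ (fun q => c (Θ q)) U := by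
    rw [← contMDiffOn_iff_contDiffOn]
    exact hcs1.comp (hΘ.mono Set.inter_subset_left) (fun q hq => hq.2)
  have hd := (mdifferentiable_chart (I := 𝓡 7) (Θ p)).mfderiv_injective hcs
  have hΘd : MDifferentiableAt 𝓘(ℝ, F) (𝓡 7) Θ p :=
    (hΘ.contMDiffAt (hO.mem_nhds hp)).mdifferentiableAt (by simp)
  have h1 := (mdifferentiable_chart (I := 𝓡 7) (Θ p)).mdifferentiableAt hcs
  have h2 := hasMFDerivAt_iff_hasFDerivAt.1 (h1.hasMFDerivAt.comp p hΘd.hasMFDerivAt)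
  let L : F →L[ℝ] E7 := (mfderiv (𝓡 7) 𝓘(ℝ, E7) c (Θ p) : E7 →L[ℝ] E7).comp
    (mfderiv 𝓘(ℝ, F) (𝓡 7) Θ p : F →L[ℝ] E7)
  have hL : Function.Injective L := hd.comp hinj
  have hdim : Module.finrank ℝ F = Module.finrank ℝ E7 := by
    rw [hF]; exact finrank_euclideanSpace_fin.symm
  let e : F ≃L[ℝ] E7 :=
    (LinearEquiv.ofInjectiveOfFinrankEq (L : F →ₗ[ℝ] E7) hL hdim).toContinuousLinearEquiv
  have he : (e : F →L[ℝ] E7) = L := by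
    ext v; rfl
  have h2' : HasFDerivAt (fun q => c (Θ q)) L p := h2
  rw [← he] at h2'
  obtain ⟨h, hph, hhU, hh, hs1, hs2⟩ := exists_openPartialHomeomorph_of_contDiffOn hUo hsm hpU e h2'
  have hsrc : (h.trans c.symm).source = h.source := by
    rw [OpenPartialHomeomorph.trans_source]
    refine Set.inter_eq_left.2 fun q hq => ?_
    rw [Set.mem_preimage, hh]
    exact c.map_source (hhU hq).2
  refine ⟨h.trans c.symm, ?_, ?_, ?_, ?_, ?_⟩
  · rw [hsrc]; exact hph
  · rw [hsrc]; exact hhU.trans Set.inter_subset_left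
  · intro q hq
    rw [hsrc] at hq
    rw [OpenPartialHomeomorph.trans_apply, hh]
    exact c.left_inv (hhU hq).2
  · exact hcs2.comp (hs1.contMDiffOn.mono (hsrc.le)) (fun q hq => by
      rw [hsrc] at hq
      have := c.map_source (hhU hq).2
      rw [← hh] at this
      exact this)
  · have ht : (h.trans c.symm).target ⊆ c.source ∩ c ⁻¹' h.target := by
      rw [OpenPartialHomeomorph.trans_target]
      exact fun q hq => hq
    exact hs2.contMDiffOn.comp (hcs1.mono fun q hq => (ht hq).1) (fun q hq => (ht hq).2)

omit [IsManifold (𝓡 7) ∞ M] [FiniteDimensional ℝ F] in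
/-- The velocities of the images of the straight lines. -/
theorem hasVelocity_parametrization {Θ : F → M} {p : F}
    (hΘ : MDifferentiableAt 𝓘(ℝ, F) (𝓡 7) Θ p) (v : F) :
    HasVelocity (fun t : ℝ => Θ (p + t • v)) 0 (mfderiv 𝓘(ℝ, F) (𝓡 7) Θ p v : E7) := by
  have h1 : HasDerivAt (fun t : ℝ => p + t • v) v 0 := by
    simpa using ((hasDerivAt_id (0 : ℝ)).smul_const v).const_add p
  have h2 : HasMFDerivAt 𝓘(ℝ, F) (𝓡 7) Θ (p + (0 : ℝ) • v)
      (mfderiv 𝓘(ℝ, F) (𝓡 7) Θ p : F →L[ℝ] E7) := by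
    rw [zero_smul, add_zero]; exact hΘ.hasMFDerivAt
  exact HasVelocity.of_model h1 h2

/-- Through each point passes a curve with a given velocity; it can be taken smooth and depending
smoothly on the velocity. -/
theorem exists_exponential (x : M) : ∃ (s : E7 → M) (O : Set E7), IsOpen O ∧ 0 ∈ O ∧
    ContMDiffOn 𝓘(ℝ, E7) (𝓡 7) ∞ s O ∧ s 0 = x ∧
    ∀ v : TangentSpace (𝓡 7) x, HasVelocity (fun t : ℝ => s (t • (v : E7))) 0 (v : E7) := by
  set c := chartAt E7 x with hc
  have hcs := mem_chart_source E7 x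
  have hct : c x ∈ c.target := c.map_source hcs
  have hd := mdifferentiable_chart (I := 𝓡 7) x
  let L : E7 →L[ℝ] E7 := mfderiv (𝓡 7) 𝓘(ℝ, E7) c x
  have hcs2 : ContMDiffOn 𝓘(ℝ, E7) (𝓡 7) ∞ c.symm c.target := contMDiffOn_chart_symm (x := x)
  refine ⟨fun v => c.symm (c x + L v), (fun v => c x + L v) ⁻¹' c.target, ?_, ?_, ?_, ?_, ?_⟩
  · exact c.open_target.preimage (by fun_prop)
  · rw [Set.mem_preimage, map_zero, add_zero]; exact hct
  · refine hcs2.comp (ContMDiff.contMDiffOn ?_) (fun v hv => hv)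
    exact ContDiff.contMDiff (by fun_prop)
  · show c.symm (c x + L 0) = x
    rw [map_zero, add_zero]; exact c.left_inv hcs
  · intro v
    have h := hasVelocity_parametrization (hd.mdifferentiableAt_symm hct) (L v)
    have h1 : (mfderiv 𝓘(ℝ, E7) (𝓡 7) c.symm (c x) (L v) : E7) = v :=
      DFunLike.congr_fun (hd.symm_comp_deriv hcs) v
    rw [h1] at h
    have e : (fun t : ℝ => c.symm (c x + L (t • (v : E7)))) =
        fun t : ℝ => c.symm (c x + t • L (v : E7)) := funext fun t =>
      congrArg (fun z : E7 => c.symm (c x + z)) (L.map_smul t v)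
    show HasVelocity (fun t : ℝ => c.symm (c x + L (t • (v : E7)))) 0 (v : E7)
    rw [e]
    exact h

end Parametrization

/-! ### Slice coordinates for the action -/

section Slice

variable {M : Type*} [TopologicalSpace M] [ChartedSpace E7 M] [IsManifold (𝓡 7) ∞ M]
  [MulAction T2SU2 M] (hs : IsSmoothAction M)

include hs in
/-- Coordinates given by the action and a complementary parametrised slice. -/
theorem exists_slice_coordinates {F : Type} [NormedAddCommGroup F] [NormedSpace ℝ F]
    [FiniteDimensional ℝ F] {𝔥 : Submodule ℝ LieT2SU2}
    (hdim : Module.finrank ℝ 𝔥 + Module.finrank ℝ F = 7) {s : F → M} {O : Set F} (hO : IsOpen O)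
    (h0 : 0 ∈ O) (hsO : ContMDiffOn 𝓘(ℝ, F) (𝓡 7) ∞ s O) (L : F →ₗ[ℝ] TangentSpace (𝓡 7) (s 0))
    (hL : ∀ v, HasVelocity (fun t : ℝ => s (t • v)) 0 (L v : E7))
    (hinj : ∀ ξ ∈ 𝔥, ∀ v, fundField (s 0) ξ + L v = 0 → ξ = 0 ∧ v = 0) :
    ∃ h : OpenPartialHomeomorph (𝔥 × F) M, 0 ∈ h.source ∧
      (∀ p ∈ h.source, p.2 ∈ O ∧ h p = lieExp p.1 • s p.2) ∧
      ContMDiffOn 𝓘(ℝ, 𝔥 × F) (𝓡 7) ∞ h h.source ∧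
      ContMDiffOn (𝓡 7) 𝓘(ℝ, 𝔥 × F) ∞ h.symm h.target := by
  let Θ : 𝔥 × F → M := fun p => lieExp p.1 • s p.2
  have hOo : IsOpen ((Prod.snd : 𝔥 × F → F) ⁻¹' O) := hO.preimage continuous_snd
  have hΘ : ContMDiffOn 𝓘(ℝ, 𝔥 × F) (𝓡 7) ∞ Θ ((Prod.snd : 𝔥 × F → F) ⁻¹' O) := by
    have e1 : ContMDiffOn 𝓘(ℝ, 𝔥 × F) 𝓘(ℝ, LieT2SU2) ∞ (fun p : 𝔥 × F => (p.1 : LieT2SU2))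
        ((Prod.snd : 𝔥 × F → F) ⁻¹' O) := by
      apply ContMDiff.contMDiffOn
      apply ContDiff.contMDiff
      exact (𝔥.subtypeL.comp (ContinuousLinearMap.fst ℝ 𝔥 F)).contDiff
    have e2 : ContMDiffOn 𝓘(ℝ, 𝔥 × F) (𝓡 7) ∞ (fun p : 𝔥 × F => s p.2)
        ((Prod.snd : 𝔥 × F → F) ⁻¹' O) := by
      refine hsO.comp (ContMDiff.contMDiffOn ?_) (fun p hp => hp)
      exact ContDiff.contMDiff contDiff_snd
    exact hs.contMDiff_lieExp_smul.comp_contMDiffOn (e1.prodMk e2)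
  have h0O : (0 : 𝔥 × F) ∈ (Prod.snd : 𝔥 × F → F) ⁻¹' O := h0
  have hΘd : MDifferentiableAt 𝓘(ℝ, 𝔥 × F) (𝓡 7) Θ 0 :=
    (hΘ.contMDiffAt (hOo.mem_nhds h0O)).mdifferentiableAt (by simp)
  have hΘ0 : Θ 0 = s 0 := by
    show lieExp 0 • s 0 = s 0
    rw [lieExp_zero, one_smul]
  have hv1 : ∀ ξ : 𝔥, (mfderiv 𝓘(ℝ, 𝔥 × F) (𝓡 7) Θ 0 (ξ, (0 : F)) : E7) = fundField (s 0) ξ := by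
    intro ξ
    have e1 := hasVelocity_parametrization hΘd (ξ, (0 : F))
    have e2 := hasVelocity_lieExp_smul_zero hs (s 0) ξ
    have e3 : (fun t : ℝ => Θ (0 + t • (ξ, (0 : F)))) = fun t : ℝ => lieExp (t • (ξ : LieT2SU2)) • s 0 := by
      ext t
      simp [Θ]
    rw [e3] at e1
    exact e1.unique e2
  have hv2 : ∀ v : F, (mfderiv 𝓘(ℝ, 𝔥 × F) (𝓡 7) Θ 0 ((0 : 𝔥), v) : E7) = L v := by
    intro v
    have e1 := hasVelocity_parametrization hΘd ((0 : 𝔥), v)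
    have e3 : (fun t : ℝ => Θ (0 + t • ((0 : 𝔥), v))) = fun t : ℝ => s (t • v) := by
      ext t
      simp [Θ, lieExp_zero]
    rw [e3] at e1
    exact e1.unique (hL v)
  have hker : Function.Injective (mfderiv 𝓘(ℝ, 𝔥 × F) (𝓡 7) Θ 0) := by
    let D : 𝔥 × F →L[ℝ] E7 := mfderiv 𝓘(ℝ, 𝔥 × F) (𝓡 7) Θ 0
    have hD : ∀ p : 𝔥 × F, D p = 0 → p = 0 := by
      rintro ⟨ξ, v⟩ hp
      have e1 : D (ξ, v) = D (ξ, 0) + D (0, v) := by rw [← map_add]; simp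
      have e2 : D (ξ, v) = (fundField (s 0) ξ + L v : TangentSpace (𝓡 7) (s 0)) := by
        rw [e1]
        exact congrArg₂ (fun a b : E7 => a + b) (hv1 ξ) (hv2 v)
      obtain ⟨e3, e4⟩ := hinj ξ ξ.2 v (e2.symm.trans hp)
      rw [Prod.mk_eq_zero]
      exact ⟨Subtype.ext e3, e4⟩
    exact (injective_iff_map_eq_zero D).2 hD
  obtain ⟨h, h1, h2, h3, h4, h5⟩ := exists_openPartialHomeomorph_of_parametrization
    (by rw [Module.finrank_prod]; exact hdim) hOo hΘ h0O hker
  exact ⟨h, h1, fun p hp => ⟨h2 hp, h3 p hp⟩, h4, h5⟩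

end Slice

local instance instGroupT2SU2 : Group T2SU2 := inferInstance

/-! ### One-parameter groups and the infinitesimal action -/

section OneParameter

variable {M : Type*} [TopologicalSpace M] [ChartedSpace E7 M] [MulAction T2SU2 M]
  (hs : IsSmoothAction M)
include hs

/-- The velocity at time `t` is the image under `exp(tξ)` of the velocity at time `0`, so it
vanishes throughout and the curve is constant. -/
theorem lieExp_smul_eq_self [T2Space M] [IsManifold (𝓡 7) ∞ M] {x : M} {ξ : LieT2SU2}
    (h : fundField x ξ = 0) (t : ℝ) : lieExp (t • ξ) • x = x := by
  have h1 : ∀ t : ℝ, HasVelocity (fun t : ℝ => lieExp (t • ξ) • x) t (0 : E7) := by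
    intro t
    have e1 : HasMFDerivAt (𝓡 7) (𝓡 7) (fun y : M => lieExp (t • ξ) • y) (lieExp ((0 : ℝ) • ξ) • x)
        (smulDeriv (lieExp (t • ξ)) x : E7 →L[ℝ] E7) := by
      rw [zero_smul, lieExp_zero, one_smul]; exact hasMFDerivAt_smul hs _ x
    have e2 := (hasVelocity_lieExp_smul_zero hs x ξ).map e1
    have e3 : (smulDeriv (lieExp (t • ξ)) x : E7 →L[ℝ] E7) (fundField x ξ) = 0 := by
      rw [h]; exact map_zero _
    have e2' : HasVelocity (fun s : ℝ => lieExp (t • ξ) • lieExp (s • ξ) • x) 0 (0 : E7) :=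
      (congrArg (fun v : E7 => HasVelocity
        (fun s : ℝ => lieExp (t • ξ) • lieExp (s • ξ) • x) 0 v) e3).mp e2
    have e4 := e2'.comp (σ := fun r : ℝ => r - t) (sub_self t) ((hasDerivAt_id t).sub_const t)
    have e5 : (fun r : ℝ => lieExp (t • ξ) • lieExp ((r - t) • ξ) • x) =
        fun t : ℝ => lieExp (t • ξ) • x := by
      ext r
      rw [smul_smul, ← lieExp_add_smul, add_sub_cancel]
    exact e5 ▸ e4
  have hM : IsManifold (𝓡 7) 1 M := IsManifold.of_le (n := ∞) (by simp)
  have h2 := eq_of_mfderiv_eq_zero (f := fun t : ℝ => lieExp (t • ξ) • x)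
    (fun t => (h1 t).mdifferentiableAt) (fun t => by
      rw [(h1 t).mfderiv]
      exact ContinuousLinearMap.ext fun r => smul_zero (A := E7) r) t 0
  simpa [lieExp_zero] using h2

theorem fundField_eq_zero {x : M} {ξ : LieT2SU2}
    (h : ∀ᶠ t : ℝ in 𝓝 0, lieExp (t • ξ) • x = x) : fundField x ξ = 0 := by
  have h1 := hasVelocity_lieExp_smul_zero hs x ξ
  have h2 : HasVelocity (fun _ : ℝ => x) 0 (fundField x ξ : E7) :=
    h1.congr_of_eventuallyEq (h.mono fun t ht => ht.symm)
  have h3 : HasVelocity (fun _ : ℝ => x) 0 (0 : E7) :=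
    hasVelocity_of_hasMFDerivAt (hasMFDerivAt_const _ _) rfl
  exact h2.unique h3

theorem injective_fundField_smul {x : M} (hx : Function.Injective (fundField x)) (g : T2SU2) :
    Function.Injective (fundField (g • x)) := by
  refine (injective_iff_map_eq_zero _).2 fun ξ hξ => ?_
  have h1 : fundField x (adT2SU2 g⁻¹ ξ) = 0 := by
    have h2 := smulDeriv_fundField hs g⁻¹ (g • x) ξ
    rw [hξ, map_zero] at h2
    have h3 : ∀ y : M, y = x → ∀ η, (fundField y η : E7) = fundField x η := by
      rintro _ rfl η; rfl
    exact (h3 _ (inv_smul_smul g x) _).symm.trans h2.symm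
  have h2 := (map_eq_zero_iff _ hx).1 h1
  exact (map_eq_zero_iff _ (adT2SU2_injective g⁻¹)).1 h2

theorem injective_fundField_of_finrank {x : M} (hx : Module.finrank ℝ (orbitTangent x) = 5) :
    Function.Injective (fundField x) := by
  have h1 : orbitTangent x ≤ LinearMap.range (fundField x : LieT2SU2 →ₗ[ℝ] TangentSpace (𝓡 7) x) := by
    rw [orbitTangent, Submodule.span_le]
    rintro _ (⟨l, rfl⟩ | ⟨i, rfl⟩)
    · exact ⟨_, (genU_eq hs l x).symm⟩
    · exact ⟨_, (genV_eq hs i x).symm⟩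
  have h3 := Submodule.finrank_mono h1
  have h2 := LinearMap.finrank_range_add_finrank_ker
    (fundField x : LieT2SU2 →ₗ[ℝ] TangentSpace (𝓡 7) x)
  have h4 : Module.finrank ℝ LieT2SU2 = 5 := by simp
  have h5 : Module.finrank ℝ (LinearMap.ker
      (fundField x : LieT2SU2 →ₗ[ℝ] TangentSpace (𝓡 7) x)) = 0 := by
    rw [hx] at h3
    rw [h4] at h2
    omega
  exact LinearMap.ker_eq_bot.1 (Submodule.finrank_eq_zero.1 h5)

theorem range_fundField (x : M) :
    LinearMap.range (fundField x : LieT2SU2 →ₗ[ℝ] TangentSpace (𝓡 7) x) = orbitTangent x := by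
  apply le_antisymm
  · rintro _ ⟨⟨a, u⟩, rfl⟩
    have ha : ((a, u) : LieT2SU2) = (a 0 • (Pi.single 0 1, 0) + a 1 • (Pi.single 1 1, 0)) +
        (u 0 • (0, Pi.single 0 1) + u 1 • (0, Pi.single 1 1) + u 2 • (0, Pi.single 2 1)) := by
      ext i
      · fin_cases i <;> simp
      · fin_cases i <;> simp
    rw [ContinuousLinearMap.coe_coe, ha]
    simp only [map_add, map_smul, ← genU_eq hs, ← genV_eq hs]
    have hU : ∀ l, genU l x ∈ orbitTangent x := fun l =>
      Submodule.subset_span (Or.inl ⟨l, rfl⟩)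
    have hV : ∀ l, genV l x ∈ orbitTangent x := fun l =>
      Submodule.subset_span (Or.inr ⟨l, rfl⟩)
    exact add_mem (add_mem (Submodule.smul_mem _ (a 0) (hU 0)) (Submodule.smul_mem _ (a 1) (hU 1)))
      (add_mem (add_mem (Submodule.smul_mem _ (u 0) (hV 0)) (Submodule.smul_mem _ (u 1) (hV 1)))
        (Submodule.smul_mem _ (u 2) (hV 2)))
  · rw [orbitTangent, Submodule.span_le]
    rintro _ (⟨l, rfl⟩ | ⟨i, rfl⟩)
    · exact ⟨_, (genU_eq hs l x).symm⟩
    · exact ⟨_, (genV_eq hs i x).symm⟩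

end OneParameter

theorem commute_of_eq_coe {γ : T2SU2} {ε : ℝ} (h : (γ.2.2 : ℍ[ℝ]) = (ε : ℍ[ℝ])) (g : T2SU2) :
    γ * g = g * γ := by
  ext1
  · exact mul_comm _ _
  · ext1
    · exact mul_comm _ _
    · apply Subtype.ext
      show (γ.2.2 : ℍ[ℝ]) * g.2.2 = g.2.2 * γ.2.2
      rw [h, Quaternion.coe_commutes]

/-! ### Stabilisers and the principal set -/

namespace IsMultiMomentPair

variable {M : Type*} [TopologicalSpace M] [ChartedSpace E7 M] [IsManifold (𝓡 7) ∞ M]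
  [PreconnectedSpace M]
  [MulAction T2SU2 M] {G : G2Manifold M} {ν : M → ℝ} {μ : M → EuclideanSpace ℝ (Fin 3)}

open G2Manifold

variable (hmm : IsMultiMomentPair G ν μ) (hs : IsSmoothAction M) (hinv : IsInvariantForm G.φ)
include hmm hs hinv

omit [PreconnectedSpace M] in
/-- The stabiliser of a point with a five-dimensional orbit is contained in `T² × {±1}`. -/
theorem exists_eq_coe_of_smul_eq [PreconnectedSpace M] {x : M}
    (hx : Function.Injective (fundField x)) {γ : T2SU2}
    (hγ : γ • x = x) : ∃ ε : ℝ, (ε = 1 ∨ ε = -1) ∧ (γ.2.2 : ℍ[ℝ]) = (ε : ℍ[ℝ]) := by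
  have hU : ∀ l, (smulDeriv γ x (genU l x) : E7) = genU l x := by
    intro l
    have : ∀ y : M, y = x → (genU l y : E7) = genU l x := by rintro _ rfl; rfl
    rw [smulDeriv_genU hs]
    exact this _ hγ
  have hF : ∀ ξ, (smulDeriv γ x (fundField x ξ) : E7) = fundField x (adT2SU2 γ ξ) := by
    intro ξ
    have : ∀ y : M, y = x → (fundField y (adT2SU2 γ ξ) : E7) = fundField x (adT2SU2 γ ξ) := by
      rintro _ rfl; rfl
    rw [smulDeriv_fundField hs]
    exact this _ hγ
  have hμ : rotSU2 γ.2.2 (fun k => μ x k) = fun k => μ x k := by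
    rw [← hmm.μ_smul hs hinv, hγ]
  have hw : (fun k => μ x k) ≠ 0 := by
    intro h
    apply hmm.μ_ne_zero hs hinv hx
    ext k
    exact congrFun h k
  -- The differential of `γ` fixes `U₁`, `U₂` and also `V_{μ(x)}`, since equivariance gives `Ad γ (μ
  -- x) = μ x`. This isotropic triple forces it to be the identity, whence `Ad γ` is trivial by
  -- local freeness.
  have hall := eq_self_of_fixes hγ (smulDeriv γ x) (φ_smulDeriv hinv γ x)
    (linearIndependent_genU_fundField hs hx hw) (hmm.φ_fundField hs hinv x _) (hU 0) (hU 1) (by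
      rw [hF, adT2SU2_apply, hμ])
  apply mem_center_of_rotSU2_eq
  intro w
  have h1 := (hF (0, w)).symm.trans (hall (fundField x (0, w)))
  have h2 := hx h1
  exact congrArg Prod.snd h2

/-- Slice coordinates at a point with a five-dimensional orbit. -/
theorem exists_gradient_slice {x : M} (hx : Function.Injective (fundField x)) :
    ∃ (s : ℝ × ℝ → M) (O : Set (ℝ × ℝ))
      (h : OpenPartialHomeomorph ((⊤ : Submodule ℝ LieT2SU2) × (ℝ × ℝ)) M),
      IsOpen O ∧ 0 ∈ O ∧ ContMDiffOn 𝓘(ℝ, ℝ × ℝ) (𝓡 7) ∞ s O ∧ s 0 = x ∧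
      (∀ v : ℝ × ℝ, HasVelocity (fun t : ℝ => s (t • v)) 0
        (v.1 • G.grad ν x + v.2 • G.grad (fun y => ‖μ y‖ ^ 2) x : TangentSpace (𝓡 7) x)) ∧
      0 ∈ h.source ∧ (∀ p ∈ h.source, p.2 ∈ O ∧ h p = lieExp p.1 • s p.2) := by
  obtain ⟨e, O, hO, h0, he, hex, hvel⟩ := exists_exponential x
  let L : ℝ × ℝ →L[ℝ] E7 := LinearMap.toContinuousLinearMap (LinearMap.coprod
    (LinearMap.toSpanSingleton ℝ E7 (G.grad ν x))
    (LinearMap.toSpanSingleton ℝ E7 (G.grad (fun y => ‖μ y‖ ^ 2) x)))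
  have hLv : ∀ v : ℝ × ℝ, (L v : TangentSpace (𝓡 7) x) =
    v.1 • G.grad ν x + v.2 • G.grad (fun y => ‖μ y‖ ^ 2) x := fun v => rfl
  have hO' : IsOpen (L ⁻¹' O) := hO.preimage L.continuous
  have h0' : (0 : ℝ × ℝ) ∈ L ⁻¹' O := by rw [Set.mem_preimage, map_zero]; exact h0
  have hsm : ContMDiffOn 𝓘(ℝ, ℝ × ℝ) (𝓡 7) ∞ (fun v => e (L v)) (L ⁻¹' O) :=
    he.comp (L.contDiff.contMDiff.contMDiffOn) (fun v hv => hv)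
  have hs0 : e (L 0) = x := by rw [map_zero, hex]
  have hvel' : ∀ v : ℝ × ℝ, HasVelocity (fun t : ℝ => e (L (t • v))) 0 (L v : E7) := by
    intro v
    have h : HasVelocity (fun t : ℝ => e (t • L v)) 0 (L v : E7) := hvel (L v)
    have h' : (fun t : ℝ => e (L (t • v))) = fun t : ℝ => e (t • L v) :=
      funext fun t => congrArg e (L.map_smul t v)
    exact h' ▸ h
  let L' : ℝ × ℝ →ₗ[ℝ] TangentSpace (𝓡 7) (e (L 0)) := (L : ℝ × ℝ →ₗ[ℝ] E7)
  obtain ⟨h, h1, h2, -, -⟩ := exists_slice_coordinates hs (𝔥 := ⊤) (by simp) (s := fun v => e (L v))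
    hO' h0' hsm L' hvel' (by
      intro ξ _ v hξv
      have hz : fundField x ξ + (v.1 • G.grad ν x + v.2 • G.grad (fun y => ‖μ y‖ ^ 2) x) = 0 := by
        have : ∀ y : M, y = x → (fundField y ξ : E7) = fundField x ξ := by rintro _ rfl; rfl
        have h3 : @HAdd.hAdd E7 E7 E7 _ (fundField (e (L 0)) ξ) (L v) = 0 := hξv
        rw [this _ hs0] at h3
        exact h3
      -- Pairing with the two gradients, which are orthogonal to each other and to the orbit,
      -- isolates the coefficients of `v`.
      have hN := hmm.g_grad_ν_pos hs hx
      have hX := hmm.g_grad_normSq_pos hs hinv hx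
      have hNX := hmm.g_grad_ν_grad_normSq hs x
      have hXN := hNX
      rw [g_symm] at hXN
      have e1 := congrArg (G.g.inner x (G.grad ν x)) hz
      have e2 := congrArg (G.g.inner x (G.grad (fun y => ‖μ y‖ ^ 2) x)) hz
      rw [map_add, map_add, map_smul, map_smul, map_zero, hNX] at e1
      rw [map_add, map_add, map_smul, map_smul, map_zero, hXN] at e2
      have e3 : G.g.inner x (G.grad ν x) (fundField x ξ) = 0 := by
        rw [hmm.g_grad_ν, hmm.φ_fundField hs hinv]
      have e4 : G.g.inner x (G.grad (fun y => ‖μ y‖ ^ 2) x) (fundField x ξ) = 0 := by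
        rw [g_grad, hmm.differential_normSq_fundField hs hinv]
      rw [e3, smul_zero, add_zero, zero_add, smul_eq_mul] at e1
      rw [e4, smul_zero, zero_add, zero_add, smul_eq_mul] at e2
      have e5 := (mul_eq_zero.1 e1).resolve_right hN.ne'
      have e6 := (mul_eq_zero.1 e2).resolve_right hX.ne'
      rw [e5, e6, zero_smul, zero_smul, add_zero, add_zero] at hz
      exact ⟨(map_eq_zero_iff _ hx).1 hz, Prod.ext e5 e6⟩)
  exact ⟨_, _, h, hO', h0', hsm, hs0, hvel', h1, h2⟩

/-- The points near a regular point are regular, and small elements of the torus act freely near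
it. -/
theorem eventually_regular [T2Space M] {x : M} (hx : Function.Injective (fundField x)) :
    (∀ᶠ y in 𝓝 x, Function.Injective (fundField y)) ∧
    ∀ᶠ p : (Fin 2 → ℝ) × M in 𝓝 (0, x), lieExp (p.1, 0) • p.2 = p.2 → p.1 = 0 := by
  obtain ⟨s, O, h, hO, h0O, hsm, hs0, -, h0, hh⟩ := hmm.exists_gradient_slice hs hinv hx
  have hx0 : h 0 = x := by
    rw [(hh 0 h0).2]
    show lieExp 0 • s 0 = x
    rw [lieExp_zero, one_smul, hs0]
  have hxt : x ∈ h.target := hx0 ▸ h.map_source h0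
  have hsx : h.symm x = 0 := by rw [← hx0, h.left_inv h0]
  have hcont := h.symm.continuousAt hxt
  constructor
  · have h1 : ∀ᶠ y in 𝓝 x, y ∈ h.target ∧ ((0, (h.symm y).2) : (⊤ : Submodule ℝ LieT2SU2) × (ℝ × ℝ)) ∈
        h.source := by
      refine Filter.Eventually.and (h.open_target.mem_nhds hxt) ?_
      have hc : ContinuousAt (fun y => ((0, (h.symm y).2) : (⊤ : Submodule ℝ LieT2SU2) × (ℝ × ℝ))) x :=
        continuousAt_const.prodMk hcont.snd
      refine hc.eventually (h.open_source.mem_nhds ?_)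
      show ((0, (h.symm x).2) : (⊤ : Submodule ℝ LieT2SU2) × (ℝ × ℝ)) ∈ h.source
      rw [hsx]; exact h0
    -- `y` is a translate of a slice point `s d` with `(0, d)` in the chart domain, so it suffices
    -- to treat `s d`. If `η` is killed there, `exp(tη)` fixes `s d` for all `t`; for small `t ≠ 0`
    -- injectivity of the chart then gives `η = 0`.
    filter_upwards [h1] with y hy
    have h2 := hh _ hy.2
    have h3 := (hh _ (h.map_target hy.1)).2
    rw [h.right_inv hy.1] at h3
    rw [h3]
    apply injective_fundField_smul hs
    refine (injective_iff_map_eq_zero _).2 fun η hη => ?_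
    have h4 : ∀ᶠ t : ℝ in 𝓝 0, (((⟨t • η, trivial⟩, (h.symm y).2)) :
        (⊤ : Submodule ℝ LieT2SU2) × (ℝ × ℝ)) ∈ h.source := by
      have hc : Continuous (fun t : ℝ => (((⟨t • η, trivial⟩, (h.symm y).2)) :
        (⊤ : Submodule ℝ LieT2SU2) × (ℝ × ℝ))) := by fun_prop
      refine hc.continuousAt.eventually (h.open_source.mem_nhds ?_)
      convert hy.2 using 2
      ext1
      exact zero_smul ℝ η
    obtain ⟨t, ht, ht0⟩ := ((h4.filter_mono nhdsWithin_le_nhds).and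
      (self_mem_nhdsWithin : ∀ᶠ t : ℝ in 𝓝[≠] 0, t ∈ ({0}ᶜ : Set ℝ))).exists
    have h5 : h (⟨t • η, trivial⟩, (h.symm y).2) = h (0, (h.symm y).2) := by
      rw [(hh _ ht).2, h2.2]
      show lieExp (t • η) • s (h.symm y).2 = lieExp 0 • s (h.symm y).2
      rw [lieExp_smul_eq_self hs hη, lieExp_zero, one_smul]
    have h6 := congrArg (fun p => (p.1 : LieT2SU2)) (h.injOn ht hy.2 h5)
    exact (smul_eq_zero.1 h6).resolve_left ht0
  -- The torus is central, so in slice coordinates a small torus element acts by translation; having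
  -- a fixed point, the translation is zero.
  · let F : (Fin 2 → ℝ) × M → (⊤ : Submodule ℝ LieT2SU2) × (ℝ × ℝ) := fun p =>
      (⟨((p.1, 0) : LieT2SU2) + ((h.symm p.2).1 : LieT2SU2), trivial⟩, (h.symm p.2).2)
    have hF : ContinuousAt F (0, x) := by
      have hc : ContinuousAt (fun p : (Fin 2 → ℝ) × M => h.symm p.2) (0, x) :=
        ContinuousAt.comp (f := fun p : (Fin 2 → ℝ) × M => p.2) hcont continuousAt_snd
      refine ContinuousAt.prodMk ?_ hc.snd
      rw [Topology.IsInducing.subtypeVal.continuousAt_iff]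
      have hc1 : ContinuousAt (fun p : (Fin 2 → ℝ) × M => ((p.1, 0) : LieT2SU2)) (0, x) :=
        continuousAt_fst.prodMk continuousAt_const
      exact hc1.add (continuous_subtype_val.continuousAt.comp hc.fst)
    have hF0 : F (0, x) ∈ h.source := by
      have : F (0, x) = 0 := by
        simp only [F, hsx]
        ext1
        · ext1
          show ((0, 0) : LieT2SU2) + 0 = 0
          rw [add_zero]; rfl
        · rfl
      rw [this]; exact h0
    have h1 : ∀ᶠ p : (Fin 2 → ℝ) × M in 𝓝 (0, x), p.2 ∈ h.target :=
      continuousAt_snd.eventually (h.open_target.mem_nhds hxt)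
    filter_upwards [h1, hF.eventually (h.open_source.mem_nhds hF0)] with p hp1 hp2 hp3
    have h2 : h (F p) = h (h.symm p.2) := by
      have h3 := (hh _ (h.map_target hp1)).2
      rw [(hh _ hp2).2, h.right_inv hp1]
      show lieExp (((p.1, 0) : LieT2SU2) + ((h.symm p.2).1 : LieT2SU2)) • s (h.symm p.2).2 = p.2
      have hcomm : Commute (imQuaternion ((p.1, 0) : LieT2SU2).2)
          (imQuaternion ((h.symm p.2).1 : LieT2SU2).2) := by
        have : imQuaternion ((p.1, 0) : LieT2SU2).2 = 0 := map_zero imQuaternionL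
        rw [this]
        exact Commute.zero_left _
      rw [lieExp_add hcomm, ← smul_smul, ← h3, h.right_inv hp1, hp3]
    have h3 := congrArg (fun p => (p.1 : LieT2SU2)) (h.injOn hp2 (h.map_target hp1) h2)
    have h4 : ((p.1, 0) : LieT2SU2) + ((h.symm p.2).1 : LieT2SU2) = (h.symm p.2).1 := h3
    have h5 := add_eq_right.1 h4
    exact congrArg Prod.fst h5

omit hmm hinv [PreconnectedSpace M] in
-- A direction killed at `x` exponentiates into the stabiliser of `x`, which is conjugate into the
-- stabiliser of a point with a five-dimensional orbit, where no direction is killed.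
theorem _root_.injective_fundField_of_mem_principalSet [T2Space M] (hcohom : HasCohomogeneityTwo M)
    {x : M} (hx : x ∈ principalSet M) : Function.Injective (fundField x) := by
  obtain ⟨x₀, hx₀⟩ := hcohom
  have hx₀' := injective_fundField_of_finrank hs hx₀
  refine (injective_iff_map_eq_zero _).2 fun ξ hξ => ?_
  obtain ⟨a, ha⟩ := hx x₀
  have h1 : fundField x₀ (adT2SU2 a ξ) = 0 := by
    apply fundField_eq_zero hs
    refine Filter.Eventually.of_forall fun t => ?_
    have h2 := ha (lieExp (t • ξ)) (lieExp_smul_eq_self hs hξ t)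
    rw [mul_lieExp, mul_inv_cancel_right, map_smul] at h2
    exact h2
  exact (map_eq_zero_iff _ (adT2SU2_injective a)).1 ((map_eq_zero_iff _ hx₀').1 h1)

variable [T2Space M] (hcohom : HasCohomogeneityTwo M)
include hcohom

theorem exists_eq_coe_of_mem_principalSet {x : M} (hx : x ∈ principalSet M) {γ : T2SU2}
    (hγ : γ • x = x) : ∃ ε : ℝ, (ε = 1 ∨ ε = -1) ∧ (γ.2.2 : ℍ[ℝ]) = (ε : ℍ[ℝ]) :=
  hmm.exists_eq_coe_of_smul_eq hs hinv (injective_fundField_of_mem_principalSet hs hcohom hx) hγ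

/-- The stabiliser of a principal point is contained in every stabiliser. -/
theorem smul_eq_of_mem_principalSet {x : M} (hx : x ∈ principalSet M) {γ : T2SU2}
    (hγ : γ • x = x) (y : M) : γ • y = y := by
  obtain ⟨ε, -, hε⟩ := hmm.exists_eq_coe_of_mem_principalSet hs hinv hcohom hx hγ
  obtain ⟨a, ha⟩ := hx y
  have h := ha γ hγ
  rwa [← commute_of_eq_coe hε, mul_inv_cancel_right] at h

/-- The stabiliser of a principal point fixes all of `M`, and this property passes along the orbit
by conjugation. -/
theorem smul_mem_principalSet {x : M} (hx : x ∈ principalSet M) (g : T2SU2) :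
    g • x ∈ principalSet M := by
  intro y
  refine ⟨1, fun h hh => ?_⟩
  have h1 : (g⁻¹ * h * g) • x = x := by
    rw [mul_smul, mul_smul, inv_smul_eq_iff]
    exact hh
  have h2 := hmm.smul_eq_of_mem_principalSet hs hinv hcohom hx h1
  rw [inv_one, one_mul, mul_one]
  have h3 := h2 (g⁻¹ • y)
  rw [mul_smul, mul_smul, smul_inv_smul, smul_left_cancel_iff] at h3
  exact h3

/-- It suffices that stabilisers of points near `x` are contained in that of `x`. They lie in `T² ×
{±1}`, whose torus part is the image of a compact cube, so the claim may be checked near each torus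
element separately. -/
theorem isOpen_principalSet : IsOpen (principalSet M) := by
  have := hs.continuousSMul
  rw [isOpen_iff_eventually]
  intro x hx
  have hxr := injective_fundField_of_mem_principalSet hs hcohom hx
  obtain ⟨h1, h2⟩ := hmm.eventually_regular hs hinv hxr
  have key : ∀ q : SU2, ∀ᶠ y in 𝓝 x, ∀ a ∈ torusCube,
      (lieExp (a, 0) * (1, 1, q) : T2SU2) • y = y → (lieExp (a, 0) * (1, 1, q) : T2SU2) • x = x := by
    intro q
    apply isCompact_torusCube.eventually_forall_of_forall_eventually
    intro a _
    by_cases hax : (lieExp (a, 0) * (1, 1, q) : T2SU2) • x = x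
    -- If the element over `a` fixes `x`, it fixes all of `M`. A nearby element fixing a point near
    -- `x` then differs from it by a small torus element fixing that point, which is trivial by
    -- local freeness.
    · have hc : Filter.Tendsto (fun z : M × (Fin 2 → ℝ) => (z.2 - a, z.1)) (𝓝 (x, a))
          (𝓝 (0, x)) := by
        have : Continuous (fun z : M × (Fin 2 → ℝ) => (z.2 - a, z.1)) := by fun_prop
        have h := this.tendsto (x, a)
        simpa using h
      filter_upwards [hc.eventually h2] with z hz hzz
      have h3 : lieExp (z.2, 0) = lieExp (z.2 - a, 0) * lieExp (a, 0) := by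
        rw [← lieExp_add]
        · simp
        · exact Commute.refl _
      rw [h3, mul_assoc, mul_smul, hmm.smul_eq_of_mem_principalSet hs hinv hcohom hx hax] at hzz
      rw [sub_eq_zero.1 (hz hzz)]
      exact hax
    · have hc : Continuous (fun z : M × (Fin 2 → ℝ) => (lieExp (z.2, 0) * (1, 1, q) : T2SU2) • z.1) := by
        have hl : Continuous (fun z : M × (Fin 2 → ℝ) => lieExp (z.2, 0)) :=
          continuous_lieExp.comp (by fun_prop)
        exact (hl.mul continuous_const).smul continuous_fst
      have hne := (isOpen_ne_fun hc continuous_fst).mem_nhds (x := (x, a)) hax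
      filter_upwards [hne] with z hz hzz
      exact absurd hzz hz
  have hone : ∀ ε : ℝ, (ε = 1 ∨ ε = -1) → ‖((ε : ℝ) : ℍ[ℝ])‖ = 1 := by
    rintro ε (rfl | rfl) <;> rw [Quaternion.norm_coe] <;> simp
  have key2 : ∀ᶠ y in 𝓝 x, ∀ γ : T2SU2, γ • y = y → γ • x = x := by
    filter_upwards [h1, key 1, key ⟨((-1 : ℝ) : ℍ[ℝ]), by
      rw [mem_sphere_zero_iff_norm]; exact hone _ (Or.inr rfl)⟩] with y hy1 hy2 hy3 γ hγ
    obtain ⟨ε, hε, hγε⟩ := hmm.exists_eq_coe_of_smul_eq hs hinv hy1 hγ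
    obtain ⟨a, ha, haγ⟩ := exists_lieExp_torus γ.1 γ.2.1
    have hγeq : γ = lieExp (a, 0) * (1, 1, γ.2.2) := by
      rw [haγ]; simp
    rcases hε with rfl | rfl
    · have hq : γ.2.2 = 1 := Subtype.ext (by rw [hγε]; simp)
      rw [hγeq, hq] at hγ ⊢
      exact hy2 a ha hγ
    · have hq : γ.2.2 = ⟨((-1 : ℝ) : ℍ[ℝ]), by
        rw [mem_sphere_zero_iff_norm]; exact hone _ (Or.inr rfl)⟩ := Subtype.ext hγε
      rw [hγeq, hq] at hγ ⊢
      exact hy3 a ha hγ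
  filter_upwards [key2] with y hy z
  exact ⟨1, fun γ hγ => by
    rw [inv_one, one_mul, mul_one]
    exact hmm.smul_eq_of_mem_principalSet hs hinv hcohom hx (hy γ hγ) z⟩

end IsMultiMomentPair

/-! ### The topology of the quotient -/

section QuotientTopology

variable {M : Type*} [TopologicalSpace M] [ChartedSpace E7 M] [MulAction T2SU2 M]

theorem projB_eq_projB {x y : principalSet M} :
    projB x = projB y ↔ ∃ g : T2SU2, g • y.1 = x.1 := Quotient.eq''

theorem projB_surjective : Function.Surjective (projB : principalSet M → OrbitSurface M) :=
  Quotient.mk_surjective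

theorem continuous_projB : Continuous (projB : principalSet M → OrbitSurface M) :=
  continuous_quotient_mk'

theorem isOpenMap_projB (hs : IsSmoothAction M) (hP : IsOpen (principalSet M)) :
    IsOpenMap (projB : principalSet M → OrbitSurface M) := by
  have := hs.continuousSMul
  intro U hU
  rw [← isQuotientMap_quotient_mk'.isOpen_preimage (s := projB '' U)]
  have h1 : IsOpen (Subtype.val '' U : Set M) := hP.isOpenMap_subtype_val U hU
  have h2 : (Quotient.mk _ : principalSet M → OrbitSurface M) ⁻¹' (projB '' U) =
      ⋃ g : T2SU2, {x : principalSet M | g • x.1 ∈ (Subtype.val '' U : Set M)} := by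
    ext x
    simp only [Set.mem_preimage, Set.mem_image, Set.mem_iUnion, Set.mem_ofPred_eq]
    constructor
    · rintro ⟨y, hy, hyx⟩
      obtain ⟨g, hg⟩ := projB_eq_projB.1 hyx
      exact ⟨g, y, hy, hg.symm⟩
    · rintro ⟨g, y, hy, hyx⟩
      exact ⟨y, hy, projB_eq_projB.2 ⟨g, hyx.symm⟩⟩
  exact h2 ▸ isOpen_iUnion fun g => h1.preimage
    ((continuous_const_smul g).comp continuous_subtype_val)

/-- The relation is the projection of a closed set along the compact group. -/
theorem isClosed_orbitRel [T2Space M] (hs : IsSmoothAction M) :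
    IsClosed {q : M × M | ∃ g : T2SU2, g • q.2 = q.1} := by
  have := hs.continuousSMul
  have h1 : IsClosed {p : T2SU2 × (M × M) | p.1 • p.2.2 = p.2.1} :=
    isClosed_eq (continuous_fst.smul continuous_snd.snd) continuous_snd.fst
  have h2 := isClosedMap_snd_of_compactSpace _ h1
  have h3 : Prod.snd '' {p : T2SU2 × (M × M) | p.1 • p.2.2 = p.2.1} =
      {q : M × M | ∃ g : T2SU2, g • q.2 = q.1} := by
    ext q
    constructor
    · rintro ⟨⟨g, q'⟩, h, rfl⟩; exact ⟨g, h⟩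
    · rintro ⟨g, h⟩; exact ⟨(g, q), h, rfl⟩
  exact h3 ▸ h2

theorem t2Space_orbitSurface [T2Space M] (hs : IsSmoothAction M) (hP : IsOpen (principalSet M)) :
    T2Space (OrbitSurface M) := by
  rw [t2Space_iff_of_isOpenQuotientMap (π := projB)
    ⟨projB_surjective, continuous_projB, isOpenMap_projB hs hP⟩]
  have h : {q : principalSet M × principalSet M | projB q.1 = projB q.2} =
      Prod.map Subtype.val Subtype.val ⁻¹' {q : M × M | ∃ g : T2SU2, g • q.2 = q.1} := by
    ext q; exact projB_eq_projB
  rw [h]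
  exact (isClosed_orbitRel hs).preimage (continuous_subtype_val.prodMap continuous_subtype_val)

end QuotientTopology

/-! ### Surfaces with a local homeomorphism to the plane -/

section LocalHomeomorph

/-- `ℝ²` with the Euclidean norm as a product. -/
def planeEquiv : EuclideanSpace ℝ (Fin 2) ≃L[ℝ] ℝ × ℝ :=
  (EuclideanSpace.equiv (Fin 2) ℝ).trans (ContinuousLinearEquiv.finTwoArrow ℝ ℝ)

variable {B : Type*} [TopologicalSpace B] {f : B → ℝ × ℝ}

/-- The manifold structure for which a local homeomorphism to the plane is a local
diffeomorphism. -/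
@[reducible] def chartedSpaceOfLocalHomeomorph (hf : IsLocalHomeomorph f) :
    ChartedSpace (EuclideanSpace ℝ (Fin 2)) B where
  atlas := {e | ∀ b, planeEquiv (e b) = f b}
  chartAt b := (hf b).choose.trans planeEquiv.symm.toHomeomorph.toOpenPartialHomeomorph
  mem_chart_source b := by
    rw [OpenPartialHomeomorph.trans_source]
    exact ⟨(hf b).choose_spec.1, trivial⟩
  chart_mem_atlas b b' := by
    have h := congrFun (hf b).choose_spec.2 b'
    exact (planeEquiv.apply_symm_apply _).trans h.symm

variable (hf : IsLocalHomeomorph f)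

theorem planeEquiv_chart (b b' : B) :
    letI := chartedSpaceOfLocalHomeomorph hf
    planeEquiv (chartAt (EuclideanSpace ℝ (Fin 2)) b b') = f b' :=
  letI := chartedSpaceOfLocalHomeomorph hf
  chart_mem_atlas (EuclideanSpace ℝ (Fin 2)) b b'

/-- All charts are restrictions of the one map `f`, up to `planeEquiv`, so the transition maps are
identities. -/
theorem isManifold_chartedSpaceOfLocalHomeomorph :
    letI := chartedSpaceOfLocalHomeomorph hf
    IsManifold (𝓡 2) ∞ B := by
  let _ := chartedSpaceOfLocalHomeomorph hf
  apply isManifold_of_contDiffOn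
  intro e e' he he'
  refine contDiffOn_id.congr fun v hv => ?_
  have hv1 : v ∈ e.target := hv.1.1
  show e' (e.symm v) = v
  apply planeEquiv.injective
  rw [he', ← he, e.right_inv hv1]

theorem isLocalDiffeomorph_chartedSpaceOfLocalHomeomorph :
    letI := chartedSpaceOfLocalHomeomorph hf
    IsLocalDiffeomorph (𝓡 2) 𝓘(ℝ, ℝ × ℝ) ∞ f := by
  let _ := chartedSpaceOfLocalHomeomorph hf
  have := isManifold_chartedSpaceOfLocalHomeomorph hf
  intro b
  refine ⟨⟨((chartAt (EuclideanSpace ℝ (Fin 2)) b).trans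
    planeEquiv.toHomeomorph.toOpenPartialHomeomorph).toPartialEquiv, ?_, ?_, ?_, ?_⟩, ?_, ?_⟩
  · exact OpenPartialHomeomorph.open_source _
  · exact OpenPartialHomeomorph.open_target _
  · refine (planeEquiv.contDiff.contMDiff.contMDiffOn (s := Set.univ)).comp
      ((contMDiffOn_chart (x := b)).mono fun x hx => ?_) fun _ _ => trivial
    exact hx.1
  · refine (contMDiffOn_chart_symm (x := b)).comp
      (planeEquiv.symm.contDiff.contMDiff.contMDiffOn) fun x hx => ?_
    exact hx.2
  · exact ⟨mem_chart_source _ b, trivial⟩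
  · intro b' _
    exact (planeEquiv_chart hf b b').symm

/-- A map to `B` is smooth if it is smooth in the coordinates `f`. -/
theorem contMDiffAt_chartedSpaceOfLocalHomeomorph {N : Type*} [TopologicalSpace N]
    [ChartedSpace E7 N] {p : N → B} {x : N} (hc : ContinuousAt p x)
    (h : ContMDiffAt (𝓡 7) 𝓘(ℝ, ℝ × ℝ) ∞ (fun y => f (p y)) x) :
    letI := chartedSpaceOfLocalHomeomorph hf
    ContMDiffAt (𝓡 7) (𝓡 2) ∞ p x := by
  let _ := chartedSpaceOfLocalHomeomorph hf
  have := isManifold_chartedSpaceOfLocalHomeomorph hf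
  rw [contMDiffAt_iff_target]
  refine ⟨hc, ?_⟩
  have h1 := (planeEquiv.symm.contDiff.contMDiff (n := ∞)).contMDiffAt.comp x h
  refine h1.congr_of_eventuallyEq (Filter.Eventually.of_forall fun y => ?_)
  apply planeEquiv.injective
  exact (planeEquiv_chart hf _ _).trans (planeEquiv.apply_symm_apply _).symm

end LocalHomeomorph

/-! ### Local sections of the projection to the orbit surface -/

namespace IsMultiMomentPair

variable {M : Type*} [TopologicalSpace M] [ChartedSpace E7 M] [IsManifold (𝓡 7) ∞ M]
  [PreconnectedSpace M] [T2Space M]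
  [MulAction T2SU2 M] {G : G2Manifold M} {ν : M → ℝ} {μ : M → EuclideanSpace ℝ (Fin 3)}

open G2Manifold

variable (hmm : IsMultiMomentPair G ν μ) (hs : IsSmoothAction M) (hinv : IsInvariantForm G.φ)
  (hcohom : HasCohomogeneityTwo M)
include hmm hs hinv hcohom

/-- `(|μ|, ν)` has local sections through each point of the principal set, which meet all orbits
nearby. -/
theorem exists_section {x : M} (hx : x ∈ principalSet M) :
    ∃ (W : Set (ℝ × ℝ)) (σ : ℝ × ℝ → M), IsOpen W ∧ (‖μ x‖, ν x) ∈ W ∧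
      ContMDiffOn 𝓘(ℝ, ℝ × ℝ) (𝓡 7) ∞ σ W ∧ σ (‖μ x‖, ν x) = x ∧
      (∀ v ∈ W, σ v ∈ principalSet M ∧ (‖μ (σ v)‖, ν (σ v)) = v) ∧
      ∀ᶠ y in 𝓝 x, (‖μ y‖, ν y) ∈ W ∧ ∃ g : T2SU2, g • σ (‖μ y‖, ν y) = y := by
  have hxr := injective_fundField_of_mem_principalSet hs hcohom hx
  have hPo := hmm.isOpen_principalSet hs hinv hcohom
  have hne : ∀ y ∈ principalSet M, μ y ≠ 0 := fun y hy =>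
    hmm.μ_ne_zero hs hinv (injective_fundField_of_mem_principalSet hs hcohom hy)
  obtain ⟨s, O, h, hO, h0, hsm, hs0, hvel, h0s, hh⟩ := hmm.exists_gradient_slice hs hinv hxr
  let j : ℝ × ℝ → (⊤ : Submodule ℝ LieT2SU2) × (ℝ × ℝ) := fun d => (0, d)
  have hj : Continuous j := by fun_prop
  have hsj : ∀ d, j d ∈ h.source → s d = h (j d) := by
    intro d hd
    rw [(hh _ hd).2]
    show s d = lieExp 0 • s d
    rw [lieExp_zero, one_smul]
  set O₁ := O ∩ (j ⁻¹' h.source ∩ s ⁻¹' principalSet M) with hO₁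
  have hO₁o : IsOpen O₁ := by
    rw [hO₁, Set.inter_comm (j ⁻¹' _), ← Set.inter_assoc]
    exact (hsm.continuousOn.isOpen_inter_preimage hO hPo).inter (h.open_source.preimage hj)
  have h0₁ : (0 : ℝ × ℝ) ∈ O₁ := ⟨h0, h0s, by rw [Set.mem_preimage, hs0]; exact hx⟩
  have hsm₁ : ContMDiffOn 𝓘(ℝ, ℝ × ℝ) (𝓡 7) ∞ s O₁ := hsm.mono Set.inter_subset_left
  have hk1 : ContDiffOn ℝ ∞ (fun d => ‖μ (s d)‖) O₁ := by
    have h1 : ContDiffOn ℝ ∞ (fun d => μ (s d)) O₁ :=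
      contMDiffOn_iff_contDiffOn.1 (hmm.smooth_μ.comp_contMDiffOn hsm₁)
    exact h1.norm ℝ fun d hd => hne _ hd.2.2
  have hk2 : ContDiffOn ℝ ∞ (fun d => ν (s d)) O₁ :=
    contMDiffOn_iff_contDiffOn.1 (hmm.smooth_ν.comp_contMDiffOn hsm₁)
  have hk := hk1.prodMk hk2
  have hd := ((hk.contDiffAt (hO₁o.mem_nhds h0₁)).differentiableAt (by simp)).hasFDerivAt
  set L := fderiv ℝ (fun d => (‖μ (s d)‖, ν (s d))) 0 with hL
  -- At `0` the slice moves in the directions of two orthogonal nonzero gradients, those of `ν` and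
  -- `|μ|²`. A vanishing derivative of `|μ|` yields one of `|μ|²`, which can be paired with the
  -- latter.
  have hLinj : Function.Injective L := by
    refine (injective_iff_map_eq_zero _).2 fun v hv => ?_
    have hline : HasDerivAt (fun t : ℝ => t • v) v 0 := by
      simpa using (hasDerivAt_id (0 : ℝ)).smul_const v
    have hd' : HasFDerivAt (fun d => (‖μ (s d)‖, ν (s d))) L ((0 : ℝ) • v) := by
      rw [zero_smul]; exact hd
    have h1 := hd'.comp_hasDerivAt 0 hline
    rw [hv] at h1
    have e1 : HasDerivAt (fun t : ℝ => ‖μ (s (t • v))‖) 0 0 := h1.fst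
    have e2 : HasDerivAt (fun t : ℝ => ν (s (t • v))) 0 0 := h1.snd
    have e3 := e1.pow 2
    have hbase : ∀ y : M, y = x → ∀ (f : M → ℝ), ContMDiff (𝓡 7) 𝓘(ℝ, ℝ) ∞ f →
        HasMFDerivAt (𝓡 7) 𝓘(ℝ, ℝ) f y (differential f x : E7 →L[ℝ] ℝ) := by
      rintro _ rfl f hf; exact hasMFDerivAt_differential hf _
    have hs0' : s ((0 : ℝ) • v) = x := by rw [zero_smul, hs0]
    have e4 := (hvel v).hasDerivAt (hbase _ hs0' _ hmm.smooth_ν)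
    have e5 := (hvel v).hasDerivAt (hbase _ hs0' _ hmm.smooth_normSq)
    have e6 := e4.unique e2
    have e7 := e5.unique e3
    have e6' : differential ν x (v.1 • G.grad ν x + v.2 • G.grad (fun y => ‖μ y‖ ^ 2) x) = 0 := e6
    have e7' : differential (fun y => ‖μ y‖ ^ 2) x
        (v.1 • G.grad ν x + v.2 • G.grad (fun y => ‖μ y‖ ^ 2) x) = 0 := by
      refine Eq.trans e7 ?_
      simp
    have hNX := hmm.g_grad_ν_grad_normSq hs x
    have hXN := hNX
    rw [g_symm] at hXN
    rw [← G.g_grad, map_add, map_smul, map_smul, hNX, smul_zero, add_zero, smul_eq_mul] at e6'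
    rw [← G.g_grad, map_add, map_smul, map_smul, hXN, smul_zero, zero_add, smul_eq_mul] at e7'
    exact Prod.ext ((mul_eq_zero.1 e6').resolve_right (hmm.g_grad_ν_pos hs hxr).ne')
      ((mul_eq_zero.1 e7').resolve_right (hmm.g_grad_normSq_pos hs hinv hxr).ne')
  let e : (ℝ × ℝ) ≃L[ℝ] ℝ × ℝ :=
    (LinearEquiv.ofInjectiveEndo (L : ℝ × ℝ →ₗ[ℝ] ℝ × ℝ) hLinj).toContinuousLinearEquiv
  have he : (e : ℝ × ℝ →L[ℝ] ℝ × ℝ) = L := ContinuousLinearMap.ext fun v => rfl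
  rw [← he] at hd
  obtain ⟨k, h0k, hkO, hkk, hks, hkt⟩ := exists_openPartialHomeomorph_of_contDiffOn hO₁o hk h0₁ e hd
  have hk0 : k 0 = (‖μ x‖, ν x) := by rw [hkk, hs0]
  have hsx : h.symm x = 0 := by
    have : h 0 = x := by rw [← hs0]; exact (hsj 0 h0s).symm
    rw [← this, h.left_inv h0s]
  have hxt : x ∈ h.target := by
    rw [← hs0, hsj 0 h0s]; exact h.map_source h0s
  refine ⟨k.target, fun v => s (k.symm v), k.open_target, hk0 ▸ k.map_source h0k,
    hsm₁.comp hkt.contMDiffOn fun v hv => hkO (k.map_target hv), ?_, fun v hv => ?_, ?_⟩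
  · show s (k.symm _) = x
    rw [← hk0, k.left_inv h0k, hs0]
  · exact ⟨(hkO (k.map_target hv)).2.2, (hkk _).symm.trans (k.right_inv hv)⟩
  · have h1 : ∀ᶠ y in 𝓝 x, y ∈ h.target ∧ (h.symm y).2 ∈ k.source := by
      refine Filter.Eventually.and (h.open_target.mem_nhds hxt) ?_
      refine (h.symm.continuousAt hxt).snd.eventually (k.open_source.mem_nhds ?_)
      show (h.symm x).2 ∈ k.source
      rw [hsx]; exact h0k
    filter_upwards [h1] with y hy
    have h2 := (hh _ (h.map_target hy.1)).2
    rw [h.right_inv hy.1] at h2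
    -- `y` and its slice point lie in one orbit, so `k` recovers the slice parameter from the
    -- invariants of `y`.
    have h3 : (‖μ y‖, ν y) = k (h.symm y).2 := by
      rw [hkk, h2, hmm.norm_μ_smul hs hinv, hmm.ν_smul hs hinv, ← h2]
    rw [h3]
    exact ⟨k.map_source hy.2, _, by rw [k.left_inv hy.2, ← h2]⟩

end IsMultiMomentPair

/-! ### Coordinates and metric of the orbit surface -/

section Descend

variable {M : Type*} [MulAction T2SU2 M]

/-- The function on `B` induced by an invariant function. -/
def descend (f : M → ℝ) (hf : ∀ (g : T2SU2) (x : M), f (g • x) = f x) : OrbitSurface M → ℝ :=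
  Quotient.lift (fun x : principalSet M => f x) (by
    rintro x y ⟨g, hg⟩
    have hg' : g • y.1 = x.1 := hg
    show f x.1 = f y.1
    rw [← hg', hf])

theorem descend_projB (f : M → ℝ) (hf : ∀ (g : T2SU2) (x : M), f (g • x) = f x)
    (x : principalSet M) : descend f hf (projB x) = f x := rfl

end Descend

section OpenSubmanifold

variable {M : Type*} [TopologicalSpace M] [ChartedSpace E7 M] [IsManifold (𝓡 7) ∞ M]

/-- The map to `U` that is the identity on `U` and constant elsewhere is smooth at `x`; followed by
the inclusion it is the identity near `x`. -/
theorem surjective_mfderiv_subtype_val (U : TopologicalSpace.Opens M) (x : U) :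
    Function.Surjective (mfderiv (𝓡 7) (𝓡 7) (Subtype.val : U → M) x) := by
  classical
  intro v
  let r : M → U := fun y => if h : y ∈ U then ⟨y, h⟩ else x
  have hr : ContMDiffAt (𝓡 7) (𝓡 7) ∞ r x.1 := by
    rw [← contMDiffAt_subtype_iff]
    have : (fun y : U => r y) = id := by
      funext y
      exact dif_pos y.2
    rw [this]
    exact contMDiffAt_id
  have hrx : r x.1 = x := dif_pos x.2
  have h1 := (hr.mdifferentiableAt (by simp)).hasMFDerivAt
  have h2 : HasMFDerivAt (𝓡 7) (𝓡 7) (Subtype.val : U → M) (r x.1)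
      (mfderiv (𝓡 7) (𝓡 7) (Subtype.val : U → M) x : E7 →L[ℝ] E7) := by
    rw [hrx]
    exact ((contMDiff_subtype_val (n := ∞)).mdifferentiable (by simp) x).hasMFDerivAt
  have h3 := h2.comp x.1 h1
  have h4 : (Subtype.val ∘ r : M → M) =ᶠ[𝓝 x.1] id := by
    filter_upwards [U.isOpen.mem_nhds x.2] with y hy
    exact congrArg Subtype.val (dif_pos hy : r y = ⟨y, hy⟩)
  have h5 := h3.congr_of_eventuallyEq h4.symm
  have h6 := congrArg (fun L : E7 →L[ℝ] E7 => L v) (hasMFDerivAt_unique h5 (hasMFDerivAt_id x.1))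
  exact ⟨_, h6⟩

end OpenSubmanifold

namespace IsMultiMomentPair

variable {M : Type*} [TopologicalSpace M] [ChartedSpace E7 M] [IsManifold (𝓡 7) ∞ M]
  [PreconnectedSpace M] [T2Space M]
  [MulAction T2SU2 M] {G : G2Manifold M} {ν : M → ℝ} {μ : M → EuclideanSpace ℝ (Fin 3)}

open G2Manifold

variable (hmm : IsMultiMomentPair G ν μ) (hs : IsSmoothAction M) (hinv : IsInvariantForm G.φ)
  (hcohom : HasCohomogeneityTwo M)

omit [T2Space M] [PreconnectedSpace M] in
include hs hinv in
theorem g_grad_self_smul {f : M → ℝ} (hf : ContMDiff (𝓡 7) 𝓘(ℝ, ℝ) ∞ f)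
    (hg : ∀ (g : T2SU2) x, f (g • x) = f x) (g : T2SU2) (x : M) :
    G.g.inner (g • x) (G.grad f (g • x)) (G.grad f (g • x)) =
      G.g.inner x (G.grad f x) (G.grad f x) := by
  rw [← smulDeriv_grad hs hinv hf (hg g), g_smulDeriv hinv]

omit [T2Space M] in
include hmm hs hinv in
/-- The decomposition of a horizontal vector. -/
theorem eq_of_isHorizontal {x : M} (hx : Function.Injective (fundField x))
    {v : TangentSpace (𝓡 7) x} (hv : IsHorizontal G v) :
    v = (differential ν x v / G.g.inner x (G.grad ν x) (G.grad ν x)) • G.grad ν x +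
      (differential (fun y => ‖μ y‖ ^ 2) x v / G.g.inner x (G.grad (fun y => ‖μ y‖ ^ 2) x)
        (G.grad (fun y => ‖μ y‖ ^ 2) x)) • G.grad (fun y => ‖μ y‖ ^ 2) x := by
  have hN := hmm.g_grad_ν_pos hs hx
  have hX := hmm.g_grad_normSq_pos hs hinv hx
  have hNX := hmm.g_grad_ν_grad_normSq hs x
  have hXN := hNX
  rw [g_symm] at hXN
  set α := differential ν x v / G.g.inner x (G.grad ν x) (G.grad ν x) with hα
  set β := differential (fun y => ‖μ y‖ ^ 2) x v / G.g.inner x (G.grad (fun y => ‖μ y‖ ^ 2) x)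
        (G.grad (fun y => ‖μ y‖ ^ 2) x) with hβ
  -- The remainder is killed by `dν` and `d|μ|²`, so it is tangent to the orbit; being also
  -- orthogonal to the orbit, it is zero.
  set w := v - (α • G.grad ν x + β • G.grad (fun y => ‖μ y‖ ^ 2) x) with hw
  have h1 : differential ν x w = 0 := by
    rw [hw, map_sub, ← G.g_grad, ← G.g_grad, map_add, map_smul, map_smul, hNX, smul_zero, add_zero,
      smul_eq_mul, hα, div_mul_cancel₀ _ hN.ne', G.g_grad, sub_self]
  have h2 : differential (fun y => ‖μ y‖ ^ 2) x w = 0 := by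
    rw [hw, map_sub, ← G.g_grad, ← G.g_grad, map_add, map_smul, map_smul, hXN, smul_zero, zero_add,
      smul_eq_mul, hβ, div_mul_cancel₀ _ hX.ne', G.g_grad, sub_self]
  obtain ⟨ξ, hξ⟩ := hmm.mem_range_fundField hs hinv hx h1 h2
  have h3 : w ∈ orbitTangent x := by
    rw [← range_fundField hs]; exact ⟨ξ, hξ⟩
  have h4 : G.g.inner x w w = 0 := by
    have e1 : G.g.inner x w v = 0 := hv w h3
    have e2 : G.g.inner x w (G.grad ν x) = 0 := by rw [g_symm, G.g_grad, h1]
    have e3 : G.g.inner x w (G.grad (fun y => ‖μ y‖ ^ 2) x) = 0 := by rw [g_symm, G.g_grad, h2]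
    have e4 : G.g.inner x w w = G.g.inner x w v -
        (α • G.g.inner x w (G.grad ν x) + β • G.g.inner x w (G.grad (fun y => ‖μ y‖ ^ 2) x)) := by
      conv_lhs => rw [hw]
      rw [← hw, map_sub, map_add, map_smul, map_smul]
    rw [e4, e1, e2, e3, smul_zero, smul_zero, add_zero, sub_zero]
  exact sub_eq_zero.1 (G.eq_zero_of_g_self h4)

/-- The coordinates `(|μ|, ν)` on `B`. -/
def coordB (b : OrbitSurface M) : ℝ × ℝ :=
  (descend (fun x => ‖μ x‖) (hmm.norm_μ_smul hs hinv) b, descend ν (hmm.ν_smul hs hinv) b)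

include hcohom

/-- The sections make `(|μ|, ν)` open. It is injective near the image of `x`, because nearby points
with equal invariants lie in the orbit of the same point of the section. -/
theorem isLocalHomeomorph_coordB : IsLocalHomeomorph (hmm.coordB hs hinv) := by
  classical
  have hP := hmm.isOpen_principalSet hs hinv hcohom
  have hcont : Continuous (hmm.coordB hs hinv) := by
    have h1 : Continuous (fun x : principalSet M => (‖μ x‖, ν x)) :=
      ((hmm.smooth_μ.continuous.norm).prodMk hmm.smooth_ν.continuous).comp continuous_subtype_val
    exact isQuotientMap_quotient_mk'.continuous_iff.2 h1
  have hopen : IsOpenMap (hmm.coordB hs hinv) := by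
    refine IsOpenMap.of_nhds_le fun b => ?_
    obtain ⟨x, rfl⟩ := projB_surjective b
    intro A hA
    obtain ⟨W, σ, hW, hxW, hσ, hσx, hWσ, -⟩ := hmm.exists_section hs hinv hcohom x.2
    have h1 : projB ⁻¹' (hmm.coordB hs hinv ⁻¹' A) ∈ 𝓝 x :=
      continuous_projB.continuousAt hA
    rw [nhds_subtype_eq_comap] at h1
    obtain ⟨A', hA', hAA'⟩ := h1
    have h2 : σ ⁻¹' A' ∈ 𝓝 (‖μ x‖, ν x) :=
      (hσ.continuousOn.continuousAt (hW.mem_nhds hxW)) (by rw [hσx]; exact hA')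
    filter_upwards [h2, hW.mem_nhds hxW] with v hv hvW
    have h3 := hAA' (show (⟨σ v, (hWσ v hvW).1⟩ : principalSet M) ∈ Subtype.val ⁻¹' A' from hv)
    have h4 : hmm.coordB hs hinv (projB ⟨σ v, (hWσ v hvW).1⟩) = v := (hWσ v hvW).2
    rw [Set.mem_preimage, Set.mem_preimage, h4] at h3
    exact h3
  refine IsLocalHomeomorph.mk _ fun b => ?_
  obtain ⟨x, rfl⟩ := projB_surjective b
  obtain ⟨W, σ, hW, hxW, hσ, hσx, hWσ, hev⟩ := hmm.exists_section hs hinv hcohom x.2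
  obtain ⟨N, hN, hNo, hxN⟩ := eventually_nhds_iff.1 hev
  have hUo : IsOpen (projB '' (Subtype.val ⁻¹' N : Set (principalSet M))) :=
    isOpenMap_projB hs hP _ (hNo.preimage continuous_subtype_val)
  have hinj : Set.InjOn (hmm.coordB hs hinv)
      (projB '' (Subtype.val ⁻¹' N : Set (principalSet M))) := by
    rintro _ ⟨y, hy, rfl⟩ _ ⟨z, hz, rfl⟩ hyz
    have hyz' : (‖μ y‖, ν y) = (‖μ z‖, ν z) := hyz
    obtain ⟨-, g, hg⟩ := hN _ hy
    obtain ⟨-, k, hk⟩ := hN _ hz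
    rw [← hyz'] at hk
    refine projB_eq_projB.2 ⟨g * k⁻¹, ?_⟩
    rw [mul_smul, ← hk, inv_smul_smul, hg]
  have : Nonempty (OrbitSurface M) := ⟨projB x⟩
  let e := Set.InjOn.toPartialEquiv (hmm.coordB hs hinv) _ hinj
  refine ⟨OpenPartialHomeomorph.ofContinuousOpen e hcont.continuousOn hopen hUo,
    ⟨x, hxN, rfl⟩, fun _ _ => rfl⟩

/-- The smooth structure of `B`. -/
@[reducible] def chartedSpaceB : ChartedSpace (EuclideanSpace ℝ (Fin 2)) (OrbitSurface M) :=
  chartedSpaceOfLocalHomeomorph (hmm.isLocalHomeomorph_coordB hs hinv hcohom)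

theorem smooth_projOpen (hP : IsOpen (principalSet M)) :
    letI := hmm.chartedSpaceB hs hinv hcohom
    ContMDiff (𝓡 7) (𝓡 2) ∞ (projOpen hP) := by
  intro x
  apply contMDiffAt_chartedSpaceOfLocalHomeomorph
  · exact (continuous_projB.comp
      (continuous_id : Continuous (id : principalSet M → principalSet M))).continuousAt (x := x)
  · have hne := hmm.μ_ne_zero hs hinv (injective_fundField_of_mem_principalSet hs hcohom x.2)
    have h1 : ContMDiffAt (𝓡 7) 𝓘(ℝ, ℝ) ∞ (fun y => ‖μ y‖) x.1 :=
      (contDiffAt_norm ℝ hne).contMDiffAt.comp x.1 (hmm.smooth_μ x.1)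
    have h2 : ContMDiffAt (𝓡 7) 𝓘(ℝ, ℝ × ℝ) ∞ (fun y => (‖μ y‖, ν y)) x.1 :=
      h1.prodMk_space (hmm.smooth_ν x.1)
    exact contMDiffAt_subtype_iff.2 h2

theorem mdifferentiable_coordB :
    letI := hmm.chartedSpaceB hs hinv hcohom
    MDifferentiable (𝓡 2) 𝓘(ℝ, ℝ × ℝ) (hmm.coordB hs hinv) :=
  letI := hmm.chartedSpaceB hs hinv hcohom
  (isLocalDiffeomorph_chartedSpaceOfLocalHomeomorph
    (hmm.isLocalHomeomorph_coordB hs hinv hcohom)).mdifferentiable (by simp)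

/-- The differential of `(|μ|, ν)` on `B`. -/
def dcoordB (b : OrbitSurface M) :
    letI := hmm.chartedSpaceB hs hinv hcohom
    TangentSpace (𝓡 2) b →L[ℝ] ℝ × ℝ :=
  letI := hmm.chartedSpaceB hs hinv hcohom
  mfderiv (𝓡 2) 𝓘(ℝ, ℝ × ℝ) (hmm.coordB hs hinv) b

theorem injective_dcoordB (b : OrbitSurface M) :
    Function.Injective (hmm.dcoordB hs hinv hcohom b) := by
  let _ := hmm.chartedSpaceB hs hinv hcohom
  exact ((isLocalDiffeomorph_chartedSpaceOfLocalHomeomorph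
    (hmm.isLocalHomeomorph_coordB hs hinv hcohom) b).mfderivToContinuousLinearEquiv
      (by simp)).injective

/-- The chain rule for `(|μ|, ν)` through the projection. The first component is expressed by `d|μ|²
= 2|μ| d|μ|`, since the available gradient is that of `|μ|²`. -/
theorem dcoordB_projOpen (hP : IsOpen (principalSet M))
    (x : (⟨principalSet M, hP⟩ : TopologicalSpace.Opens M)) (Z : TangentSpace (𝓡 7) x) :
    letI := hmm.chartedSpaceB hs hinv hcohom
    let ι := mfderiv (𝓡 7) (𝓡 7)
      (Subtype.val : (⟨principalSet M, hP⟩ : TopologicalSpace.Opens M) → M) x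
    let P := mfderiv (𝓡 7) (𝓡 2) (projOpen hP) x
    2 * ‖μ x.1‖ * (hmm.dcoordB hs hinv hcohom _ (P Z)).1 =
      differential (fun y => ‖μ y‖ ^ 2) x.1 (ι Z) ∧
    (hmm.dcoordB hs hinv hcohom _ (P Z)).2 = differential ν x.1 (ι Z) := by
  let _ := hmm.chartedSpaceB hs hinv hcohom
  intro ι P
  have h1 : HasMFDerivAt (𝓡 7) 𝓘(ℝ, ℝ × ℝ) (fun y => hmm.coordB hs hinv (projOpen hP y)) x
      ((hmm.dcoordB hs hinv hcohom _).comp P) :=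
    HasMFDerivAt.comp x (hmm.mdifferentiable_coordB hs hinv hcohom _).hasMFDerivAt
      ((hmm.smooth_projOpen hs hinv hcohom hP).mdifferentiable (by simp) x).hasMFDerivAt
  have hι : HasMFDerivAt (𝓡 7) (𝓡 7)
      (Subtype.val : (⟨principalSet M, hP⟩ : TopologicalSpace.Opens M) → M) x ι :=
    ((contMDiff_subtype_val (n := ∞)).mdifferentiable (by simp) x).hasMFDerivAt
  have h2 := HasMFDerivAt.comp x (hasMFDerivAt_differential hmm.smooth_ν x.1) hι
  have h3 := HasMFDerivAt.comp x (hasMFDerivAt_differential hmm.smooth_normSq x.1) hι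
  have h4 : HasMFDerivAt 𝓘(ℝ, ℝ × ℝ) 𝓘(ℝ, ℝ) (fun p : ℝ × ℝ => p.2)
    (hmm.coordB hs hinv (projOpen hP x)) (ContinuousLinearMap.snd ℝ ℝ ℝ) :=
    hasMFDerivAt_iff_hasFDerivAt.2 hasFDerivAt_snd
  have h5 : HasMFDerivAt 𝓘(ℝ, ℝ × ℝ) 𝓘(ℝ, ℝ) (fun p : ℝ × ℝ => p.1 ^ 2)
    (hmm.coordB hs hinv (projOpen hP x)) ((2 * ‖μ x.1‖) • ContinuousLinearMap.fst ℝ ℝ ℝ) := by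
    refine hasMFDerivAt_iff_hasFDerivAt.2 ?_
    have h := (hasFDerivAt_fst (𝕜 := ℝ) (E := ℝ) (F := ℝ)
      (p := hmm.coordB hs hinv (projOpen hP x))).pow 2
    have e : (hmm.coordB hs hinv (projOpen hP x)).1 = ‖μ x.1‖ := rfl
    rw [e] at h
    have h' : HasFDerivAt (fun p : ℝ × ℝ => p.1 ^ 2) ((2 * ‖μ x.1‖) • ContinuousLinearMap.fst ℝ ℝ ℝ)
        (hmm.coordB hs hinv (projOpen hP x)) := by simpa using h
    exact h'
  constructor
  · exact congrArg (fun L : E7 →L[ℝ] ℝ => L Z) (hasMFDerivAt_unique (HasMFDerivAt.comp x h5 h1) h3)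
  · exact congrArg (fun L : E7 →L[ℝ] ℝ => L Z) (hasMFDerivAt_unique (HasMFDerivAt.comp x h4 h1) h2)

theorem isQuotientSurface (hP : IsOpen (principalSet M)) :
    letI := hmm.chartedSpaceB hs hinv hcohom
    IsQuotientSurface hP := by
  let _ := hmm.chartedSpaceB hs hinv hcohom
  refine ⟨t2Space_orbitSurface hs hP, isManifold_chartedSpaceOfLocalHomeomorph _,
    hmm.smooth_projOpen hs hinv hcohom hP, fun x w => ?_⟩
  have hx := injective_fundField_of_mem_principalSet hs hcohom x.2
  have hN := hmm.g_grad_ν_pos hs hx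
  have hX := hmm.g_grad_normSq_pos hs hinv hx
  have hNX := hmm.g_grad_ν_grad_normSq hs x.1
  have hXN := hNX
  rw [g_symm] at hXN
  have hμ := norm_pos_iff.2 (hmm.μ_ne_zero hs hinv hx)
  set w' := hmm.dcoordB hs hinv hcohom _ w with hw'
  -- The combination of the two orthogonal gradients that has the prescribed derivatives of `ν` and
  -- `|μ|²`.
  obtain ⟨Z, hZ⟩ := surjective_mfderiv_subtype_val ⟨principalSet M, hP⟩ x
    ((w'.2 / G.g.inner x.1 (G.grad ν x.1) (G.grad ν x.1)) • G.grad ν x.1 +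
      (2 * ‖μ x.1‖ * w'.1 / G.g.inner x.1 (G.grad (fun y => ‖μ y‖ ^ 2) x.1)
        (G.grad (fun y => ‖μ y‖ ^ 2) x.1)) • G.grad (fun y => ‖μ y‖ ^ 2) x.1)
  refine ⟨Z, hmm.injective_dcoordB hs hinv hcohom _ ?_⟩
  obtain ⟨h1, h2⟩ := hmm.dcoordB_projOpen hs hinv hcohom hP x Z
  rw [hZ, ← G.g_grad, map_add, map_smul, map_smul, hXN, smul_zero, zero_add, smul_eq_mul,
    div_mul_cancel₀ _ hX.ne'] at h1
  rw [hZ, ← G.g_grad, map_add, map_smul, map_smul, hNX, smul_zero, add_zero, smul_eq_mul,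
    div_mul_cancel₀ _ hN.ne'] at h2
  exact Prod.ext (mul_left_cancel₀ (by positivity) h1) h2

/-- The quotient metric of `B`. -/
def metricB (b : OrbitSurface M) :
    letI := hmm.chartedSpaceB hs hinv hcohom
    TangentSpace (𝓡 2) b →ₗ[ℝ] TangentSpace (𝓡 2) b →ₗ[ℝ] ℝ :=
  letI := hmm.chartedSpaceB hs hinv hcohom
  let D := hmm.dcoordB hs hinv hcohom b
  -- Since `∇|μ|² = 2|μ| ∇|μ|`, the two coefficients are the inverse squared lengths of `∇|μ|` and
  -- `∇ν`; both are constant on orbits.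
  let a := descend (fun x => 4 * ‖μ x‖ ^ 2 / G.g.inner x (G.grad (fun y => ‖μ y‖ ^ 2) x)
    (G.grad (fun y => ‖μ y‖ ^ 2) x)) (fun g x => by
      rw [hmm.norm_μ_smul hs hinv, g_grad_self_smul hs hinv hmm.smooth_normSq
        (fun g x => by rw [hmm.norm_μ_smul hs hinv])]) b
  let c := descend (fun x => (G.g.inner x (G.grad ν x) (G.grad ν x))⁻¹) (fun g x => by
      rw [g_grad_self_smul hs hinv hmm.smooth_ν (hmm.ν_smul hs hinv)]) b
  LinearMap.mk₂ ℝ (fun X Y => a * ((D X).1 * (D Y).1) + c * ((D X).2 * (D Y).2))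
    (fun X X' Y => by rw [map_add]; simp only [Prod.fst_add, Prod.snd_add]; ring)
    (fun r X Y => by
      rw [map_smul]; simp only [Prod.smul_fst, Prod.smul_snd, smul_eq_mul]; ring)
    (fun X Y Y' => by rw [map_add]; simp only [Prod.fst_add, Prod.snd_add]; ring)
    (fun r X Y => by
      rw [map_smul]; simp only [Prod.smul_fst, Prod.smul_snd, smul_eq_mul]; ring)

theorem metricB_apply (x : principalSet M) :
    letI := hmm.chartedSpaceB hs hinv hcohom
    ∀ X Y : TangentSpace (𝓡 2) (projB x), hmm.metricB hs hinv hcohom (projB x) X Y =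
      4 * ‖μ x.1‖ ^ 2 / G.g.inner x.1 (G.grad (fun y => ‖μ y‖ ^ 2) x.1)
        (G.grad (fun y => ‖μ y‖ ^ 2) x.1) * ((hmm.dcoordB hs hinv hcohom _ X).1 *
          (hmm.dcoordB hs hinv hcohom _ Y).1) +
      (G.g.inner x.1 (G.grad ν x.1) (G.grad ν x.1))⁻¹ * ((hmm.dcoordB hs hinv hcohom _ X).2 *
          (hmm.dcoordB hs hinv hcohom _ Y).2) := fun _ _ => rfl

/-- Expanding horizontal vectors in the orthogonal vectors `∇ν` and `∇|μ|²` diagonalises their inner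
product in terms of `dν` and `d|μ|²`. -/
theorem isQuotientMetric (hP : IsOpen (principalSet M)) :
    letI := hmm.chartedSpaceB hs hinv hcohom
    IsQuotientMetric G hP (hmm.metricB hs hinv hcohom) := by
  let _ := hmm.chartedSpaceB hs hinv hcohom
  intro x Z W ι P hZ hW
  have hx := injective_fundField_of_mem_principalSet hs hcohom x.2
  have hN := hmm.g_grad_ν_pos hs hx
  have hX := hmm.g_grad_normSq_pos hs hinv hx
  have hNX := hmm.g_grad_ν_grad_normSq hs x.1
  have hXN := hNX
  rw [g_symm] at hXN
  have hμ := norm_pos_iff.2 (hmm.μ_ne_zero hs hinv hx)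
  obtain ⟨z1, z2⟩ := hmm.dcoordB_projOpen hs hinv hcohom hP x Z
  obtain ⟨w1, w2⟩ := hmm.dcoordB_projOpen hs hinv hcohom hP x W
  have hm := hmm.metricB_apply hs hinv hcohom x (P Z) (P W)
  refine Eq.trans hm ?_
  have e := hmm.eq_of_isHorizontal hs hinv hx hZ
  have e' := hmm.eq_of_isHorizontal hs hinv hx hW
  have e2 : G.g.inner x.1 (ι Z) (ι W) =
      differential ν x.1 (ι Z) / G.g.inner x.1 (G.grad ν x.1) (G.grad ν x.1) *
        differential ν x.1 (ι W) +
      differential (fun y => ‖μ y‖ ^ 2) x.1 (ι Z) / G.g.inner x.1 (G.grad (fun y => ‖μ y‖ ^ 2) x.1)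
        (G.grad (fun y => ‖μ y‖ ^ 2) x.1) * differential (fun y => ‖μ y‖ ^ 2) x.1 (ι W) := by
    have lin : ∀ (α β : ℝ) (a b c : TangentSpace (𝓡 7) x.1), G.g.inner x.1 (α • a + β • b) c =
        α * G.g.inner x.1 a c + β * G.g.inner x.1 b c := by
      intro α β a b c
      rw [map_add, map_smul, map_smul]; rfl
    conv_lhs => rw [e]
    rw [lin, G.g_grad ν x.1 (ι W), G.g_grad (fun y => ‖μ y‖ ^ 2) x.1 (ι W)]
  refine (e2.trans ?_).symm
  have key : ∀ m c d z z' w w' : ℝ, w / c * w' + 2 * m * z / d * (2 * m * z') =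
      4 * m ^ 2 / d * (z * z') + c⁻¹ * (w * w') := fun m c d z z' w w' => by ring
  rw [← z1, ← z2, ← w1, ← w2]
  exact key _ _ _ _ _ _ _

theorem isLocalOrthogonalParametrization :
    letI := hmm.chartedSpaceB hs hinv hcohom
    IsLocalOrthogonalParametrization (hmm.metricB hs hinv hcohom)
      (descend (fun x => ‖μ x‖) (hmm.norm_μ_smul hs hinv)) (descend ν (hmm.ν_smul hs hinv)) := by
  let _ := hmm.chartedSpaceB hs hinv hcohom
  refine ⟨isLocalDiffeomorph_chartedSpaceOfLocalHomeomorph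
    (hmm.isLocalHomeomorph_coordB hs hinv hcohom), fun b X Y hX hY => ?_⟩
  obtain ⟨x, rfl⟩ := projB_surjective b
  have h1 : HasMFDerivAt (𝓡 2) 𝓘(ℝ, ℝ × ℝ) (hmm.coordB hs hinv) (projB x)
      (hmm.dcoordB hs hinv hcohom (projB x)) :=
    (hmm.mdifferentiable_coordB hs hinv hcohom _).hasMFDerivAt
  have h2 : HasMFDerivAt 𝓘(ℝ, ℝ × ℝ) 𝓘(ℝ, ℝ) (fun p : ℝ × ℝ => p.2)
      (hmm.coordB hs hinv (projB x)) (ContinuousLinearMap.snd ℝ ℝ ℝ) :=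
    hasMFDerivAt_iff_hasFDerivAt.2 hasFDerivAt_snd
  have h3 : HasMFDerivAt 𝓘(ℝ, ℝ × ℝ) 𝓘(ℝ, ℝ) (fun p : ℝ × ℝ => p.1)
      (hmm.coordB hs hinv (projB x)) (ContinuousLinearMap.fst ℝ ℝ ℝ) :=
    hasMFDerivAt_iff_hasFDerivAt.2 hasFDerivAt_fst
  have hX' : (hmm.dcoordB hs hinv hcohom _ X).2 = 0 :=
    (congrArg (fun L : EuclideanSpace ℝ (Fin 2) →L[ℝ] ℝ => L X)
      (HasMFDerivAt.comp _ h2 h1).mfderiv).symm.trans hX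
  have hY' : (hmm.dcoordB hs hinv hcohom _ Y).1 = 0 :=
    (congrArg (fun L : EuclideanSpace ℝ (Fin 2) →L[ℝ] ℝ => L Y)
      (HasMFDerivAt.comp _ h3 h1).mfderiv).symm.trans hY
  refine (hmm.metricB_apply hs hinv hcohom x X Y).trans ?_
  rw [hX', hY', mul_zero, zero_mul, mul_zero, mul_zero, add_zero]

end IsMultiMomentPair

/-! ### The leaves swept out by a torus and a transverse vector field -/

section Leaf

variable (M : Type*) [TopologicalSpace M] [ChartedSpace E7 M] [MulAction T2SU2 M]

/-- A torus `K` with Lie algebra `𝔥`, acting locally freely on the open set `P`, a `K`-invariant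
function `f`, and a smooth `K`-invariant vector field `Y` on `P` with `Y f = 1`. -/
structure LeafData where
  P : Set M
  𝔥 : Submodule ℝ LieT2SU2
  commute : ∀ ξ ∈ 𝔥, ∀ η ∈ 𝔥, Commute (imQuaternion ξ.2) (imQuaternion η.2)
  K : Subgroup T2SU2
  lieExp_mem : ∀ ξ ∈ 𝔥, lieExp ξ ∈ K
  C : Set LieT2SU2
  isCompact_C : IsCompact C
  C_subset : C ⊆ 𝔥
  exists_lieExp : ∀ g ∈ K, ∃ ξ ∈ C, lieExp ξ = g
  f : M → ℝ
  smooth_f : ContMDiff (𝓡 7) 𝓘(ℝ, ℝ) ∞ f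
  f_smul : ∀ k ∈ K, ∀ x, f (k • x) = f x
  Y : ∀ x : M, TangentSpace (𝓡 7) x
  differential_Y : ∀ x ∈ P, differential f x (Y x) = 1
  smul_mem : ∀ k ∈ K, ∀ x ∈ P, k • x ∈ P
  smulDeriv_Y : ∀ k ∈ K, ∀ x ∈ P, smulDeriv k x (Y x) = Y (k • x)
  injective : ∀ x ∈ P, Function.Injective (fundField x)
  flow : ∀ x ∈ P, ∃ (Φ : ℝ × E7 → M) (O : Set (ℝ × E7)), IsOpen O ∧ 0 ∈ O ∧
    ContMDiffOn 𝓘(ℝ, ℝ × E7) (𝓡 7) ∞ Φ O ∧ Φ 0 = x ∧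
    (∀ p ∈ O, Φ p ∈ P ∧ HasVelocity (fun t => Φ (t, p.2)) p.1 (Y (Φ p))) ∧
    ∀ v : E7, HasVelocity (fun r : ℝ => Φ (0, r • v)) 0 v

variable {M}

namespace LeafData

variable (D : LeafData M)

/-- Coordinates around a point in which the action of `K` and the vector field are given by
translations. -/
structure Box (y : M) where
  W : Submodule ℝ E7
  finrank_W : Module.finrank ℝ D.𝔥 + 1 + Module.finrank ℝ W = 7
  h : OpenPartialHomeomorph (D.𝔥 × (ℝ × W)) M
  δ : ℝ
  δ_pos : 0 < δ
  source_eq : h.source = Metric.ball 0 δ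
  h_zero : h 0 = y
  smooth : ContMDiffOn 𝓘(ℝ, D.𝔥 × (ℝ × W)) (𝓡 7) ∞ h h.source
  smooth_symm : ContMDiffOn (𝓡 7) 𝓘(ℝ, D.𝔥 × (ℝ × W)) ∞ h.symm h.target
  mem : ∀ p ∈ h.source, h p ∈ D.P
  translate : ∀ (a : D.𝔥), ∀ p ∈ h.source, (a + p.1, p.2) ∈ h.source →
    h (a + p.1, p.2) = lieExp a • h p
  line : ∀ p ∈ h.source, HasVelocity (fun r => h (p.1, (r, p.2.2))) p.2.1 (D.Y (h p) : E7)

variable [IsManifold (𝓡 7) ∞ M] (hs : IsSmoothAction M)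
include hs

/-- Applying `df` gives `t = 0`, because `f` is `K`-invariant and `Y f = 1`; local freeness does the
rest. -/
theorem eq_zero_of_fundField_add {y : M} (hy : y ∈ D.P) {ξ : LieT2SU2} (hξ : ξ ∈ D.𝔥) {t : ℝ}
    (h : fundField y ξ + t • D.Y y = 0) : ξ = 0 ∧ t = 0 := by
  have h1 := congrArg (differential D.f y) h
  have h2 : differential D.f y (fundField y ξ) = 0 :=
    G2Manifold.differential_fundField hs D.smooth_f fun t =>
      D.f_smul _ (D.lieExp_mem _ (D.𝔥.smul_mem t hξ)) y
  rw [map_add, map_smul, h2, D.differential_Y y hy, zero_add, map_zero, smul_eq_mul, mul_one] at h1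
  rw [h1, zero_smul, add_zero] at h
  exact ⟨(map_eq_zero_iff _ (D.injective y hy)).1 h, h1⟩

/-- The chart is `(a, t, w) ↦ exp(a) • Φ(t, w)`, with `w` in a complement of the span of the
`K`-orbit directions and the field. Commutativity makes `K` act by translation in `a`, and
invariance of the field keeps the `t`-lines integral for every `a`. -/
theorem nonempty_box {y : M} (hy : y ∈ D.P) : Nonempty (D.Box y) := by
  obtain ⟨Φ, O, hO, h0, hΦ, hΦ0, hΦO, hΦv⟩ := D.flow y hy
  let Fy : LieT2SU2 →L[ℝ] E7 := fundField y
  let Yy : E7 := D.Y y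
  let A : (D.𝔥 × ℝ) →ₗ[ℝ] E7 := LinearMap.coprod
    ((Fy : LieT2SU2 →ₗ[ℝ] E7) ∘ₗ D.𝔥.subtype) (LinearMap.toSpanSingleton ℝ E7 Yy)
  have hA : Function.Injective A := by
    refine (injective_iff_map_eq_zero _).2 ?_
    rintro ⟨ξ, t⟩ h
    obtain ⟨h1, h2⟩ := D.eq_zero_of_fundField_add hs hy ξ.2 (t := t) h
    exact Prod.ext (Subtype.ext h1) h2
  obtain ⟨W, hW⟩ := Submodule.exists_isCompl (LinearMap.range A)
  have hdim : Module.finrank ℝ D.𝔥 + 1 + Module.finrank ℝ W = 7 := by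
    have h1 := Submodule.finrank_add_eq_of_isCompl hW
    rw [LinearMap.finrank_range_of_inj hA, Module.finrank_prod, Module.finrank_self] at h1
    exact h1.trans finrank_euclideanSpace_fin
  let j : ℝ × W →L[ℝ] ℝ × E7 := (ContinuousLinearMap.id ℝ ℝ).prodMap W.subtypeL
  let s : ℝ × W → M := fun p => Φ (j p)
  have hO' : IsOpen (j ⁻¹' O) := hO.preimage j.continuous
  have h0' : (0 : ℝ × W) ∈ j ⁻¹' O := by rw [Set.mem_preimage, map_zero]; exact h0
  have hsm : ContMDiffOn 𝓘(ℝ, ℝ × W) (𝓡 7) ∞ s (j ⁻¹' O) :=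
    hΦ.comp (j.contDiff.contMDiff.contMDiffOn) fun p hp => hp
  have hs0 : s 0 = y := by show Φ (j 0) = y; rw [map_zero, hΦ0]
  have hΦd : MDifferentiableAt 𝓘(ℝ, ℝ × E7) (𝓡 7) Φ 0 :=
    (hΦ.contMDiffAt (hO.mem_nhds h0)).mdifferentiableAt (by simp)
  let DΦ : ℝ × E7 →L[ℝ] E7 := mfderiv 𝓘(ℝ, ℝ × E7) (𝓡 7) Φ 0
  have hD1 : DΦ (1, 0) = Yy := by
    have e1 := hasVelocity_parametrization hΦd ((1, 0) : ℝ × E7)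
    have e2 := (hΦO 0 h0).2
    have e3 : (fun t : ℝ => Φ (0 + t • ((1, 0) : ℝ × E7))) =
        fun t : ℝ => Φ (t, (0 : ℝ × E7).2) := by ext t; simp
    rw [e3] at e1
    have e4 : ∀ z : M, z = y → (D.Y z : E7) = D.Y y := by rintro _ rfl; rfl
    exact (e1.unique e2).trans (e4 _ hΦ0)
  have hD2 : ∀ v, DΦ (0, v) = v := by
    intro v
    have e1 := hasVelocity_parametrization hΦd ((0, v) : ℝ × E7)
    have e3 : (fun t : ℝ => Φ (0 + t • ((0, v) : ℝ × E7))) =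
        fun t : ℝ => Φ (0, t • v) := by ext t; simp
    rw [e3] at e1
    exact e1.unique (hΦv v)
  let L : ℝ × W →ₗ[ℝ] TangentSpace (𝓡 7) (s 0) := ((DΦ.comp j : ℝ × W →L[ℝ] E7) : ℝ × W →ₗ[ℝ] E7)
  have hLv : ∀ v : ℝ × W, DΦ (j v) = v.1 • Yy + (v.2 : E7) := by
    intro v
    have : j v = v.1 • ((1, 0) : ℝ × E7) + (0, (v.2 : E7)) := by
      ext1
      · show v.1 = v.1 • 1 + 0; simp
      · show (v.2 : E7) = v.1 • 0 + v.2; simp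
    rw [this, map_add, map_smul, hD1, hD2]
  have hvel : ∀ v, HasVelocity (fun t : ℝ => s (t • v)) 0 (L v : E7) := by
    intro v
    have e1 := hasVelocity_parametrization hΦd (j v)
    have e3 : (fun t : ℝ => Φ (0 + t • j v)) = fun t : ℝ => s (t • v) := by
      ext t
      show Φ (0 + t • j v) = Φ (j (t • v))
      rw [zero_add, map_smul]
    rw [e3] at e1
    exact e1
  have hdim' : Module.finrank ℝ D.𝔥 + Module.finrank ℝ (ℝ × W) = 7 := by
    rw [Module.finrank_prod, Module.finrank_self]
    omega
  obtain ⟨h, hh0, hh, hh1, hh2⟩ := exists_slice_coordinates hs hdim' hO' h0' hsm L hvel (by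
    intro ξ hξ v hv
    have e : ∀ z : M, z = y → (fundField z ξ : E7) = Fy ξ := by rintro _ rfl; rfl
    have hv1 : @HAdd.hAdd E7 E7 E7 _ (fundField (s 0) ξ) (DΦ (j v)) = 0 := hv
    rw [e _ hs0, hLv] at hv1
    have hA1 : A (⟨ξ, hξ⟩, v.1) = Fy ξ + v.1 • Yy := rfl
    have hv2 : A (⟨ξ, hξ⟩, v.1) + (v.2 : E7) = 0 := by
      rw [hA1, add_assoc]; exact hv1
    have hmem : A (⟨ξ, hξ⟩, v.1) ∈ W := by
      rw [eq_neg_of_add_eq_zero_left hv2]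
      exact W.neg_mem v.2.2
    have hz := Submodule.disjoint_def.1 hW.disjoint _ (LinearMap.mem_range_self A _) hmem
    rw [hz, zero_add] at hv2
    have := (map_eq_zero_iff _ hA).1 hz
    exact ⟨congrArg Subtype.val (congrArg Prod.fst this),
      Prod.ext (congrArg Prod.snd this) (Subtype.ext hv2)⟩)
  -- A ball for the maximum norm is a product, so each coordinate can be moved independently of the
  -- others.
  obtain ⟨δ, hδ, hball⟩ := Metric.isOpen_iff.1 h.open_source 0 hh0
  have hsrc : (h.restrOpen _ (Metric.isOpen_ball (x := (0 : D.𝔥 × (ℝ × W))) (ε := δ))).source =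
      Metric.ball 0 δ := by
    rw [OpenPartialHomeomorph.restrOpen_source]
    exact Set.inter_eq_right.2 hball
  have hmemb : ∀ p ∈ h.source, h p ∈ D.P := by
    intro p hp
    rw [(hh p hp).2]
    exact D.smul_mem _ (D.lieExp_mem _ p.1.2) _ (hΦO _ (hh p hp).1).1
  refine ⟨⟨W, hdim, h.restrOpen _ Metric.isOpen_ball, δ, hδ, hsrc, ?_, ?_, ?_, ?_, ?_, ?_⟩⟩
  · show h 0 = y
    rw [(hh 0 hh0).2, ← hs0]
    show lieExp 0 • s 0 = s 0
    rw [lieExp_zero, one_smul]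
  · rw [hsrc]
    exact hh1.mono hball
  · exact hh2.mono fun z hz => hz.1
  · rw [hsrc]
    exact fun p hp => hmemb p (hball hp)
  · rw [hsrc]
    intro a p hp hap
    show h (a + p.1, p.2) = lieExp a • h p
    rw [(hh _ (hball hp)).2, (hh _ (hball hap)).2, smul_smul]
    show lieExp ((a : LieT2SU2) + p.1) • _ = _
    rw [lieExp_add (D.commute _ a.2 _ p.1.2)]
  · rw [hsrc]
    intro p hp
    have e1 := (hΦO _ (hh p (hball hp)).1).2
    have e2 := e1.map (hasMFDerivAt_smul hs (lieExp p.1) _)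
    have e3 : (smulDeriv (lieExp p.1) (Φ (j p.2)) (D.Y (Φ (j p.2))) : E7) = D.Y (h p) := by
      have e4 : ∀ z : M, z = h p → (D.Y z : E7) = D.Y (h p) := by rintro _ rfl; rfl
      rw [D.smulDeriv_Y _ (D.lieExp_mem _ p.1.2) _ (hΦO _ (hh p (hball hp)).1).1]
      exact e4 _ (hh p (hball hp)).2.symm
    have e5 : HasVelocity (fun t => lieExp p.1 • Φ (t, (j p.2).2)) p.2.1 (D.Y (h p) : E7) :=
      (congrArg (fun v : E7 => HasVelocity (fun t => lieExp p.1 • Φ (t, (j p.2).2)) p.2.1 v) e3).mp e2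
    refine e5.congr_of_eventuallyEq ?_
    have hc : Continuous (fun r : ℝ => ((p.1, (r, p.2.2)) : D.𝔥 × (ℝ × W))) := by fun_prop
    filter_upwards [hc.continuousAt.eventually (Metric.isOpen_ball.mem_nhds
      (show ((p.1, (p.2.1, p.2.2)) : D.𝔥 × (ℝ × W)) ∈ Metric.ball 0 δ from hp))] with r hr
    exact (hh _ (hball hr)).2

end LeafData
end Leaf

theorem IsPreconnected.iff_of_eventually {X : Type*} [TopologicalSpace X] {S : Set X}
    (hS : IsPreconnected S) {Q : X → Prop} (h : ∀ x ∈ S, ∀ᶠ y in 𝓝[S] x, (Q x ↔ Q y)) {x y : X}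
    (hx : x ∈ S) (hy : y ∈ S) : Q x ↔ Q y :=
  hS.induction₂ (fun x y => (Q x ↔ Q y)) (fun x hx => h x hx)
    (fun _ _ _ _ _ _ h1 h2 => h1.trans h2) (fun _ _ _ _ h => h.symm) hx hy

theorem eq_of_hasDerivAt_zero {F : Type*} [NormedAddCommGroup F] [NormedSpace ℝ F] {u : ℝ → F}
    {a b : ℝ} (h : ∀ s ∈ Set.Ioo a b, HasDerivAt u 0 s) {s t : ℝ} (hs : s ∈ Set.Ioo a b)
    (ht : t ∈ Set.Ioo a b) : u s = u t := by
  refine (convex_Ioo a b).is_const_of_fderivWithin_eq_zero (𝕜 := ℝ)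
    (fun s hs => (h s hs).differentiableAt.differentiableWithinAt) (fun s hs => ?_) hs ht
  have h1 := (h s hs).hasFDerivAt
  rw [fderivWithin_of_isOpen isOpen_Ioo hs, h1.fderiv]
  ext
  simp

theorem eventually_eq_of_hasDerivAt_zero {F : Type*} [NormedAddCommGroup F] [NormedSpace ℝ F]
    {u : ℝ → F} {s₀ : ℝ} (h : ∀ᶠ s in 𝓝 s₀, HasDerivAt u 0 s) : ∀ᶠ s in 𝓝 s₀, u s = u s₀ := by
  obtain ⟨ε, hε, hball⟩ := Metric.eventually_nhds_iff_ball.1 h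
  rw [Real.ball_eq_Ioo] at hball
  have hs₀ : s₀ ∈ Set.Ioo (s₀ - ε) (s₀ + ε) := ⟨by linarith, by linarith⟩
  filter_upwards [isOpen_Ioo.mem_nhds hs₀] with s hs
  exact eq_of_hasDerivAt_zero hball hs hs₀

/-! ### Integral curves of the transverse field -/

section Leaf

variable {M : Type*} [TopologicalSpace M] [ChartedSpace E7 M] [MulAction T2SU2 M]

namespace LeafData

variable {D : LeafData M}

namespace Box

variable {y : M} (B : D.Box y)

theorem mem_source {p : D.𝔥 × (ℝ × B.W)} :
    p ∈ B.h.source ↔ ‖p.1‖ < B.δ ∧ |p.2.1| < B.δ ∧ ‖p.2.2‖ < B.δ := by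
  rw [B.source_eq, mem_ball_zero_iff, Prod.norm_def, max_lt_iff, Prod.norm_def, max_lt_iff,
    Real.norm_eq_abs]

theorem zero_mem_source : (0 : D.𝔥 × (ℝ × B.W)) ∈ B.h.source := by
  rw [B.source_eq]; exact Metric.mem_ball_self B.δ_pos

theorem mem_target : y ∈ B.h.target := by
  have h := B.h.map_source B.zero_mem_source
  rwa [B.h_zero] at h

theorem symm_self : B.h.symm y = 0 := by
  have h := B.h.left_inv B.zero_mem_source
  rwa [B.h_zero] at h

end Box

variable [IsManifold (𝓡 7) ∞ M] (hs : IsSmoothAction M)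
include hs

omit [IsManifold (𝓡 7) ∞ M] in
/-- The differential of the coordinates. -/
theorem Box.exists_derivatives {y : M} (B : D.Box y) {z : M} (hz : z ∈ B.h.target) :
    ∃ (A : D.𝔥 × (ℝ × B.W) →L[ℝ] E7) (A' : E7 →L[ℝ] D.𝔥 × (ℝ × B.W)),
      HasMFDerivAt 𝓘(ℝ, D.𝔥 × (ℝ × B.W)) (𝓡 7) B.h (B.h.symm z) A ∧
      HasMFDerivAt (𝓡 7) 𝓘(ℝ, D.𝔥 × (ℝ × B.W)) B.h.symm z A' ∧
      (∀ q, A' (A q) = q) ∧ (∀ v, A (A' v) = v) ∧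
      ∀ (a : D.𝔥) (t : ℝ), A (a, (t, 0)) = (fundField z a + t • D.Y z : TangentSpace (𝓡 7) z) := by
  have hd : B.h.MDifferentiable 𝓘(ℝ, D.𝔥 × (ℝ × B.W)) (𝓡 7) :=
    ⟨B.smooth.mdifferentiableOn (by simp), B.smooth_symm.mdifferentiableOn (by simp)⟩
  have hp := B.h.map_target hz
  set p := B.h.symm z with hpz
  have hhp : B.h p = z := B.h.right_inv hz
  have hdp := hd.mdifferentiableAt hp
  let A : D.𝔥 × (ℝ × B.W) →L[ℝ] E7 := mfderiv 𝓘(ℝ, D.𝔥 × (ℝ × B.W)) (𝓡 7) B.h p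
  let A' : E7 →L[ℝ] D.𝔥 × (ℝ × B.W) := mfderiv (𝓡 7) 𝓘(ℝ, D.𝔥 × (ℝ × B.W)) B.h.symm z
  refine ⟨A, A', hdp.hasMFDerivAt, (hd.mdifferentiableAt_symm hz).hasMFDerivAt, fun q => ?_,
    fun v => ?_, fun a t => ?_⟩
  · have h1 := hd.symm_comp_deriv hp
    rw [hhp] at h1
    exact DFunLike.congr_fun h1 q
  · exact DFunLike.congr_fun (hd.comp_symm_deriv hz) v
  · have e0 : A (a, (t, 0)) = A (a, 0) + t • A (0, (1, 0)) := by
      rw [← map_smul, ← map_add]; simp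
    have hc : ∀ v : D.𝔥 × (ℝ × B.W), ∀ᶠ r : ℝ in 𝓝 0, p + r • v ∈ B.h.source := by
      intro v
      have hc : Continuous (fun r : ℝ => p + r • v) := by fun_prop
      refine hc.continuousAt.eventually (B.h.open_source.mem_nhds ?_)
      show p + (0 : ℝ) • v ∈ B.h.source
      rw [zero_smul, add_zero]; exact hp
    have e1 : A (a, 0) = fundField z a := by
      have h1 := hasVelocity_parametrization hdp ((a, 0) : D.𝔥 × (ℝ × B.W))
      have h2 := hasVelocity_lieExp_smul_zero hs z a
      refine h1.unique (h2.congr_of_eventuallyEq ?_)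
      filter_upwards [hc (a, 0)] with r hr
      have e : p + r • ((a, 0) : D.𝔥 × (ℝ × B.W)) = ((r • a) + p.1, p.2) := by
        ext1
        · exact add_comm _ _
        · show p.2 + r • (0 : ℝ × B.W) = p.2
          rw [smul_zero, add_zero]
      rw [e] at hr ⊢
      rw [B.translate _ _ hp hr, hhp]
      rfl
    have e2 : A (0, (1, 0)) = D.Y z := by
      have h1 := hasVelocity_parametrization hdp ((0, (1, 0)) : D.𝔥 × (ℝ × B.W))
      have h2 := (B.line p hp).comp (σ := fun r => p.2.1 + r) (s := 0) (add_zero _)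
        ((hasDerivAt_id 0).const_add _)
      have e : (fun r : ℝ => B.h (p + r • ((0, (1, 0)) : D.𝔥 × (ℝ × B.W)))) =
          fun r : ℝ => B.h (p.1, (p.2.1 + r, p.2.2)) := by
        funext r
        congr 1
        ext1
        · show p.1 + r • (0 : D.𝔥) = p.1
          rw [smul_zero, add_zero]
        · ext1
          · show p.2.1 + r • 1 = p.2.1 + r
            rw [smul_eq_mul, mul_one]
          · show p.2.2 + r • (0 : B.W) = p.2.2
            rw [smul_zero, add_zero]
      rw [e] at h1
      have e4 : ∀ z' : M, z' = z → (D.Y z' : E7) = D.Y z := by rintro _ rfl; rfl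
      exact (h1.unique h2).trans (e4 _ hhp)
    rw [e0, e1, e2]
    rfl

/-- `γ` is an integral curve of the vector field in `P` on the interval `(a, b)`. -/
def IsIntegral (D : LeafData M) (γ : ℝ → M) (a b : ℝ) : Prop :=
  ∀ s ∈ Set.Ioo a b, γ s ∈ D.P ∧ HasVelocity γ s (D.Y (γ s) : E7)

omit [IsManifold (𝓡 7) ∞ M] hs in
theorem IsIntegral.continuousAt {γ : ℝ → M} {a b : ℝ} (h : D.IsIntegral γ a b) {s : ℝ}
    (hs : s ∈ Set.Ioo a b) : ContinuousAt γ s := (h s hs).2.continuousAt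

omit [IsManifold (𝓡 7) ∞ M] hs in
theorem IsIntegral.comp_sub {γ : ℝ → M} {a b : ℝ} (h : D.IsIntegral γ a b) (c : ℝ) :
    D.IsIntegral (fun s => γ (s - c)) (a + c) (b + c) := by
  intro s hs
  have hs' : s - c ∈ Set.Ioo a b := ⟨by linarith [hs.1], by linarith [hs.2]⟩
  exact ⟨(h _ hs').1, (h _ hs').2.comp rfl ((hasDerivAt_id s).sub_const c)⟩

omit [IsManifold (𝓡 7) ∞ M] in
theorem IsIntegral.smul {γ : ℝ → M} {a b : ℝ} (h : D.IsIntegral γ a b) {g : T2SU2}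
    (hP : ∀ x ∈ D.P, g • x ∈ D.P) (hY : ∀ x ∈ D.P, smulDeriv g x (D.Y x) = D.Y (g • x)) :
    D.IsIntegral (fun s => g • γ s) a b := by
  intro s hs'
  have h1 := (h s hs').2.map (hasMFDerivAt_smul hs g _)
  refine ⟨hP _ (h s hs').1, ?_⟩
  exact (congrArg (fun v : E7 => HasVelocity (fun s => g • γ s) s v) (hY _ (h s hs').1)).mp h1

omit [IsManifold (𝓡 7) ∞ M] hs in
/-- The derivative of a function along an integral curve. -/
theorem IsIntegral.hasDerivAt {γ : ℝ → M} {a b : ℝ} (h : D.IsIntegral γ a b) {q : M → ℝ}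
    (hq : ContMDiff (𝓡 7) 𝓘(ℝ, ℝ) ∞ q) {s : ℝ} (hs' : s ∈ Set.Ioo a b) :
    HasDerivAt (fun s => q (γ s)) (differential q (γ s) (D.Y (γ s))) s :=
  (h s hs').2.hasDerivAt (hasMFDerivAt_differential hq (γ s))

/-- Since `Y f = 1`, the function `f` is a clock on the integral curves; leaves can therefore be
parametrised by the value of `f`. -/
theorem IsIntegral.f_eq {γ : ℝ → M} {a b : ℝ} (h : D.IsIntegral γ a b) {s t : ℝ}
    (hs' : s ∈ Set.Ioo a b) (ht : t ∈ Set.Ioo a b) : D.f (γ t) = D.f (γ s) + (t - s) := by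
  have h1 := eq_of_hasDerivAt_zero (u := fun r => D.f (γ r) - r) (a := a) (b := b) (fun r hr => by
    have := (h.hasDerivAt D.smooth_f hr).sub (hasDerivAt_id r)
    rw [D.differential_Y _ (h r hr).1, sub_self] at this
    exact this) hs' ht
  linarith

/-- The local form of the integral curves. -/
theorem Box.eventually_symm_eq {γ : ℝ → M} {a b s₀ : ℝ} (h : D.IsIntegral γ a b)
    (hs₀ : s₀ ∈ Set.Ioo a b) (B : D.Box (γ s₀)) :
    ∀ᶠ s in 𝓝 s₀, γ s ∈ B.h.target ∧ B.h.symm (γ s) = (0, (s - s₀, 0)) := by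
  have hev : ∀ᶠ s in 𝓝 s₀, γ s ∈ B.h.target :=
    (h.continuousAt hs₀).eventually (B.h.open_target.mem_nhds B.mem_target)
  -- In the box the curve and the `t`-line have the same velocity, so their difference is locally
  -- constant.
  have hd : ∀ᶠ s in 𝓝 s₀, HasDerivAt
      (fun s => B.h.symm (γ s) - ((0, (s - s₀, 0)) : D.𝔥 × (ℝ × B.W))) 0 s := by
    filter_upwards [hev, isOpen_Ioo.mem_nhds hs₀] with s h1 h2
    obtain ⟨A, A', hA, hA', hAA, -, hAY⟩ := B.exists_derivatives hs h1
    have h3 := (h s h2).2.hasDerivAt hA'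
    have h4 : A' (D.Y (γ s) : E7) = ((0, (1, 0)) : D.𝔥 × (ℝ × B.W)) := by
      rw [← hAA (0, (1, 0)), hAY]
      congr 1
      have : fundField (γ s) ((0 : D.𝔥) : LieT2SU2) + (1 : ℝ) • D.Y (γ s) = D.Y (γ s) := by
        rw [one_smul]
        exact (congrArg (fun v => v + D.Y (γ s)) (map_zero (fundField (γ s)))).trans (zero_add _)
      exact this.symm
    have h5 : HasDerivAt (fun s : ℝ => ((0, (s - s₀, 0)) : D.𝔥 × (ℝ × B.W))) (0, (1, 0)) s :=
      (hasDerivAt_const s (0 : D.𝔥)).prodMk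
        (((hasDerivAt_id s).sub_const s₀).prodMk (hasDerivAt_const s (0 : B.W)))
    have h6 := h3.sub h5
    have h7 : A' (D.Y (γ s) : E7) - ((0, (1, 0)) : D.𝔥 × (ℝ × B.W)) = 0 := sub_eq_zero.2 h4
    exact h7 ▸ h6
  filter_upwards [hev, eventually_eq_of_hasDerivAt_zero hd] with s h1 h2
  refine ⟨h1, ?_⟩
  rw [B.symm_self, sub_self] at h2
  have h3 : (0 : D.𝔥 × (ℝ × B.W)) - (0, ((0 : ℝ), 0)) = 0 := sub_self _
  exact sub_eq_zero.1 (h2.trans h3)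

/-- The set of agreement is open, since in a box an integral curve is locally determined by one
point, and closed because `M` is Hausdorff. -/
theorem IsIntegral.eqOn [T2Space M] {γ γ' : ℝ → M} {a b s₀ : ℝ} (h : D.IsIntegral γ a b)
    (h' : D.IsIntegral γ' a b) (hs₀ : s₀ ∈ Set.Ioo a b) (h0 : γ s₀ = γ' s₀) :
    Set.EqOn γ γ' (Set.Ioo a b) := by
  intro s hs'
  refine (isPreconnected_Ioo.iff_of_eventually (Q := fun s => γ s = γ' s) (fun t ht => ?_)
    hs₀ hs').1 h0
  apply Filter.Eventually.filter_mono nhdsWithin_le_nhds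
  by_cases hq : γ t = γ' t
  · obtain ⟨B⟩ := D.nonempty_box hs (h t ht).1
    have e1 := Box.eventually_symm_eq hs h ht B
    have e2 : ∀ᶠ s in 𝓝 t, γ' s ∈ B.h.target ∧ B.h.symm (γ' s) = (0, (s - t, 0)) := by
      obtain ⟨z, hz⟩ : ∃ z, γ t = z := ⟨_, rfl⟩
      have : ∀ (z : M) (B : D.Box z), z = γ' t →
          ∀ᶠ s in 𝓝 t, γ' s ∈ B.h.target ∧ B.h.symm (γ' s) = (0, (s - t, 0)) := by
        rintro _ B rfl
        exact Box.eventually_symm_eq hs h' ht B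
      exact this _ B hq
    filter_upwards [e1, e2] with s k1 k2
    refine iff_of_true hq ?_
    rw [← B.h.right_inv k1.1, ← B.h.right_inv k2.1, k1.2, k2.2]
  · have e1 := (h.continuousAt ht).prodMk (h'.continuousAt ht)
    have e2 : ∀ᶠ s in 𝓝 t, ¬γ s = γ' s :=
      e1.eventually ((isClosed_diagonal (X := M)).isOpen_compl.mem_nhds hq)
    filter_upwards [e2] with s k1
    exact iff_of_false hq k1

theorem IsIntegral.glue [T2Space M] {γ γ' : ℝ → M} {a b c d s₀ : ℝ} (h : D.IsIntegral γ a b)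
    (h' : D.IsIntegral γ' c d) (hs₀ : s₀ ∈ Set.Ioo a b) (hs₀' : s₀ ∈ Set.Ioo c d)
    (h0 : γ s₀ = γ' s₀) : ∃ Γ : ℝ → M, D.IsIntegral Γ (min a c) (max b d) ∧
      Set.EqOn Γ γ (Set.Ioo a b) ∧ Set.EqOn Γ γ' (Set.Ioo c d) := by
  classical
  have e1 : Set.EqOn (fun s => if s ∈ Set.Ioo a b then γ s else γ' s) γ (Set.Ioo a b) :=
    fun s hs' => if_pos hs'
  have e2 : Set.EqOn (fun s => if s ∈ Set.Ioo a b then γ s else γ' s) γ' (Set.Ioo c d) := by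
    intro s hs'
    by_cases hsab : s ∈ Set.Ioo a b
    · refine (if_pos hsab).trans ?_
      have k1 : D.IsIntegral γ (max a c) (min b d) := fun r hr => h r
        ⟨(le_max_left _ _).trans_lt hr.1, hr.2.trans_le (min_le_left _ _)⟩
      have k2 : D.IsIntegral γ' (max a c) (min b d) := fun r hr => h' r
        ⟨(le_max_right _ _).trans_lt hr.1, hr.2.trans_le (min_le_right _ _)⟩
      exact k1.eqOn hs k2 ⟨max_lt hs₀.1 hs₀'.1, lt_min hs₀.2 hs₀'.2⟩ h0
        ⟨max_lt hsab.1 hs'.1, lt_min hsab.2 hs'.2⟩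
    · exact if_neg hsab
  refine ⟨fun s => if s ∈ Set.Ioo a b then γ s else γ' s, ?_, e1, e2⟩
  have key : ∀ {δ : ℝ → M} {a' b' : ℝ}, D.IsIntegral δ a' b' →
      Set.EqOn (fun s => if s ∈ Set.Ioo a b then γ s else γ' s) δ (Set.Ioo a' b') →
      ∀ s ∈ Set.Ioo a' b', (if s ∈ Set.Ioo a b then γ s else γ' s) ∈ D.P ∧
        HasVelocity (fun s => if s ∈ Set.Ioo a b then γ s else γ' s) s
          (D.Y (if s ∈ Set.Ioo a b then γ s else γ' s) : E7) := by
    intro δ a' b' hδ he s hs'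
    have k1 := he hs'
    simp only at k1
    rw [k1]
    refine ⟨(hδ s hs').1, ?_⟩
    exact (hδ s hs').2.congr_of_eventuallyEq (he.eventuallyEq_of_mem (isOpen_Ioo.mem_nhds hs'))
  intro s hs'
  have hcase : s ∈ Set.Ioo a b ∨ s ∈ Set.Ioo c d := by
    rcases le_total s s₀ with hle | hle
    · rcases min_lt_iff.1 hs'.1 with k | k
      · exact Or.inl ⟨k, hle.trans_lt hs₀.2⟩
      · exact Or.inr ⟨k, hle.trans_lt hs₀'.2⟩
    · rcases lt_max_iff.1 hs'.2 with k | k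
      · exact Or.inl ⟨hs₀.1.trans_le hle, k⟩
      · exact Or.inr ⟨hs₀'.1.trans_le hle, k⟩
  rcases hcase with k | k
  · exact key h e1 s k
  · exact key h' e2 s k

end LeafData
end Leaf

/-! ### The leaves as embedded submanifolds -/

section Leaf

variable {M : Type*} [TopologicalSpace M] [ChartedSpace E7 M] [MulAction T2SU2 M]

namespace LeafData

variable {D : LeafData M}

/-- The leaf through `x`: the union of the `K`-orbits that meet the integral curve through `x`. -/
def leaf (D : LeafData M) (x : M) : Set M :=
  {y | ∃ (γ : ℝ → M) (a b : ℝ), D.f x ∈ Set.Ioo a b ∧ D.f y ∈ Set.Ioo a b ∧ D.IsIntegral γ a b ∧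
    γ (D.f x) = x ∧ ∃ k ∈ D.K, k • γ (D.f y) = y}

theorem leaf_subset {x : M} : D.leaf x ⊆ D.P := by
  rintro y ⟨γ, a, b, -, hb, hγ, -, k, hk, h⟩
  exact h ▸ D.smul_mem k hk _ (hγ _ hb).1

theorem smul_mem_leaf {x y : M} (h : y ∈ D.leaf x) {k : T2SU2} (hk : k ∈ D.K) :
    k • y ∈ D.leaf x := by
  obtain ⟨γ, a, b, h1, h2, h3, h4, k', hk', h5⟩ := h
  refine ⟨γ, a, b, h1, ?_, h3, h4, k * k', D.K.mul_mem hk hk', ?_⟩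
  · rwa [D.f_smul k hk]
  · rw [D.f_smul k hk, mul_smul, h5]

theorem exists_smul_eq_of_mem_leaf {x y : M} (h : y ∈ D.leaf x) (hf : D.f y = D.f x) :
    ∃ k ∈ D.K, k • x = y := by
  obtain ⟨γ, a, b, -, -, -, h4, k, hk, h5⟩ := h
  rw [hf, h4] at h5
  exact ⟨k, hk, h5⟩

variable [IsManifold (𝓡 7) ∞ M] (hs : IsSmoothAction M)
include hs

theorem leaf_symm {x y : M} (h : y ∈ D.leaf x) : x ∈ D.leaf y := by
  obtain ⟨γ, a, b, h1, h2, h3, h4, k, hk, h5⟩ := h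
  refine ⟨fun s => k • γ s, a, b, h2, h1, h3.smul hs (D.smul_mem k hk) (D.smulDeriv_Y k hk), h5,
    k⁻¹, D.K.inv_mem hk, ?_⟩
  rw [inv_smul_smul, h4]

/-- The second curve, moved by `k⁻¹`, meets the first one at time `f y`, and the two are glued
there. -/
theorem leaf_trans [T2Space M] {x y z : M} (h : y ∈ D.leaf x) (h' : z ∈ D.leaf y) :
    z ∈ D.leaf x := by
  obtain ⟨γ, a, b, h1, h2, h3, h4, k, hk, h5⟩ := h
  obtain ⟨γ', a', b', h1', h2', h3', h4', k', hk', h5'⟩ := h'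
  have hk1 := D.K.inv_mem hk
  have h6 : γ (D.f y) = k⁻¹ • γ' (D.f y) := by
    rw [h4']; exact (inv_smul_eq_iff.2 h5.symm).symm
  obtain ⟨Γ, hΓ, e1, e2⟩ := h3.glue hs (h3'.smul hs (D.smul_mem _ hk1) (D.smulDeriv_Y _ hk1)) h2 h1' h6
  have hsub : Set.Ioo a b ⊆ Set.Ioo (min a a') (max b b') :=
    Set.Ioo_subset_Ioo (min_le_left _ _) (le_max_left _ _)
  have hsub' : Set.Ioo a' b' ⊆ Set.Ioo (min a a') (max b b') :=
    Set.Ioo_subset_Ioo (min_le_right _ _) (le_max_right _ _)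
  refine ⟨Γ, _, _, hsub h1, hsub' h2', hΓ, (e1 h1).trans h4, k' * k, D.K.mul_mem hk' hk, ?_⟩
  rw [e2 h2', mul_smul, smul_inv_smul, h5']

theorem leaf_eq [T2Space M] {x y : M} (h : y ∈ D.leaf x) : D.leaf y = D.leaf x :=
  Set.Subset.antisymm (fun _ hz => leaf_trans hs h hz) fun _ hz => leaf_trans hs (leaf_symm hs h) hz

/-- A symmetry of the data maps leaves to leaves. -/
theorem smul_mem_leaf_smul {x y : M} (h : y ∈ D.leaf x) {g : T2SU2}
    (hP : ∀ x ∈ D.P, g • x ∈ D.P) (hY : ∀ x ∈ D.P, smulDeriv g x (D.Y x) = D.Y (g • x))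
    (hf : ∀ x, D.f (g • x) = D.f x) (hK : ∀ k ∈ D.K, g * k * g⁻¹ ∈ D.K) :
    g • y ∈ D.leaf (g • x) := by
  obtain ⟨γ, a, b, h1, h2, h3, h4, k, hk, h5⟩ := h
  refine ⟨fun s => g • γ s, a, b, by rwa [hf], by rwa [hf], h3.smul hs hP hY, ?_,
    g * k * g⁻¹, hK k hk, ?_⟩
  · show g • γ (D.f (g • x)) = g • x
    rw [hf, h4]
  · show (g * k * g⁻¹) • g • γ (D.f (g • y)) = g • y
    have e : g * k * g⁻¹ * g = g * k := inv_mul_cancel_right (g * k) g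
    rw [hf, smul_smul, e, mul_smul, h5]

/-- A `K`-invariant function annihilated by the vector field is constant on the leaves. -/
theorem eq_of_mem_leaf {x y : M} (h : y ∈ D.leaf x) {q : M → ℝ}
    (hq : ContMDiff (𝓡 7) 𝓘(ℝ, ℝ) ∞ q) (hK : ∀ k ∈ D.K, ∀ x, q (k • x) = q x)
    (hY : ∀ z ∈ D.leaf x, differential q z (D.Y z) = 0) : q y = q x := by
  obtain ⟨γ, a, b, h1, h2, h3, h4, k, hk, h5⟩ := h
  have hmem : ∀ s ∈ Set.Ioo a b, γ s ∈ D.leaf x := by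
    intro s hs'
    have e : D.f (γ s) = s := by rw [h3.f_eq hs h1 hs', h4]; ring
    exact ⟨γ, a, b, h1, e.symm ▸ hs', h3, h4, 1, D.K.one_mem, by rw [e, one_smul]⟩
  have h6 := eq_of_hasDerivAt_zero (u := fun s => q (γ s)) (a := a) (b := b) (fun s hs' => by
    have := h3.hasDerivAt hq hs'
    rwa [hY _ (hmem s hs')] at this) h2 h1
  rw [← h5, hK k hk, h6, h4]

theorem Box.isIntegral_line {y : M} (B : D.Box y) {a : D.𝔥} {w : B.W} (ha : ‖a‖ < B.δ)
    (hw : ‖w‖ < B.δ) : D.IsIntegral (fun r => B.h (a, (r, w))) (-B.δ) B.δ := by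
  intro r hr
  have hp : (a, (r, w)) ∈ B.h.source := B.mem_source.2 ⟨ha, abs_lt.2 hr, hw⟩
  exact ⟨B.mem _ hp, B.line _ hp⟩

theorem Box.f_eq {y : M} (B : D.Box y) {p p' : D.𝔥 × (ℝ × B.W)} (hp : p ∈ B.h.source)
    (hp' : p' ∈ B.h.source) (hpp : p'.2.2 = p.2.2) :
    D.f (B.h p') = D.f (B.h p) + (p'.2.1 - p.2.1) := by
  obtain ⟨h1, h2, h3⟩ := B.mem_source.1 hp
  obtain ⟨h1', h2', h3'⟩ := B.mem_source.1 hp'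
  have hq : (p.1, p'.2) ∈ B.h.source := B.mem_source.2 ⟨h1, h2', h3'⟩
  have e1 := B.translate (p'.1 - p.1) (p.1, p'.2) hq (by rw [sub_add_cancel]; exact hp')
  rw [sub_add_cancel] at e1
  have e2 := (B.isIntegral_line hs h1 h3).f_eq hs (abs_lt.1 h2) (abs_lt.1 h2')
  have e3 : (p.1, p'.2) = (p.1, (p'.2.1, p.2.2)) := by rw [← hpp]
  have e4 : D.f (B.h p') = D.f (B.h (p.1, p'.2)) := by
    rw [← D.f_smul _ (D.lieExp_mem _ (p'.1 - p.1).2) (B.h (p.1, p'.2))]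
    exact congrArg D.f e1
  rw [e4, e3]
  exact e2

/-- Within a plaque, move along the `t`-line and then by an element of `K`. -/
theorem Box.mem_leaf {y : M} (B : D.Box y) {p p' : D.𝔥 × (ℝ × B.W)} (hp : p ∈ B.h.source)
    (hp' : p' ∈ B.h.source) (hpp : p'.2.2 = p.2.2) : B.h p' ∈ D.leaf (B.h p) := by
  obtain ⟨h1, h2, h3⟩ := B.mem_source.1 hp
  obtain ⟨h1', h2', h3'⟩ := B.mem_source.1 hp'
  have hq : (p.1, p'.2) ∈ B.h.source := B.mem_source.2 ⟨h1, h2', h3'⟩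
  have e1 := B.translate (p'.1 - p.1) (p.1, p'.2) hq (by rw [sub_add_cancel]; exact hp')
  rw [sub_add_cancel] at e1
  -- The line is reparametrised so that time equals the value of `f`, as the definition of `leaf`
  -- requires.
  have e2 := (B.isIntegral_line hs h1 h3).comp_sub (D.f (B.h p) - p.2.1)
  have e3 := B.f_eq hs hp hp' hpp
  refine ⟨_, _, _, ?_, ?_, e2, ?_, lieExp (p'.1 - p.1 : D.𝔥), D.lieExp_mem _ (p'.1 - p.1).2, ?_⟩
  · have := abs_lt.1 h2
    constructor <;> linarith
  · rw [e3]
    have := abs_lt.1 h2'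
    constructor <;> linarith
  · show B.h (p.1, (D.f (B.h p) - (D.f (B.h p) - p.2.1), p.2.2)) = B.h p
    rw [sub_sub_cancel]
  · show lieExp (p'.1 - p.1 : D.𝔥) • B.h (p.1, (D.f (B.h p') - (D.f (B.h p) - p.2.1), p.2.2)) = B.h p'
    have e4 : D.f (B.h p') - (D.f (B.h p) - p.2.1) = p'.2.1 := by rw [e3]; ring
    rw [e4, ← hpp]
    exact e1.symm

theorem mem_leaf_self {x : M} (hx : x ∈ D.P) : x ∈ D.leaf x := by
  obtain ⟨B⟩ := D.nonempty_box hs hx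
  have := B.mem_leaf hs B.zero_mem_source B.zero_mem_source rfl
  rwa [B.h_zero] at this

/-- The torus is the image of its Lie algebra, so each point is joined to `x` inside the image of
the connected set `𝔥 × (a, b)` under `(ξ, s) ↦ exp(ξ) • γ s`. -/
theorem isConnected_leaf {x : M} (hx : x ∈ D.P) : IsConnected (D.leaf x) := by
  refine ⟨⟨x, mem_leaf_self hs hx⟩, isPreconnected_of_forall x ?_⟩
  rintro y ⟨γ, a, b, h1, h2, h3, h4, k, hk, h5⟩
  obtain ⟨ξ, hξ, rfl⟩ := D.exists_lieExp k hk
  have := hs.continuousSMul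
  refine ⟨(fun p : D.𝔥 × ℝ => lieExp p.1 • γ p.2) '' (Set.univ ×ˢ Set.Ioo a b), ?_,
    ⟨(0, D.f x), ⟨trivial, h1⟩, ?_⟩, ⟨(⟨ξ, D.C_subset hξ⟩, D.f y), ⟨trivial, h2⟩, h5⟩, ?_⟩
  · rintro _ ⟨p, ⟨-, hp⟩, rfl⟩
    have e : D.f (lieExp p.1 • γ p.2) = p.2 := by
      rw [D.f_smul _ (D.lieExp_mem _ p.1.2), h3.f_eq hs h1 hp, h4]; ring
    exact ⟨γ, a, b, h1, e.symm ▸ hp, h3, h4, _, D.lieExp_mem _ p.1.2, by rw [e]⟩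
  · show lieExp 0 • γ (D.f x) = x
    rw [lieExp_zero, one_smul, h4]
  · refine (isPreconnected_univ.prod isPreconnected_Ioo).image _ ?_
    have hγ : ContinuousOn γ (Set.Ioo a b) := fun s hs' => (h3.continuousAt hs').continuousWithinAt
    exact ((continuous_lieExp.comp (continuous_subtype_val.comp continuous_fst)).continuousOn).smul
      (hγ.comp continuous_snd.continuousOn fun p hp => hp.2)

/-- Near `y`, the `K`-orbit of `y` is contained in a plaque. -/
theorem Box.eventually_of_smul_eq [T2Space M] {y : M} (B : D.Box y) :
    ∀ᶠ q in 𝓝 y, ∀ k ∈ D.K, k • y = q → (B.h.symm q).2.2 = 0 := by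
  have hcs := hs.continuousSMul
  have key : ∀ᶠ q in 𝓝 y, ∀ ξ ∈ D.C, ξ ∈ D.𝔥 → lieExp ξ • y = q → (B.h.symm q).2.2 = 0 := by
    apply D.isCompact_C.eventually_forall_of_forall_eventually
    intro ξ hξ
    -- Elements close to one that fixes `y` move `y` by a small translation inside its plaque;
    -- elements close to one that moves `y` do not bring `y` near itself.
    by_cases hy : lieExp ξ • y = y
    · have hc : Continuous (fun z : M × LieT2SU2 => ‖z.2 - ξ‖) := by fun_prop
      have h2 : ‖(y, ξ).2 - ξ‖ < B.δ := by simpa using B.δ_pos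
      filter_upwards [hc.continuousAt.eventually (isOpen_Iio.mem_nhds h2)] with z hz hz𝔥 hzq
      have hd : z.2 - ξ ∈ D.𝔥 := D.𝔥.sub_mem hz𝔥 (D.C_subset hξ)
      have hp : ((⟨z.2 - ξ, hd⟩ + 0, 0) : D.𝔥 × (ℝ × B.W)) ∈ B.h.source := by
        rw [add_zero]
        exact B.mem_source.2 ⟨hz, by simpa using B.δ_pos, by simpa using B.δ_pos⟩
      have h3 := B.translate ⟨z.2 - ξ, hd⟩ 0 B.zero_mem_source hp
      have h4 : lieExp z.2 = lieExp (z.2 - ξ) * lieExp ξ := by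
        rw [← lieExp_add (D.commute _ hd _ (D.C_subset hξ)), sub_add_cancel]
      rw [h4, mul_smul, hy] at hzq
      rw [B.h_zero] at h3
      rw [← hzq, ← h3]
      exact congrArg (fun p => p.2.2) (B.h.left_inv hp)
    · have hc : Continuous (fun z : M × LieT2SU2 => lieExp z.2 • y) :=
        (continuous_lieExp.comp continuous_snd).smul continuous_const
      have hne := (isOpen_ne_fun hc continuous_fst).mem_nhds (x := (y, ξ)) hy
      filter_upwards [hne] with z hz _ hzz
      exact absurd hzz hz
  filter_upwards [key] with q hq k hk hkq
  obtain ⟨ξ, hξ, rfl⟩ := D.exists_lieExp k hk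
  exact hq ξ hξ (D.C_subset hξ) hkq

/-- Near each of its points, a leaf consists of one plaque. -/
theorem Box.eventually_mem_leaf_iff [T2Space M] {x y : M} (hy : y ∈ D.leaf x) (B : D.Box y) :
    ∀ᶠ z in 𝓝 y, z ∈ B.h.target ∧ (z ∈ D.leaf x ↔ (B.h.symm z).2.2 = 0) := by
  let w : M → B.W := fun z => (B.h.symm z).2.2
  have hw : ContinuousAt w y := (B.h.symm.continuousAt B.mem_target).snd.snd
  have hwy : w y = 0 := by
    show (B.h.symm y).2.2 = 0
    rw [B.symm_self]; rfl
  have hh0 : ContinuousAt B.h 0 := B.h.continuousAt B.zero_mem_source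
  -- The point `(0, t z, w z)` of the plaque of `z` lies on the level `f = f y`. A leaf through `y`
  -- meets that level only in the `K`-orbit of `y`, which near `y` has transverse coordinate zero.
  -- So near `y` the leaf has no plaque other than `w = 0`.
  let t : M → ℝ := fun z => D.f y - D.f (B.h (0, (0, w z)))
  have hty : t y = 0 := by
    show D.f y - D.f (B.h (0, (0, w y))) = 0
    rw [hwy]
    show D.f y - D.f (B.h 0) = 0
    rw [B.h_zero, sub_self]
  have hc1 : ContinuousAt (fun z => ((0, (0, w z)) : D.𝔥 × (ℝ × B.W))) y :=
    continuousAt_const.prodMk (continuousAt_const.prodMk hw)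
  have hc2 : ContinuousAt (fun z => B.h (0, (0, w z))) y := by
    refine ContinuousAt.comp (f := fun z => ((0, (0, w z)) : D.𝔥 × (ℝ × B.W))) ?_ hc1
    show ContinuousAt B.h (0, (0, w y))
    rw [hwy]; exact hh0
  have ht : ContinuousAt t y := continuousAt_const.sub
    (D.smooth_f.continuous.continuousAt.comp hc2)
  have hc3 : ContinuousAt (fun z => ((0, (t z, w z)) : D.𝔥 × (ℝ × B.W))) y :=
    continuousAt_const.prodMk (ht.prodMk hw)
  have hq0 : ((0, (t y, w y)) : D.𝔥 × (ℝ × B.W)) = 0 := by rw [hty, hwy]; rfl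
  have hc4 : ContinuousAt (fun z => B.h (0, (t z, w z))) y := by
    refine ContinuousAt.comp (f := fun z => ((0, (t z, w z)) : D.𝔥 × (ℝ × B.W))) ?_ hc3
    rw [hq0]; exact hh0
  have hqy : B.h (0, (t y, w y)) = y := by rw [hq0, B.h_zero]
  have ev1 : ∀ᶠ z in 𝓝 y, z ∈ B.h.target := B.h.open_target.mem_nhds B.mem_target
  have ev2 : ∀ᶠ z in 𝓝 y, ((0, (t z, w z)) : D.𝔥 × (ℝ × B.W)) ∈ B.h.source :=
    hc3.eventually (B.h.open_source.mem_nhds (by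
      show ((0, (t y, w y)) : D.𝔥 × (ℝ × B.W)) ∈ B.h.source
      rw [hq0]; exact B.zero_mem_source))
  have ev3 : ∀ᶠ z in 𝓝 y, ∀ k ∈ D.K, k • y = B.h (0, (t z, w z)) →
      (B.h.symm (B.h (0, (t z, w z)))).2.2 = 0 := by
    have h : Filter.Tendsto (fun z => B.h (0, (t z, w z))) (𝓝 y) (𝓝 y) := by
      have h := hc4.tendsto
      rwa [hqy] at h
    exact h.eventually (B.eventually_of_smul_eq hs)
  filter_upwards [ev1, ev2, ev3] with z h1 h2 h3
  refine ⟨h1, fun hz => ?_, fun hz => ?_⟩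
  · have hzy := leaf_trans hs (leaf_symm hs hy) hz
    have hp := B.h.map_target h1
    have e1 := B.mem_leaf hs hp h2 rfl
    rw [B.h.right_inv h1] at e1
    have e2 := leaf_trans hs hzy e1
    have h0 : ((0, (0, w z)) : D.𝔥 × (ℝ × B.W)) ∈ B.h.source := by
      obtain ⟨k1, -, k3⟩ := B.mem_source.1 h2
      exact B.mem_source.2 ⟨k1, by simpa using B.δ_pos, k3⟩
    have e3 : D.f (B.h (0, (t z, w z))) = D.f y := by
      rw [B.f_eq hs h0 h2 rfl]
      show D.f (B.h (0, (0, w z))) + (t z - 0) = D.f y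
      simp only [t]; ring
    obtain ⟨k, hk, e4⟩ := exists_smul_eq_of_mem_leaf e2 e3
    have e5 := h3 k hk e4
    rw [B.h.left_inv h2] at e5
    exact e5
  · have e1 := B.mem_leaf hs B.zero_mem_source (B.h.map_target h1) hz
    rw [B.h.right_inv h1, B.h_zero] at e1
    exact leaf_trans hs hy e1

/-- The leaves are embedded submanifolds. -/
theorem isSubmanifold_leaf [T2Space M] (x : M) :
    IsSubmanifold (Module.finrank ℝ D.𝔥 + 1) (D.leaf x) := by
  intro y hy
  obtain ⟨B⟩ := D.nonempty_box hs (leaf_subset hy)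
  obtain ⟨N, hN, hNo, hyN⟩ := eventually_nhds_iff.1 (B.eventually_mem_leaf_iff hs hy)
  have hdim : Module.finrank ℝ (D.𝔥 × (ℝ × B.W)) = Module.finrank ℝ E7 := by
    have h7 : Module.finrank ℝ E7 = 7 := finrank_euclideanSpace_fin
    have hW := B.finrank_W
    rw [Module.finrank_prod, Module.finrank_prod, Module.finrank_self, h7]
    omega
  let e := ContinuousLinearEquiv.ofFinrankEq hdim
  let c : OpenPartialHomeomorph M E7 := (B.h.symm.restrOpen N hNo).trans
    e.toHomeomorph.toOpenPartialHomeomorph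
  have hcs : c.source = B.h.target ∩ N := by
    show B.h.target ∩ N ∩ _ = _
    exact Set.inter_univ _
  let pr : (D.𝔥 × (ℝ × B.W)) →ₗ[ℝ] B.W := LinearMap.snd ℝ ℝ B.W ∘ₗ LinearMap.snd ℝ D.𝔥 (ℝ × B.W)
  have hpr : Function.Surjective pr := fun w => ⟨(0, (0, w)), rfl⟩
  refine ⟨c, c.mem_maximalAtlas_of_contMDiffOn ?_ ?_, ?_, (LinearMap.ker pr).map
    (e : (D.𝔥 × (ℝ × B.W)) →ₗ[ℝ] E7), ?_, fun z hz => ?_⟩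
  · rw [hcs]
    exact (e.contDiff.contMDiff.comp_contMDiffOn (B.smooth_symm.mono Set.inter_subset_left))
  · refine ContMDiffOn.comp (t := B.h.source) B.smooth
      (e.symm.contDiff.contMDiff.contMDiffOn) fun z hz => ?_
    exact hz.2.1
  · rw [hcs]; exact ⟨B.mem_target, hyN⟩
  · have h1 := LinearEquiv.finrank_map_eq e.toLinearEquiv (LinearMap.ker pr)
    have h2 := LinearMap.finrank_range_add_finrank_ker pr
    rw [LinearMap.range_eq_top.2 hpr, finrank_top, Module.finrank_prod, Module.finrank_prod,
      Module.finrank_self] at h2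
    refine h1.trans ?_
    omega
  · rw [hcs] at hz
    rw [(hN z hz.2).2]
    constructor
    · intro h; exact ⟨B.h.symm z, h, rfl⟩
    · rintro ⟨p, hp, hpe⟩
      have : p = B.h.symm z := e.injective hpe
      exact this ▸ hp

/-- The tangent spaces of the leaves. -/
theorem mem_tangentTo_leaf [T2Space M] {x y : M} (hy : y ∈ D.leaf x)
    {v : TangentSpace (𝓡 7) y} : v ∈ tangentTo (D.leaf x) y ↔
      ∃ a ∈ D.𝔥, ∃ t : ℝ, v = fundField y a + t • D.Y y := by
  obtain ⟨B⟩ := D.nonempty_box hs (leaf_subset hy)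
  obtain ⟨A, A', hA, hA', hAA', hA'A, hAY⟩ := B.exists_derivatives hs B.mem_target
  rw [mem_tangentTo]
  constructor
  · rintro ⟨γ, w, h0, rfl, hγ, hγv⟩
    have h1 : HasMFDerivAt (𝓡 7) 𝓘(ℝ, D.𝔥 × (ℝ × B.W)) B.h.symm (γ 0) A' := by
      rw [h0]; exact hA'
    have h2 : HasDerivAt (fun s => B.h.symm (γ s)) (A' w) 0 := hγv.hasDerivAt h1
    have h3 : HasDerivAt (fun s => (B.h.symm (γ s)).2.2) (A' w).2.2 0 := h2.snd.snd
    have h4 : ∀ᶠ s in 𝓝 (0 : ℝ), (B.h.symm (γ s)).2.2 = 0 := by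
      have hc : Filter.Tendsto γ (𝓝 0) (𝓝 y) := by
        have := hγv.continuousAt.tendsto
        rwa [h0] at this
      filter_upwards [hγ, hc.eventually (B.eventually_mem_leaf_iff hs hy)] with s k1 k2
      exact k2.2.1 k1
    have h5 : (A' w).2.2 = 0 := h3.unique
      ((hasDerivAt_const (0 : ℝ) (0 : B.W)).congr_of_eventuallyEq h4)
    refine ⟨(A' w).1, (A' w).1.2, (A' w).2.1, ?_⟩
    rw [← hAY, ← h5]
    exact (hA'A w).symm
  · rintro ⟨a, ha, t, rfl⟩
    have h1 : HasMFDerivAt 𝓘(ℝ, D.𝔥 × (ℝ × B.W)) (𝓡 7) B.h 0 A := by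
      rw [B.symm_self] at hA; exact hA
    have h2 := hasVelocity_parametrization h1.mdifferentiableAt
      ((⟨a, ha⟩, (t, 0)) : D.𝔥 × (ℝ × B.W))
    rw [h1.mfderiv] at h2
    refine ⟨_, _, ?_, hAY ⟨a, ha⟩ t, ?_, h2⟩
    · simp only [zero_smul, add_zero, B.h_zero]
    · have hc : Continuous (fun r : ℝ => (0 : D.𝔥 × (ℝ × B.W)) + r • (⟨a, ha⟩, (t, 0))) := by
        fun_prop
      have hev : ∀ᶠ r : ℝ in 𝓝 0, (0 : D.𝔥 × (ℝ × B.W)) + r • (⟨a, ha⟩, (t, 0)) ∈ B.h.source := by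
        refine hc.continuousAt.eventually (B.h.open_source.mem_nhds ?_)
        simpa using B.zero_mem_source
      filter_upwards [hev] with r hr
      have e1 := B.mem_leaf hs B.zero_mem_source hr (by simp)
      rw [B.h_zero] at e1
      exact leaf_trans hs hy e1

/-- A connected submanifold that is tangent to the leaves lies in a leaf. -/
theorem subset_leaf [T2Space M] {k : ℕ} {S : Set M} (hSP : S ⊆ D.P) (hS : IsSubmanifold k S)
    (hconn : IsPreconnected S) (htan : ∀ y ∈ S, ∀ v ∈ tangentTo S y,
      ∃ a ∈ D.𝔥, ∃ t : ℝ, v = fundField y a + t • D.Y y) {x : M} (hx : x ∈ S) :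
    S ⊆ D.leaf x := by
  intro z hz
  refine (hconn.iff_of_eventually (Q := fun z => z ∈ D.leaf x) (fun y hy => ?_) hx hz).1
    (mem_leaf_self hs (hSP hx))
  obtain ⟨B⟩ := D.nonempty_box hs (hSP hy)
  suffices h : ∀ᶠ z in 𝓝[S] y, z ∈ B.h.target ∧ (B.h.symm z).2.2 = 0 by
    filter_upwards [h] with z hz
    have e1 := B.mem_leaf hs B.zero_mem_source (B.h.map_target hz.1) hz.2
    rw [B.h.right_inv hz.1, B.h_zero] at e1
    exact ⟨fun h => leaf_trans hs h e1, fun h => leaf_trans hs h (leaf_symm hs e1)⟩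
  obtain ⟨c, hc, hyc, F, -, hF⟩ := hS y hy
  have hVo : IsOpen (c.target ∩ c.symm ⁻¹' B.h.target) :=
    c.isOpen_inter_preimage_symm B.h.open_target
  have hyV : c y ∈ c.target ∩ c.symm ⁻¹' B.h.target :=
    ⟨c.map_source hyc, by rw [Set.mem_preimage, c.left_inv hyc]; exact B.mem_target⟩
  obtain ⟨ε, hε, hball⟩ := Metric.isOpen_iff.1 hVo _ hyV
  have hev : ∀ᶠ z in 𝓝 y, z ∈ c.source ∧ c z ∈ Metric.ball (c y) ε :=
    Filter.Eventually.and (c.open_source.mem_nhds hyc)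
      ((c.continuousAt hyc).eventually (Metric.ball_mem_nhds _ hε))
  filter_upwards [hev.filter_mono nhdsWithin_le_nhds, self_mem_nhdsWithin] with z hz hzS
  have hzt : z ∈ B.h.target := by
    have := (hball hz.2).2
    rwa [Set.mem_preimage, c.left_inv hz.1] at this
  refine ⟨hzt, ?_⟩
  have hcsm := contMDiffOn_symm_of_mem_maximalAtlas hc
  -- In a submanifold chart `S` is linear, so the segment from `y` to `z` stays in `S`. Tangency to
  -- the leaves makes the transverse coordinate have derivative zero along it.
  let l : ℝ → E7 := fun r => c y + r • (c z - c y)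
  have hlc : Continuous l := by fun_prop
  have hlF : ∀ r, l r ∈ F := fun r => F.add_mem ((hF y hyc).1 hy)
    (F.smul_mem r (F.sub_mem ((hF z hz.1).1 hzS) ((hF y hyc).1 hy)))
  have hl : ∀ r, HasDerivAt l (c z - c y) r := fun r => by
    have h := ((hasDerivAt_id r).smul_const (c z - c y)).const_add (c y)
    rw [one_smul] at h
    exact h
  have hlV : ∀ r ∈ Set.Icc (0 : ℝ) 1, l r ∈ Metric.ball (c y) ε := by
    intro r hr
    rw [Metric.mem_ball, dist_eq_norm, add_sub_cancel_left, norm_smul, Real.norm_eq_abs,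
      abs_of_nonneg hr.1]
    have h1 := hz.2
    rw [Metric.mem_ball, dist_eq_norm] at h1
    exact (mul_le_of_le_one_left (norm_nonneg _) hr.2).trans_lt h1
  have hder : ∀ r ∈ Set.Icc (0 : ℝ) 1, HasDerivAt (fun r => (B.h.symm (c.symm (l r))).2.2) 0 r := by
    intro r hr
    obtain ⟨k1, k2⟩ := hball (hlV r hr)
    have m1 := ((hcsm.contMDiffAt (c.open_target.mem_nhds k1)).mdifferentiableAt
      (by simp)).hasMFDerivAt
    have m2 := HasVelocity.of_model (hl r) m1
    have hSr : ∀ᶠ s in 𝓝 r, c.symm (l s) ∈ S := by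
      filter_upwards [hlc.continuousAt.eventually (c.open_target.mem_nhds k1)] with s hs'
      rw [hF _ (c.map_target hs'), c.right_inv hs']
      exact hlF s
    have hmem : c.symm (l r) ∈ S := hSr.self_of_nhds
    obtain ⟨v, hv⟩ : ∃ v : E7, HasVelocity (fun s => c.symm (l s)) r v := ⟨_, m2⟩
    obtain ⟨a, ha, t, hat⟩ := htan _ hmem v (by
      refine (mem_tangentTo (x := c.symm (l r)) (v := v)).2 ⟨fun s => c.symm (l (r + s)), v,
        by show c.symm (l (r + 0)) = _; rw [add_zero], rfl, ?_,
        hv.comp (σ := fun s => r + s) (add_zero r) ((hasDerivAt_id 0).const_add r)⟩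
      have hc0 : Filter.Tendsto (fun s : ℝ => r + s) (𝓝 0) (𝓝 r) := by
        have : Continuous (fun s : ℝ => r + s) := by fun_prop
        simpa using this.tendsto 0
      exact hc0.eventually hSr)
    obtain ⟨A, A', hA, hA', hAA', -, hAY⟩ := B.exists_derivatives hs k2
    have m3 : HasDerivAt (fun s => B.h.symm (c.symm (l s))) (A' v) r := hv.hasDerivAt hA'
    have m4 : A' v = (⟨a, ha⟩, (t, 0)) := by
      rw [← hAA' (⟨a, ha⟩, (t, 0)), hAY]
      exact congrArg A' hat
    rw [m4] at m3
    exact m3.snd.snd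
  have hcon := constant_of_has_deriv_right_zero
    (fun r hr => (hder r hr).continuousAt.continuousWithinAt)
    (fun r hr => (hder r ⟨hr.1, hr.2.le⟩).hasDerivWithinAt) 1 ⟨zero_le_one, le_rfl⟩
  have e1 : c.symm (l 1) = z := by
    show c.symm (c y + (1 : ℝ) • (c z - c y)) = z
    rw [one_smul, add_sub_cancel, c.left_inv hz.1]
  have e0 : c.symm (l 0) = y := by
    show c.symm (c y + (0 : ℝ) • (c z - c y)) = y
    rw [zero_smul, add_zero, c.left_inv hyc]
  rw [e1, e0, B.symm_self] at hcon
  exact hcon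

end LeafData
end Leaf

/-! ### The flow of a normalised gradient -/

namespace G2Manifold

section GradientFlow

variable {M : Type*} [TopologicalSpace M] [ChartedSpace E7 M] [IsManifold (𝓡 7) ∞ M]
  (G : G2Manifold M)

/-- The differential of the inverse of the chart at `x`. -/
def dchartSymm (x : M) (z : E7) : E7 →L[ℝ] E7 := mfderiv 𝓘(ℝ, E7) (𝓡 7) (chartAt E7 x).symm z

/-- The metric in the chart at `x`. -/
def gChart (x : M) (z : E7) : E7 →L[ℝ] E7 →L[ℝ] ℝ :=
  (show E7 →L[ℝ] E7 →L[ℝ] ℝ from G.g.inner ((chartAt E7 x).symm z)).bilinearComp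
    (dchartSymm x z) (dchartSymm x z)

theorem gChart_apply (x : M) (z u v : E7) : G.gChart x z u v =
    G.g.inner ((chartAt E7 x).symm z) (dchartSymm x z u) (dchartSymm x z v) := rfl

/-- The tangent map of the inverse chart, applied to a constant vector field. -/
theorem contMDiffOn_dchartSymm (x : M) (u : E7) :
    ContMDiffOn 𝓘(ℝ, E7) (𝓡 7).tangent ∞ (fun z => (Bundle.TotalSpace.mk' E7
      (E := fun x : M => TangentSpace (𝓡 7) x) ((chartAt E7 x).symm z) (dchartSymm x z u)))
      (chartAt E7 x).target := by
  have hc : ContMDiffOn 𝓘(ℝ, E7) (𝓡 7) ∞ (chartAt E7 x).symm (chartAt E7 x).target :=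
    contMDiffOn_chart_symm (x := x)
  have ho := (chartAt E7 x).open_target
  have h1 := hc.contMDiffOn_tangentMapWithin (m := ∞) le_rfl ho.uniqueMDiffOn
  have h2 : ContMDiff 𝓘(ℝ, E7) 𝓘(ℝ, E7).tangent ∞
      (fun z : E7 => (⟨z, u⟩ : TangentBundle 𝓘(ℝ, E7) E7)) :=
    contMDiff_vectorSpace_iff_contDiff.2 contDiff_const
  refine (h1.comp h2.contMDiffOn fun z hz => hz).congr fun z hz => ?_
  have h3 : (mfderivWithin 𝓘(ℝ, E7) (𝓡 7) (chartAt E7 x).symm (chartAt E7 x).target z :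
      E7 →L[ℝ] E7) = dchartSymm x z := mfderivWithin_of_isOpen ho hz
  exact congrArg (fun A : E7 →L[ℝ] E7 => Bundle.TotalSpace.mk' E7
    (E := fun x : M => TangentSpace (𝓡 7) x) ((chartAt E7 x).symm z) (A u)) h3.symm

theorem contDiffOn_gChart (x : M) : ContDiffOn ℝ ∞ (G.gChart x) (chartAt E7 x).target := by
  rw [contDiffOn_clm_apply]
  intro u
  rw [contDiffOn_clm_apply]
  intro v
  rw [← contMDiffOn_iff_contDiffOn]
  have hc : ContMDiffOn 𝓘(ℝ, E7) (𝓡 7) ∞ (chartAt E7 x).symm (chartAt E7 x).target :=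
    contMDiffOn_chart_symm (x := x)
  intro z hz
  have h1 : ContMDiffWithinAt 𝓘(ℝ, E7) ((𝓡 7).prod 𝓘(ℝ, ℝ)) ∞
      (fun z => Bundle.TotalSpace.mk' ℝ (E := Bundle.Trivial M ℝ) ((chartAt E7 x).symm z)
        (G.g.inner ((chartAt E7 x).symm z) (dchartSymm x z u) (dchartSymm x z v)))
      (chartAt E7 x).target z := by
    apply ContMDiffWithinAt.clm_bundle_apply₂ (F₁ := E7) (F₂ := E7)
    · exact ContMDiffAt.comp_contMDiffWithinAt z G.g.contMDiff.contMDiffAt (hc z hz)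
    · exact contMDiffOn_dchartSymm x u z hz
    · exact contMDiffOn_dchartSymm x v z hz
  rw [Bundle.contMDiffWithinAt_totalSpace] at h1
  exact h1.2

theorem bijective_dchartSymm (x : M) {z : E7} (hz : z ∈ (chartAt E7 x).target) :
    Function.Bijective (dchartSymm x z) := by
  have hd := mdifferentiable_chart (I := 𝓡 7) x
  have hi : Function.Injective (dchartSymm x z) :=
    Function.LeftInverse.injective (g := (mfderiv (𝓡 7) 𝓘(ℝ, E7) (chartAt E7 x)
      ((chartAt E7 x).symm z) : E7 →L[ℝ] E7)) fun u =>
        DFunLike.congr_fun (hd.comp_symm_deriv hz) u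
  exact ⟨hi, (LinearMap.injective_iff_surjective (f := (dchartSymm x z : E7 →ₗ[ℝ] E7))).1 hi⟩

theorem isInvertible_gChart (x : M) {z : E7} (hz : z ∈ (chartAt E7 x).target) :
    (G.gChart x z).IsInvertible := by
  have hi : Function.Injective (G.gChart x z) := by
    refine (injective_iff_map_eq_zero _).2 fun u hu => ?_
    have h1 : G.gChart x z u u = 0 := by rw [hu]; rfl
    have h2 : dchartSymm x z u = 0 := G.eq_zero_of_g_self h1
    exact (bijective_dchartSymm x hz).1 (h2.trans (map_zero _).symm)
  have hdim : Module.finrank ℝ E7 = Module.finrank ℝ (E7 →L[ℝ] ℝ) :=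
    ((InnerProductSpace.toDual ℝ E7).toLinearEquiv.finrank_eq)
  refine ⟨(LinearEquiv.ofInjectiveOfFinrankEq (G.gChart x z : E7 →ₗ[ℝ] E7 →L[ℝ] ℝ) hi
    hdim).toContinuousLinearEquiv, ?_⟩
  ext
  rfl

/-- The gradient in the chart at `x`. -/
def gradChart (f : M → ℝ) (x : M) (z : E7) : E7 :=
  (G.gChart x z).inverse (fderiv ℝ (f ∘ (chartAt E7 x).symm) z)

variable {f : M → ℝ} (hf : ContMDiff (𝓡 7) 𝓘(ℝ, ℝ) ∞ f)
include hf

theorem contDiffOn_fderiv_comp_chart_symm (x : M) :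
    ContDiffOn ℝ ∞ (fderiv ℝ (f ∘ (chartAt E7 x).symm)) (chartAt E7 x).target :=
  (contMDiffOn_iff_contDiffOn.1 (hf.comp_contMDiffOn (contMDiffOn_chart_symm (x := x)))
    ).fderiv_of_isOpen (chartAt E7 x).open_target (by simp)

theorem fderiv_comp_chart_symm (x : M) {z : E7} (hz : z ∈ (chartAt E7 x).target) (u : E7) :
    fderiv ℝ (f ∘ (chartAt E7 x).symm) z u =
      differential f ((chartAt E7 x).symm z) (dchartSymm x z u) := by
  have hd := mdifferentiable_chart (I := 𝓡 7) x
  have h1 := (hasMFDerivAt_differential hf ((chartAt E7 x).symm z)).comp z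
    (hd.mdifferentiableAt_symm hz).hasMFDerivAt
  let A : E7 →L[ℝ] ℝ := (show E7 →L[ℝ] ℝ from differential f ((chartAt E7 x).symm z)).comp
    (dchartSymm x z)
  have h1' : HasFDerivAt (f ∘ (chartAt E7 x).symm) A z := hasMFDerivAt_iff_hasFDerivAt.1 h1
  exact DFunLike.congr_fun h1'.fderiv u

/-- Inversion of linear isomorphisms is smooth, so the gradient depends smoothly on the metric and
the differential. -/
theorem contDiffOn_gradChart (x : M) :
    ContDiffOn ℝ ∞ (G.gradChart f x) (chartAt E7 x).target := by
  have h2 := contDiffOn_fderiv_comp_chart_symm hf x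
  intro z hz
  have h3 : ContDiffWithinAt ℝ ∞ (fun z => (G.gChart x z).inverse) (chartAt E7 x).target z := by
    obtain ⟨e, he⟩ := G.isInvertible_gChart x hz
    refine ContDiffAt.comp_contDiffWithinAt z (g := ContinuousLinearMap.inverse) ?_
      (G.contDiffOn_gChart x z hz)
    rw [← he]
    exact contDiffAt_map_inverse e
  exact h3.clm_apply (h2 z hz)

theorem dchartSymm_gradChart (x : M) {z : E7} (hz : z ∈ (chartAt E7 x).target) :
    dchartSymm x z (G.gradChart f x z) = G.grad f ((chartAt E7 x).symm z) := by
  refine G.ext_g fun v => ?_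
  obtain ⟨u, rfl⟩ := (bijective_dchartSymm x hz).2 v
  have h2 := fderiv_comp_chart_symm hf x hz u
  have h3 : G.gChart x z (G.gradChart f x z) = fderiv ℝ (f ∘ (chartAt E7 x).symm) z := by
    obtain ⟨e, he⟩ := G.isInvertible_gChart x hz
    rw [gradChart, ← he, ContinuousLinearMap.inverse_equiv]
    exact e.apply_symm_apply _
  have h4 := DFunLike.congr_fun h3 u
  rw [h2, gChart_apply] at h4
  exact h4.trans (G.g_grad f _ _).symm

/-- Lets `dq(∇f)` be differentiated once more along a leaf. -/
theorem contMDiff_differential_grad {q : M → ℝ} (hq : ContMDiff (𝓡 7) 𝓘(ℝ, ℝ) ∞ q) :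
    ContMDiff (𝓡 7) 𝓘(ℝ, ℝ) ∞ (fun y => differential q y (G.grad f y)) := by
  intro x
  have h1 : ContDiffOn ℝ ∞ (fun z => fderiv ℝ (q ∘ (chartAt E7 x).symm) z (G.gradChart f x z))
      (chartAt E7 x).target :=
    (contDiffOn_fderiv_comp_chart_symm hq x).clm_apply (G.contDiffOn_gradChart hf x)
  have h2 := (contMDiffOn_iff_contDiffOn.2 h1).comp (contMDiffOn_chart (I := 𝓡 7) (x := x))
    fun y hy => (chartAt E7 x).map_source hy
  refine (h2.congr fun y hy => ?_).contMDiffAt ((chartAt E7 x).open_source.mem_nhds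
    (mem_chart_source E7 x))
  show _ = fderiv ℝ (q ∘ (chartAt E7 x).symm) (chartAt E7 x y) (G.gradChart f x (chartAt E7 x y))
  have hy' := (chartAt E7 x).map_source hy
  have e : ∀ y', y' = y → differential q y' (G.grad f y') = differential q y (G.grad f y) := by
    rintro _ rfl; rfl
  rw [fderiv_comp_chart_symm hq x hy', dchartSymm_gradChart G hf x hy']
  exact (e _ ((chartAt E7 x).left_inv hy)).symm

/-- The local flow of `∇f / |∇f|²`. -/
theorem exists_flow_grad {P : Set M} (hP : IsOpen P)
    (hpos : ∀ x ∈ P, 0 < G.g.inner x (G.grad f x) (G.grad f x)) {x : M} (hx : x ∈ P) :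
    ∃ (Φ : ℝ × E7 → M) (O : Set (ℝ × E7)), IsOpen O ∧ 0 ∈ O ∧
      ContMDiffOn 𝓘(ℝ, ℝ × E7) (𝓡 7) ∞ Φ O ∧ Φ 0 = x ∧
      (∀ p ∈ O, Φ p ∈ P ∧ HasVelocity (fun t => Φ (t, p.2)) p.1
        ((G.g.inner (Φ p) (G.grad f (Φ p)) (G.grad f (Φ p)))⁻¹ • G.grad f (Φ p))) ∧
      ∀ v : E7, HasVelocity (fun r : ℝ => Φ (0, r • v)) 0 v := by
  set c := chartAt E7 x with hc
  have hcs := mem_chart_source E7 x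
  have hct : c x ∈ c.target := c.map_source hcs
  have hd := mdifferentiable_chart (I := 𝓡 7) x
  have hcs2 : ContMDiffOn 𝓘(ℝ, E7) (𝓡 7) ∞ c.symm c.target := contMDiffOn_chart_symm (x := x)
  let L : E7 →L[ℝ] E7 := mfderiv (𝓡 7) 𝓘(ℝ, E7) c x
  let U : Set E7 := c.target ∩ c.symm ⁻¹' P
  have hU : IsOpen U := c.isOpen_inter_preimage_symm hP
  have hxU : c x ∈ U := ⟨hct, by rw [Set.mem_preimage, c.left_inv hcs]; exact hx⟩
  let F : E7 → E7 := fun z =>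
    (G.gChart x z (G.gradChart f x z) (G.gradChart f x z))⁻¹ • G.gradChart f x z
  have hg : ∀ z ∈ c.target, G.gChart x z (G.gradChart f x z) (G.gradChart f x z) =
      G.g.inner (c.symm z) (G.grad f (c.symm z)) (G.grad f (c.symm z)) := by
    intro z hz
    rw [gChart_apply, dchartSymm_gradChart G hf x hz]
  have hF : ContDiffOn ℝ ∞ F U := by
    have h1 := (G.contDiffOn_gradChart hf x).mono (Set.inter_subset_left : U ⊆ c.target)
    have h2 := (G.contDiffOn_gChart x).mono (Set.inter_subset_left : U ⊆ c.target)
    refine (((h2.clm_apply h1).clm_apply h1).inv fun z hz => ?_).smul h1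
    rw [hg z hz.1]
    exact (hpos _ hz.2).ne'
  obtain ⟨Ψ, ε, hε, hΨ, hΨ0, hΨv⟩ := exists_smooth_flow hU hF hxU
  -- Initial points are parametrised through the differential of the chart, so that `v ↦ Φ(0, v)`
  -- has the identity as its differential at `0`.
  let a : E7 → E7 := fun v => c x + L v
  have ha : ContDiff ℝ ∞ a := by fun_prop
  have ha0 : a 0 = c x := by show c x + L 0 = c x; rw [map_zero, add_zero]
  let O : Set (ℝ × E7) := Metric.ball 0 ε ×ˢ (a ⁻¹' Metric.ball (c x) ε)
  have haO : ∀ v, v ∈ a ⁻¹' Metric.ball (c x) ε → a v ∈ Metric.ball (c x) ε := fun v hv => hv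
  have hO : IsOpen O := Metric.isOpen_ball.prod (Metric.isOpen_ball.preimage ha.continuous)
  have h0a : (0 : E7) ∈ a ⁻¹' Metric.ball (c x) ε := by
    rw [Set.mem_preimage, ha0]; exact Metric.mem_ball_self hε
  refine ⟨fun p => c.symm (Ψ (p.1, a p.2)), O, hO, ⟨Metric.mem_ball_self hε, h0a⟩, ?_, ?_, ?_, ?_⟩
  · refine hcs2.comp (t := c.target) (f := fun p : ℝ × E7 => Ψ (p.1, a p.2))
      (contMDiffOn_iff_contDiffOn.2 ?_) fun p hp => (hΨv p.1 hp.1 _ (haO _ hp.2)).1.1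
    exact hΨ.comp (t := Metric.ball 0 ε ×ˢ Metric.ball (c x) ε)
      (f := fun p : ℝ × E7 => (p.1, a p.2))
      (contDiff_fst.prodMk (ha.comp contDiff_snd)).contDiffOn fun p hp => ⟨hp.1, haO _ hp.2⟩
  · show c.symm (Ψ (0, a 0)) = x
    rw [hΨ0 _ (haO _ h0a), ha0, c.left_inv hcs]
  · intro p hp
    obtain ⟨h1, h2⟩ := hΨv p.1 hp.1 _ (haO _ hp.2)
    refine ⟨h1.2, ?_⟩
    have h3 := HasVelocity.of_model h2 (hd.mdifferentiableAt_symm h1.1).hasMFDerivAt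
    have h4 : dchartSymm x (Ψ (p.1, a p.2)) (F (Ψ (p.1, a p.2))) =
        (G.g.inner (c.symm (Ψ (p.1, a p.2))) (G.grad f (c.symm (Ψ (p.1, a p.2))))
          (G.grad f (c.symm (Ψ (p.1, a p.2)))))⁻¹ • G.grad f (c.symm (Ψ (p.1, a p.2))) := by
      refine (map_smul (dchartSymm x (Ψ (p.1, a p.2))) _ _).trans ?_
      rw [hg _ h1.1, dchartSymm_gradChart G hf x h1.1]
      rfl
    exact (congrArg (fun v : E7 => HasVelocity (fun t => c.symm (Ψ (t, a p.2))) p.1 v) h4).mp h3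
  · intro v
    have h := hasVelocity_parametrization (hd.mdifferentiableAt_symm hct) (L v)
    have h1 : (mfderiv 𝓘(ℝ, E7) (𝓡 7) c.symm (c x) (L v) : E7) = v :=
      DFunLike.congr_fun (hd.symm_comp_deriv hcs) v
    rw [h1] at h
    refine HasVelocity.congr_of_eventuallyEq h ?_
    have hcont : Continuous (fun r : ℝ => r • v) := by fun_prop
    filter_upwards [hcont.continuousAt.eventually ((Metric.isOpen_ball.preimage
      ha.continuous).mem_nhds (show (0 : ℝ) • v ∈ a ⁻¹' Metric.ball (c x) ε by
        rw [zero_smul]; exact h0a))] with r hr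
    have e1 : Ψ (0, a (r • v)) = c x + r • L v := by
      rw [hΨ0 _ (haO _ hr), ← map_smul]
    exact congrArg c.symm e1

end GradientFlow
end G2Manifold

/-! ### The foliations by coassociatives and associatives -/

section TangentPlanes

variable {M : Type*} [TopologicalSpace M] [ChartedSpace E7 M] [MulAction T2SU2 M]
  (hs : IsSmoothAction M)
include hs

theorem fundField_mem_tangentTo {K : Subgroup T2SU2} {S : Set M} (hS : IsInvariantSet K S) {y : M}
    (hy : y ∈ S) {ξ : LieT2SU2} (hξ : ∀ t : ℝ, lieExp (t • ξ) ∈ K) :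
    fundField y ξ ∈ tangentTo S y :=
  mem_tangentTo.2 ⟨fun t => lieExp (t • ξ) • y, fundField y ξ,
    by show lieExp ((0 : ℝ) • ξ) • y = y; rw [zero_smul, lieExp_zero, one_smul], rfl,
    Filter.Eventually.of_forall fun t => hS _ (hξ t) y hy, hasVelocity_lieExp_smul_zero hs y ξ⟩

theorem fundField_torus (y : M) (a : Fin 2 → ℝ) (w : Fin 3 → ℝ) (s : ℝ) :
    fundField y (a, s • w) = a 0 • genU 0 y + a 1 • genU 1 y + s • fundField y (0, w) := by
  rw [genU_eq hs, genU_eq hs, ← map_smul, ← map_smul, ← map_smul, ← map_add, ← map_add]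
  congr 1
  ext i
  · fin_cases i <;> simp
  · simp

/-- Matches the plane spanned by the generators and a gradient `X` with the tangent space of a leaf,
whose transverse field is the rescaled `r • X`. -/
theorem mem_span_torus3_iff {y : M} {w : Fin 3 → ℝ} {X : TangentSpace (𝓡 7) y} {r : ℝ} (hr : r ≠ 0)
    (v : TangentSpace (𝓡 7) y) :
    v ∈ Submodule.span ℝ (Set.range ![genU 0 y, genU 1 y, fundField y (0, w), X]) ↔
      ∃ a ∈ lieTorus3 w, ∃ t : ℝ, v = fundField y a + t • r • X := by
  rw [Submodule.mem_span_range_iff_exists_fun]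
  constructor
  · rintro ⟨c, rfl⟩
    refine ⟨(![c 0, c 1], c 2 • w), ⟨trivial, Submodule.mem_span_singleton.2 ⟨_, rfl⟩⟩, c 3 * r⁻¹, ?_⟩
    rw [fundField_torus hs, Fin.sum_univ_four, smul_smul, mul_assoc, inv_mul_cancel₀ hr, mul_one]
    rfl
  · rintro ⟨⟨a, b⟩, ⟨-, hb⟩, t, rfl⟩
    obtain ⟨s, rfl⟩ := Submodule.mem_span_singleton.1 hb
    refine ⟨![a 0, a 1, s, t * r], ?_⟩
    rw [fundField_torus hs, Fin.sum_univ_four, smul_smul]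
    rfl

theorem mem_span_torus2_iff {y : M} {X : TangentSpace (𝓡 7) y} {r : ℝ} (hr : r ≠ 0)
    (v : TangentSpace (𝓡 7) y) :
    v ∈ Submodule.span ℝ (Set.range ![genU 0 y, genU 1 y, X]) ↔
      ∃ a ∈ lieTorus2, ∃ t : ℝ, v = fundField y a + t • r • X := by
  rw [Submodule.mem_span_range_iff_exists_fun]
  constructor
  · rintro ⟨c, rfl⟩
    refine ⟨(![c 0, c 1], (0 : ℝ) • (0 : Fin 3 → ℝ)), ⟨trivial, (Submodule.mem_bot ℝ).2
      (smul_zero _)⟩, c 2 * r⁻¹, ?_⟩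
    rw [fundField_torus hs, Fin.sum_univ_three, smul_smul, mul_assoc, inv_mul_cancel₀ hr, mul_one,
      zero_smul, add_zero]
    rfl
  · rintro ⟨⟨a, b⟩, ⟨-, hb⟩, t, rfl⟩
    obtain rfl : b = (0 : ℝ) • (0 : Fin 3 → ℝ) := ((Submodule.mem_bot ℝ).1 hb).trans (smul_zero _).symm
    refine ⟨![a 0, a 1, t * r], ?_⟩
    rw [fundField_torus hs, Fin.sum_univ_three, smul_smul, zero_smul, add_zero]
    rfl

end TangentPlanes

theorem dirSU2_ne_zero {n : SU2} (hn : (n : ℍ[ℝ]).re = 0) : dirSU2 n ≠ 0 := by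
  intro h
  have h1 := imQuaternion_dirSU2 hn
  rw [h, ← imQuaternionL_apply, map_zero] at h1
  have h2 : ‖(n : ℍ[ℝ])‖ = 1 := by simp
  rw [← h1, norm_zero] at h2
  exact zero_ne_one h2

theorem rotSU2_dirSU2_of_mem {n q : SU2} (hn : (n : ℍ[ℝ]).re = 0) (hq : q ∈ circleSU2 n) :
    rotSU2 q (dirSU2 n) = dirSU2 n := by
  apply imQuaternion_injective
  rw [imQuaternion_rotSU2, imQuaternion_dirSU2 hn]
  have h : (q : ℍ[ℝ]) * n = n * q := congrArg Subtype.val (Subgroup.mem_centralizer_singleton_iff.1 hq)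
  rw [h, mul_assoc, self_mul_star_SU2, mul_one]

theorem finrank_lieTorus2 : Module.finrank ℝ lieTorus2 = 2 := by
  have h : lieTorus2 = LinearMap.range (LinearMap.inl ℝ (Fin 2 → ℝ) (Fin 3 → ℝ)) := by
    rw [LinearMap.range_inl]
    ext ξ
    exact ⟨fun h => h.2, fun h => ⟨trivial, h⟩⟩
  rw [h, LinearMap.finrank_range_of_inj LinearMap.inl_injective, Module.finrank_fin_fun]

theorem finrank_lieTorus3 {w : Fin 3 → ℝ} (hw : w ≠ 0) : Module.finrank ℝ (lieTorus3 w) = 3 := by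
  let A : (Fin 2 → ℝ) × ℝ →ₗ[ℝ] LieT2SU2 :=
    LinearMap.prodMap LinearMap.id (LinearMap.toSpanSingleton ℝ _ w)
  have h : lieTorus3 w = LinearMap.range A := by
    ext ξ
    constructor
    · rintro ⟨-, h⟩
      obtain ⟨s, hs⟩ := Submodule.mem_span_singleton.1 h
      exact ⟨(ξ.1, s), Prod.ext rfl hs⟩
    · rintro ⟨p, rfl⟩
      exact ⟨trivial, Submodule.mem_span_singleton.2 ⟨p.2, rfl⟩⟩
  have hA : Function.Injective A := by
    rintro ⟨a, s⟩ ⟨b, t⟩ hab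
    have h2 : s • w = t • w := congrArg Prod.snd hab
    exact Prod.ext (congrArg Prod.fst hab :) (smul_left_injective ℝ hw h2)
  rw [h, LinearMap.finrank_range_of_inj hA, Module.finrank_prod, Module.finrank_fin_fun,
    Module.finrank_self]

namespace IsMultiMomentPair

variable {M : Type*} [TopologicalSpace M] [ChartedSpace E7 M] [IsManifold (𝓡 7) ∞ M]
  [PreconnectedSpace M] [T2Space M]
  [MulAction T2SU2 M] {G : G2Manifold M} {ν : M → ℝ} {μ : M → EuclideanSpace ℝ (Fin 3)}

open G2Manifold

variable (hmm : IsMultiMomentPair G ν μ) (hs : IsSmoothAction M) (hinv : IsInvariantForm G.φ)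
  (hcohom : HasCohomogeneityTwo M)

/-- The data given by a torus and the normalised gradient of an invariant function. -/
def gradLeafData {K : Subgroup T2SU2} {𝔥 : Submodule ℝ LieT2SU2}
    (hcomm : ∀ ξ ∈ 𝔥, ∀ η ∈ 𝔥, Commute (imQuaternion ξ.2) (imQuaternion η.2))
    (hexp : ∀ ξ ∈ 𝔥, lieExp ξ ∈ K)
    (hC : ∃ C : Set LieT2SU2, IsCompact C ∧ C ⊆ 𝔥 ∧ ∀ g ∈ K, ∃ ξ ∈ C, lieExp ξ = g)
    {f : M → ℝ} (hf : ContMDiff (𝓡 7) 𝓘(ℝ, ℝ) ∞ f) (hfK : ∀ k ∈ K, ∀ x, f (k • x) = f x)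
    (hpos : ∀ x ∈ principalSet M, 0 < G.g.inner x (G.grad f x) (G.grad f x)) : LeafData M where
  P := principalSet M
  𝔥 := 𝔥
  commute := hcomm
  K := K
  lieExp_mem := hexp
  C := hC.choose
  isCompact_C := hC.choose_spec.1
  C_subset := hC.choose_spec.2.1
  exists_lieExp := hC.choose_spec.2.2
  f := f
  smooth_f := hf
  f_smul := hfK
  Y x := (G.g.inner x (G.grad f x) (G.grad f x))⁻¹ • G.grad f x
  differential_Y x hx := by
    rw [map_smul, ← G.g_grad, smul_eq_mul, inv_mul_cancel₀ (hpos x hx).ne']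
  smul_mem k _ _ hx := hmm.smul_mem_principalSet hs hinv hcohom hx k
  smulDeriv_Y k hk x _ := by
    rw [map_smul, smulDeriv_grad hs hinv hf (hfK k hk), ← smulDeriv_grad hs hinv hf (hfK k hk),
      g_smulDeriv hinv]
  injective _ hx := injective_fundField_of_mem_principalSet hs hcohom hx
  flow _ hx := G.exists_flow_grad hf (hmm.isOpen_principalSet hs hinv hcohom) hpos hx

include hmm hs hinv in
omit [T2Space M] in
-- Conjugation by the circle fixes its own axis, and `μ` is equivariant.
theorem muDir_smul {n : SU2} (hn : (n : ℍ[ℝ]).re = 0) {k : T2SU2} (hk : k ∈ torus3 n) (x : M) :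
    muDir μ (dirSU2 n) (k • x) = muDir μ (dirSU2 n) x := by
  rw [muDir, hmm.μ_smul hs hinv]
  conv_lhs => rw [← rotSU2_dirSU2_of_mem hn hk.2.2]
  exact (rotSU2_dotProduct_cross _ _ _).1

/-- The foliation of the principal set by coassociatives. -/
def coassocLeaf {n : SU2} (hn : (n : ℍ[ℝ]).re = 0) : LeafData M :=
  hmm.gradLeafData hs hinv hcohom (K := torus3 n) (lieTorus3_commute (dirSU2 n))
    (fun _ h => lieExp_mem_torus3 hn h) (exists_lieExp_eq_torus3 hn) (hmm.smooth_muDir (dirSU2 n))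
    (fun _ hk x => hmm.muDir_smul hs hinv hn hk x) fun _ hx => hmm.g_grad_muDir_pos hs hinv
      (injective_fundField_of_mem_principalSet hs hcohom hx) (dirSU2_ne_zero hn)

/-- The foliation of the principal set by associatives. -/
def assocLeaf : LeafData M :=
  hmm.gradLeafData hs hinv hcohom (K := torus2) lieTorus2_commute
    (fun _ h => lieExp_mem_torus2 h) exists_lieExp_eq_torus2 hmm.smooth_ν
    (fun k _ x => hmm.ν_smul hs hinv k x) fun _ hx => hmm.g_grad_ν_pos hs
      (injective_fundField_of_mem_principalSet hs hcohom hx)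

include hmm hs hinv hcohom

section Coassociative

variable {n : SU2} (hn : (n : ℍ[ℝ]).re = 0)
include hn

/-- The triple `U₁, U₂, V_n` is isotropic, and the fourth direction, dual to `∗φ(U₁, U₂, V_n, ·)`,
is the gradient of the component of `μ` along `n`. -/
theorem coassociative_plane {y : M} (hy : y ∈ principalSet M) :
    G.IsCoassociativePlane (Submodule.span ℝ (Set.range ![genU 0 y, genU 1 y,
      fundField y (0, dirSU2 n), G.grad (muDir μ (dirSU2 n)) y])) ∧
    ∀ F : Submodule ℝ (TangentSpace (𝓡 7) y), G.IsCoassociativePlane F → genU 0 y ∈ F →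
      genU 1 y ∈ F → fundField y (0, dirSU2 n) ∈ F →
      F = Submodule.span ℝ (Set.range ![genU 0 y, genU 1 y,
      fundField y (0, dirSU2 n), G.grad (muDir μ (dirSU2 n)) y]) := by
  have hinj := injective_fundField_of_mem_principalSet hs hcohom hy
  have hpos := hmm.g_grad_muDir_pos hs hinv hinj (dirSU2_ne_zero hn)
  refine isCoassociativePlane_span (linearIndependent_genU_fundField hs hinj (dirSU2_ne_zero hn))
    (hmm.φ_fundField hs hinv y _) (hmm.g_grad_muDir hs _ y) fun h => ?_
  rw [h] at hpos
  simp at hpos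

/-- The leaves are coassociative. -/
theorem isT3Coassociative_leaf {x : M} (hx : x ∈ principalSet M) :
    IsT3Coassociative G n ((hmm.coassocLeaf hs hinv hcohom hn).leaf x) where
  subset := LeafData.leaf_subset
  connected := LeafData.isConnected_leaf hs hx
  invariant a ha y hy := LeafData.smul_mem_leaf hy ha
  coassociative := by
    refine ⟨?_, fun y hy => ?_⟩
    · have h := LeafData.isSubmanifold_leaf (D := hmm.coassocLeaf hs hinv hcohom hn) hs x
      have h3 : Module.finrank ℝ (hmm.coassocLeaf hs hinv hcohom hn).𝔥 + 1 = 4 :=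
        congrArg (· + 1) (finrank_lieTorus3 (dirSU2_ne_zero hn))
      rwa [h3] at h
    · have hyP := LeafData.leaf_subset hy
      refine ⟨_, ?_, (hmm.coassociative_plane hs hinv hcohom hn hyP).1⟩
      ext v
      refine Iff.trans ?_ (LeafData.mem_tangentTo_leaf hs hy).symm
      exact mem_span_torus3_iff hs (inv_ne_zero (hmm.g_grad_muDir_pos hs hinv
        (injective_fundField_of_mem_principalSet hs hcohom hyP) (dirSU2_ne_zero hn)).ne') v

/-- Invariance puts the `T³`-orbit directions into each tangent plane, and only one coassociative
plane contains them; so the submanifold is everywhere tangent to the leaves. -/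
theorem subset_coassocLeaf {S : Set M} (hS : IsT3Coassociative G n S) {x : M} (hx : x ∈ S) :
    S ⊆ (hmm.coassocLeaf hs hinv hcohom hn).leaf x := by
  refine LeafData.subset_leaf hs hS.subset hS.coassociative.1 hS.connected.isPreconnected
    (fun y hy v hv => ?_) hx
  have hyP := hS.subset hy
  obtain ⟨F, hF, hFc⟩ := hS.coassociative.2 y hy
  have hmem : ∀ ξ ∈ lieTorus3 (dirSU2 n), fundField y ξ ∈ F := fun ξ hξ => by
    have h := fundField_mem_tangentTo hs hS.invariant hy (ξ := ξ)
      (fun t => lieExp_mem_torus3 hn (Submodule.smul_mem _ t hξ))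
    rw [← hF] at h
    exact h
  have e := (hmm.coassociative_plane hs hinv hcohom hn hyP).2 F hFc
    (by rw [genU_eq hs]; exact hmem _ ⟨trivial, Submodule.zero_mem _⟩)
    (by rw [genU_eq hs]; exact hmem _ ⟨trivial, Submodule.zero_mem _⟩)
    (hmem _ ⟨trivial, Submodule.mem_span_singleton_self _⟩)
  have hvF : v ∈ F := by rw [← hF] at hv; exact hv
  rw [e] at hvF
  exact (mem_span_torus3_iff hs (inv_ne_zero (hmm.g_grad_muDir_pos hs hinv
    (injective_fundField_of_mem_principalSet hs hcohom hyP) (dirSU2_ne_zero hn)).ne') v).1 hvF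

/-- `φ` vanishes on coassociative planes, and `dν = φ(U₁, U₂, ·)`. This is why `ν` is constant on
the coassociative leaves. -/
theorem differential_ν_grad_muDir {y : M} (hy : y ∈ principalSet M) :
    differential ν y (G.grad (muDir μ (dirSU2 n)) y) = 0 := by
  rw [hmm.differential_ν]
  exact (hmm.coassociative_plane hs hinv hcohom hn hy).1.isotropic
    (Submodule.subset_span ⟨0, rfl⟩) (Submodule.subset_span ⟨1, rfl⟩) (Submodule.subset_span ⟨3, rfl⟩)

theorem ν_eq_of_mem_coassocLeaf {x y : M}
    (hy : y ∈ (hmm.coassocLeaf hs hinv hcohom hn).leaf x) : ν y = ν x := by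
  refine LeafData.eq_of_mem_leaf hs hy hmm.smooth_ν (fun k _ x => hmm.ν_smul hs hinv k x)
    fun z hz => ?_
  have h := hmm.differential_ν_grad_muDir hs hinv hcohom hn (LeafData.leaf_subset hz)
  refine (map_smul (differential ν z) _ _).trans ?_
  rw [h, smul_zero]

end Coassociative

section Associative

theorem associative_plane {y : M} (hy : y ∈ principalSet M) :
    G.IsAssociativePlane (Submodule.span ℝ (Set.range ![genU 0 y, genU 1 y, G.grad ν y])) ∧
    ∀ F : Submodule ℝ (TangentSpace (𝓡 7) y), G.IsAssociativePlane F → genU 0 y ∈ F →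
      genU 1 y ∈ F → F = Submodule.span ℝ (Set.range ![genU 0 y, genU 1 y, G.grad ν y]) :=
  isAssociativePlane_span (linearIndependent_genU hs
    (injective_fundField_of_mem_principalSet hs hcohom hy)) (hmm.g_grad_ν y)

theorem isT2Associative_leaf {x : M} (hx : x ∈ principalSet M) :
    IsT2Associative G ((hmm.assocLeaf hs hinv hcohom).leaf x) where
  subset := LeafData.leaf_subset
  connected := LeafData.isConnected_leaf hs hx
  invariant a ha y hy := LeafData.smul_mem_leaf hy ha
  associative := by
    refine ⟨?_, fun y hy => ?_⟩
    · have h := LeafData.isSubmanifold_leaf (D := hmm.assocLeaf hs hinv hcohom) hs x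
      have h3 : Module.finrank ℝ (hmm.assocLeaf hs hinv hcohom).𝔥 + 1 = 3 :=
        congrArg (· + 1) finrank_lieTorus2
      rwa [h3] at h
    · have hyP := LeafData.leaf_subset hy
      refine ⟨_, ?_, (hmm.associative_plane hs hinv hcohom hyP).1⟩
      ext v
      refine Iff.trans ?_ (LeafData.mem_tangentTo_leaf hs hy).symm
      exact mem_span_torus2_iff hs (inv_ne_zero (hmm.g_grad_ν_pos hs
        (injective_fundField_of_mem_principalSet hs hcohom hyP)).ne') v

/-- The tangent planes are associative and contain `U₁, U₂`, so their third direction is `U₁ × U₂ =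
∇ν`. -/
theorem subset_assocLeaf {S : Set M} (hS : IsT2Associative G S) {x : M} (hx : x ∈ S) :
    S ⊆ (hmm.assocLeaf hs hinv hcohom).leaf x := by
  refine LeafData.subset_leaf hs hS.subset hS.associative.1 hS.connected.isPreconnected
    (fun y hy v hv => ?_) hx
  have hyP := hS.subset hy
  obtain ⟨F, hF, hFc⟩ := hS.associative.2 y hy
  have hmem : ∀ ξ ∈ lieTorus2, fundField y ξ ∈ F := fun ξ hξ => by
    have h := fundField_mem_tangentTo hs hS.invariant hy (ξ := ξ)
      (fun t => lieExp_mem_torus2 (Submodule.smul_mem _ t hξ))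
    rw [← hF] at h
    exact h
  have e := (hmm.associative_plane hs hinv hcohom hyP).2 F hFc
    (by rw [genU_eq hs]; exact hmem _ ⟨trivial, Submodule.zero_mem _⟩)
    (by rw [genU_eq hs]; exact hmem _ ⟨trivial, Submodule.zero_mem _⟩)
  have hvF : v ∈ F := by rw [← hF] at hv; exact hv
  rw [e] at hvF
  exact (mem_span_torus2_iff hs (inv_ne_zero (hmm.g_grad_ν_pos hs
    (injective_fundField_of_mem_principalSet hs hcohom hyP)).ne') v).1 hvF

/-- Across its `T²`-orbits the leaf moves along `∇ν`, which is orthogonal to `∇|μ|²`. -/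
theorem norm_μ_eq_of_mem_assocLeaf {x y : M} (hy : y ∈ (hmm.assocLeaf hs hinv hcohom).leaf x) :
    ‖μ y‖ = ‖μ x‖ := by
  have h : ‖μ y‖ ^ 2 = ‖μ x‖ ^ 2 := by
    refine LeafData.eq_of_mem_leaf (q := fun y => ‖μ y‖ ^ 2) hs hy hmm.smooth_normSq
      (fun k _ x => by rw [hmm.norm_μ_smul hs hinv]) fun z _ => ?_
    have h := hmm.g_grad_ν_grad_normSq hs z
    rw [g_symm, g_grad] at h
    refine (map_smul (differential (fun y => ‖μ y‖ ^ 2) z) _ _).trans ?_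
    rw [h, smul_zero]
  exact (sq_eq_sq₀ (norm_nonneg _) (norm_nonneg _)).1 h

end Associative

end IsMultiMomentPair

/-! ### Images of the leaves in the orbit surface -/

section Leaf

variable {M : Type*} [TopologicalSpace M] [ChartedSpace E7 M]

theorem differential_eq_zero_of_mem_tangentTo {q : M → ℝ} [IsManifold (𝓡 7) ∞ M]
    (hq : ContMDiff (𝓡 7) 𝓘(ℝ, ℝ) ∞ q) {S : Set M} {c : ℝ} (hc : ∀ y ∈ S, q y = c) {y : M}
    {v : TangentSpace (𝓡 7) y} (hv : v ∈ tangentTo S y) : differential q y v = 0 := by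
  obtain ⟨γ, w, rfl, rfl, hγ, hγv⟩ := mem_tangentTo.1 hv
  have h := hγv.hasDerivAt (hasMFDerivAt_differential hq (γ 0))
  exact h.unique ((hasDerivAt_const (0 : ℝ) c).congr_of_eventuallyEq (hγ.mono fun s hs => hc _ hs))

variable [MulAction T2SU2 M]

namespace LeafData

variable {D : LeafData M} [IsManifold (𝓡 7) ∞ M] (hs : IsSmoothAction M)
include hs

/-- The integral curve through a point, parametrised by `f`. -/
theorem exists_curve {x : M} (hx : x ∈ D.P) : ∃ (γ : ℝ → M) (δ : ℝ), 0 < δ ∧ γ 0 = x ∧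
    ∀ s ∈ Set.Ioo (-δ) δ, γ s ∈ D.leaf x ∧ D.f (γ s) = D.f x + s ∧ ContinuousAt γ s := by
  obtain ⟨B⟩ := D.nonempty_box hs hx
  have h0 : ‖(0 : D.𝔥)‖ < B.δ ∧ ‖(0 : B.W)‖ < B.δ := by simpa using B.δ_pos
  refine ⟨fun r => B.h (0, (r, 0)), B.δ, B.δ_pos, B.h_zero, fun s hs' => ?_⟩
  have hp : ((0, (s, 0)) : D.𝔥 × (ℝ × B.W)) ∈ B.h.source :=
    B.mem_source.2 ⟨h0.1, abs_lt.2 hs', h0.2⟩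
  have h1 := B.mem_leaf hs B.zero_mem_source hp rfl
  have h2 := B.f_eq hs B.zero_mem_source hp rfl
  rw [B.h_zero] at h1 h2
  refine ⟨h1, ?_, (B.isIntegral_line hs h0.1 h0.2).continuousAt hs'⟩
  rw [h2]
  show D.f x + (s - 0) = _
  rw [sub_zero]

end LeafData

end Leaf

theorem isPreconnected_imageB {M : Type*} [TopologicalSpace M] [MulAction T2SU2 M] {S : Set M}
    (hS : IsPreconnected S) (hSP : S ⊆ principalSet M) : IsPreconnected (imageB S) := by
  have h : IsPreconnected (Subtype.val ⁻¹' S : Set (principalSet M)) := by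
    rw [← Topology.IsInducing.subtypeVal.isPreconnected_image, Subtype.image_preimage_coe,
      Set.inter_eq_right.2 hSP]
    exact hS
  exact h.image _ continuous_quotient_mk'.continuousOn

theorem mem_imageB {M : Type*} [MulAction T2SU2 M] {S : Set M} (hSP : S ⊆ principalSet M)
    (p : principalSet M) : projB p ∈ imageB S ↔ ∃ g : T2SU2, g • p.1 ∈ S := by
  constructor
  · rintro ⟨y, hy, h⟩
    obtain ⟨g, hg⟩ := Quotient.eq''.1 h
    refine ⟨g, ?_⟩
    have hg' : g • p.1 = y.1 := hg
    rw [hg']; exact hy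
  · rintro ⟨g, hg⟩
    exact ⟨⟨g • p.1, hSP hg⟩, hg, Quotient.eq''.2 ⟨g, rfl⟩⟩

namespace IsMultiMomentPair

variable {M : Type*} [TopologicalSpace M] [ChartedSpace E7 M] [IsManifold (𝓡 7) ∞ M]
  [PreconnectedSpace M] [T2Space M]
  [MulAction T2SU2 M] {G : G2Manifold M} {ν : M → ℝ} {μ : M → EuclideanSpace ℝ (Fin 3)}

open G2Manifold

variable (hmm : IsMultiMomentPair G ν μ) (hs : IsSmoothAction M) (hinv : IsInvariantForm G.φ)
  (hcohom : HasCohomogeneityTwo M)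
include hmm hs hinv hcohom

/-- The whole group preserves `ν` and its gradient and normalises `T²`, so it permutes the
associative leaves. -/
theorem smul_mem_assocLeaf {x y : M} (h : y ∈ (hmm.assocLeaf hs hinv hcohom).leaf x) (g : T2SU2) :
    g • y ∈ (hmm.assocLeaf hs hinv hcohom).leaf (g • x) := by
  refine LeafData.smul_mem_leaf_smul hs h
    (fun x hx => hmm.smul_mem_principalSet hs hinv hcohom hx g) (fun x _ => ?_)
    (fun x => hmm.ν_smul hs hinv g x) fun k hk => ?_
  · refine (map_smul (smulDeriv g x) _ _).trans ?_
    rw [smulDeriv_grad hs hinv hmm.smooth_ν (hmm.ν_smul hs hinv g),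
      ← g_grad_self_smul hs hinv hmm.smooth_ν (hmm.ν_smul hs hinv) g x]
    rfl
  · obtain ⟨h1, h2, h3⟩ := hk
    refine ⟨trivial, trivial, ?_⟩
    have h3' : k.2.2 = 1 := h3
    show g.2.2 * k.2.2 * g.2.2⁻¹ = 1
    rw [h3', mul_one, mul_inv_cancel]

/-- Near the image of `p`, the level set of `|μ|` is the image of the leaf through `p`. -/
theorem eventually_mem_imageB_assocLeaf (p : principalSet M) :
    ∀ᶠ b in 𝓝 (projB p), descend (fun x => ‖μ x‖) (hmm.norm_μ_smul hs hinv) b = ‖μ p‖ →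
      b ∈ imageB ((hmm.assocLeaf hs hinv hcohom).leaf p) := by
  obtain ⟨γ, δ, hδ, h0, hγ⟩ := LeafData.exists_curve (D := hmm.assocLeaf hs hinv hcohom) hs p.2
  have hloc := hmm.isLocalHomeomorph_coordB hs hinv hcohom
  obtain ⟨e, hpe, he⟩ := hloc (projB p)
  classical
  let Γ : ℝ → principalSet M := fun s => if h : γ s ∈ principalSet M then ⟨γ s, h⟩ else p
  have hΓ : ∀ s ∈ Set.Ioo (-δ) δ, (Γ s).1 = γ s := fun s hs' => by
    have h : γ s ∈ principalSet M := LeafData.leaf_subset (hγ s hs').1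
    show (if h : γ s ∈ principalSet M then (⟨γ s, h⟩ : principalSet M) else p).1 = γ s
    rw [dif_pos h]
  have h00 : (0 : ℝ) ∈ Set.Ioo (-δ) δ := ⟨by linarith, hδ⟩
  have hΓ0 : Γ 0 = p := Subtype.ext ((hΓ 0 h00).trans h0)
  have hΓc : ContinuousAt Γ 0 := by
    rw [Topology.IsInducing.subtypeVal.continuousAt_iff]
    exact (hγ 0 h00).2.2.congr (by filter_upwards [isOpen_Ioo.mem_nhds h00] with s hs'
      using (hΓ s hs').symm)
  have hc : Filter.Tendsto (fun s => projB (Γ s)) (𝓝 0) (𝓝 (projB p)) := by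
    have h := (continuous_projB.continuousAt (x := Γ 0)).comp hΓc
    have h' : Filter.Tendsto (fun s => projB (Γ s)) (𝓝 0) (𝓝 (projB (Γ 0))) := h
    rwa [hΓ0] at h'
  have hev : ∀ᶠ s in 𝓝 (0 : ℝ), s ∈ Set.Ioo (-δ) δ ∧ projB (Γ s) ∈ e.source :=
    Filter.Eventually.and (isOpen_Ioo.mem_nhds h00) (hc (e.open_source.mem_nhds hpe))
  have hν : Continuous (descend ν (hmm.ν_smul hs hinv)) :=
    isQuotientMap_quotient_mk'.continuous_iff.2
      (hmm.smooth_ν.continuous.comp continuous_subtype_val)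
  have hν' : Filter.Tendsto (fun b => descend ν (hmm.ν_smul hs hinv) b - ν p) (𝓝 (projB p))
      (𝓝 0) := by
    have h : Filter.Tendsto (fun b => descend ν (hmm.ν_smul hs hinv) b - ν p) (𝓝 (projB p))
      (𝓝 (descend ν (hmm.ν_smul hs hinv) (projB p) - ν p)) := (hν.sub continuous_const).tendsto _
    rwa [descend_projB, sub_self] at h
  filter_upwards [hν'.eventually hev, e.open_source.mem_nhds hpe] with b hb hbe hbμ
  obtain ⟨h1, h2, -⟩ := hγ _ hb.1
  -- The curve in the leaf is parametrised by `ν` and keeps `|μ|` fixed. At the time when its `ν` is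
  -- that of `b`, it has both coordinates of `b` and hence projects to `b`.
  refine ⟨Γ (descend ν (hmm.ν_smul hs hinv) b - ν p), ?_, e.injOn hb.2 hbe ?_⟩
  · show (Γ _).1 ∈ (hmm.assocLeaf hs hinv hcohom).leaf p
    rw [hΓ _ hb.1]; exact h1
  · rw [← he]
    refine Prod.ext ?_ ?_
    · show ‖μ (Γ _).1‖ = descend (fun x => ‖μ x‖) (hmm.norm_μ_smul hs hinv) b
      rw [hbμ, hΓ _ hb.1]
      exact hmm.norm_μ_eq_of_mem_assocLeaf hs hinv hcohom h1
    · show ν (Γ _).1 = descend ν (hmm.ν_smul hs hinv) b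
      rw [hΓ _ hb.1]
      exact h2.trans (by show ν p + _ = _; ring)

/-- The image is connected and lies in the level set. Conversely, near any `p` the level set is
covered by the image of the leaf through `p`, and the images of two leaves coincide once they meet,
because the group permutes leaves. So membership in the image is locally constant on the component.
-/
theorem imageB_assocLeaf (x : principalSet M) :
    imageB ((hmm.assocLeaf hs hinv hcohom).leaf x) =
      connectedComponentIn {b | descend (fun x => ‖μ x‖) (hmm.norm_μ_smul hs hinv) b =
        descend (fun x => ‖μ x‖) (hmm.norm_μ_smul hs hinv) (projB x)} (projB x) := by
  have hsub : (hmm.assocLeaf hs hinv hcohom).leaf x ⊆ principalSet M := LeafData.leaf_subset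
  have hself : x.1 ∈ (hmm.assocLeaf hs hinv hcohom).leaf x := LeafData.mem_leaf_self hs x.2
  apply Set.Subset.antisymm
  · refine (isPreconnected_imageB (LeafData.isConnected_leaf hs x.2).isPreconnected
      hsub).subset_connectedComponentIn ⟨x, hself, rfl⟩ ?_
    rintro _ ⟨y, hy, rfl⟩
    exact hmm.norm_μ_eq_of_mem_assocLeaf hs hinv hcohom hy
  · intro b hb
    have hx := mem_connectedComponentIn (x := projB x)
      (F := {b | descend (fun x => ‖μ x‖) (hmm.norm_μ_smul hs hinv) b =
        descend (fun x => ‖μ x‖) (hmm.norm_μ_smul hs hinv) (projB x)}) rfl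
    refine (isPreconnected_connectedComponentIn.iff_of_eventually
      (Q := fun b => b ∈ imageB ((hmm.assocLeaf hs hinv hcohom).leaf x)) (fun b hb => ?_)
      hx hb).1 ⟨x, hself, rfl⟩
    obtain ⟨p, rfl⟩ := projB_surjective b
    have hp := connectedComponentIn_subset _ _ hb
    filter_upwards [(hmm.eventually_mem_imageB_assocLeaf hs hinv hcohom p).filter_mono
      nhdsWithin_le_nhds, self_mem_nhdsWithin] with b' hb' hb'C
    have hb'x := connectedComponentIn_subset _ _ hb'C
    obtain ⟨p', rfl⟩ := projB_surjective b'
    obtain ⟨g, hg⟩ := (mem_imageB LeafData.leaf_subset p').1 (hb' (Eq.trans hb'x (Eq.symm hp)))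
    rw [mem_imageB hsub, mem_imageB hsub]
    constructor
    · rintro ⟨a, ha⟩
      refine ⟨a * g, ?_⟩
      rw [mul_smul]
      exact LeafData.leaf_trans hs ha (hmm.smul_mem_assocLeaf hs hinv hcohom hg a)
    · rintro ⟨a, ha⟩
      refine ⟨a * g⁻¹, ?_⟩
      have h := hmm.smul_mem_assocLeaf hs hinv hcohom (LeafData.leaf_symm hs hg) (a * g⁻¹)
      rw [smul_smul, inv_mul_cancel_right] at h
      exact LeafData.leaf_trans hs ha h

end IsMultiMomentPair

/-! ### Coassociative leaves do not stay over one point -/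

open Matrix in
-- The triple product identity gives `b × (c × n) = 0`, and `b` is also orthogonal to `c × n ≠ 0`,
-- so Lagrange's identity leaves `|b|² |c × n|² = 0`.
theorem eq_zero_of_orthogonal_cross {b c n : Fin 3 → ℝ} (hn : b ⬝ᵥ n = 0) (hc : b ⬝ᵥ c = 0)
    (hcn : b ⬝ᵥ crossProduct c n = 0) (h0 : crossProduct c n ≠ 0) : b = 0 := by
  have h1 : crossProduct b (crossProduct c n) = 0 := by
    have h : crossProduct b (crossProduct c n) = (b ⬝ᵥ n) • c - (b ⬝ᵥ c) • n := by
      ext i; fin_cases i <;> simp [cross_apply, dotProduct, Fin.sum_univ_three] <;> ring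
    rw [h, hn, hc, zero_smul, zero_smul, sub_zero]
  have h2 := cross_dot_cross b (crossProduct c n) b (crossProduct c n)
  rw [h1, hcn, zero_dotProduct, zero_mul, sub_zero] at h2
  rcases mul_eq_zero.1 h2.symm with h | h
  · exact dotProduct_self_eq_zero.1 h
  · exact absurd (dotProduct_self_eq_zero.1 h) h0

/-- The derivative of the adjoint action. -/
theorem hasDerivAt_rotSU2_expSU2 (u w : Fin 3 → ℝ) :
    HasDerivAt (fun t : ℝ => rotSU2 (expSU2 (t • u)) w) ((2 : ℝ) • crossProduct u w) 0 := by
  have e : ∀ t : ℝ, imQuaternion (rotSU2 (expSU2 (t • u)) w) =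
      NormedSpace.exp (t • imQuaternion u) * imQuaternion w * NormedSpace.exp (t • -imQuaternion u) := by
    intro t
    rw [imQuaternion_rotSU2]
    have h1 : (expSU2 (t • u) : ℍ[ℝ]) = NormedSpace.exp (t • imQuaternion u) := by
      show NormedSpace.exp (imQuaternionL (t • u)) = _
      rw [map_smul, imQuaternionL_apply]
    have h2 : (expSU2 (t • u))⁻¹ = expSU2 (-t • u) := by
      refine inv_eq_of_mul_eq_one_right ?_
      rw [← expSU2_add (commute_smul_imQuaternion _ _), ← add_smul, add_neg_cancel, zero_smul,
        expSU2_zero]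
    have h3 : (expSU2 (-t • u) : ℍ[ℝ]) = NormedSpace.exp (t • -imQuaternion u) := by
      show NormedSpace.exp (imQuaternionL (-t • u)) = _
      rw [map_smul, imQuaternionL_apply, neg_smul, smul_neg]
    rw [← coe_inv_SU2, h2, h3, h1]
  have h1 := hasDerivAt_exp_smul_const (𝕂 := ℝ) (imQuaternion u) 0
  have h2 := hasDerivAt_exp_smul_const (𝕂 := ℝ) (-imQuaternion u) 0
  have h3 := (h1.mul_const (imQuaternion w)).mul h2
  have h4 : HasDerivAt (fun t : ℝ => imQuaternion (rotSU2 (expSU2 (t • u)) w))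
      (imQuaternion ((2 : ℝ) • crossProduct u w)) 0 := by
    refine HasDerivAt.congr_of_eventuallyEq (h3.congr_deriv ?_) (Filter.Eventually.of_forall e)
    rw [zero_smul, zero_smul, NormedSpace.exp_zero, one_mul, mul_one, one_mul, one_mul, mul_neg,
      imQuaternion_mul, imQuaternion_mul, dotProduct_comm w u]
    ext <;> simp [cross_apply] <;> ring
  let P : ℍ[ℝ] →L[ℝ] (Fin 3 → ℝ) := LinearMap.toContinuousLinearMap
    { toFun := imPart
      map_add' := fun a b => by ext i; fin_cases i <;> rfl
      map_smul' := fun r a => by ext i; fin_cases i <;> rfl }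
  have h5 := P.hasFDerivAt.comp_hasDerivAt (0 : ℝ) h4
  have h6 : P (imQuaternion ((2 : ℝ) • crossProduct u w)) = (2 : ℝ) • crossProduct u w :=
    imPart_imQuaternion _
  rw [h6] at h5
  exact h5.congr_of_eventuallyEq (Filter.Eventually.of_forall fun t => (imPart_imQuaternion _).symm)

namespace IsMultiMomentPair

variable {M : Type*} [TopologicalSpace M] [ChartedSpace E7 M] [IsManifold (𝓡 7) ∞ M]
  [PreconnectedSpace M] [T2Space M]
  [MulAction T2SU2 M] {G : G2Manifold M} {ν : M → ℝ} {μ : M → EuclideanSpace ℝ (Fin 3)}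

open G2Manifold

variable (hmm : IsMultiMomentPair G ν μ) (hs : IsSmoothAction M) (hinv : IsInvariantForm G.φ)
  (hcohom : HasCohomogeneityTwo M)
include hmm hs hinv

omit [T2Space M] in
-- All ingredients of `∗φ(U₁, U₂, V_n, ∇|μ|²)` are carried along by `g`, so moving the point amounts
-- to rotating `n` backwards.
theorem differential_muDir_grad_normSq_smul (n : Fin 3 → ℝ) (g : T2SU2) (x : M) :
    differential (muDir μ n) (g • x) (G.grad (fun y => ‖μ y‖ ^ 2) (g • x)) =
      differential (muDir μ (rotSU2 g.2.2⁻¹ n)) x (G.grad (fun y => ‖μ y‖ ^ 2) x) := by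
  have hq : ∀ x, ‖μ (g • x)‖ ^ 2 = ‖μ x‖ ^ 2 := fun x => by rw [hmm.norm_μ_smul hs hinv]
  have h := ψ_smulDeriv hinv g x (genU 0 x) (genU 1 x) (fundField x (0, rotSU2 g.2.2⁻¹ n))
    (G.grad (fun y => ‖μ y‖ ^ 2) x)
  rw [smulDeriv_genU hs, smulDeriv_genU hs, smulDeriv_fundField hs,
    smulDeriv_grad hs hinv hmm.smooth_normSq hq, adT2SU2_apply, rotSU2_rotSU2_inv] at h
  rw [hmm.differential_muDir hs, hmm.differential_muDir hs]
  exact h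

omit [T2Space M] in
-- By equivariance the value at `exp(tξ) • x` is the one at `x` for a rotated `n`. The `2⁻¹` in
-- `lieExp` cancels the factor `2` in the derivative of the adjoint action.
theorem differential_differential_muDir_grad_normSq (n : Fin 3 → ℝ) (x : M) (ξ : LieT2SU2) :
    differential (fun y => differential (muDir μ n) y (G.grad (fun y => ‖μ y‖ ^ 2) y)) x
      (fundField x ξ) =
      differential (muDir μ (crossProduct ξ.2 n)) x (G.grad (fun y => ‖μ y‖ ^ 2) x) := by
  let A : (Fin 3 → ℝ) →L[ℝ] ℝ := LinearMap.toContinuousLinearMap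
    ((G.ψ₂ x (genU 0 x) (genU 1 x)).flip (G.grad (fun y => ‖μ y‖ ^ 2) x) ∘ₗ
      (fundField x : LieT2SU2 →ₗ[ℝ] TangentSpace (𝓡 7) x) ∘ₗ LinearMap.inr ℝ _ _)
  have hA : ∀ w, differential (muDir μ w) x (G.grad (fun y => ‖μ y‖ ^ 2) x) = A w := fun w =>
    hmm.differential_muDir hs w x _
  have hβ := contMDiff_differential_grad G hmm.smooth_normSq (hmm.smooth_muDir n)
  have h1 := (hasVelocity_lieExp_smul_zero hs x ξ).hasDerivAt (f := fun y =>
    differential (muDir μ n) y (G.grad (fun y => ‖μ y‖ ^ 2) y))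
    (L := differential (fun y => differential (muDir μ n) y (G.grad (fun y => ‖μ y‖ ^ 2) y)) x)
    (by
      show HasMFDerivAt (𝓡 7) 𝓘(ℝ, ℝ) _ (lieExp ((0 : ℝ) • ξ) • x) _
      have e : ∀ y, y = x → HasMFDerivAt (𝓡 7) 𝓘(ℝ, ℝ) (fun y =>
        differential (muDir μ n) y (G.grad (fun y => ‖μ y‖ ^ 2) y)) y
        (differential (fun y => differential (muDir μ n) y (G.grad (fun y => ‖μ y‖ ^ 2) y)) x :
          E7 →L[ℝ] ℝ) := by
        rintro _ rfl; exact hasMFDerivAt_differential hβ _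
      exact e _ (by rw [zero_smul, lieExp_zero, one_smul]))
  have h2 := A.hasFDerivAt.comp_hasDerivAt (0 : ℝ) (hasDerivAt_rotSU2_expSU2 ((2⁻¹ : ℝ) • ξ.2) n)
  have h3 : ∀ t : ℝ, differential (muDir μ n) (lieExp (t • ξ) • x)
      (G.grad (fun y => ‖μ y‖ ^ 2) (lieExp (t • ξ) • x)) =
      A (rotSU2 (expSU2 (t • (2⁻¹ : ℝ) • ξ.2)) n) := by
    intro t
    rw [hmm.differential_muDir_grad_normSq_smul hs hinv, hA]
    have h4 : (lieExp (t • ξ)).2.2⁻¹ = expSU2 (t • (2⁻¹ : ℝ) • ξ.2) := by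
      refine inv_eq_of_mul_eq_one_right ?_
      show expSU2 (-(2⁻¹ : ℝ) • t • ξ.2) * _ = 1
      have e1 : -(2⁻¹ : ℝ) • t • ξ.2 = (-(2⁻¹ : ℝ) * t) • ξ.2 := smul_smul _ _ _
      have e2 : t • (2⁻¹ : ℝ) • ξ.2 = (t * 2⁻¹ : ℝ) • ξ.2 := smul_smul _ _ _
      rw [e1, e2, ← expSU2_add (commute_smul_imQuaternion _ _), ← add_smul]
      have e3 : -(2⁻¹ : ℝ) * t + t * 2⁻¹ = 0 := by ring
      rw [e3, zero_smul, expSU2_zero]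
    rw [h4]
  have h5 := h1.unique (h2.congr_of_eventuallyEq (Filter.Eventually.of_forall h3))
  refine h5.trans ?_
  rw [hA]
  congr 1
  rw [map_smul, LinearMap.smul_apply, smul_smul, mul_inv_cancel₀ two_ne_zero, one_smul]

omit hmm hinv [PreconnectedSpace M] [T2Space M] in
theorem ψ₂_fundField_left (x : M) (ξ : LieT2SU2) (z : TangentSpace (𝓡 7) x) :
    G.ψ₂ x (genU 0 x) (genU 1 x) (fundField x ξ) z =
      G.ψ₂ x (genU 0 x) (genU 1 x) (fundField x (0, ξ.2)) z := by
  have h := fundField_torus hs x ξ.1 ξ.2 1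
  rw [one_smul, one_smul] at h
  have h0 : G.ψ₂ x (genU 0 x) (genU 1 x) (genU 0 x) z = 0 := by
    rw [ψ₂_swap, ψ₂_left, neg_zero]
  have h1 : G.ψ₂ x (genU 0 x) (genU 1 x) (genU 1 x) z = 0 := by
    rw [ψ₂_swap, ψ₂_right, neg_zero]
  rw [show fundField x ξ = _ from h]
  simp only [map_add, map_smul, LinearMap.add_apply, LinearMap.smul_apply, h0, h1, smul_zero,
    zero_add]

include hcohom in
/-- A coassociative leaf is not contained in an orbit. -/
theorem nontrivial_imageB_coassocLeaf {n : SU2} (hn : (n : ℍ[ℝ]).re = 0) {x : M}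
    (hx : x ∈ principalSet M) :
    (imageB ((hmm.coassocLeaf hs hinv hcohom hn).leaf x)).Nontrivial := by
  by_contra hnt
  rw [Set.not_nontrivial_iff] at hnt
  set D := hmm.coassocLeaf hs hinv hcohom hn with hD
  set w := dirSU2 n with hw
  have hself : x ∈ D.leaf x := LeafData.mem_leaf_self hs hx
  -- If the image in `B` is a point, the leaf lies in one orbit and `|μ|` is constant on it.
  have hq : ∀ y ∈ D.leaf x, ‖μ y‖ ^ 2 = ‖μ x‖ ^ 2 := by
    intro y hy
    obtain ⟨g, hg⟩ := projB_eq_projB.1 (hnt ⟨⟨y, LeafData.leaf_subset hy⟩, hy, rfl⟩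
      ⟨⟨x, hx⟩, hself, rfl⟩)
    have hg' : g • x = y := hg
    rw [← hg', hmm.norm_μ_smul hs hinv]
  have hpos : ∀ y ∈ D.leaf x, 0 < G.g.inner y (G.grad (muDir μ w) y) (G.grad (muDir μ w) y) :=
    fun y hy => hmm.g_grad_muDir_pos hs hinv (injective_fundField_of_mem_principalSet hs hcohom
      (LeafData.leaf_subset hy)) (dirSU2_ne_zero hn)
  have htan : ∀ y ∈ D.leaf x, G.grad (muDir μ w) y ∈ tangentTo (D.leaf x) y := by
    intro y hy
    refine (LeafData.mem_tangentTo_leaf hs hy).2 ⟨0, Submodule.zero_mem _,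
      G.g.inner y (G.grad (muDir μ w) y) (G.grad (muDir μ w) y), ?_⟩
    show _ = fundField y 0 + _ • (_ : ℝ)⁻¹ • _
    rw [map_zero, zero_add, smul_smul, mul_inv_cancel₀ (hpos y hy).ne', one_smul]
  have hβ : ∀ y ∈ D.leaf x, differential (muDir μ w) y (G.grad (fun y => ‖μ y‖ ^ 2) y) = 0 := by
    intro y hy
    rw [← g_grad, g_symm, g_grad]
    exact differential_eq_zero_of_mem_tangentTo hmm.smooth_normSq hq (htan y hy)
  -- `∇⟨μ, n⟩` is killed by `dν` and by `d|μ|²`, so it is tangent to the orbit.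
  obtain ⟨ξ, hξ⟩ := hmm.mem_range_fundField hs hinv
    (injective_fundField_of_mem_principalSet hs hcohom hx)
    (hmm.differential_ν_grad_muDir hs hinv hcohom hn hx)
    (differential_eq_zero_of_mem_tangentTo hmm.smooth_normSq hq (htan x hself))
  -- `A w = d⟨μ, w⟩(∇|μ|²)` will turn out to vanish on `n`, on the `su(2)` part of `ξ` and on the
  -- cross product of the two, which form a basis, although `A (μ x) > 0`.
  let A : (Fin 3 → ℝ) →ₗ[ℝ] ℝ :=
    (G.ψ₂ x (genU 0 x) (genU 1 x)).flip (G.grad (fun y => ‖μ y‖ ^ 2) x) ∘ₗ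
      (fundField x : LieT2SU2 →ₗ[ℝ] TangentSpace (𝓡 7) x) ∘ₗ LinearMap.inr ℝ _ _
  have hA : ∀ w, differential (muDir μ w) x (G.grad (fun y => ‖μ y‖ ^ 2) x) = A w := fun w =>
    hmm.differential_muDir hs w x _
  have hA1 : A w = 0 := by rw [← hA, hβ x hself]
  -- Differentiate `d⟨μ, n⟩(∇|μ|²) = 0` along the leaf in the direction `∇⟨μ, n⟩ = fundField x ξ`.
  have hA3 : A (crossProduct ξ.2 w) = 0 := by
    rw [← hA, ← hmm.differential_differential_muDir_grad_normSq hs hinv, hξ]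
    exact differential_eq_zero_of_mem_tangentTo
      (contMDiff_differential_grad G hmm.smooth_normSq (hmm.smooth_muDir w)) hβ (htan x hself)
  have hdf : ∀ z, G.g.inner x (G.grad (muDir μ w) x) z =
      G.ψ₂ x (genU 0 x) (genU 1 x) (fundField x (0, w)) z := hmm.g_grad_muDir hs w x
  have hχ : ∀ z, G.g.inner x (G.grad (muDir μ ξ.2) x) z =
      G.ψ x ![genU 0 x, genU 1 x, G.grad (muDir μ w) x, z] := by
    intro z
    rw [hmm.g_grad_muDir hs, ← hξ]
    exact (ψ₂_fundField_left hs x ξ z).symm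
  -- `A ξ` is twice the inner product of the vectors dual to `∗φ(U₁, U₂, ∇⟨μ, n⟩, ·)` and `∗φ(U₁,
  -- U₂, V_μ, ·)`. Each term of the Gram formula contains the product of `∇⟨μ, n⟩` with `U₁`, `U₂`
  -- or `V_μ`, or else `dν(∇⟨μ, n⟩)`; all of these vanish.
  have hA2 : A ξ.2 = 0 := by
    have e1 := g_χ_χ hχ (hmm.g_grad_muDir hs (fun k => μ x k) x)
    have e2 : G.g.inner x (G.grad (muDir μ w) x) (fundField x (0, fun k => μ x k)) = 0 := by
      rw [hdf, hmm.ψ₂_fundField hs, dot_cross_self, neg_zero]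
    have e3 : G.g.inner x (genU 0 x) (G.grad (muDir μ w) x) = 0 := by
      rw [g_symm, hdf, ψ₂_left]
    have e4 : G.g.inner x (genU 1 x) (G.grad (muDir μ w) x) = 0 := by
      rw [g_symm, hdf, ψ₂_right]
    have e5 : G.φ x ![genU 0 x, genU 1 x, G.grad (muDir μ w) x] = 0 := by
      rw [← hmm.differential_ν]; exact hmm.differential_ν_grad_muDir hs hinv hcohom hn hx
    rw [e2, e3, e4, e5, g_symm, hmm.g_grad_muDir hs] at e1
    rw [← hA, ← g_grad, g_symm, g_grad, hmm.differential_normSq hs]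
    have e6 : G.ψ₂ x (genU 0 x) (genU 1 x) (fundField x (0, fun k => μ x k))
      (G.grad (muDir μ ξ.2) x) = _ := e1
    rw [e6]
    ring
  -- Otherwise `|∇⟨μ, n⟩|² = ∗φ(U₁, U₂, V_n, V_ξ) = ⟨μ, ξ × n⟩` would be zero.
  have hcross : crossProduct ξ.2 w ≠ 0 := by
    intro h0
    have h1 := hpos x hself
    have h2 := ψ₂_fundField_left (G := G) hs x ξ (fundField x (0, w))
    rw [hdf, ψ₂_swap] at h1
    have h3 : G.ψ₂ x (genU 0 x) (genU 1 x) (G.grad (muDir μ w) x) (fundField x (0, w)) =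
        G.ψ₂ x (genU 0 x) (genU 1 x) (fundField x ξ) (fundField x (0, w)) := by rw [hξ]
    rw [h3, h2, hmm.ψ₂_fundField hs, h0] at h1
    simp at h1
  have hAμ : 0 < A (fun k => μ x k) := by
    have h1 := hmm.g_grad_normSq_pos hs hinv (injective_fundField_of_mem_principalSet hs hcohom hx)
    rw [g_grad, hmm.differential_normSq hs] at h1
    have h2 : A (fun k => μ x k) = G.ψ₂ x (genU 0 x) (genU 1 x) (fundField x (0, fun k => μ x k))
      (G.grad (fun y => ‖μ y‖ ^ 2) x) := rfl
    linarith
  let b : Fin 3 → ℝ := fun i => A (Pi.single i 1)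
  have hb : ∀ v, A v = dotProduct b v := by
    intro v
    have e : v = ∑ i, v i • (Pi.single i 1 : Fin 3 → ℝ) := pi_eq_sum_univ' v
    conv_lhs => rw [e]
    rw [map_sum]
    simp [dotProduct, b, mul_comm]
  rw [hb] at hA1 hA2 hA3 hAμ
  rw [eq_zero_of_orthogonal_cross hA1 hA2 hA3 hcross, zero_dotProduct] at hAμ
  exact lt_irrefl _ hAμ

end IsMultiMomentPair

/-! ### The `T³`-orbits in an orbit -/

/-- Two continuous surjections from a compact space to Hausdorff spaces with the same fibres have
homeomorphic targets. -/
theorem exists_homeomorph_of_fibres {X Y Z : Type*} [TopologicalSpace X] [CompactSpace X]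
    [TopologicalSpace Y] [T2Space Y] [TopologicalSpace Z] [T2Space Z] {f : X → Y} {g : X → Z}
    (hf : Continuous f) (hg : Continuous g) (hfs : Function.Surjective f)
    (hgs : Function.Surjective g) (h : ∀ x x', f x = f x' ↔ g x = g x') :
    ∃ e : Y ≃ₜ Z, ∀ x, e (f x) = g x := by
  have hq : Topology.IsQuotientMap f := hf.isClosedMap.isQuotientMap hf hfs
  let k : Y → Z := fun y => g (hfs y).choose
  have hk : ∀ x, k (f x) = g x := fun x => (h _ _).1 (hfs (f x)).choose_spec
  have hkc : Continuous k := hq.continuous_iff.2 (by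
    have : k ∘ f = g := funext hk
    rwa [this])
  have hbij : Function.Bijective k := by
    constructor
    · intro y y' hy
      obtain ⟨x, rfl⟩ := hfs y
      obtain ⟨x', rfl⟩ := hfs y'
      rw [hk, hk] at hy
      exact (h _ _).2 hy
    · intro z
      obtain ⟨x, rfl⟩ := hgs z
      exact ⟨f x, hk x⟩
  have : CompactSpace Y := hfs.compactSpace hf
  exact ⟨Continuous.homeoOfEquivCompactToT2 (f := Equiv.ofBijective k hbij) hkc, hk⟩

theorem torus3_mk_eq_iff {M : Type*} [MulAction T2SU2 M] {n : SU2} {x y : M} :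
    Quotient.mk (MulAction.orbitRel (torus3 n) M) x = Quotient.mk (MulAction.orbitRel (torus3 n) M) y ↔
      ∃ k ∈ torus3 n, k • y = x := by
  rw [Quotient.eq, MulAction.orbitRel_apply]
  constructor
  · rintro ⟨k, h⟩; exact ⟨k.1, k.2, h⟩
  · rintro ⟨k, hk, h⟩; exact ⟨⟨k, hk⟩, h⟩

theorem isCompact_torus3 {n : SU2} (hn : (n : ℍ[ℝ]).re = 0) : IsCompact (torus3 n : Set T2SU2) := by
  obtain ⟨C, hC, hsub, hex⟩ := exists_lieExp_eq_torus3 hn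
  have h : (torus3 n : Set T2SU2) = lieExp '' C := by
    ext k
    exact ⟨fun hk => hex k hk, by rintro ⟨ξ, hξ, rfl⟩; exact lieExp_mem_torus3 hn (hsub hξ)⟩
  rw [h]
  exact hC.image continuous_lieExp

theorem t2Space_quotient_torus3 {M : Type*} [TopologicalSpace M] [ChartedSpace E7 M]
    [MulAction T2SU2 M] [T2Space M] (hs : IsSmoothAction M) {n : SU2} (hn : (n : ℍ[ℝ]).re = 0) :
    T2Space (Quotient (MulAction.orbitRel (torus3 n) M)) := by
  have hcs := hs.continuousSMul
  have : ContinuousConstSMul (torus3 n) M := ⟨fun k => continuous_const_smul k.1⟩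
  have : CompactSpace (torus3 n) := isCompact_iff_compactSpace.1 (isCompact_torus3 hn)
  rw [t2Space_iff_of_isOpenQuotientMap MulAction.isOpenQuotientMap_quotientMk]
  have h1 : IsClosed {p : torus3 n × (M × M) | p.1.1 • p.2.2 = p.2.1} :=
    isClosed_eq ((continuous_subtype_val.comp continuous_fst).smul continuous_snd.snd)
      continuous_snd.fst
  have h2 := isClosedMap_snd_of_compactSpace _ h1
  have h3 : Prod.snd '' {p : torus3 n × (M × M) | p.1.1 • p.2.2 = p.2.1} =
      {q : M × M | Quotient.mk (MulAction.orbitRel (torus3 n) M) q.1 = Quotient.mk _ q.2} := by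
    ext q
    refine Iff.trans ?_ torus3_mk_eq_iff.symm
    constructor
    · rintro ⟨⟨g, q'⟩, h, rfl⟩; exact ⟨g.1, g.2, h⟩
    · rintro ⟨g, hg, h⟩; exact ⟨(⟨g, hg⟩, q), h, rfl⟩
  exact h3 ▸ h2

/-- The direction of the circle conjugate to the circle with direction `n`. -/
def conjDir (n q : SU2) : EuclideanSpace ℝ (Fin 3) := WithLp.toLp 2 (rotSU2 q⁻¹ (dirSU2 n))

/-- Fixing the axis under conjugation means commuting with `n`, and the circle is the centraliser of
`n`. -/
theorem rotSU2_inv_dirSU2_eq_iff {n : SU2} (hn : (n : ℍ[ℝ]).re = 0) (q r : SU2) :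
    rotSU2 q⁻¹ (dirSU2 n) = rotSU2 r⁻¹ (dirSU2 n) ↔ q * r⁻¹ ∈ circleSU2 n := by
  have h1 : rotSU2 q⁻¹ (dirSU2 n) = rotSU2 r⁻¹ (dirSU2 n) ↔
      rotSU2 (q * r⁻¹) (dirSU2 n) = dirSU2 n := by
    rw [rotSU2_mul]
    constructor
    · intro h; rw [← h, rotSU2_rotSU2_inv]
    · intro h; rw [← h, rotSU2_inv_rotSU2, h]
  rw [h1]
  refine ⟨fun h => ?_, rotSU2_dirSU2_of_mem hn⟩
  have h2 := congrArg imQuaternion h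
  rw [imQuaternion_rotSU2, imQuaternion_dirSU2 hn] at h2
  refine Subgroup.mem_centralizer_singleton_iff.2 (Subtype.ext ?_)
  show ((q * r⁻¹ : SU2) : ℍ[ℝ]) * n = n * (q * r⁻¹ : SU2)
  rw [← h2, mul_assoc _ (star _), star_mul_self_SU2, mul_one, h2]

open Matrix in
theorem dirSU2_dotProduct_self {n : SU2} (hn : (n : ℍ[ℝ]).re = 0) : dirSU2 n ⬝ᵥ dirSU2 n = 1 := by
  have hN : ‖(n : ℍ[ℝ])‖ = 1 := by simp
  have h2 := Quaternion.normSq_def' (a := (n : ℍ[ℝ]))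
  rw [Quaternion.normSq_eq_norm_mul_self, hN, hn] at h2
  have h3 : dirSU2 n ⬝ᵥ dirSU2 n = (n : ℍ[ℝ]).imI * (n : ℍ[ℝ]).imI + (n : ℍ[ℝ]).imJ * (n : ℍ[ℝ]).imJ +
    (n : ℍ[ℝ]).imK * (n : ℍ[ℝ]).imK := by
    simp [dirSU2, imPart, dotProduct, Fin.sum_univ_three]
  rw [h3]; linarith

theorem norm_toLp_eq_one_iff (v : Fin 3 → ℝ) :
    (WithLp.toLp 2 v : EuclideanSpace ℝ (Fin 3)) ∈ Metric.sphere 0 1 ↔ dotProduct v v = 1 := by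
  have h : ‖(WithLp.toLp 2 v : EuclideanSpace ℝ (Fin 3))‖ ^ 2 = dotProduct v v := by
    rw [EuclideanSpace.real_norm_sq_eq]
    simp [dotProduct, sq]
  rw [mem_sphere_zero_iff_norm, ← h]
  exact (pow_eq_one_iff_of_nonneg (norm_nonneg _) two_ne_zero).symm

theorem conjDir_mem_sphere {n : SU2} (hn : (n : ℍ[ℝ]).re = 0) (q : SU2) :
    conjDir n q ∈ Metric.sphere (0 : EuclideanSpace ℝ (Fin 3)) 1 := by
  rw [conjDir, norm_toLp_eq_one_iff, (rotSU2_dotProduct_cross _ _ _).1, dirSU2_dotProduct_self hn]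

theorem continuous_conjDir (n : SU2) : Continuous (conjDir n) := by
  refine (PiLp.continuous_toLp 2 _).comp ?_
  have h : Continuous (fun q : SU2 => imPart (((q⁻¹ : SU2) : ℍ[ℝ]) * imQuaternion (dirSU2 n) *
      star ((q⁻¹ : SU2) : ℍ[ℝ]))) := by
    have hP : Continuous imPart := LinearMap.continuous_of_finiteDimensional (
      { toFun := imPart
        map_add' := fun a b => by ext i; fin_cases i <;> rfl
        map_smul' := fun r a => by ext i; fin_cases i <;> rfl } : ℍ[ℝ] →ₗ[ℝ] (Fin 3 → ℝ))
    have hi : Continuous (fun q : SU2 => ((q⁻¹ : SU2) : ℍ[ℝ])) := by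
      simp only [coe_inv_SU2]; fun_prop
    exact hP.comp ((hi.mul continuous_const).mul hi.star)
  exact h

open Matrix in
/-- The adjoint action of `SU(2)` is transitive on the unit vectors. -/
theorem exists_rotSU2_eq {u v : Fin 3 → ℝ} (hu : u ⬝ᵥ u = 1) (hv : v ⬝ᵥ v = 1) :
    ∃ q : SU2, rotSU2 q u = v := by
  have hsq : ∀ w : Fin 3 → ℝ, w ⬝ᵥ w = 1 → imQuaternion w * imQuaternion w = -1 := by
    intro w hw
    rw [imQuaternion_mul, hw, cross_self, ← imQuaternionL_apply, map_zero]; simp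
  -- any nonzero `p` with `p u = v p` gives a solution
  have key : ∀ p : ℍ[ℝ], p ≠ 0 → p * imQuaternion u = imQuaternion v * p → ∃ q : SU2, rotSU2 q u = v := by
    intro p hp h
    have hn : ‖p‖ ≠ 0 := norm_ne_zero_iff.2 hp
    let q : SU2 := ⟨‖p‖⁻¹ • p, by
      rw [mem_sphere_zero_iff_norm, norm_smul, norm_inv, norm_norm, inv_mul_cancel₀ hn]⟩
    refine ⟨q, imQuaternion_injective ?_⟩
    have h1 : (q : ℍ[ℝ]) * imQuaternion u = imQuaternion v * q := by
      show (‖p‖⁻¹ • p) * imQuaternion u = imQuaternion v * (‖p‖⁻¹ • p)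
      rw [smul_mul_assoc, h, mul_smul_comm]
    rw [imQuaternion_rotSU2, h1, mul_assoc, self_mul_star_SU2, mul_one]
  -- `p = 1 - v u` satisfies `p u = u + v = v p`, as `u² = v² = -1`. It vanishes only if `v = -u`,
  -- and then any nonzero `w` orthogonal to `u` anticommutes with `u` and serves as `p`.
  by_cases h0 : 1 - imQuaternion v * imQuaternion u = 0
  · have huv : imQuaternion v * imQuaternion u = 1 := (sub_eq_zero.1 h0).symm
    have hvu : imQuaternion v = -imQuaternion u := by
      have h1 := congrArg (fun a => a * imQuaternion u) huv
      simp only [mul_assoc, hsq u hu, one_mul] at h1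
      rw [← h1]; simp
    obtain ⟨w, hw0, hw⟩ : ∃ w : Fin 3 → ℝ, w ≠ 0 ∧ w ⬝ᵥ u = 0 := by
      by_cases h2 : u 0 = 0 ∧ u 1 = 0
      · refine ⟨![1, 0, 0], fun h => by simpa using congrFun h 0, ?_⟩
        simp [dotProduct, Fin.sum_univ_three, h2.1]
      · refine ⟨![u 1, -u 0, 0], fun h => h2 ⟨?_, ?_⟩, ?_⟩
        · simpa using congrFun h 1
        · simpa using congrFun h 0
        · simp [dotProduct, Fin.sum_univ_three]; ring
    refine key (imQuaternion w) (fun h => hw0 ?_) ?_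
    · exact imQuaternion_injective (by rw [h, ← imQuaternionL_apply, map_zero])
    · rw [hvu, neg_mul, imQuaternion_mul, imQuaternion_mul, hw, dotProduct_comm, hw,
        ← cross_anticomm u w]
      simp only [← imQuaternionL_apply, map_neg]
      simp
  · refine key _ h0 ?_
    rw [sub_mul, mul_sub, ← mul_assoc, hsq v hv, mul_assoc, hsq u hu]
    simp [sub_eq_add_neg, add_comm]

theorem surjective_conjDir {n : SU2} (hn : (n : ℍ[ℝ]).re = 0) :
    Function.Surjective (fun q => (⟨conjDir n q, conjDir_mem_sphere hn q⟩ : S2)) := by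
  rintro ⟨y, hy⟩
  obtain ⟨q, hq⟩ := exists_rotSU2_eq (dirSU2_dotProduct_self hn)
    ((norm_toLp_eq_one_iff (WithLp.ofLp y)).1 hy)
  refine ⟨q⁻¹, Subtype.ext ?_⟩
  show WithLp.toLp 2 (rotSU2 q⁻¹⁻¹ (dirSU2 n)) = y
  rw [inv_inv, hq]

namespace IsMultiMomentPair

variable {M : Type*} [TopologicalSpace M] [ChartedSpace E7 M] [IsManifold (𝓡 7) ∞ M]
  [PreconnectedSpace M] [T2Space M]
  [MulAction T2SU2 M] {G : G2Manifold M} {ν : M → ℝ} {μ : M → EuclideanSpace ℝ (Fin 3)}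

variable (hmm : IsMultiMomentPair G ν μ) (hs : IsSmoothAction M) (hinv : IsInvariantForm G.φ)
  (hcohom : HasCohomogeneityTwo M)
include hmm hs hinv hcohom

/-- Each `T³`-orbit over the point contains some `(1, 1, q) • x`, and `q` and `r` give the same
orbit exactly when `q r⁻¹ ∈ S¹`, which is also when they conjugate the axis to the same unit vector.
So two maps on the compact group `SU(2)` have the same fibres. -/
theorem exists_homeomorph_fibreModT3 {n : SU2} (hn : (n : ℍ[ℝ]).re = 0) (x : principalSet M) :
    ∃ e : S2 ≃ₜ fibreModT3 n (projB x), ∀ y, ∃ q : SU2,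
      (e y).1 = Quotient.mk _ (((1, 1, q) : T2SU2) • x.1) := by
  have hcs := hs.continuousSMul
  have := t2Space_quotient_torus3 (M := M) hs hn
  let A : SU2 → fibreModT3 n (projB x) := fun q => ⟨Quotient.mk _ (((1, 1, q) : T2SU2) • x.1),
    ⟨⟨_, hmm.smul_mem_principalSet hs hinv hcohom x.2 (1, 1, q)⟩,
      projB_eq_projB.2 ⟨(1, 1, q), rfl⟩, rfl⟩⟩
  have hA : Continuous A := by
    refine Continuous.subtype_mk (continuous_quot_mk.comp ?_) _
    have h : Continuous (fun q : SU2 => ((1, 1, q) : T2SU2)) := by fun_prop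
    exact h.smul continuous_const
  have hAs : Function.Surjective A := by
    rintro ⟨_, y, hy, rfl⟩
    obtain ⟨g, hg⟩ := projB_eq_projB.1 (show projB y = projB x from hy)
    refine ⟨g.2.2, Subtype.ext (torus3_mk_eq_iff.2 ⟨(g.1⁻¹, g.2.1⁻¹, 1), ⟨trivial, trivial,
      Subgroup.one_mem _⟩, ?_⟩)⟩
    rw [← hg, smul_smul]
    congr 1
    exact Prod.ext (inv_mul_cancel _) (Prod.ext (inv_mul_cancel _) (one_mul _))
  obtain ⟨e, he⟩ := exists_homeomorph_of_fibres (f := fun q =>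
    (⟨conjDir n q, conjDir_mem_sphere hn q⟩ : S2)) (g := A)
    ((continuous_conjDir n).subtype_mk _) hA (surjective_conjDir hn) hAs (fun q r => by
      have h1 : (⟨conjDir n q, conjDir_mem_sphere hn q⟩ : S2) = ⟨conjDir n r, conjDir_mem_sphere hn r⟩
          ↔ rotSU2 q⁻¹ (dirSU2 n) = rotSU2 r⁻¹ (dirSU2 n) := by
        rw [Subtype.mk.injEq]
        exact (WithLp.toLp_injective 2).eq_iff
      rw [h1, rotSU2_inv_dirSU2_eq_iff hn, Subtype.ext_iff]
      refine Iff.trans ?_ torus3_mk_eq_iff.symm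
      constructor
      · intro h
        refine ⟨(1, 1, q * r⁻¹), ⟨trivial, trivial, h⟩, ?_⟩
        rw [smul_smul]
        congr 1
        exact Prod.ext (one_mul _) (Prod.ext (one_mul _) (inv_mul_cancel_right _ _))
      · rintro ⟨k, hk, h⟩
        -- This element fixes `x`, so its `SU(2)` part is `±1`, which is central and lies in `S¹`;
        -- the coset is not affected.
        have h2 : (((1, 1, q) : T2SU2)⁻¹ * (k * (1, 1, r))) • x.1 = x.1 := by
          rw [mul_smul, mul_smul, h, inv_smul_smul]
        obtain ⟨ε, hε, h3⟩ := hmm.exists_eq_coe_of_mem_principalSet hs hinv hcohom x.2 h2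
        have h4 : ((q⁻¹ * (k.2.2 * r) : SU2) : ℍ[ℝ]) = (ε : ℍ[ℝ]) := h3
        have h5 : ∀ p : SU2, (q⁻¹ * (k.2.2 * r)) * p = p * (q⁻¹ * (k.2.2 * r)) := fun p => by
          refine Subtype.ext ?_
          show ((q⁻¹ * (k.2.2 * r) : SU2) : ℍ[ℝ]) * p = p * ((q⁻¹ * (k.2.2 * r) : SU2) : ℍ[ℝ])
          rw [h4, Quaternion.coe_commutes]
        have h6 : q * r⁻¹ * (q⁻¹ * (k.2.2 * r)) = k.2.2 := by
          rw [mul_assoc, ← h5, mul_assoc, mul_assoc, mul_inv_cancel, mul_one, mul_inv_cancel_left]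
        rw [eq_mul_inv_of_mul_eq h6]
        exact Subgroup.mul_mem _ hk.2.2 (Subgroup.inv_mem _
          (Subgroup.mem_centralizer_singleton_iff.2 (h5 n))))
  refine ⟨e, fun y => ?_⟩
  obtain ⟨q, rfl⟩ := surjective_conjDir hn y
  exact ⟨q, congrArg Subtype.val (he q)⟩

end IsMultiMomentPair

end

/-! ### The theorem on the orbit surface -/

theorem mainTheorem11 {M : Type*} [TopologicalSpace M] [T2Space M] [SecondCountableTopology M]
    [SimplyConnectedSpace M] [ChartedSpace E7 M] [IsManifold (𝓡 7) ∞ M] (G : G2Manifold M)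
    [MulAction T2SU2 M] (hsmooth : IsSmoothAction M) (hinv : IsInvariantForm G.φ)
    (hcohom : HasCohomogeneityTwo M)
    (ν : M → ℝ) (μ : M → EuclideanSpace ℝ (Fin 3)) (hmm : IsMultiMomentPair G ν μ) :
    ∃ (hP : IsOpen (principalSet M))
      (_ : ChartedSpace (EuclideanSpace ℝ (Fin 2)) (OrbitSurface M))
      (gB : ∀ b : OrbitSurface M,
        TangentSpace (𝓡 2) b →ₗ[ℝ] TangentSpace (𝓡 2) b →ₗ[ℝ] ℝ)
      (absμB νB : OrbitSurface M → ℝ),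
      -- `B` is a surface with its quotient metric, and `|μ|` and `ν` descend to `B`
      IsQuotientSurface hP ∧ IsQuotientMetric G hP gB ∧
      (∀ x : principalSet M, absμB (projB x) = ‖μ x‖) ∧
      (∀ x : principalSet M, νB (projB x) = ν x) ∧
      -- for every circle `S¹ < SU(2)`, with direction `n`
      (∀ n : SU2, (n : ℍ[ℝ]).re = 0 →
        -- a `T³`-invariant coassociative projects into a level set of `ν`
        (∀ S : Set M, IsT3Coassociative G n S → ∃ c : ℝ, imageB S ⊆ {b | νB b = c}) ∧
        -- over every point of a level set of `ν` there is a 2-sphere of `T³`-orbits, and each of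
        -- them lies in a largest connected `T³`-invariant coassociative, which projects to a
        -- nonconstant part of the level set
        (∀ (c : ℝ) (b : OrbitSurface M), νB b = c →
          ∃ (e : S2 ≃ₜ fibreModT3 n b) (S : S2 → Set M), ∀ y : S2,
            IsT3Coassociative G n (S y) ∧
            (∀ x : M, Quotient.mk (MulAction.orbitRel (torus3 n) M) x = (e y).1 → x ∈ S y) ∧
            imageB (S y) ⊆ {b' | νB b' = c} ∧
            (imageB (S y)).Nontrivial ∧
            (∀ S' : Set M, IsT3Coassociative G n S' →
              (∃ x ∈ S', Quotient.mk (MulAction.orbitRel (torus3 n) M) x = (e y).1) →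
              S' ⊆ S y))) ∧
      -- `(|μ|, ν)` is a local orthogonal parametrization of `B`
      IsLocalOrthogonalParametrization gB absμB νB ∧
      -- the lines `|μ| = const` are the projections of the `T²`-invariant associatives
      (∀ L : Set M, IsT2Associative G L → ∃ c : ℝ, imageB L ⊆ {b | absμB b = c}) ∧
      (∀ x : principalSet M, ∃ L : Set M,
        IsT2Associative G L ∧ x.1 ∈ L ∧
        imageB L = connectedComponentIn {b | absμB b = absμB (projB x)} (projB x) ∧
        (∀ L' : Set M, IsT2Associative G L' → x.1 ∈ L' → L' ⊆ L)) := by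
  have hP := hmm.isOpen_principalSet hsmooth hinv hcohom
  let _ := hmm.chartedSpaceB hsmooth hinv hcohom
  refine ⟨hP, hmm.chartedSpaceB hsmooth hinv hcohom, hmm.metricB hsmooth hinv hcohom,
    descend (fun x => ‖μ x‖) (hmm.norm_μ_smul hsmooth hinv), descend ν (hmm.ν_smul hsmooth hinv),
    hmm.isQuotientSurface hsmooth hinv hcohom hP, hmm.isQuotientMetric hsmooth hinv hcohom hP,
    fun _ => rfl, fun _ => rfl, fun n hn => ⟨fun S hS => ?_, fun c b hb => ?_⟩,
    hmm.isLocalOrthogonalParametrization hsmooth hinv hcohom, fun L hL => ?_, fun x =>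
      ⟨(hmm.assocLeaf hsmooth hinv hcohom).leaf x,
        hmm.isT2Associative_leaf hsmooth hinv hcohom x.2, LeafData.mem_leaf_self hsmooth x.2,
        hmm.imageB_assocLeaf hsmooth hinv hcohom x,
        fun L hL hx => hmm.subset_assocLeaf hsmooth hinv hcohom hL hx⟩⟩
  · obtain ⟨x, hx⟩ := hS.connected.nonempty
    refine ⟨ν x, ?_⟩
    rintro _ ⟨y, hy, rfl⟩
    exact hmm.ν_eq_of_mem_coassocLeaf hsmooth hinv hcohom hn
      (hmm.subset_coassocLeaf hsmooth hinv hcohom hn hS hx hy)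
  · obtain ⟨p, rfl⟩ := projB_surjective b
    obtain ⟨e, he⟩ := hmm.exists_homeomorph_fibreModT3 hsmooth hinv hcohom hn p
    choose q hq using he
    have hqP : ∀ y, ((1, 1, q y) : T2SU2) • p.1 ∈ principalSet M := fun y =>
      hmm.smul_mem_principalSet hsmooth hinv hcohom p.2 _
    have hmem : ∀ (y : S2) (x : M), Quotient.mk (MulAction.orbitRel (torus3 n) M) x = (e y).1 →
        x ∈ (hmm.coassocLeaf hsmooth hinv hcohom hn).leaf (((1, 1, q y) : T2SU2) • p.1) := by
      intro y x hx
      obtain ⟨k, hk, rfl⟩ := torus3_mk_eq_iff.1 (hx.trans (hq y))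
      exact LeafData.smul_mem_leaf (LeafData.mem_leaf_self hsmooth (hqP y)) hk
    refine ⟨e, fun y => (hmm.coassocLeaf hsmooth hinv hcohom hn).leaf (((1, 1, q y) : T2SU2) • p.1),
      fun y => ⟨hmm.isT3Coassociative_leaf hsmooth hinv hcohom hn (hqP y), hmem y, ?_,
        hmm.nontrivial_imageB_coassocLeaf hsmooth hinv hcohom hn (hqP y), ?_⟩⟩
    · rintro _ ⟨z, hz, rfl⟩
      refine ((hmm.ν_eq_of_mem_coassocLeaf hsmooth hinv hcohom hn hz).trans ?_).trans hb
      exact hmm.ν_smul hsmooth hinv _ _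
    · rintro S' hS' ⟨x, hx, hxy⟩
      have h := hmm.subset_coassocLeaf hsmooth hinv hcohom hn hS' hx
      -- The leaf does not depend on which point of the given `T³`-orbit it is started from.
      rwa [LeafData.leaf_eq hsmooth (hmem y x hxy)] at h
  · obtain ⟨x, hx⟩ := hL.connected.nonempty
    refine ⟨‖μ x‖, ?_⟩
    rintro _ ⟨y, hy, rfl⟩
    exact hmm.norm_μ_eq_of_mem_assocLeaf hsmooth hinv hcohom
      (hmm.subset_assocLeaf hsmooth hinv hcohom hL hx hy)
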